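/- Let $M$ be a metrizable real analytic surface (2-manifold) without boundary, possibly noncompact, let $k\ge 1$ be an integer, and let $X,Y$ be $C^k$ vector fields on $M$. Write $Z(X)$ for the zero set of $X$. A compact set $K\subset Z(X)$ is a *block* for $X$ if it has a precompact open neighborhood $U$ with $Z(X)\cap\overline U=K$; such a $U$ is called *isolating* for $(X,K)$. The *index* $i_K(X)\in\mathbb Z$ of the block is the sum of the Poincaré–Hopf indices of the zeroes in $U$ of any continuous vector field that is sufficiently close to $X$ (uniformly on compact sets) and has only finitely many zeroes in $U$; it does not depend on $U$. The field $X$ is *$k$-flat* at $p\in Z(X)$ if, in a $C^{k+1}$ chart around $p$, all its partial derivatives of orders $1,\dots,k$ vanish at $p$. Let $\Phi^X,\Phi^Y$ be the local flows of $X$ and $Y$. The field $Y$ *tracks* $X$ if for every $t\in\mathbb R$ the diffeomorphism $\Phi^Y_t:\mathcal D_t\to\mathcal R_t$ between open subsets of $M$ maps orbits of $X|\mathcal D_t$ to orbits of $X|\mathcal R_t$. A *line field* on $N\subset M$ is a continuous choice $p\mapsto\Lambda_p$ of a line through the origin in each tangent space $T_pM$, $p\in N$; it *controls* $X$ in $N$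 if $X_p\in\Lambda_p$ for all $p\in N$. **Theorem.** Assume: (a) $K$ is a block for $X$ and $X$ is not $k$-flat at any point of $K$; (b) $Y$ tracks $X$; (c) $Y$ has no zeroes in $K$; (d) $U$ is an isolating neighborhood for $(X,K)$. Then: (i) $i_K(X)=0$. (ii) $K$ has only finitely many connected components, and each component is a $C^k$-embedded circle and a periodic orbit of $Y$. (iii) $X$ is controlled in $U$ by a unique line field on $U$. (iv) Each component $L$ of $K$ is a block for $X$, and $i_L(X)=0$. (v) $X$ is a limit, in the $C^k$ topology (uniform convergence, in charts, of all derivatives of order at most $k$ on compact sets), of $C^k$ vector fields that have no zeroes in $U$ and agree with $X$ outside $U$. -/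

import Mathlib

open Set Filter Topology Manifold
open scoped ContDiff LinearAlgebra.Projectivization

noncomputable section

namespace SurfaceFields

/-- The Euclidean plane, the model space of a surface. -/
abbrev Plane : Type := EuclideanSpace ℝ (Fin 2)

/-- The vector space of `C^k` vector fields on a surface `M` (continuous fields for `k = 0`). -/
abbrev VField (M : Type*) [TopologicalSpace M] [ChartedSpace Plane M] [IsManifold (𝓡 2) ω M]
    (k : ℕ) :=
  Cₛ^k⟮𝓡 2; Plane, (TangentSpace (𝓡 2) : M → Type _)⟯

section Basic

variable {M : Type*} [TopologicalSpace M] [ChartedSpace Plane M]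

/-- The representation `F : e.target → ℝ²` of a vector field `X` in the chart `e`. Only the values
on `e.target` are meaningful. -/
def chartRep (e : OpenPartialHomeomorph M Plane) (X : ∀ p : M, TangentSpace (𝓡 2) p) :
    Plane → Plane :=
  fun z => mfderiv (𝓡 2) 𝓘(ℝ, Plane) e (e.symm z) (X (e.symm z))

/-- The zero set of a vector field. -/
def zeros (X : ∀ p : M, TangentSpace (𝓡 2) p) : Set M := {p | X p = 0}

/-- `U` is isolating for `(X, K)`: it is a precompact open neighbourhood of `K` whose closure
contains no zeroes of `X` other than the points of `K`, all of which are zeroes. -/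
def IsIsolating (X : ∀ p : M, TangentSpace (𝓡 2) p) (K U : Set M) : Prop :=
  IsOpen U ∧ IsCompact (closure U) ∧ K ⊆ U ∧ zeros X ∩ closure U = K

/-- `K` is a block of zeroes for `X`. -/
def IsBlock (X : ∀ p : M, TangentSpace (𝓡 2) p) (K : Set M) : Prop :=
  IsCompact K ∧ K ⊆ zeros X ∧ ∃ U, IsIsolating X K U

/-! ### Order of vanishing -/

/-- `X` has order `j` at `p` (as a `C^k` vector field): `1 ≤ j ≤ k` and, in some `C^{k+1}` chart,
the derivatives of `X` of order less than `j` vanish at `p` and the `j`-th one does not. -/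
def HasOrder (k : ℕ) (X : ∀ p : M, TangentSpace (𝓡 2) p) (p : M) (j : ℕ) : Prop :=
  1 ≤ j ∧ j ≤ k ∧ ∃ e ∈ IsManifold.maximalAtlas (𝓡 2) ((k : ℕ∞ω) + 1) M, p ∈ e.source ∧
    (∀ i < j, iteratedFDeriv ℝ i (chartRep e X) (e p) = 0) ∧
    iteratedFDeriv ℝ j (chartRep e X) (e p) ≠ 0

/-- `X` is `k`-flat at its zero `p`. -/
def IsFlat (k : ℕ) (X : ∀ p : M, TangentSpace (𝓡 2) p) (p : M) : Prop :=
  ¬ ∃ j, HasOrder k X p j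

/-! ### Local flows, orbits and tracking -/

/-- The graph of the time `t` map `Φ_t` of the local flow of `Y`: the integral curve of `Y` through
`p` at time `0` is defined at time `t`, and it is then at `q`. -/
def FlowRel (Y : ∀ p : M, TangentSpace (𝓡 2) p) (t : ℝ) (p q : M) : Prop :=
  ∃ (γ : ℝ → M) (a b : ℝ), (0 : ℝ) ∈ Ioo a b ∧ t ∈ Ioo a b ∧
    IsMIntegralCurveOn γ Y (Ioo a b) ∧ γ 0 = p ∧ γ t = q

/-- The domain `D_t` of `Φ_t`. -/
def flowDomain (Y : ∀ p : M, TangentSpace (𝓡 2) p) (t : ℝ) : Set M := {p | ∃ q, FlowRel Y t p q}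

/-- The range `R_t` of `Φ_t`. -/
def flowRange (Y : ∀ p : M, TangentSpace (𝓡 2) p) (t : ℝ) : Set M := {q | ∃ p, FlowRel Y t p q}

/-- The image of `S` under `Φ_t`. -/
def flowImage (Y : ∀ p : M, TangentSpace (𝓡 2) p) (t : ℝ) (S : Set M) : Set M :=
  {q | ∃ p ∈ S, FlowRel Y t p q}

/-- The orbit of `p` under the restriction `X|D` of `X` to the open set `D`. -/
def orbitIn (X : ∀ p : M, TangentSpace (𝓡 2) p) (D : Set M) (p : M) : Set M :=
  {q | ∃ (γ : ℝ → M) (a b s : ℝ), (0 : ℝ) ∈ Ioo a b ∧ s ∈ Ioo a b ∧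
    IsMIntegralCurveOn γ X (Ioo a b) ∧ (∀ u ∈ Ioo a b, γ u ∈ D) ∧ γ 0 = p ∧ γ s = q}

/-- `O` is an orbit of `X|D`. -/
def IsOrbitIn (X : ∀ p : M, TangentSpace (𝓡 2) p) (D O : Set M) : Prop :=
  ∃ p ∈ D, O = orbitIn X D p

/-- `Y` tracks `X`: for every `t` the map `Φ^Y_t : D_t → R_t` maps orbits of `X|D_t` to orbits of
`X|R_t`. -/
def Tracks (Y X : ∀ p : M, TangentSpace (𝓡 2) p) : Prop :=
  ∀ (t : ℝ) (O : Set M), IsOrbitIn X (flowDomain Y t) O →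
    IsOrbitIn X (flowRange Y t) (flowImage Y t O)

/-- The set `L` is a periodic orbit of `Y`, of minimal period `T > 0`. -/
def IsPeriodicOrbit (Y : ∀ p : M, TangentSpace (𝓡 2) p) (L : Set M) : Prop :=
  ∃ (γ : ℝ → M) (T : ℝ), 0 < T ∧ IsMIntegralCurve γ Y ∧ Function.Periodic γ T ∧
    InjOn γ (Ico 0 T) ∧ range γ = L

/-- `L` is a `C^k`-embedded circle. -/
def IsEmbeddedCircle (k : ℕ) (L : Set M) : Prop :=
  ∃ f : Circle → M, IsSmoothEmbedding (𝓡 1) (𝓡 2) (k : ℕ∞ω) f ∧ range f = L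

/-! ### The Poincaré–Hopf index at an isolated zero -/

/-- The unit vector of angle `s`. -/
def unitVec (s : ℝ) : Plane := !₂[Real.cos s, Real.sin s]

/-- The loop `c : [0, 2π] → ℝ² ∖ {0}` has winding number `n` about the origin: it has a continuous
angle function whose total increase is `2πn`. -/
def HasWinding (c : ℝ → Plane) (n : ℤ) : Prop :=
  ∃ θ : ℝ → ℝ, ContinuousOn θ (Icc 0 (2 * Real.pi)) ∧
    (∀ s ∈ Icc 0 (2 * Real.pi), c s ≠ 0 ∧ c s = ‖c s‖ • unitVec (θ s)) ∧
    θ (2 * Real.pi) - θ 0 = n * (2 * Real.pi)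

/-- The isolated zero `p` of `X` has Poincaré–Hopf index `n`: in the chart at `p`, the field winds
`n` times around the origin along a small circle about `p` that encloses no other zero. -/
def HasLocalIndex (X : ∀ p : M, TangentSpace (𝓡 2) p) (p : M) (n : ℤ) : Prop :=
  ∃ r : ℝ, 0 < r ∧ Metric.closedBall (chartAt Plane p p) r ⊆ (chartAt Plane p).target ∧
    (∀ z ∈ Metric.closedBall (chartAt Plane p p) r, z ≠ chartAt Plane p p →
      chartRep (chartAt Plane p) X z ≠ 0) ∧
    HasWinding (fun s => chartRep (chartAt Plane p) X (chartAt Plane p p + r • unitVec s)) n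

/-- `X` has finitely many zeroes in `U`, and their Poincaré–Hopf indices add up to `n`. -/
def HasIndexSum (X : ∀ p : M, TangentSpace (𝓡 2) p) (U : Set M) (n : ℤ) : Prop :=
  (zeros X ∩ U).Finite ∧ ∃ ι : M → ℤ,
    (∀ p ∈ zeros X ∩ U, HasLocalIndex X p (ι p)) ∧ ∑ᶠ p ∈ zeros X ∩ U, ι p = n

end Basic

variable {M : Type*} [TopologicalSpace M] [ChartedSpace Plane M] [IsManifold (𝓡 2) ω M]

/-! ### Topologies and the index of a block -/

/-- The `C^k` topology: uniform convergence of the derivatives of order `0, …, k`, in every chart,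
on the compact subsets of the chart domain. For `k = 0` this is the topology of uniform convergence
on compact sets. -/
instance ckTopology (k : ℕ) : TopologicalSpace (VField M k) :=
  ⨅ (e : OpenPartialHomeomorph M Plane)
    (_ : e ∈ IsManifold.maximalAtlas (𝓡 2) ((k : ℕ∞ω) + 1) M) (i : ℕ) (_ : i ≤ k),
    TopologicalSpace.induced
      (fun X : VField M k => UniformOnFun.ofFun {L : Set Plane | IsCompact L ∧ L ⊆ e.target}
        (iteratedFDeriv ℝ i (chartRep e X)))
      inferInstance

/-- A `C^k` vector field viewed as a continuous vector field. -/
def VField.toC0 {k : ℕ} (X : VField M k) : VField M 0 :=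
  ⟨X, X.contMDiff.of_le (by simp)⟩

/-- `i(X, U) = n`: there are arbitrarily close (continuous) approximations of `X` with only finitely
many zeroes in `U`, and for all sufficiently close ones the indices of these zeroes add up
to `n`. -/
def HasIndexOn {k : ℕ} (X : VField M k) (U : Set M) (n : ℤ) : Prop :=
  (∃ᶠ X' : VField M 0 in 𝓝 X.toC0, (zeros X' ∩ U).Finite) ∧
  (∀ᶠ X' : VField M 0 in 𝓝 X.toC0, (zeros X' ∩ U).Finite → HasIndexSum X' U n)

/-- `i_K(X) = n`: the set `K` is an `X`-block and `i(X, U) = n` for its isolating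
neighbourhoods `U`. -/
def HasIndexAt {k : ℕ} (X : VField M k) (K : Set M) (n : ℤ) : Prop :=
  IsBlock X K ∧ ∀ U, IsIsolating X K U → HasIndexOn X U n

/-! ### Line fields -/

/-- A line field on `N`: a choice of a line in each tangent space `T_p M`, `p ∈ N`, that is
continuous, i.e. locally spanned by continuous nonvanishing vector fields. -/
structure LineField (N : Set M) where
  /-- the line at a point -/
  line : ∀ p : N, ℙ ℝ (TangentSpace (𝓡 2) (p : M))
  continuous_line : ∀ p : N, ∃ W : Set N, IsOpen W ∧ p ∈ W ∧
    ∃ v : ∀ q : N, TangentSpace (𝓡 2) (q : M),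
      ContinuousOn (fun q : N => (⟨q, v q⟩ : TangentBundle (𝓡 2) M)) W ∧
      ∀ q ∈ W, ∃ h : v q ≠ 0, line q = Projectivization.mk ℝ (v q) h

/-- The line field `Λ` controls `X` in `N`. -/
def LineField.Controls {N : Set M} (Λ : LineField N) (X : ∀ p : M, TangentSpace (𝓡 2) p) : Prop :=
  ∀ p : N, X p ∈ (Λ.line p).submodule

end SurfaceFields

end

/-! Tracking says that the local flow of Y permutes the orbits of X. Zeroes of X are the points
whose orbit is a single point, so the flow of Y carries zeroes to zeroes
(`Tracks.eq_zero_of_eq_zero`), and the block K is a union of trajectories of Y. Non-flatness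
describes X across such a trajectory. At p in K the first nonvanishing derivative, of order j, is a
symmetric form that is nonzero on the diagonal in some direction n transverse to Y p, so X(p + s n)
~ s^j ℓ with ℓ ≠ 0 (`exists_transversal_expansion`). Hence p is the only zero on a short
transversal, and flowing along Y shows that the zeroes near p lie on the trajectory of p.
Trajectories in K are therefore relatively clopen; by compactness K consists of finitely many of
them, and each is a periodic orbit.

The line field rests on the estimate that the time t map of Y turns the direction of X by O(t)
(`abs_det2_flow_le`). Tracking matches orbits only as sets, without parametrizations, so this is not
a computation with derivatives. The image of a short arc of X lies in one orbit, which is a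
countable union of compact arcs. By Baire some subarc is mapped into a single arc, and this gives
chords almost parallel to X whose image chords are again almost parallel to X (`exists_chord`).
Every point near p is reached in a short time from the transversal, where the direction of X tends
to ℓ, so X has the limit direction ℓ at p. Limit directions vary continuously and form the line
field; it is unique because X is nonzero on a dense subset of U.

To remove the zeroes one looks for V such that X + εV has no zeroes near K for any ε > 0 (`Pushes`).
The points of K where V = Y works, and those where V = -Y works, are relatively clopen in K, because
the flow of Y preserves antiparallelism of X and ±Y (`antiparallel_flow`). Where neither works, the
limit direction is that of Y, and X runs along Y on one side of K and against it on the other. The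
first side is a coherent choice of a side of K, so local transversal fields pointing to it can be
added up to a field V transverse to the limit direction (`exists_pushes_transversal`). Gluing the
three cases and cutting off gives W, compactly supported in U, such that X + εW has no zeroes in U
for all ε > 0. This is the approximation statement.

For the index it remains to see that the index sum of a field with finitely many zeroes depends only
on its behaviour near the boundary of U (`idxSum_eq`). A change on a compact set is broken into
changes inside coordinate discs, with Sard's theorem keeping the zeroes finite in number. In one
disc the winding number of the field along a boundary circle counts the zeroes
(`argument_principle`). A field close to X is joined near the boundary of U, by a segment of
nonvanishing fields, to X + W, so its index sum is 0. A component of K is compact and relatively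
open in K, so the same argument applies to it with a smaller isolating neighbourhood. -/

noncomputable section

namespace SurfaceFields

set_option linter.unusedSectionVars false

/-! ### Winding numbers of loops in the punctured complex plane -/

/-- A nowhere vanishing continuous function on a simply connected space has a continuous logarithm. -/
theorem exists_continuous_log {A : Type*} [TopologicalSpace A] [SimplyConnectedSpace A]
    [LocallyPathConnectedSpace A] (f : A → ℂ) (hf : Continuous f) (h0 : ∀ a, f a ≠ 0) :
    ∃ L : A → ℂ, Continuous L ∧ ∀ a, f a = Complex.exp (L a) := by
  have a₀ : A := Classical.choice inferInstance
  obtain ⟨F, ⟨-, hF⟩, -⟩ := Complex.isCoveringMap_exp.existsUnique_continuousMap_lifts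
    (⟨fun a => (⟨f a, h0 a⟩ : {z : ℂ // z ≠ 0}), by fun_prop⟩ : C(A, {z : ℂ // z ≠ 0}))
    a₀ (Complex.log (f a₀)) (by
      ext
      simp [Complex.exp_log (h0 a₀)])
  refine ⟨F, F.continuous, fun a => ?_⟩
  have := congrFun hF a
  simpa using (congrArg Subtype.val this).symm

/-- A continuous function on a connected space all of whose values have the same exponential is
constant. -/
theorem eq_of_exp_eq {A : Type*} [TopologicalSpace A] [PreconnectedSpace A] {d : A → ℂ}
    (hd : Continuous d) (h : ∀ a b, Complex.exp (d a) = Complex.exp (d b)) (a b : A) : d a = d b :=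
  Complex.isCoveringMap_exp.const_of_comp hd (fun a b => Subtype.ext (h a b)) a b

/-- The `2π`-periodic loop `c : ℝ → ℂ ∖ {0}` has winding number `n`. -/
def Wind (c : ℝ → ℂ) (n : ℤ) : Prop :=
  ∃ L : ℝ → ℂ, Continuous L ∧ (∀ s, c s = Complex.exp (L s)) ∧
    ∀ s, L (s + 2 * Real.pi) = L s + n * (2 * Real.pi * Complex.I)

/-- On the simply connected plane H has a logarithm; its increment over one period is continuous
with exponential 1, hence a single constant 2πin for all t. -/
theorem Wind.of_homotopy_real {H : ℝ × ℝ → ℂ} (hH : Continuous H) (h0 : ∀ p, H p ≠ 0)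
    (hper : ∀ t s, H (t, s + 2 * Real.pi) = H (t, s)) :
    ∃ n : ℤ, ∀ t, Wind (fun s => H (t, s)) n := by
  obtain ⟨L, hL, hLe⟩ := exists_continuous_log H hH h0
  have hd : Continuous fun p : ℝ × ℝ => L (p.1, p.2 + 2 * Real.pi) - L p := by fun_prop
  have hexp : ∀ p : ℝ × ℝ, Complex.exp (L (p.1, p.2 + 2 * Real.pi) - L p) = 1 := by
    intro p
    rw [Complex.exp_sub, ← hLe, ← hLe, hper, div_self (h0 _)]
  have hconst := eq_of_exp_eq hd (fun a b => by rw [hexp, hexp])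
  obtain ⟨n, hn⟩ := Complex.exp_eq_one_iff.1 (hexp (0, 0))
  refine ⟨n, fun t => ⟨fun s => L (t, s), by fun_prop, fun s => hLe _, fun s => ?_⟩⟩
  have := hconst (t, s) (0, 0)
  rw [hn] at this
  linear_combination this

theorem Wind.exists {c : ℝ → ℂ} (hc : Continuous c) (h0 : ∀ s, c s ≠ 0)
    (hper : ∀ s, c (s + 2 * Real.pi) = c s) : ∃ n, Wind c n := by
  obtain ⟨n, hn⟩ := Wind.of_homotopy_real (H := fun p => c p.2) (by fun_prop) (fun p => h0 _)
    (fun t s => hper s)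
  exact ⟨n, hn 0⟩

theorem Wind.unique {c : ℝ → ℂ} {n m : ℤ} (hn : Wind c n) (hm : Wind c m) : n = m := by
  obtain ⟨L, hL, hLe, hLp⟩ := hn
  obtain ⟨L', hL', hLe', hLp'⟩ := hm
  have h := eq_of_exp_eq (d := fun s => L s - L' s) (by fun_prop) (fun a b => by
    rw [Complex.exp_sub, Complex.exp_sub, ← hLe, ← hLe', ← hLe, ← hLe', div_self, div_self]
    · rw [hLe]; exact Complex.exp_ne_zero _
    · rw [hLe]; exact Complex.exp_ne_zero _) (0 + 2 * Real.pi) 0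
  simp only [hLp, hLp'] at h
  have h2 : ((n : ℂ) - m) * (2 * Real.pi * Complex.I) = 0 := by linear_combination h
  rcases mul_eq_zero.1 h2 with h3 | h3
  · exact_mod_cast sub_eq_zero.1 h3
  · exact absurd h3 Complex.two_pi_I_ne_zero

theorem Wind.mul {c d : ℝ → ℂ} {n m : ℤ} (hn : Wind c n) (hm : Wind d m) :
    Wind (fun s => c s * d s) (n + m) := by
  obtain ⟨L, hL, hLe, hLp⟩ := hn
  obtain ⟨L', hL', hLe', hLp'⟩ := hm
  refine ⟨fun s => L s + L' s, by fun_prop, fun s => ?_, fun s => ?_⟩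
  · dsimp only
    rw [Complex.exp_add, hLe, hLe']
  · dsimp only
    rw [hLp, hLp']; push_cast; ring

theorem Wind.zpow {c : ℝ → ℂ} {n : ℤ} (hn : Wind c n) (m : ℤ) :
    Wind (fun s => c s ^ m) (m * n) := by
  obtain ⟨L, hL, hLe, hLp⟩ := hn
  refine ⟨fun s => m * L s, by fun_prop, fun s => ?_, fun s => ?_⟩
  · dsimp only
    rw [Complex.exp_int_mul, hLe]
  · dsimp only
    rw [hLp]; push_cast; ring

theorem Wind.const {a : ℂ} (ha : a ≠ 0) : Wind (fun _ => a) 0 :=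
  ⟨fun _ => Complex.log a, by fun_prop, fun s => (Complex.exp_log ha).symm, fun s => by simp⟩

theorem Wind.exp : Wind (fun s => Complex.exp (s * Complex.I)) 1 :=
  ⟨fun s => s * Complex.I, by fun_prop, fun s => rfl, fun s => by push_cast; ring⟩

theorem Wind.comp_neg {c : ℝ → ℂ} {n : ℤ} (hn : Wind c n) : Wind (fun s => c (-s)) (-n) := by
  obtain ⟨L, hL, hLe, hLp⟩ := hn
  refine ⟨fun s => L (-s), by fun_prop, fun s => hLe _, fun s => ?_⟩
  have := hLp (-(s + 2 * Real.pi))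
  rw [show -(s + 2 * Real.pi) + 2 * Real.pi = -s by ring] at this
  push_cast
  linear_combination -this

theorem Wind.conj {c : ℝ → ℂ} {n : ℤ} (hn : Wind c n) :
    Wind (fun s => (starRingEnd ℂ) (c s)) (-n) := by
  obtain ⟨L, hL, hLe, hLp⟩ := hn
  refine ⟨fun s => (starRingEnd ℂ) (L s), by fun_prop, fun s => ?_, fun s => ?_⟩
  · dsimp only
    rw [Complex.exp_conj, hLe]
  · dsimp only
    rw [hLp]; simp [map_ofNat]

theorem Wind.congr {c d : ℝ → ℂ} {n : ℤ} (hn : Wind c n) (h : ∀ s, d s = c s) : Wind d n := by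
  rwa [show d = c from funext h]

theorem Wind.homotopy {H : ℝ → ℝ → ℂ} {n : ℤ}
    (hH : ContinuousOn (fun p : ℝ × ℝ => H p.1 p.2) (Icc 0 1 ×ˢ univ))
    (h0 : ∀ t ∈ Icc (0 : ℝ) 1, ∀ s, H t s ≠ 0)
    (hper : ∀ t ∈ Icc (0 : ℝ) 1, ∀ s, H t (s + 2 * Real.pi) = H t s) (hn : Wind (H 0) n) :
    Wind (H 1) n := by
  -- Freezing the homotopy outside [0, 1] makes it defined on the whole plane, so that one logarithm
  -- serves all times.
  have hp : ∀ t : ℝ, (projIcc (0 : ℝ) 1 zero_le_one t : ℝ) ∈ Icc (0 : ℝ) 1 := fun t => (projIcc _ _ _ t).2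
  obtain ⟨m, hm⟩ := Wind.of_homotopy_real
    (H := fun p : ℝ × ℝ => H (projIcc (0 : ℝ) 1 zero_le_one p.1 : ℝ) p.2)
    (hH.comp_continuous (f := fun p : ℝ × ℝ => ((projIcc (0 : ℝ) 1 zero_le_one p.1 : ℝ), p.2))
      (by fun_prop) (fun p => ⟨hp _, mem_univ _⟩)) (fun p => h0 _ (hp _) _)
      (fun t s => hper _ (hp _) _)
  have e0 := hm 0
  have e1 := hm 1
  simp only [projIcc_left, projIcc_right] at e0 e1
  rw [← e0.unique hn]
  exact e1

theorem Wind.of_lineMap {c d : ℝ → ℂ} {n : ℤ} (hc : Continuous c) (hd : Continuous d)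
    (h0 : ∀ t ∈ Icc (0 : ℝ) 1, ∀ s, (1 - t) * c s + t * d s ≠ 0)
    (hcp : ∀ s, c (s + 2 * Real.pi) = c s) (hdp : ∀ s, d (s + 2 * Real.pi) = d s)
    (hn : Wind c n) : Wind d n := by
  have := Wind.homotopy (H := fun t s => (1 - t) * c s + t * d s) (n := n)
    (by fun_prop) h0 (fun t _ s => by rw [hcp, hdp]) (hn.congr fun s => by simp)
  exact this.congr fun s => by simp

/-! ### The index of an isolated zero of a planar map -/

/-- The point of angle `s` on the circle of radius `r` about `z`. -/
def circ (z : ℂ) (r : ℝ) (s : ℝ) : ℂ := z + r * Complex.exp (s * Complex.I)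

theorem continuous_circ : Continuous fun p : ℂ × ℝ × ℝ => circ p.1 p.2.1 p.2.2 := by
  unfold circ; fun_prop

theorem circ_periodic (z : ℂ) (r s : ℝ) : circ z r (s + 2 * Real.pi) = circ z r s := by
  unfold circ
  push_cast
  rw [add_mul, Complex.exp_add, Complex.exp_two_pi_mul_I, mul_one]

theorem dist_circ (z : ℂ) {r : ℝ} (hr : 0 ≤ r) (s : ℝ) : dist (circ z r s) z = r := by
  simp [circ, Complex.norm_exp_ofReal_mul_I, abs_of_nonneg hr]

theorem circ_mem_closedBall (z : ℂ) {r R : ℝ} (hr : 0 ≤ r) (h : r ≤ R) (s : ℝ) :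
    circ z r s ∈ Metric.closedBall z R := by
  rw [Metric.mem_closedBall, dist_circ z hr]; exact h

theorem circ_ne (z : ℂ) {r : ℝ} (hr : 0 < r) (s : ℝ) : circ z r s ≠ z := by
  rw [← dist_pos, dist_circ z hr.le]; exact hr

/-- The index of the planar map `f` at `z`, a zero isolated in a neighbourhood. -/
def IsIdx (f : ℂ → ℂ) (z : ℂ) (n : ℤ) : Prop :=
  ∃ r > 0, ContinuousOn f (Metric.closedBall z r) ∧
    (∀ w ∈ Metric.closedBall z r, w ≠ z → f w ≠ 0) ∧ Wind (fun s => f (circ z r s)) n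

theorem Wind.circ_radius {f : ℂ → ℂ} {z : ℂ} {R r r' : ℝ}
    (hf : ContinuousOn f (Metric.closedBall z R))
    (h0 : ∀ w ∈ Metric.closedBall z R, w ≠ z → f w ≠ 0) (hr : 0 < r) (hrR : r ≤ R)
    (hr' : 0 < r') (hrR' : r' ≤ R) {n : ℤ} (h : Wind (fun s => f (circ z r s)) n) :
    Wind (fun s => f (circ z r' s)) n := by
  have hpos : ∀ t ∈ Icc (0 : ℝ) 1, 0 < (1 - t) * r + t * r' ∧ (1 - t) * r + t * r' ≤ R := by
    rintro t ⟨ht0, ht1⟩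
    constructor
    · rcases eq_or_lt_of_le ht0 with rfl | h
      · simpa using hr
      · nlinarith [mul_pos h hr', mul_nonneg (sub_nonneg.2 ht1) hr.le]
    · nlinarith
  have := Wind.homotopy (H := fun t s => f (circ z ((1 - t) * r + t * r') s)) (n := n) ?_ ?_ ?_
    (h.congr fun s => by simp)
  · exact this.congr fun s => by simp
  · refine hf.comp ?_ ?_
    · exact (continuous_circ.comp (by fun_prop : Continuous fun p : ℝ × ℝ =>
        (z, (1 - p.1) * r + p.1 * r', p.2))).continuousOn
    · rintro ⟨t, s⟩ ⟨ht, -⟩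
      exact circ_mem_closedBall _ (hpos t ht).1.le (hpos t ht).2 _
  · intro t ht s
    exact h0 _ (circ_mem_closedBall _ (hpos t ht).1.le (hpos t ht).2 _) (circ_ne _ (hpos t ht).1 _)
  · intro t ht s
    simp only [circ_periodic]

/-- The index may be computed on any small circle. -/
theorem IsIdx.wind {f : ℂ → ℂ} {z : ℂ} {n : ℤ} (h : IsIdx f z n) {R : ℝ} (hR : 0 < R)
    (hf : ContinuousOn f (Metric.closedBall z R))
    (h0 : ∀ w ∈ Metric.closedBall z R, w ≠ z → f w ≠ 0) : Wind (fun s => f (circ z R s)) n := by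
  obtain ⟨r, hr, hfr, h0r, hw⟩ := h
  have h1 := hw.circ_radius hfr h0r hr le_rfl (lt_min hr hR) (min_le_left r R)
  exact h1.circ_radius hf h0 (lt_min hr hR) (min_le_right r R) hR le_rfl

theorem IsIdx.unique {f : ℂ → ℂ} {z : ℂ} {n m : ℤ} (h : IsIdx f z n) (h' : IsIdx f z m) :
    n = m := by
  obtain ⟨r, hr, hfr, h0r, hw⟩ := h'
  exact (h.wind hr hfr h0r).unique hw

theorem continuous_comp_circ {f : ℂ → ℂ} {z : ℂ} {r : ℝ} (hr : 0 ≤ r)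
    (hf : ContinuousOn f (Metric.closedBall z r)) : Continuous fun s => f (circ z r s) :=
  hf.comp_continuous (continuous_circ.comp (by fun_prop : Continuous fun s : ℝ => (z, r, s)))
    (fun s => circ_mem_closedBall _ hr le_rfl s)

theorem IsIdx.exists {f : ℂ → ℂ} {z : ℂ} {r : ℝ} (hr : 0 < r)
    (hf : ContinuousOn f (Metric.closedBall z r))
    (h0 : ∀ w ∈ Metric.closedBall z r, w ≠ z → f w ≠ 0) : ∃ n, IsIdx f z n := by
  obtain ⟨n, hn⟩ := Wind.exists (continuous_comp_circ hr.le hf)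
    (fun s => h0 _ (circ_mem_closedBall _ hr.le le_rfl s) (circ_ne z hr s))
    (fun s => by simp only [circ_periodic])
  exact ⟨n, r, hr, hf, h0, hn⟩

theorem IsIdx.exists_radius {f : ℂ → ℂ} {z : ℂ} {n : ℤ} (h : IsIdx f z n) {s : Set ℂ}
    (hs : s ∈ 𝓝 z) : ∃ r > 0, Metric.closedBall z r ⊆ s ∧ ContinuousOn f (Metric.closedBall z r) ∧
    (∀ w ∈ Metric.closedBall z r, w ≠ z → f w ≠ 0) ∧ Wind (fun s => f (circ z r s)) n := by
  obtain ⟨r, hr, hfr, h0r, hw⟩ := h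
  obtain ⟨ρ, hρ, hρs⟩ := Metric.nhds_basis_closedBall.mem_iff.1 hs
  refine ⟨min r ρ, lt_min hr hρ, (Metric.closedBall_subset_closedBall (min_le_right _ _)).trans hρs,
    hfr.mono (Metric.closedBall_subset_closedBall (min_le_left _ _)),
    fun w hw' => h0r w (Metric.closedBall_subset_closedBall (min_le_left _ _) hw'), ?_⟩
  exact hw.circ_radius hfr h0r hr le_rfl (lt_min hr hρ) (min_le_left r ρ)

theorem IsIdx.congr {f g : ℂ → ℂ} {z : ℂ} {n : ℤ} (h : IsIdx f z n) (hfg : g =ᶠ[𝓝 z] f) :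
    IsIdx g z n := by
  obtain ⟨r, hr, hs, hc, h0, hw⟩ := h.exists_radius hfg
  refine ⟨r, hr, hc.congr fun w hw => hs hw, fun w hw hne => ?_, hw.congr fun s => ?_⟩
  · rw [show g w = f w from hs hw]; exact h0 w hw hne
  · exact hs (circ_mem_closedBall _ hr.le le_rfl s)

/-- Shrinking the circle to its centre contracts the loop to a nonzero constant. -/
theorem Wind.of_ne_zero {f : ℂ → ℂ} {z : ℂ} {r : ℝ} (hr : 0 ≤ r)
    (hf : ContinuousOn f (Metric.closedBall z r)) (h0 : ∀ w ∈ Metric.closedBall z r, f w ≠ 0) :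
    Wind (fun s => f (circ z r s)) 0 := by
  have hm : ∀ t ∈ Icc (0 : ℝ) 1, ∀ s, circ z (t * r) s ∈ Metric.closedBall z r := fun t ht s =>
    circ_mem_closedBall _ (mul_nonneg ht.1 hr) (by nlinarith [ht.2]) _
  have := Wind.homotopy (H := fun t s => f (circ z (t * r) s)) (n := 0) ?_ ?_ ?_
    ((Wind.const (h0 z (Metric.mem_closedBall_self hr))).congr fun s => by simp [circ])
  · exact this.congr fun s => by simp
  · refine hf.comp ?_ ?_
    · exact (continuous_circ.comp (by fun_prop : Continuous fun p : ℝ × ℝ =>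
        (z, p.1 * r, p.2))).continuousOn
    · rintro ⟨t, s⟩ ⟨ht, -⟩
      exact hm t ht s
  · exact fun t ht s => h0 _ (hm t ht s)
  · intro t ht s
    simp only [circ_periodic]

theorem IsIdx.mul_ne_zero {f h : ℂ → ℂ} {z : ℂ} {n : ℤ} (hf : IsIdx f z n) {s : Set ℂ}
    (hs : s ∈ 𝓝 z) (hh : ContinuousOn h s) (h0 : ∀ w ∈ s, h w ≠ 0) :
    IsIdx (fun w => f w * h w) z n := by
  obtain ⟨r, hr, hrs, hc, hf0, hw⟩ := hf.exists_radius hs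
  refine ⟨r, hr, hc.mul (hh.mono hrs), fun w hw hne => _root_.mul_ne_zero (hf0 w hw hne) (h0 w (hrs hw)), ?_⟩
  simpa using hw.mul (Wind.of_ne_zero hr.le (hh.mono hrs) fun w hw => h0 w (hrs hw))

/-- A map with an isolated zero of index `0` can be replaced near the zero by a map without
zeroes. -/
theorem exists_exp_extension {f : ℂ → ℂ} {z : ℂ} {r : ℝ} (hr : 0 < r)
    (hw : Wind (fun s => f (circ z r s)) 0) :
    ∃ L : ℂ → ℂ, Continuous L ∧ ∀ w, dist w z = r → f w = Complex.exp (L w) := by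
  obtain ⟨L, hL, hLe, hLp⟩ := hw
  have hLp' : ∀ s, L (s + 2 * Real.pi) = L s := fun s => by simpa using hLp s
  -- Winding number 0 makes the logarithm 2π-periodic, so it descends to the circle; Tietze's
  -- theorem then extends it to the plane.
  have hq : IsQuotientMap (Circle.exp : ℝ → Circle) :=
    Circle.isCoveringMap_exp.isQuotientMap Circle.exp_surjective
  let L' : C(Circle, ℂ) := hq.lift (f := Circle.exp) (⟨L, hL⟩ : C(ℝ, ℂ)) (by
    intro a b hab
    obtain ⟨m, hm⟩ := Circle.exp_eq_exp.1 hab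
    have hper : Function.Periodic L (2 * Real.pi) := hLp'
    rw [hm]
    simpa using hper.int_mul m b)
  have hL' : ∀ s, L' (Circle.exp s) = L s := fun s => by
    have := hq.lift_comp (f := Circle.exp) (⟨L, hL⟩ : C(ℝ, ℂ)) (by
      intro a b hab
      obtain ⟨m, hm⟩ := Circle.exp_eq_exp.1 hab
      have hper : Function.Periodic L (2 * Real.pi) := hLp'
      rw [hm]
      simpa using hper.int_mul m b)
    exact DFunLike.congr_fun this s
  let e : Circle → ℂ := fun u => z + r * u
  have he : Topology.IsClosedEmbedding e := by
    refine Continuous.isClosedEmbedding (by fun_prop) fun u v huv => ?_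
    have : (r : ℂ) ≠ 0 := by exact_mod_cast hr.ne'
    ext
    simpa [e, this] using huv
  obtain ⟨g, hg⟩ := ContinuousMap.exists_extension he L'
  refine ⟨g, g.continuous, fun w hw => ?_⟩
  have hn : ‖(w - z) / r‖ = 1 := by
    rw [norm_div, ← dist_eq_norm, hw]; simp [abs_of_pos hr, hr.ne']
  obtain ⟨s, hs⟩ := Circle.exp_surjective ⟨(w - z) / r, by simpa [Submonoid.unitSphere] using hn⟩
  have hs' : Complex.exp (s * Complex.I) = (w - z) / r := by
    have := congrArg (fun u : Circle => (u : ℂ)) hs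
    simpa [Circle.coe_exp] using this
  have hcw : circ z r s = w := by
    have : (r : ℂ) ≠ 0 := by exact_mod_cast hr.ne'
    rw [circ, hs']; field_simp; ring
  have h1 := hLe s
  rw [← hL', ← hg] at h1
  have h2 : e (Circle.exp s) = w := by
    rw [← hcw]; simp [e, circ, Circle.coe_exp]
  simp only [hcw, ContinuousMap.comp_apply, ContinuousMap.coe_mk, h2] at h1
  exact h1

/-- Sliding z₁ to the centre z₀ inside the disc never meets the circle, and about the centre the
loop is exp(is). -/
theorem wind_unit {z₀ z₁ : ℂ} {R : ℝ} (h : dist z₁ z₀ < R) :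
    Wind (fun s => (circ z₀ R s - z₁) / ‖circ z₀ R s - z₁‖) 1 := by
  have hR : 0 < R := dist_nonneg.trans_lt h
  have hne : ∀ t ∈ Icc (0 : ℝ) 1, ∀ s, circ z₀ R s - (z₀ + t * (z₁ - z₀)) ≠ 0 := by
    intro t ht s h0
    have h1 : circ z₀ R s - z₀ = t * (z₁ - z₀) := by linear_combination h0
    have h2 := dist_circ z₀ hR.le s
    rw [dist_eq_norm, h1, norm_mul, ← dist_eq_norm] at h2
    have : ‖(t : ℂ)‖ ≤ 1 := by simpa [abs_of_nonneg ht.1] using ht.2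
    nlinarith [dist_nonneg (x := z₁) (y := z₀)]
  have := Wind.homotopy (H := fun t s => (circ z₀ R s - (z₀ + t * (z₁ - z₀))) /
    ‖circ z₀ R s - (z₀ + t * (z₁ - z₀))‖) (n := 1) ?_ ?_ ?_ (Wind.exp.congr fun s => ?_)
  · exact this.congr fun s => by simp
  · have hc : Continuous fun p : ℝ × ℝ => circ z₀ R p.2 - (z₀ + p.1 * (z₁ - z₀)) :=
      (continuous_circ.comp (by fun_prop : Continuous fun p : ℝ × ℝ => (z₀, R, p.2))).sub
        (by fun_prop)
    refine hc.continuousOn.div (Complex.continuous_ofReal.comp hc.norm).continuousOn ?_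
    rintro ⟨t, s⟩ ⟨ht, -⟩
    simpa using hne t ht s
  · intro t ht s
    exact div_ne_zero (hne t ht s) (by simpa using hne t ht s)
  · intro t ht s
    simp only [circ_periodic]
  · have : ‖circ z₀ R s - z₀‖ = R := by rw [← dist_eq_norm, dist_circ _ hR.le]
    simp only [Complex.ofReal_zero, zero_mul, add_zero, this]
    rw [circ]; field_simp [hR.ne']; ring

/-- The argument principle for a continuous map with finitely many zeroes in a disc. -/
theorem argument_principle {z₀ : ℂ} {R : ℝ} (hR : 0 < R) (Z : Finset ℂ) :
    ∀ (f : ℂ → ℂ) (ι : ℂ → ℤ), ContinuousOn f (Metric.closedBall z₀ R) →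
    (∀ w ∈ Metric.closedBall z₀ R, f w = 0 ↔ w ∈ Z) → (∀ z ∈ Z, z ∈ Metric.ball z₀ R) →
    (∀ z ∈ Z, IsIdx f z (ι z)) → Wind (fun s => f (circ z₀ R s)) (∑ z ∈ Z, ι z) := by
  classical
  induction Z using Finset.induction_on with
  | empty =>
    intro f ι hf h0 _ _
    simpa using Wind.of_ne_zero hR.le hf fun w hw => by simpa using h0 w hw
  | insert z₁ Z hz₁ ih =>
    intro f ι hf h0 hZ hι
    have hz₁b : z₁ ∈ Metric.ball z₀ R := hZ z₁ (Finset.mem_insert_self _ _)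
    set n := ι z₁ with hn
    -- A model zero of index 1 and modulus 1. Multiplication by u^(-n) does not increase the
    -- modulus, so continuity at z₁ survives; it makes the index at z₁ zero and leaves the other
    -- indices alone. The zero z₁ can then be filled in by an exponential on a small disc, and the
    -- factor u^n gives back its contribution n on the big circle.
    let u : ℂ → ℂ := fun w => (w - z₁) / ‖w - z₁‖
    have hu_cont : ContinuousOn u {z₁}ᶜ := by
      refine ContinuousOn.div (by fun_prop) (by fun_prop) fun w hw => ?_
      simpa [sub_eq_zero] using hw
    have hu_norm : ∀ w, w ≠ z₁ → ‖u w‖ = 1 := fun w hw => by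
      simp [u, div_self (norm_ne_zero_iff.2 (sub_ne_zero.2 hw))]
    have hu_ne : ∀ w, w ≠ z₁ → u w ≠ 0 := fun w hw => by
      rw [← norm_ne_zero_iff, hu_norm w hw]; exact one_ne_zero
    have hun_cont : ContinuousOn (fun w => u w ^ (-n)) {z₁}ᶜ :=
      hu_cont.zpow₀ _ fun w hw => Or.inl (hu_ne w hw)
    have hf1 : f z₁ = 0 :=
      (h0 z₁ (Metric.ball_subset_closedBall hz₁b)).2 (Finset.mem_insert_self _ _)
    let g : ℂ → ℂ := fun w => f w * u w ^ (-n)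
    have hgn : ∀ w, ‖g w‖ ≤ ‖f w‖ := fun w => by
      by_cases hw : w = z₁
      · subst hw; simp [g, hf1]
      · simp [g, norm_zpow, hu_norm w hw]
    have hg1 : g z₁ = 0 := by simp [g, hf1]
    have hgc : ContinuousOn g (Metric.closedBall z₀ R) := by
      intro w hw
      by_cases hw1 : w = z₁
      · subst hw1
        have h1 := hf w hw
        rw [ContinuousWithinAt, hf1] at h1
        rw [ContinuousWithinAt, hg1]
        exact squeeze_zero_norm hgn (by simpa using h1.norm)
      · exact (hf w hw).mul
          ((hun_cont.continuousAt (isOpen_compl_singleton.mem_nhds hw1)).continuousWithinAt)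
    have hg0 : ∀ w ∈ Metric.closedBall z₀ R, g w = 0 ↔ w ∈ insert z₁ Z := by
      intro w hw
      rw [← h0 w hw]
      by_cases hw1 : w = z₁
      · subst hw1; simp [hg1, hf1]
      · simp [g, zpow_ne_zero _ (hu_ne w hw1)]
    -- a small disc about `z₁`
    have hnh : Metric.ball z₀ R ∩ ((Z : Set ℂ))ᶜ ∈ 𝓝 z₁ :=
      (Metric.isOpen_ball.inter Z.finite_toSet.isClosed.isOpen_compl).mem_nhds
        ⟨hz₁b, by simpa using hz₁⟩
    obtain ⟨r, hr, hrs, hfc, hf0, hfw⟩ := (hι z₁ (Finset.mem_insert_self _ _)).exists_radius hnh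
    have hgw : Wind (fun s => g (circ z₁ r s)) 0 := by
      have h1 := hfw.mul ((wind_unit (z₀ := z₁) (z₁ := z₁) (R := r) (by simpa using hr)).zpow (-n))
      rw [show ι z₁ + -n * 1 = 0 by simp [hn]] at h1
      exact h1
    obtain ⟨L, hL, hLe⟩ := exists_exp_extension hr hgw
    let h : ℂ → ℂ := (Metric.closedBall z₁ r).piecewise (fun w => Complex.exp (L w)) g
    have hin : ∀ w ∈ Metric.closedBall z₁ r, h w = Complex.exp (L w) := fun w hw =>
      Set.piecewise_eq_of_mem _ _ _ hw
    have hout : ∀ w ∉ Metric.closedBall z₁ r, h w = g w := fun w hw =>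
      Set.piecewise_eq_of_notMem _ _ _ hw
    have hhc : ContinuousOn h (Metric.closedBall z₀ R) := by
      refine ContinuousOn.piecewise (fun w hw => ?_) (by fun_prop) (hgc.mono inter_subset_left)
      have := hw.2
      rw [frontier_closedBall _ hr.ne', Metric.mem_sphere] at this
      exact (hLe w this).symm
    have hh0 : ∀ w ∈ Metric.closedBall z₀ R, h w = 0 ↔ w ∈ Z := by
      intro w hw
      by_cases hwr : w ∈ Metric.closedBall z₁ r
      · rw [hin w hwr]
        simp only [Complex.exp_ne_zero, false_iff]
        exact (hrs hwr).2
      · rw [hout w hwr, hg0 w hw, Finset.mem_insert, or_iff_right]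
        rintro rfl
        exact hwr (Metric.mem_closedBall_self hr.le)
    have hhι : ∀ z ∈ Z, IsIdx h z (ι z) := by
      intro z hz
      have hzr : z ∉ Metric.closedBall z₁ r := fun hzr => (hrs hzr).2 hz
      have hz1 : z ≠ z₁ := fun h => hz₁ (h ▸ hz)
      refine ((hι z (Finset.mem_insert_of_mem hz)).mul_ne_zero (isOpen_compl_singleton.mem_nhds hz1)
        hun_cont fun w hw => zpow_ne_zero _ (hu_ne w hw)).congr ?_
      filter_upwards [Metric.isClosed_closedBall.isOpen_compl.mem_nhds hzr] with w hw
      exact hout w hw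
    have hW := ih h ι hhc hh0 (fun z hz => hZ z (Finset.mem_insert_of_mem hz)) hhι
    have hW2 := hW.mul ((wind_unit (Metric.mem_ball.1 hz₁b)).zpow n)
    rw [Finset.sum_insert hz₁]
    rw [show ∑ z ∈ Z, ι z + n * 1 = ι z₁ + ∑ z ∈ Z, ι z by rw [hn]; ring] at hW2
    refine hW2.congr fun s => ?_
    have hs1 : circ z₀ R s ∉ Metric.ball z₀ R := by
      rw [Metric.mem_ball, dist_circ _ hR.le]; exact lt_irrefl _
    have hs2 : circ z₀ R s ∉ Metric.closedBall z₁ r := fun h => hs1 (hrs h).1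
    have hs3 : circ z₀ R s ≠ z₁ := fun h => hs1 (h ▸ hz₁b)
    rw [hout _ hs2]
    change _ = f _ * u (circ z₀ R s) ^ (-n) * u (circ z₀ R s) ^ n
    rw [mul_assoc, ← zpow_add₀ (hu_ne _ hs3)]
    simp

/-! ### Invariance of the index under diffeomorphisms -/

theorem Wind.shift {c : ℝ → ℂ} {n : ℤ} (hn : Wind c n) (a : ℝ) : Wind (fun s => c (s + a)) n := by
  obtain ⟨L, hL, hLe, hLp⟩ := hn
  refine ⟨fun s => L (s + a), by fun_prop, fun s => hLe _, fun s => ?_⟩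
  dsimp only
  rw [← hLp, show s + 2 * Real.pi + a = s + a + 2 * Real.pi by ring]

theorem Wind.continuous {c : ℝ → ℂ} {n : ℤ} (hn : Wind c n) : Continuous c := by
  obtain ⟨L, hL, hLe, hLp⟩ := hn
  rw [show c = fun s => Complex.exp (L s) from funext hLe]
  fun_prop

theorem Wind.ne_zero {c : ℝ → ℂ} {n : ℤ} (hn : Wind c n) (s : ℝ) : c s ≠ 0 := by
  obtain ⟨L, hL, hLe, hLp⟩ := hn
  rw [hLe]; exact Complex.exp_ne_zero _

theorem Wind.periodic {c : ℝ → ℂ} {n : ℤ} (hn : Wind c n) (s : ℝ) :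
    c (s + 2 * Real.pi) = c s := by
  obtain ⟨L, hL, hLe, hLp⟩ := hn
  rw [hLe, hLe, hLp, Complex.exp_add, Complex.exp_int_mul_two_pi_mul_I, mul_one]

/-- The real-linear map `w ↦ a w + b w̄`. -/
def realLin (a b w : ℂ) : ℂ := a * w + b * (starRingEnd ℂ) w

theorem realLin_eq (A : ℂ →L[ℝ] ℂ) :
    ∃ a b : ℂ, ∀ w, A w = realLin a b w := by
  refine ⟨(A 1 - Complex.I * A Complex.I) / 2, (A 1 + Complex.I * A Complex.I) / 2, fun w => ?_⟩
  have h : A w = w.re * A 1 + w.im * A Complex.I := by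
    conv_lhs => rw [show w = w.re • (1 : ℂ) + w.im • Complex.I by simp]
    rw [map_add, map_smul, map_smul, Complex.real_smul, Complex.real_smul]
  rw [h, realLin]
  have h1 : w = w.re + w.im * Complex.I := (Complex.re_add_im w).symm
  have h2 : (starRingEnd ℂ) w = w.re - w.im * Complex.I := by
    apply Complex.ext <;> simp
  rw [h2]
  conv_rhs => rw [h1]
  simp only [Complex.add_re, Complex.ofReal_re, Complex.mul_re, Complex.I_re, mul_zero,
    Complex.ofReal_im, Complex.I_im, mul_one, sub_self, add_zero, Complex.add_im, Complex.mul_im,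
    zero_add]
  linear_combination ((w.im : ℂ) * A Complex.I) * Complex.I_sq

theorem realLin_ne_zero {a b w : ℂ} (h : ‖b‖ < ‖a‖) (hw : w ≠ 0) : realLin a b w ≠ 0 := by
  intro h0
  have h1 : a * w = -(b * (starRingEnd ℂ) w) := by rw [realLin] at h0; linear_combination h0
  have h2 := congrArg norm h1
  rw [norm_neg, norm_mul, norm_mul, RCLike.norm_conj] at h2
  exact h.ne' (mul_right_cancel₀ (norm_ne_zero_iff.2 hw) h2)

theorem norm_realLin_le (a b w : ℂ) : ‖realLin a b w‖ ≤ (‖a‖ + ‖b‖) * ‖w‖ := by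
  refine (norm_add_le _ _).trans ?_
  rw [norm_mul, norm_mul, RCLike.norm_conj, add_mul]

/-- When ‖b‖ < ‖a‖ (orientation preserved), scaling b to 0 stays among injective maps and ends at
multiplication by a, which does not change the winding. -/
theorem Wind.realLin_pos {c : ℝ → ℂ} {n : ℤ} {a b : ℂ} (h : ‖b‖ < ‖a‖) (hn : Wind c n) :
    Wind (fun s => realLin a b (c s)) n := by
  have ha : a ≠ 0 := norm_pos_iff.1 ((norm_nonneg b).trans_lt h)
  have h1 : Wind (fun s => a * c s) n := by simpa using (Wind.const ha).mul hn
  have hcont := hn.continuous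
  refine Wind.of_lineMap (c := fun s => a * c s) (by fun_prop) (by unfold realLin; fun_prop) ?_ ?_ ?_ h1
  · intro t ht s
    have : (1 - (t : ℂ)) * (a * c s) + t * realLin a b (c s) = realLin a (t * b) (c s) := by
      unfold realLin; ring
    rw [this]
    refine realLin_ne_zero (lt_of_le_of_lt ?_ h) (hn.ne_zero s)
    rw [norm_mul, Complex.norm_real, Real.norm_of_nonneg ht.1]
    exact mul_le_of_le_one_left (norm_nonneg b) ht.2
  · intro s; simp only [hn.periodic]
  · intro s; simp only [hn.periodic]

theorem Wind.realLin_neg {c : ℝ → ℂ} {n : ℤ} {a b : ℂ} (h : ‖a‖ < ‖b‖) (hn : Wind c n) :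
    Wind (fun s => realLin a b (c s)) (-n) := by
  refine (hn.conj.realLin_pos h).congr fun s => ?_
  simp [realLin, add_comm]

/-- Scaling b to 0 deforms the ellipse, away from z, to the circle of radius ‖a‖ r traversed with
the phase shift arg a. -/
theorem Wind.comp_realLin_pos {f : ℂ → ℂ} {z : ℂ} {R : ℝ}
    (hf : ContinuousOn f (Metric.closedBall z R))
    (h0 : ∀ w ∈ Metric.closedBall z R, w ≠ z → f w ≠ 0) {a b : ℂ} (h : ‖b‖ < ‖a‖) {r : ℝ}
    (hr : 0 < r) (hrR : (‖a‖ + ‖b‖) * r ≤ R) {n : ℤ} (hn : IsIdx f z n) :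
    Wind (fun s => f (z + realLin a b (r * Complex.exp (s * Complex.I)))) n := by
  have ha : 0 < ‖a‖ := (norm_nonneg b).trans_lt h
  have hR : 0 < R := lt_of_lt_of_le (by positivity) hrR
  obtain ⟨θ, hθ⟩ : ∃ θ : ℝ, a = ‖a‖ * Complex.exp (θ * Complex.I) :=
    ⟨a.arg, (Complex.norm_mul_exp_arg_mul_I a).symm⟩
  have h1 : Wind (fun s => f (circ z (‖a‖ * r) s)) n :=
    (hn.wind hR hf h0).circ_radius hf h0 hR le_rfl (by positivity)
      (le_trans (by nlinarith [norm_nonneg b]) hrR)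
  have h2 : Wind (fun s => f (z + realLin a 0 (r * Complex.exp (s * Complex.I)))) n := by
    refine (h1.shift θ).congr fun s => ?_
    congr 1
    rw [circ, realLin]
    conv_lhs => rw [hθ]
    push_cast
    rw [add_mul, Complex.exp_add]
    ring
  have hmem : ∀ t ∈ Icc (0 : ℝ) 1, ∀ s : ℝ,
      z + realLin a (t * b) (r * Complex.exp (s * Complex.I)) ∈ Metric.closedBall z R := by
    intro t ht s
    rw [Metric.mem_closedBall, dist_eq_norm, add_sub_cancel_left]
    refine (norm_realLin_le _ _ _).trans (le_trans ?_ hrR)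
    rw [norm_mul, norm_mul, Complex.norm_exp_ofReal_mul_I, Complex.norm_real, Complex.norm_real,
      Real.norm_of_nonneg ht.1, Real.norm_of_nonneg hr.le, mul_one]
    gcongr
    exact mul_le_of_le_one_left (norm_nonneg b) ht.2
  have := Wind.homotopy
    (H := fun t s => f (z + realLin a (t * b) (r * Complex.exp (s * Complex.I)))) (n := n) ?_ ?_ ?_
    (h2.congr fun s => by simp)
  · exact this.congr fun s => by simp
  · refine hf.comp ?_ (fun p hp => hmem p.1 hp.1 p.2)
    unfold realLin
    fun_prop
  · intro t ht s
    refine h0 _ (hmem t ht s) ?_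
    rw [ne_eq, add_eq_left]
    refine realLin_ne_zero (lt_of_le_of_lt ?_ h) (mul_ne_zero ?_ (Complex.exp_ne_zero _))
    · rw [norm_mul, Complex.norm_real, Real.norm_of_nonneg ht.1]
      exact mul_le_of_le_one_left (norm_nonneg b) ht.2
    · exact_mod_cast hr.ne'
  · intro t ht s
    have : Complex.exp ((s + 2 * Real.pi : ℝ) * Complex.I) = Complex.exp (s * Complex.I) := by
      push_cast
      rw [add_mul, Complex.exp_add, Complex.exp_two_pi_mul_I, mul_one]
    simp only [this]

theorem Wind.comp_realLin_neg {f : ℂ → ℂ} {z : ℂ} {R : ℝ}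
    (hf : ContinuousOn f (Metric.closedBall z R))
    (h0 : ∀ w ∈ Metric.closedBall z R, w ≠ z → f w ≠ 0) {a b : ℂ} (h : ‖a‖ < ‖b‖) {r : ℝ}
    (hr : 0 < r) (hrR : (‖a‖ + ‖b‖) * r ≤ R) {n : ℤ} (hn : IsIdx f z n) :
    Wind (fun s => f (z + realLin a b (r * Complex.exp (s * Complex.I)))) (-n) := by
  refine (Wind.comp_realLin_pos hf h0 h hr (by rwa [add_comm]) hn).comp_neg.congr fun s => ?_
  have : (starRingEnd ℂ) (Complex.exp (s * Complex.I)) = Complex.exp ((-s : ℝ) * Complex.I) := by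
    rw [← Complex.exp_conj]; simp
  have h2 : (starRingEnd ℂ) (Complex.exp ((-s : ℝ) * Complex.I)) = Complex.exp (s * Complex.I) := by
    rw [← Complex.exp_conj]; simp
  simp only [realLin, map_mul, Complex.conj_ofReal, this, h2]
  rw [add_comm (a * _)]

/-- The index at an isolated zero is invariant under a change of coordinates: `ψ` is the inverse of
the change of coordinates and `A y` is its derivative at `ψ y`. -/
theorem IsIdx.diffeo {f : ℂ → ℂ} {y₀ : ℂ} {n : ℤ} {ψ : ℂ → ℂ} (hf : IsIdx f (ψ y₀) n)
    {s : Set ℂ} (hs : s ∈ 𝓝 y₀) (hψ : ContinuousOn ψ s) (B : ℂ ≃L[ℝ] ℂ)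
    (hB : HasFDerivAt ψ (B : ℂ →L[ℝ] ℂ) y₀) {A : ℂ → ℂ →L[ℝ] ℂ} (hA : ContinuousOn A s)
    (hAB : A y₀ = (B.symm : ℂ →L[ℝ] ℂ)) : IsIdx (fun y => A y (f (ψ y))) y₀ n := by
  obtain ⟨R, hR, -, hfc, hf0, -⟩ := hf.exists_radius univ_mem
  set z₀ := ψ y₀ with hz₀
  obtain ⟨γ, δ, hBr⟩ := realLin_eq (B : ℂ →L[ℝ] ℂ)
  obtain ⟨α, β, hAr⟩ := realLin_eq (B.symm : ℂ →L[ℝ] ℂ)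
  -- lower bounds for the linear maps
  obtain ⟨c, hc, hcB⟩ : ∃ c > 0, ∀ v, c * ‖v‖ ≤ ‖B v‖ := by
    refine ⟨(‖(B.symm : ℂ →L[ℝ] ℂ)‖ + 1)⁻¹, by positivity, fun v => ?_⟩
    rw [inv_mul_le_iff₀ (by positivity)]
    calc ‖v‖ = ‖(B.symm : ℂ →L[ℝ] ℂ) (B v)‖ := by simp
      _ ≤ ‖(B.symm : ℂ →L[ℝ] ℂ)‖ * ‖B v‖ := ContinuousLinearMap.le_opNorm _ _
      _ ≤ _ := by gcongr; linarith
  obtain ⟨a, ha, haA⟩ : ∃ a > 0, ∀ v, a * ‖v‖ ≤ ‖B.symm v‖ := by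
    refine ⟨(‖(B : ℂ →L[ℝ] ℂ)‖ + 1)⁻¹, by positivity, fun v => ?_⟩
    rw [inv_mul_le_iff₀ (by positivity)]
    calc ‖v‖ = ‖(B : ℂ →L[ℝ] ℂ) (B.symm v)‖ := by simp
      _ ≤ ‖(B : ℂ →L[ℝ] ℂ)‖ * ‖B.symm v‖ := ContinuousLinearMap.le_opNorm _ _
      _ ≤ _ := by gcongr; linarith
  set N := ‖γ‖ + ‖δ‖ with hN
  have hN0 : 0 ≤ N := by positivity
  have hA0 : ContinuousAt A y₀ := hA.continuousAt hs
  have e1 : ∀ᶠ y in 𝓝 y₀, ‖A y - A y₀‖ < a := by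
    have := Metric.continuousAt_iff'.1 hA0 a ha
    simpa [dist_eq_norm] using this
  have e2 : ∀ᶠ y in 𝓝 y₀, ‖ψ y - z₀ - B (y - y₀)‖ ≤ c / 2 * ‖y - y₀‖ :=
    hB.isLittleO.def (by positivity)
  have e3 : ∀ᶠ y in 𝓝 y₀, (N + c) * ‖y - y₀‖ ≤ R := by
    have : ContinuousAt (fun y : ℂ => (N + c) * ‖y - y₀‖) y₀ := by fun_prop
    filter_upwards [this.eventually_lt_const (by simpa using hR)] with y hy using le_of_lt hy
  obtain ⟨r, hr, hrs⟩ := Metric.nhds_basis_closedBall.mem_iff.1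
    (((e1.and e2).and e3).and hs)
  -- the displacement along the homotopy
  have hBn : ∀ v, ‖B v‖ ≤ N * ‖v‖ := fun v => by
    have := hBr v
    simp only [ContinuousLinearEquiv.coe_coe] at this
    rw [this]; exact norm_realLin_le _ _ _
  have hdisp : ∀ t ∈ Icc (0 : ℝ) 1, ∀ y ∈ Metric.closedBall y₀ r,
      z₀ + (B (y - y₀) + t * (ψ y - z₀ - B (y - y₀))) ∈ Metric.closedBall z₀ R ∧
      (y ≠ y₀ → z₀ + (B (y - y₀) + t * (ψ y - z₀ - B (y - y₀))) ≠ z₀) := by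
    intro t ht y hy
    obtain ⟨⟨⟨-, h2⟩, h3⟩, -⟩ := hrs hy
    have ht' : ‖(t : ℂ)‖ ≤ 1 := by simpa [abs_of_nonneg ht.1] using ht.2
    have h4 : ‖(t : ℂ) * (ψ y - z₀ - B (y - y₀))‖ ≤ c / 2 * ‖y - y₀‖ := by
      rw [norm_mul]
      exact (mul_le_of_le_one_left (norm_nonneg _) ht').trans h2
    constructor
    · rw [Metric.mem_closedBall, dist_eq_norm, add_sub_cancel_left]
      refine (norm_add_le _ _).trans ?_
      nlinarith [hBn (y - y₀), norm_nonneg (y - y₀)]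
    · intro hne h
      rw [add_eq_left, add_eq_zero_iff_eq_neg] at h
      have h5 := hcB (y - y₀)
      rw [h, norm_neg] at h5
      have : 0 < ‖y - y₀‖ := norm_pos_iff.2 (sub_ne_zero.2 hne)
      nlinarith
  have hψm : ∀ y ∈ Metric.closedBall y₀ r, ψ y ∈ Metric.closedBall z₀ R ∧ (y ≠ y₀ → ψ y ≠ z₀) := by
    intro y hy
    have := hdisp 1 (by simp) y hy
    simpa using this
  have hAne : ∀ t ∈ Icc (0 : ℝ) 1, ∀ y ∈ Metric.closedBall y₀ r, ∀ v : ℂ, v ≠ 0 →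
      (1 - t) * B.symm v + t * A y v ≠ 0 := by
    intro t ht y hy v hv h
    obtain ⟨⟨⟨h1, -⟩, -⟩, -⟩ := hrs hy
    have ht' : ‖(t : ℂ)‖ ≤ 1 := by simpa [abs_of_nonneg ht.1] using ht.2
    have h2 : B.symm v = -(t * ((A y - A y₀) v)) := by
      rw [_root_.sub_apply, hAB]
      simp only [ContinuousLinearEquiv.coe_coe]
      linear_combination h
    have h3 := haA v
    rw [h2, norm_neg, norm_mul] at h3
    have h4 := (A y - A y₀).le_opNorm v
    have hv' : 0 < ‖v‖ := norm_pos_iff.2 hv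
    have h5 : ‖(t : ℂ)‖ * ‖(A y - A y₀) v‖ ≤ ‖(A y - A y₀) v‖ :=
      mul_le_of_le_one_left (norm_nonneg _) ht'
    nlinarith
  have hsb : Metric.closedBall y₀ r ⊆ s := fun y hy => (hrs hy).2
  have hcb : ∀ s, circ y₀ r s ∈ Metric.closedBall y₀ r := circ_mem_closedBall _ hr.le le_rfl
  have hcp : ∀ s, circ y₀ r (s + 2 * Real.pi) = circ y₀ r s := circ_periodic _ _
  have hcc : Continuous fun s : ℝ => circ y₀ r s :=
    continuous_circ.comp (by fun_prop : Continuous fun s : ℝ => (y₀, r, s))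
  have hψc : Continuous fun s => ψ (circ y₀ r s) := hψ.comp_continuous hcc fun s => hsb (hcb s)
  have hAc : Continuous fun s => A (circ y₀ r s) := hA.comp_continuous hcc fun s => hsb (hcb s)
  have hgc : ContinuousOn (fun y => A y (f (ψ y))) (Metric.closedBall y₀ r) :=
    (hA.mono hsb).clm_apply (hfc.comp (hψ.mono hsb) fun y hy => (hψm y hy).1)
  have hg0 : ∀ y ∈ Metric.closedBall y₀ r, y ≠ y₀ → A y (f (ψ y)) ≠ 0 := by
    intro y hy hne
    have h1 := hAne 1 (by simp) y hy _ (hf0 _ (hψm y hy).1 ((hψm y hy).2 hne))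
    simpa using h1
  refine ⟨r, hr, hgc, hg0, ?_⟩
  -- the homotopies
  have key : ∀ m : ℤ, Wind (fun s => f (z₀ + B (r * Complex.exp (s * Complex.I)))) m →
      (∀ c : ℝ → ℂ, Wind c m → Wind (fun s => B.symm (c s)) n) →
      Wind (fun s => A (circ y₀ r s) (f (ψ (circ y₀ r s)))) n := by
    intro m hm hAm
    have hc0 : ∀ s, circ y₀ r s - y₀ = r * Complex.exp (s * Complex.I) := fun s => by simp [circ]
    have hm1 := Wind.homotopy (n := m) (H := fun t s => f (z₀ + (B (circ y₀ r s - y₀) +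
      t * (ψ (circ y₀ r s) - z₀ - B (circ y₀ r s - y₀))))) (by
        refine hfc.comp ?_ (fun p hp => (hdisp p.1 hp.1 _ (hcb p.2)).1)
        have h1 : Continuous fun p : ℝ × ℝ => ψ (circ y₀ r p.2) := hψc.comp continuous_snd
        have h2 : Continuous fun p : ℝ × ℝ => B (circ y₀ r p.2 - y₀) :=
          B.continuous.comp ((hcc.comp continuous_snd).sub continuous_const)
        exact (continuous_const.add (h2.add ((Complex.continuous_ofReal.comp continuous_fst).mul
          ((h1.sub continuous_const).sub h2)))).continuousOn)
      (fun t ht s => hf0 _ (hdisp t ht _ (hcb s)).1 ((hdisp t ht _ (hcb s)).2 (circ_ne y₀ hr s)))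
      (fun t ht s => by simp only [hcp]) (hm.congr fun s => by simp [hc0])
    have hm2 : Wind (fun s => f (ψ (circ y₀ r s))) m := hm1.congr fun s => by simp
    have hm3 := hAm _ hm2
    refine Wind.of_lineMap hm3.continuous (hAc.clm_apply hm2.continuous) ?_ hm3.periodic
      (fun s => by simp only [hcp]) hm3
    intro t ht s
    exact hAne t ht _ (hcb s) _ (hm2.ne_zero s)
  have hrR : (‖γ‖ + ‖δ‖) * r ≤ R := by
    obtain ⟨⟨-, h3⟩, -⟩ := hrs (hcb 0)
    rw [← dist_eq_norm, dist_circ _ hr.le] at h3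
    nlinarith
  have hBs : ∀ v, B v = realLin γ δ v := hBr
  have hAs : ∀ v, B.symm v = realLin α β v := hAr
  -- B⁻¹B = id evaluated at 1 and I, separated into linear and antilinear coefficients. These
  -- relations force ‖γ‖ ≠ ‖δ‖, so B either preserves or reverses orientation, and B⁻¹ does the
  -- same.
  have r1 : α * γ + β * (starRingEnd ℂ) δ = 1 ∧ α * δ + β * (starRingEnd ℂ) γ = 0 := by
    have h1 : ∀ v, realLin α β (realLin γ δ v) = v := fun v => by rw [← hBs, ← hAs]; simp
    have hv1 := h1 1
    have hvI := h1 Complex.I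
    simp only [realLin, map_add, map_mul, Complex.conj_I, map_one, mul_one,
      map_neg] at hv1 hvI
    constructor
    · linear_combination (1 / 2 : ℂ) * hv1 - (1 / 2 : ℂ) * Complex.I * hvI + (-1/2 + α * γ / 2 - α * δ / 2 - β * (starRingEnd ℂ) γ / 2 + β * (starRingEnd ℂ) δ / 2) * Complex.I_sq
    · linear_combination (1 / 2 : ℂ) * hv1 + (1 / 2 : ℂ) * Complex.I * hvI - (-1/2 + α * γ / 2 - α * δ / 2 - β * (starRingEnd ℂ) γ / 2 + β * (starRingEnd ℂ) δ / 2) * Complex.I_sq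
  have r2 : ‖α‖ * ‖δ‖ = ‖β‖ * ‖γ‖ := by
    have := congrArg norm (eq_neg_of_add_eq_zero_left r1.2)
    rwa [norm_neg, norm_mul, norm_mul, RCLike.norm_conj] at this
  have r3 : ‖γ‖ ≠ ‖δ‖ := by
    intro h
    by_cases hγ : γ = 0
    · have hδ : δ = 0 := by rw [← norm_eq_zero, ← h, hγ, norm_zero]
      have := r1.1
      simp [hγ, hδ] at this
    · have hγn : ‖γ‖ ≠ 0 := norm_ne_zero_iff.2 hγ
      rw [h] at r2
      have hδn : ‖δ‖ ≠ 0 := h ▸ hγn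
      have h2 : ‖α‖ = ‖β‖ := mul_right_cancel₀ hδn r2
      have h3 : α * (γ * (starRingEnd ℂ) γ - δ * (starRingEnd ℂ) δ) = (starRingEnd ℂ) γ := by
        linear_combination (starRingEnd ℂ) γ * r1.1 - (starRingEnd ℂ) δ * r1.2
      rw [Complex.mul_conj, Complex.mul_conj, Complex.normSq_eq_norm_sq, Complex.normSq_eq_norm_sq,
        h, sub_self, mul_zero] at h3
      exact hγ (by simpa using h3.symm)
  rcases lt_or_gt_of_ne r3 with h | h
  · have hαβ : ‖α‖ < ‖β‖ := by
      by_contra! hle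
      have hα : 0 < ‖α‖ := by
        rw [norm_pos_iff]
        rintro rfl
        have : β = 0 := by simpa using hle
        simpa [this] using r1.1
      nlinarith [norm_nonneg γ, norm_nonneg δ, norm_nonneg β]
    refine key (-n) ?_ fun c hc => ?_
    · simp only [hBs]
      exact Wind.comp_realLin_neg hfc hf0 h hr hrR hf
    · simp only [hAs]
      simpa using hc.realLin_neg hαβ
  · have hαβ : ‖β‖ < ‖α‖ := by
      by_contra! hle
      have hβ : 0 < ‖β‖ := by
        rw [norm_pos_iff]
        rintro rfl
        have : α = 0 := by simpa using hle
        simpa [this] using r1.1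
      nlinarith [norm_nonneg γ, norm_nonneg δ, norm_nonneg α]
    refine key n ?_ fun c hc => ?_
    · simp only [hBs]
      exact Wind.comp_realLin_pos hfc hf0 h hr hrR hf
    · simp only [hAs]
      exact hc.realLin_pos hαβ

/-! ### Perturbing a map so that it has finitely many zeroes -/

theorem exists_cutoff {E : Type*} [TopologicalSpace E] [T2Space E] [RegularSpace E]
    [LocallyCompactSpace E] {P O : Set E} (hP : IsCompact P) (hO : IsOpen O) (hPO : P ⊆ O) :
    ∃ (χ : E → ℝ) (V : Set E), Continuous χ ∧ IsOpen V ∧ P ⊆ V ∧ closure V ⊆ O ∧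
      IsCompact (closure V) ∧ (∀ x ∈ closure V, χ x = 1) ∧
      HasCompactSupport χ ∧ tsupport χ ⊆ O ∧ ∀ x, χ x ∈ Icc (0 : ℝ) 1 := by
  obtain ⟨P₁, hP₁, hPP₁, hP₁O⟩ := exists_compact_between hP hO hPO
  obtain ⟨P₂, hP₂, hP₁P₂, hP₂O⟩ := exists_compact_between hP₁ hO hP₁O
  obtain ⟨χ, h1, h0, hcs, hI⟩ := exists_continuous_one_zero_of_isCompact hP₁
    isOpen_interior.isClosed_compl (disjoint_compl_right_iff_subset.2 hP₁P₂)
  have hcl : closure (interior P₁) ⊆ P₁ := hP₁.isClosed.closure_subset_iff.2 interior_subset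
  refine ⟨χ, interior P₁, χ.continuous, isOpen_interior, hPP₁, hcl.trans hP₁O,
    hP₁.of_isClosed_subset isClosed_closure hcl, fun x hx => h1 (hcl hx), hcs, ?_, hI⟩
  refine (hP₂.isClosed.closure_subset_iff.2 fun x hx => ?_).trans hP₂O
  by_contra hx2
  exact hx (h0 fun hx3 => hx2 (interior_subset hx3))

/-- By Sard's theorem, a continuous map `f` of a finite-dimensional space to itself whose zeroes
outside of a compact set `P` are finite in number can be changed near `P` so that it has finitely
many zeroes. -/
theorem exists_perturbation {E : Type*} [NormedAddCommGroup E] [NormedSpace ℝ E]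
    [FiniteDimensional ℝ E] [MeasurableSpace E] [BorelSpace E] {O P : Set E} (hO : IsOpen O)
    (hP : IsCompact P) (hPO : P ⊆ O) {f : E → E} (hf : ContinuousOn f O)
    (hfin : {z | z ∈ O \ P ∧ f z = 0}.Finite) :
    ∃ g : E → E, Continuous g ∧ HasCompactSupport g ∧ tsupport g ⊆ O ∧
      {z | z ∈ O ∧ f z + g z = 0}.Finite := by
  have : ProperSpace E := FiniteDimensional.proper_real E
  -- Deleting the finitely many zeroes off P leaves an open set in which every zero of f lies in P;
  -- the change is confined to it.
  set O' := O \ {z | z ∈ O \ P ∧ f z = 0} with hO'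
  have hO'o : IsOpen O' := hO.sdiff hfin.isClosed
  have hPO' : P ⊆ O' := fun z hz => ⟨hPO hz, fun h => h.1.2 hz⟩
  have hf0 : ∀ z ∈ O', f z = 0 → z ∈ P := fun z hz h => by
    by_contra hzP
    exact hz.2 ⟨⟨hz.1, hzP⟩, h⟩
  obtain ⟨χ, V, hχ, hV, hPV, hVO, hVc, hχ1, hχc, hχs, hχI⟩ := exists_cutoff hP hO'o hPO'
  obtain ⟨χ₂, V₂, hχ₂, hV₂, hPV₂, -, -, hχ₂1, hχ₂c, hχ₂s, -⟩ := exists_cutoff (P := tsupport χ) hχc hO'o hχs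
  -- a continuous extension of `f`
  have hfe : Continuous fun z => χ₂ z • f z := by
    rw [← continuousOn_univ]
    have : (univ : Set E) = O' ∪ (tsupport χ₂)ᶜ := by
      symm
      rw [eq_univ_iff_forall]
      intro z
      by_cases hz : z ∈ tsupport χ₂
      · exact Or.inl (hχ₂s hz)
      · exact Or.inr hz
    rw [this]
    refine ContinuousOn.union_of_isOpen (hχ₂.continuousOn.smul (hf.mono sdiff_subset)) ?_ hO'o
      (isClosed_tsupport _).isOpen_compl
    refine continuousOn_const (c := (0 : E)).congr fun z hz => ?_
    simp [image_eq_zero_of_notMem_tsupport hz]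
  -- the map is bounded below on the collar
  have hcol : IsCompact (tsupport χ \ V) := IsCompact.diff hχc hV
  obtain ⟨η, hη, hηf⟩ : ∃ η > 0, ∀ z ∈ tsupport χ \ V, 2 * η ≤ ‖f z‖ := by
    rcases (tsupport χ \ V).eq_empty_or_nonempty with he | hne
    · exact ⟨1, one_pos, by simp [he]⟩
    · have hc : ContinuousOn (fun z => ‖f z‖) (tsupport χ \ V) :=
        (hf.mono (fun z hz => (hχs hz.1).1)).norm
      obtain ⟨z, hz, hzm⟩ := hcol.exists_isMinOn hne hc
      refine ⟨‖f z‖ / 2, half_pos (norm_pos_iff.2 fun h => hz.2 (hPV (hf0 z (hχs hz.1) h))), ?_⟩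
      intro w hw
      have : ‖f z‖ ≤ ‖f w‖ := hzm hw
      linarith
  -- On the support of χ the approximation s is within η/2 of f, and the regular value c will have
  -- norm below η/2. The change is thus smaller than η, while ‖f‖ ≥ 2η on the collar where χ is cut
  -- off, so no zero appears there.
  obtain ⟨s, hs, hsf, -⟩ := hfe.exists_contDiff_approx (ε := fun _ => η / 2) 1 continuous_const
    (fun _ => half_pos hη)
  have hsf' : ∀ z ∈ tsupport χ, ‖s z - f z‖ < η / 2 := fun z hz => by
    have := hsf z
    rwa [hχ₂1 z (subset_closure (hPV₂ hz)), one_smul, dist_eq_norm] at this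
  -- a small regular value
  have hsd : Differentiable ℝ s := hs.differentiable (by simp)
  have hsard := MeasureTheory.addHaar_image_eq_zero_of_det_fderivWithin_eq_zero
    (MeasureTheory.Measure.addHaar (G := E)) (s := {z | (fderiv ℝ s z).det = 0}) (f := s)
    (f' := fun z => fderiv ℝ s z) (fun z _ => (hsd z).hasFDerivAt.hasFDerivWithinAt)
    (fun z hz => hz)
  obtain ⟨c, hc, hcr⟩ : ∃ c ∈ Metric.ball (0 : E) (η / 2), c ∉ s '' {z | (fderiv ℝ s z).det = 0} := by
    by_contra! h
    have h1 := MeasureTheory.measure_mono_null (show Metric.ball (0 : E) (η / 2) ⊆ _ from h) hsard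
    exact (Metric.measure_ball_pos (MeasureTheory.Measure.addHaar (G := E)) 0 (half_pos hη)).ne' h1
  have hgeq : ∀ z, χ z • (s z - c - χ₂ z • f z) = χ z • (s z - c - f z) := fun z => by
    by_cases hz : z ∈ tsupport χ
    · rw [hχ₂1 z (subset_closure (hPV₂ hz)), one_smul]
    · rw [image_eq_zero_of_notMem_tsupport hz, zero_smul, zero_smul]
  have hgsub : tsupport (fun z => χ z • (s z - c - χ₂ z • f z)) ⊆ tsupport χ := by
    refine closure_mono fun z hz => ?_
    simp only [Function.mem_support] at hz ⊢
    exact fun h => hz (by rw [h, zero_smul])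
  refine ⟨fun z => χ z • (s z - c - χ₂ z • f z), ?_, ?_, ?_, ?_⟩
  · exact hχ.smul ((hs.continuous.sub continuous_const).sub hfe)
  · exact IsCompact.of_isClosed_subset hχc (isClosed_tsupport _) hgsub
  · exact hgsub.trans (hχs.trans sdiff_subset)
  · simp only [hgeq]
    -- The derivative is invertible at the preimages of a regular value, so these are isolated, and
    -- a compact discrete set is finite.
    have hreg : {z | z ∈ closure V ∧ s z = c}.Finite := by
      have hK : IsCompact {z | z ∈ closure V ∧ s z = c} :=
        hVc.inter_right (isClosed_eq hs.continuous continuous_const)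
      refine hK.finite ?_
      rw [isDiscrete_iff_nhdsNE]
      rintro z ⟨hz, hzc⟩
      have hdet : (fderiv ℝ s z).det ≠ 0 := fun h => hcr ⟨z, h, hzc⟩
      have h1 : HasFDerivAt s (((fderiv ℝ s z).toContinuousLinearEquivOfDetNeZero hdet : E ≃L[ℝ] E)
        : E →L[ℝ] E) z := (hsd z).hasFDerivAt
      have h2 := h1.eventually_ne (c := c) ⟨_, (ContinuousLinearEquiv.antilipschitz _)⟩
      rw [← Filter.empty_mem_iff_bot]
      rw [← hzc] at h2
      have h3 := Filter.inter_mem_inf h2 (Filter.mem_principal_self {z | z ∈ closure V ∧ s z = c})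
      refine Filter.mem_of_superset h3 ?_
      rintro w ⟨hw1, hw2⟩
      exact hw1 (hw2.2.trans hzc.symm)
    refine (hfin.union hreg).subset ?_
    rintro z ⟨hz, h0⟩
    by_cases hzO : z ∈ O'
    · right
      by_cases hzV : z ∈ closure V
      · refine ⟨hzV, ?_⟩
        rw [hχ1 z hzV, one_smul] at h0
        rw [← sub_eq_zero]
        simpa using h0
      · exfalso
        by_cases hzs : z ∈ tsupport χ
        · have h1 := hηf z ⟨hzs, fun h => hzV (subset_closure h)⟩
          have h2 : f z = -(χ z • (s z - c - f z)) := eq_neg_of_add_eq_zero_left h0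
          have h3 : ‖f z‖ < η := by
            rw [h2, norm_neg, norm_smul, Real.norm_of_nonneg (hχI z).1]
            have h4 : ‖s z - c - f z‖ < η := by
              rw [show s z - c - f z = (s z - f z) - c by abel]
              refine (norm_sub_le _ _).trans_lt ?_
              have := mem_ball_zero_iff.1 hc
              linarith [hsf' z hzs]
            nlinarith [(hχI z).1, (hχI z).2, norm_nonneg (s z - c - f z)]
          linarith
        · rw [image_eq_zero_of_notMem_tsupport hzs, zero_smul, add_zero] at h0
          exact hzs (subset_tsupport _ (by
            have := hχ1 z (subset_closure (hPV (hf0 z hzO h0)))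
            simp [this]))
    · left
      simp only [hO', Set.mem_sdiff, not_and, not_not] at hzO
      exact hzO hz

/-! ### Vector fields in charts -/

section Charts

variable {M : Type*} [TopologicalSpace M] [ChartedSpace Plane M] [IsManifold (𝓡 2) ω M]
  {e e' : OpenPartialHomeomorph M Plane}

theorem mem_maximalAtlas_one {k : ℕ} (he : e ∈ IsManifold.maximalAtlas (𝓡 2) ((k : ℕ∞ω) + 1) M) :
    e ∈ IsManifold.maximalAtlas (𝓡 2) 1 M :=
  IsManifold.maximalAtlas_subset_of_le le_add_self he

theorem chartAt_mem_maximalAtlas (n : ℕ∞ω) (p : M) :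
    chartAt Plane p ∈ IsManifold.maximalAtlas (𝓡 2) n M :=
  IsManifold.maximalAtlas_subset_of_le le_top (IsManifold.chart_mem_maximalAtlas (n := ω) p)

theorem mdifferentiable_of_mem (he : e ∈ IsManifold.maximalAtlas (𝓡 2) 1 M) :
    e.MDifferentiable (𝓡 2) (𝓡 2) :=
  ⟨(contMDiffOn_of_mem_maximalAtlas he).mdifferentiableOn (by simp),
    (contMDiffOn_symm_of_mem_maximalAtlas he).mdifferentiableOn (by simp)⟩

theorem chartRep_apply (X : ∀ p : M, TangentSpace (𝓡 2) p) {q : M} (hq : q ∈ e.source) :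
    chartRep e X (e q) = mfderiv (𝓡 2) 𝓘(ℝ, Plane) e q (X q) := by
  have : ∀ p, p = q → (mfderiv (𝓡 2) 𝓘(ℝ, Plane) e p (X p) : Plane) =
    mfderiv (𝓡 2) 𝓘(ℝ, Plane) e q (X q) := by rintro _ rfl; rfl
  exact this _ (e.left_inv hq)

theorem chartRep_apply_eq_zero (he : e ∈ IsManifold.maximalAtlas (𝓡 2) 1 M)
    (X : ∀ p : M, TangentSpace (𝓡 2) p) {q : M} (hq : q ∈ e.source) :
    chartRep e X (e q) = 0 ↔ X q = 0 := by
  rw [chartRep_apply X hq]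
  have h := (mdifferentiable_of_mem he).mfderiv_injective hq
  constructor
  · intro h0
    exact h (h0.trans (map_zero (mfderiv (𝓡 2) 𝓘(ℝ, Plane) e q)).symm)
  · intro h0
    rw [h0]
    exact map_zero (mfderiv (𝓡 2) 𝓘(ℝ, Plane) e q)

theorem chartRep_eq_zero (he : e ∈ IsManifold.maximalAtlas (𝓡 2) 1 M)
    (X : ∀ p : M, TangentSpace (𝓡 2) p) {z : Plane} (hz : z ∈ e.target) :
    chartRep e X z = 0 ↔ X (e.symm z) = 0 := by
  rw [← chartRep_apply_eq_zero he X (e.map_target hz), e.right_inv hz]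

theorem contDiffOn_transition {n : ℕ∞ω} (he : e ∈ IsManifold.maximalAtlas (𝓡 2) n M)
    (he' : e' ∈ IsManifold.maximalAtlas (𝓡 2) n M) :
    ContDiffOn ℝ n (e' ∘ e.symm) (e.target ∩ e.symm ⁻¹' e'.source) := by
  rw [← contMDiffOn_iff_contDiffOn]
  exact (contMDiffOn_of_mem_maximalAtlas he').comp
    ((contMDiffOn_symm_of_mem_maximalAtlas he).mono inter_subset_left) inter_subset_right

theorem isOpen_transition_source (e e' : OpenPartialHomeomorph M Plane) :
    IsOpen (e.target ∩ e.symm ⁻¹' e'.source) :=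
  e.symm.isOpen_inter_preimage e'.open_source

theorem contDiffAt_transition {n : ℕ∞ω} (he : e ∈ IsManifold.maximalAtlas (𝓡 2) n M)
    (he' : e' ∈ IsManifold.maximalAtlas (𝓡 2) n M) {z : Plane} (hz : z ∈ e.target)
    (hz' : e.symm z ∈ e'.source) : ContDiffAt ℝ n (e' ∘ e.symm) z :=
  (contDiffOn_transition he he').contDiffAt ((isOpen_transition_source e e').mem_nhds ⟨hz, hz'⟩)

theorem chartRep_change (he : e ∈ IsManifold.maximalAtlas (𝓡 2) 1 M)
    (he' : e' ∈ IsManifold.maximalAtlas (𝓡 2) 1 M) (X : ∀ p : M, TangentSpace (𝓡 2) p)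
    {z : Plane} (hz : z ∈ e.target) (hz' : e.symm z ∈ e'.source) :
    chartRep e' X (e' (e.symm z)) = fderiv ℝ (e' ∘ e.symm) z (chartRep e X z) := by
  rw [chartRep_apply X hz', ← mfderiv_eq_fderiv]
  have h1 := (mdifferentiable_of_mem he').mdifferentiableAt hz'
  have h2 := (mdifferentiable_of_mem he).mdifferentiableAt_symm hz
  have h3 := (mdifferentiable_of_mem he).symm_comp_deriv (e.map_target hz)
  rw [e.right_inv hz] at h3
  have h4 := mfderiv_comp z h1 h2
  have h5 : (mfderiv (𝓡 2) (𝓡 2) (e' ∘ e.symm) z) (chartRep e X z) =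
      (mfderiv (𝓡 2) (𝓡 2) e' (e.symm z)) ((mfderiv (𝓡 2) (𝓡 2) e.symm z) (chartRep e X z)) := by
    rw [h4]; rfl
  refine Eq.trans ?_ h5.symm
  congr 1
  exact (DFunLike.congr_fun h3 (X (e.symm z))).symm

/-- The derivative of a change of charts, as a linear equivalence. -/
theorem exists_equiv_transition (he : e ∈ IsManifold.maximalAtlas (𝓡 2) 1 M)
    (he' : e' ∈ IsManifold.maximalAtlas (𝓡 2) 1 M) {z : Plane} (hz : z ∈ e.target)
    (hz' : e.symm z ∈ e'.source) : ∃ B : Plane ≃L[ℝ] Plane,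
      HasFDerivAt (e' ∘ e.symm) (B : Plane →L[ℝ] Plane) z ∧
      HasFDerivAt (e ∘ e'.symm) (B.symm : Plane →L[ℝ] Plane) (e' (e.symm z)) := by
  have h1 : HasFDerivAt (e' ∘ e.symm) (fderiv ℝ (e' ∘ e.symm) z) z :=
    ((contDiffAt_transition he he' hz hz').differentiableAt (by simp)).hasFDerivAt
  set w := e' (e.symm z) with hw
  have hwt : w ∈ e'.target := e'.map_source hz'
  have hws : e'.symm w = e.symm z := e'.left_inv hz'
  have hwz : e (e'.symm w) = z := by rw [hws, e.right_inv hz]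
  have h2 : HasFDerivAt (e ∘ e'.symm) (fderiv ℝ (e ∘ e'.symm) w) w :=
    ((contDiffAt_transition he' he hwt (by rw [hws]; exact e.map_target hz)).differentiableAt
      (by simp)).hasFDerivAt
  have h12 : (fderiv ℝ (e ∘ e'.symm) w).comp (fderiv ℝ (e' ∘ e.symm) z) =
      ContinuousLinearMap.id ℝ Plane := by
    refine (h2.comp z h1).unique ((hasFDerivAt_id z).congr_of_eventuallyEq ?_)
    filter_upwards [(isOpen_transition_source e e').mem_nhds ⟨hz, hz'⟩] with y hy
    simp only [Function.comp_apply, id]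
    rw [e'.left_inv hy.2, e.right_inv hy.1]
  have h21 : (fderiv ℝ (e' ∘ e.symm) z).comp (fderiv ℝ (e ∘ e'.symm) w) =
      ContinuousLinearMap.id ℝ Plane := by
    have h1' : HasFDerivAt (e' ∘ e.symm) (fderiv ℝ (e' ∘ e.symm) z) ((e ∘ e'.symm) w) := by
      simp only [Function.comp_apply]; rw [hwz]; exact h1
    refine (h1'.comp w h2).unique ((hasFDerivAt_id w).congr_of_eventuallyEq ?_)
    filter_upwards [(isOpen_transition_source e' e).mem_nhds
      ⟨hwt, by rw [mem_preimage, hws]; exact e.map_target hz⟩] with y hy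
    simp only [Function.comp_apply, id]
    rw [e.left_inv hy.2, e'.right_inv hy.1]
  refine ⟨ContinuousLinearEquiv.equivOfInverse' _ _ h21 h12, h1, h2⟩

/-- The representation contains the derivative of the chart, which costs one order: hence charts of
class C^{k+1}. -/
theorem contDiffOn_chartRep {k : ℕ} (X : VField M k)
    (he : e ∈ IsManifold.maximalAtlas (𝓡 2) ((k : ℕ∞ω) + 1) M) :
    ContDiffOn ℝ k (chartRep e X) e.target := by
  have h1 : ContMDiffOn (𝓡 2).tangent (𝓡 2).tangent k
      (tangentMapWithin (𝓡 2) (𝓡 2) e e.source) _ :=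
    (contMDiffOn_of_mem_maximalAtlas he).contMDiffOn_tangentMapWithin le_rfl
      e.open_source.uniqueMDiffOn
  have hk1 : (k : ℕ∞ω) ≤ (k : ℕ∞ω) + 1 := le_self_add
  have h2 : ContMDiffOn (𝓡 2) (𝓡 2).tangent k
      (fun z : Plane => (⟨e.symm z, X (e.symm z)⟩ : TangentBundle (𝓡 2) M)) e.target :=
    X.contMDiff.comp_contMDiffOn ((contMDiffOn_symm_of_mem_maximalAtlas he).of_le hk1)
  have h3 := h1.comp h2 (fun z hz => e.map_target hz)
  have h4 := (contMDiff_snd_tangentBundle_modelSpace Plane (𝓡 2) (n := k)).comp_contMDiffOn h3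
  rw [← contMDiffOn_iff_contDiffOn]
  refine h4.congr fun z hz => ?_
  exact (DFunLike.congr_fun (mfderivWithin_of_isOpen (I := 𝓡 2) (I' := 𝓡 2) (f := e) e.open_source
    (e.map_target hz)) (X (e.symm z))).symm

theorem continuousOn_chartRep {k : ℕ} (X : VField M k)
    (he : e ∈ IsManifold.maximalAtlas (𝓡 2) 1 M) : ContinuousOn (chartRep e X) e.target := by
  have := contDiffOn_chartRep (e := e) X.toC0 (by simpa using he)
  exact this.continuousOn

/-- The vector field with the representation `g` in the chart `e`, extended by zero. -/
def pushField (e : OpenPartialHomeomorph M Plane) (g : Plane → Plane) (p : M) :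
    TangentSpace (𝓡 2) p :=
  (mfderiv (𝓡 2) 𝓘(ℝ, Plane) e p).inverse (e.source.indicator (fun q => g (e q)) p)

theorem pushField_of_eq_zero {g : Plane → Plane} {p : M} (hp : p ∈ e.source → g (e p) = 0) :
    pushField e g p = 0 := by
  have h : e.source.indicator (fun q => g (e q)) p = 0 := by
    rw [Set.indicator_apply_eq_zero]; exact hp
  exact (congrArg (mfderiv (𝓡 2) 𝓘(ℝ, Plane) e p).inverse h).trans
    (map_zero (mfderiv (𝓡 2) 𝓘(ℝ, Plane) e p).inverse)

theorem chartRep_pushField_apply (he : e ∈ IsManifold.maximalAtlas (𝓡 2) 1 M) (g : Plane → Plane)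
    {p : M} (hp : p ∈ e.source) : chartRep e (pushField e g) (e p) = g (e p) := by
  rw [chartRep_apply _ hp]
  have h : e.source.indicator (fun q => g (e q)) p = g (e p) := Set.indicator_of_mem hp _
  have h1 : (mfderiv (𝓡 2) 𝓘(ℝ, Plane) e p).inverse =
      (((mdifferentiable_of_mem he).mfderiv hp).symm : _ →L[ℝ] TangentSpace (𝓡 2) p) :=
    ContinuousLinearMap.inverse_equiv ((mdifferentiable_of_mem he).mfderiv hp)
  have h2 : pushField e g p = ((mdifferentiable_of_mem he).mfderiv hp).symm (g (e p)) :=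
    (congrArg (mfderiv (𝓡 2) 𝓘(ℝ, Plane) e p).inverse h).trans (DFunLike.congr_fun h1 (g (e p)))
  exact (congrArg (mfderiv (𝓡 2) 𝓘(ℝ, Plane) e p) h2).trans
    (((mdifferentiable_of_mem he).mfderiv hp).apply_symm_apply (g (e p)))

theorem eq_of_chartRep_eq (he : e ∈ IsManifold.maximalAtlas (𝓡 2) 1 M)
    {X Y : ∀ p : M, TangentSpace (𝓡 2) p} {q : M} (hq : q ∈ e.source)
    (h : chartRep e X (e q) = chartRep e Y (e q)) : X q = Y q := by
  rw [chartRep_apply X hq, chartRep_apply Y hq] at h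
  exact (mdifferentiable_of_mem he).mfderiv_injective hq h

theorem contMDiffOn_pushField {k : ℕ} (he : e ∈ IsManifold.maximalAtlas (𝓡 2) ((k : ℕ∞ω) + 1) M)
    {g : Plane → Plane} {s : Set Plane} (hg : ContDiffOn ℝ k g s) :
    ContMDiffOn (𝓡 2) (𝓡 2).tangent k
      (fun p => (⟨p, pushField e g p⟩ : TangentBundle (𝓡 2) M)) (e.source ∩ e ⁻¹' s) := by
  have h1 : ContMDiffOn (𝓡 2).tangent (𝓡 2).tangent k
      (tangentMapWithin (𝓡 2) (𝓡 2) e.symm e.target) _ :=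
    (contMDiffOn_symm_of_mem_maximalAtlas he).contMDiffOn_tangentMapWithin le_rfl
      e.open_target.uniqueMDiffOn
  have hk1 : (k : ℕ∞ω) ≤ (k : ℕ∞ω) + 1 := le_self_add
  have h2 : ContMDiffOn (𝓡 2) (𝓡 2).tangent k
      (fun z : Plane => (⟨z, g z⟩ : TangentBundle (𝓡 2) Plane)) s := by
    intro z hz
    rw [Bundle.contMDiffWithinAt_totalSpace]
    refine ⟨contMDiffWithinAt_id, ?_⟩
    have := (hg z hz).contMDiffWithinAt
    simpa [TangentBundle.trivializationAt_apply] using this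
  have h3 := h2.comp (((contMDiffOn_of_mem_maximalAtlas he).of_le hk1).mono
    (inter_subset_left (t := e ⁻¹' s))) (fun p hp => hp.2)
  have h4 := h1.comp h3 (fun p hp => e.map_source hp.1)
  refine h4.congr fun p hp => ?_
  have he1 := mem_maximalAtlas_one he
  have h5 : ∀ q, q = p → ∀ v : TangentSpace (𝓡 2) q,
      (mfderiv (𝓡 2) 𝓘(ℝ, Plane) e q v : Plane) = g (e p) →
      (⟨p, pushField e g p⟩ : TangentBundle (𝓡 2) M) = ⟨q, v⟩ := by
    rintro _ rfl v hv
    congr 1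
    refine (mdifferentiable_of_mem he1).mfderiv_injective hp.1 ?_
    have := chartRep_pushField_apply he1 g hp.1
    rw [chartRep_apply _ hp.1] at this
    exact this.trans hv.symm
  refine h5 _ (e.left_inv hp.1) _ ?_
  have h6 := DFunLike.congr_fun ((mdifferentiable_of_mem he1).comp_symm_deriv (e.map_source hp.1))
    (g (e p))
  have h7 := DFunLike.congr_fun (mfderivWithin_of_isOpen (I := 𝓡 2) (I' := 𝓡 2) (f := e.symm)
    e.open_target (e.map_source hp.1)) (g (e p))
  exact (congrArg (mfderiv (𝓡 2) 𝓘(ℝ, Plane) e (e.symm (e p))) h7).trans h6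

/-- The `C^k` vector field that has the compactly supported `C^k` representation `g` in the
chart `e`. -/
def ofChart [T2Space M] {k : ℕ} (he : e ∈ IsManifold.maximalAtlas (𝓡 2) ((k : ℕ∞ω) + 1) M)
    {g : Plane → Plane} (hg : ContDiff ℝ k g) (hc : HasCompactSupport g)
    (hs : tsupport g ⊆ e.target) : VField M k :=
  ⟨pushField e g, by
    have hcl : IsClosed (e.symm '' tsupport g) :=
      (hc.isCompact.image_of_continuousOn (e.continuousOn_symm.mono hs)).isClosed
    have h1 : ContMDiffOn (𝓡 2) (𝓡 2).tangent k
        (fun p => (⟨p, pushField e g p⟩ : TangentBundle (𝓡 2) M)) e.source :=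
      (contMDiffOn_pushField he hg.contDiffOn).mono fun p hp => ⟨hp, e.map_source hp⟩
    have h2 : ContMDiffOn (𝓡 2) (𝓡 2).tangent k
        (fun p => (⟨p, pushField e g p⟩ : TangentBundle (𝓡 2) M)) (e.symm '' tsupport g)ᶜ := by
      refine (Bundle.contMDiff_zeroSection ℝ (TangentSpace (𝓡 2) : M → Type _)).contMDiffOn.congr
        fun p hp => ?_
      have : pushField e g p = 0 := pushField_of_eq_zero fun hps =>
        image_eq_zero_of_notMem_tsupport fun h => hp ⟨e p, h, e.left_inv hps⟩
      rw [this]; rfl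
    rw [← contMDiffOn_univ]
    have : (univ : Set M) = e.source ∪ (e.symm '' tsupport g)ᶜ := by
      symm
      rw [eq_univ_iff_forall]
      intro p
      by_cases hp : p ∈ e.symm '' tsupport g
      · obtain ⟨z, hz, rfl⟩ := hp
        exact Or.inl (e.map_target (hs hz))
      · exact Or.inr hp
    rw [this]
    exact h1.union_of_isOpen h2 e.open_source hcl.isOpen_compl⟩

theorem chartRep_add (X Y : ∀ p : M, TangentSpace (𝓡 2) p) (z : Plane) :
    chartRep e (fun p => X p + Y p) z = chartRep e X z + chartRep e Y z :=
  map_add (mfderiv (𝓡 2) 𝓘(ℝ, Plane) e (e.symm z)) _ _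

theorem chartRep_smul (c : M → ℝ) (X : ∀ p : M, TangentSpace (𝓡 2) p) (z : Plane) :
    chartRep e (fun p => c p • X p) z = c (e.symm z) • chartRep e X z :=
  map_smul (mfderiv (𝓡 2) 𝓘(ℝ, Plane) e (e.symm z)) _ _

/-- The product of a vector field with a function. -/
def VField.mulFun {k : ℕ} (X : VField M k) {c : M → ℝ} (hc : ContMDiff (𝓡 2) 𝓘(ℝ, ℝ) k c) :
    VField M k :=
  ⟨fun p => c p • X p, hc.smul_section X.contMDiff⟩

theorem VField.mulFun_apply {k : ℕ} (X : VField M k) {c : M → ℝ}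
    (hc : ContMDiff (𝓡 2) 𝓘(ℝ, ℝ) k c) (p : M) : X.mulFun hc p = c p • X p := rfl

end Charts

/-! ### The index sum of a vector field -/

/-- The isometry of the plane onto the complex numbers. -/
@[irreducible] def toC : Plane ≃L[ℝ] ℂ := Complex.orthonormalBasisOneI.repr.symm.toContinuousLinearEquiv

theorem toC_apply (v : Plane) : toC v = v 0 + v 1 * Complex.I := by
  rw [toC, LinearIsometryEquiv.coe_toContinuousLinearEquiv, Complex.orthonormalBasisOneI_repr_symm_apply]

theorem toC_unitVec (s : ℝ) : toC (unitVec s) = Complex.exp (s * Complex.I) := by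
  rw [toC_apply, Complex.exp_mul_I]
  simp [unitVec]

theorem norm_toC (v : Plane) : ‖toC v‖ = ‖v‖ := by
  rw [toC]
  exact Complex.orthonormalBasisOneI.repr.symm.norm_map v

theorem toC_mem_closedBall {v w : Plane} {r : ℝ} :
    toC v ∈ Metric.closedBall (toC w) r ↔ v ∈ Metric.closedBall w r := by
  rw [mem_closedBall_iff_norm, mem_closedBall_iff_norm, ← map_sub, norm_toC]

theorem Wind.hasWinding {c : ℝ → Plane} {n : ℤ} (h : Wind (fun s => toC (c s)) n) :
    HasWinding c n := by
  obtain ⟨L, hL, hLe, hLp⟩ := h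
  dsimp only at hLe
  refine ⟨fun s => (L s).im, by fun_prop, fun s _ => ⟨fun h0 => ?_, ?_⟩, ?_⟩
  · have := hLe s
    rw [h0, map_zero] at this
    exact Complex.exp_ne_zero _ this.symm
  · dsimp only
    apply toC.injective
    rw [map_smul, toC_unitVec, ← norm_toC, hLe s, Complex.norm_exp, Complex.real_smul,
      Complex.ofReal_exp, ← Complex.exp_add]
    congr 1
    exact (Complex.re_add_im (L s)).symm
  · have := congrArg Complex.im (hLp 0)
    simp at this
    dsimp only
    linarith

section Index

variable {M : Type*} [TopologicalSpace M] [ChartedSpace Plane M] [IsManifold (𝓡 2) ω M]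
  {e e' : OpenPartialHomeomorph M Plane}

/-- The representation of a vector field in a chart, as a complex function. -/
def cRep (e : OpenPartialHomeomorph M Plane) (X : ∀ p : M, TangentSpace (𝓡 2) p) (w : ℂ) : ℂ :=
  toC (chartRep e X (toC.symm w))

theorem cRep_toC (X : ∀ p : M, TangentSpace (𝓡 2) p) (z : Plane) :
    cRep e X (toC z) = toC (chartRep e X z) := by
  rw [cRep, toC.symm_apply_apply]

theorem continuousOn_cRep {k : ℕ} (X : VField M k) (he : e ∈ IsManifold.maximalAtlas (𝓡 2) 1 M) :
    ContinuousOn (cRep e X) (toC.symm ⁻¹' e.target) :=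
  toC.continuous.comp_continuousOn ((continuousOn_chartRep X he).comp toC.symm.continuous.continuousOn
    fun _ h => h)

theorem cRep_eq_zero (he : e ∈ IsManifold.maximalAtlas (𝓡 2) 1 M)
    (X : ∀ p : M, TangentSpace (𝓡 2) p) {w : ℂ} (hw : toC.symm w ∈ e.target) :
    cRep e X w = 0 ↔ X (e.symm (toC.symm w)) = 0 := by
  rw [cRep, map_eq_zero_iff toC toC.injective, chartRep_eq_zero he X hw]

/-- `IsIdx.diffeo` with ψ the transition from e' to e, and with the derivative of the opposite
transition acting on vectors. -/
theorem IsIdx.change (he : e ∈ IsManifold.maximalAtlas (𝓡 2) 1 M)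
    (he' : e' ∈ IsManifold.maximalAtlas (𝓡 2) 1 M) {X : ∀ p : M, TangentSpace (𝓡 2) p} {p : M}
    (hp : p ∈ e.source) (hp' : p ∈ e'.source) {n : ℤ} (h : IsIdx (cRep e X) (toC (e p)) n) :
    IsIdx (cRep e' X) (toC (e' p)) n := by
  obtain ⟨B, hB, hB'⟩ := exists_equiv_transition he' he (e'.map_source hp')
    (by rwa [e'.left_inv hp'])
  set S : Set Plane := e'.target ∩ e'.symm ⁻¹' e.source with hS
  have hSo : IsOpen S := isOpen_transition_source e' e
  have hpS : e' p ∈ S := ⟨e'.map_source hp', by rw [mem_preimage, e'.left_inv hp']; exact hp⟩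
  have hpe : (e ∘ e'.symm) (e' p) = e p := by simp [e'.left_inv hp']
  have hct : ContinuousOn (e ∘ e'.symm) S := (contDiffOn_transition he' he).continuousOn
  have hsC : toC.symm ⁻¹' S ∈ 𝓝 (toC (e' p)) :=
    (hSo.preimage toC.symm.continuous).mem_nhds (by simpa using hpS)
  have hmS : MapsTo toC.symm (toC.symm ⁻¹' S) S := fun _ h => h
  have hψ : ContinuousOn (fun y => toC ((e ∘ e'.symm) (toC.symm y))) (toC.symm ⁻¹' S) :=
    toC.continuous.comp_continuousOn (hct.comp toC.symm.continuous.continuousOn hmS)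
  have hψ' : HasFDerivAt (fun y => toC ((e ∘ e'.symm) (toC.symm y)))
      (((toC.symm.trans B).trans toC : ℂ ≃L[ℝ] ℂ) : ℂ →L[ℝ] ℂ) (toC (e' p)) := by
    have h1 : HasFDerivAt (e ∘ e'.symm) (B : Plane →L[ℝ] Plane) (toC.symm (toC (e' p))) := by
      rwa [toC.symm_apply_apply]
    have h2 := h1.comp (toC (e' p)) toC.symm.hasFDerivAt
    exact toC.hasFDerivAt.comp (toC (e' p)) h2
  have hA : ContinuousOn (fun y => (toC : Plane →L[ℝ] ℂ).comp
      ((fderiv ℝ (e' ∘ e.symm) ((e ∘ e'.symm) (toC.symm y))).comp (toC.symm : ℂ →L[ℝ] Plane)))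
      (toC.symm ⁻¹' S) := by
    have h1 : ContinuousOn (fderiv ℝ (e' ∘ e.symm)) (e.target ∩ e.symm ⁻¹' e'.source) :=
      (contDiffOn_transition he he').continuousOn_fderiv_of_isOpen
        (isOpen_transition_source e e') le_rfl
    have h2 : ContinuousOn (fun y => fderiv ℝ (e' ∘ e.symm) ((e ∘ e'.symm) (toC.symm y)))
        (toC.symm ⁻¹' S) := by
      refine h1.comp (hct.comp toC.symm.continuous.continuousOn hmS) fun y hy => ?_
      refine ⟨e.map_source hy.2, ?_⟩
      simp only [mem_preimage, Function.comp_apply]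
      rw [e.left_inv hy.2]
      exact e'.map_target hy.1
    exact continuousOn_const.clm_comp (h2.clm_comp continuousOn_const)
  have hAB : (toC : Plane →L[ℝ] ℂ).comp
      ((fderiv ℝ (e' ∘ e.symm) ((e ∘ e'.symm) (toC.symm (toC (e' p))))).comp
        (toC.symm : ℂ →L[ℝ] Plane)) =
      (((toC.symm.trans B).trans toC : ℂ ≃L[ℝ] ℂ).symm : ℂ →L[ℝ] ℂ) := by
    rw [toC.symm_apply_apply, Function.comp_apply, hB'.fderiv]
    rfl
  have hf : IsIdx (cRep e X) (toC ((e ∘ e'.symm) (toC.symm (toC (e' p))))) n := by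
    rwa [toC.symm_apply_apply, hpe]
  have key := IsIdx.diffeo hf hsC hψ _ hψ' hA hAB
  refine key.congr ?_
  filter_upwards [hsC] with y hy
  simp only [cRep, ContinuousLinearMap.comp_apply, ContinuousLinearEquiv.coe_coe,
    toC.symm_apply_apply, Function.comp_apply]
  have h3 := chartRep_change he he' X (z := e (e'.symm (toC.symm y))) (e.map_source hy.2)
    (by rw [e.left_inv hy.2]; exact e'.map_target hy.1)
  rw [e.left_inv hy.2, e'.right_inv hy.1] at h3
  rw [h3]

/-- `X` has index `n` at `p`, in terms of complex loops. -/
def IsLocIdx (X : ∀ p : M, TangentSpace (𝓡 2) p) (p : M) (n : ℤ) : Prop :=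
  IsIdx (cRep (chartAt Plane p) X) (toC (chartAt Plane p p)) n

theorem isLocIdx_iff (he : e ∈ IsManifold.maximalAtlas (𝓡 2) 1 M)
    {X : ∀ p : M, TangentSpace (𝓡 2) p} {p : M} (hp : p ∈ e.source) {n : ℤ} :
    IsLocIdx X p n ↔ IsIdx (cRep e X) (toC (e p)) n :=
  ⟨fun h => h.change (chartAt_mem_maximalAtlas 1 p) he (mem_chart_source _ p) hp,
    fun h => h.change he (chartAt_mem_maximalAtlas 1 p) hp (mem_chart_source _ p)⟩

theorem IsLocIdx.hasLocalIndex {X : ∀ p : M, TangentSpace (𝓡 2) p} {p : M} {n : ℤ}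
    (h : IsLocIdx X p n) : HasLocalIndex X p n := by
  obtain ⟨r, hr, hs, -, h0, hw⟩ := h.exists_radius (s := toC.symm ⁻¹' (chartAt Plane p).target)
    (((chartAt Plane p).open_target.preimage toC.symm.continuous).mem_nhds (by simp))
  refine ⟨r, hr, fun z hz => ?_, fun z hz hne h => ?_, ?_⟩
  · simpa using hs (toC_mem_closedBall.2 hz)
  · refine h0 _ (toC_mem_closedBall.2 hz) (fun h => hne (toC.injective h)) ?_
    rw [cRep_toC, h, map_zero]
  · refine Wind.hasWinding (hw.congr fun s => ?_)
    rw [← cRep_toC, map_add, map_smul, toC_unitVec, Complex.real_smul]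
    rfl

theorem IsLocIdx.unique {X : ∀ p : M, TangentSpace (𝓡 2) p} {p : M} {n m : ℤ}
    (h : IsLocIdx X p n) (h' : IsLocIdx X p m) : n = m :=
  IsIdx.unique h h'

theorem IsLocIdx.congr {X Y : ∀ p : M, TangentSpace (𝓡 2) p} {p : M} {n : ℤ}
    (h : IsLocIdx X p n) (hXY : ∀ᶠ q in 𝓝 p, Y q = X q) : IsLocIdx Y p n := by
  refine IsIdx.congr h ?_
  have h1 : Tendsto (fun w => (chartAt Plane p).symm (toC.symm w))
      (𝓝 (toC (chartAt Plane p p))) (𝓝 p) := by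
    have h2 := (chartAt Plane p).continuousAt_symm (mem_chart_target Plane p)
    have h3 : ContinuousAt (fun w => (chartAt Plane p).symm (toC.symm w))
        (toC (chartAt Plane p p)) :=
      ContinuousAt.comp (g := (chartAt Plane p).symm) (by simpa using h2)
        toC.symm.continuous.continuousAt
    simpa [ContinuousAt] using h3
  filter_upwards [h1.eventually hXY] with w hw
  unfold cRep chartRep
  rw [hw]

theorem exists_isLocIdx (X : VField M 0) {p : M} (h : ∀ᶠ q in 𝓝[≠] p, X q ≠ 0) :
    ∃ n, IsLocIdx X p n := by
  set e := chartAt Plane p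
  have he : e ∈ IsManifold.maximalAtlas (𝓡 2) 1 M := chartAt_mem_maximalAtlas 1 p
  obtain ⟨O, hO, hOX⟩ := mem_nhdsWithin_iff_exists_mem_nhds_inter.1 h
  have h1 : e.target ∩ e.symm ⁻¹' O ∈ 𝓝 (e p) :=
    inter_mem (e.open_target.mem_nhds (mem_chart_target Plane p))
      ((e.continuousAt_symm (mem_chart_target Plane p)).preimage_mem_nhds
        (by rwa [e.left_inv (mem_chart_source Plane p)]))
  obtain ⟨r, hr, hrs⟩ := Metric.nhds_basis_closedBall.mem_iff.1 h1
  have h2 : ∀ w ∈ Metric.closedBall (toC (e p)) r, toC.symm w ∈ Metric.closedBall (e p) r :=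
    fun w hw => toC_mem_closedBall.1 (by simpa using hw)
  refine IsIdx.exists hr ((continuousOn_cRep X he).mono fun w hw => (hrs (h2 w hw)).1)
    fun w hw hne h0 => ?_
  rw [cRep_eq_zero he X (hrs (h2 w hw)).1] at h0
  refine hOX ⟨(hrs (h2 w hw)).2, fun hp => hne ?_⟩ h0
  have hp' : e.symm (toC.symm w) = p := hp
  have h3 := e.right_inv (hrs (h2 w hw)).1
  rw [hp'] at h3
  rw [h3, toC.apply_symm_apply]

open Classical in
/-- The index of `X` at `p`. -/
def localIdx (X : ∀ p : M, TangentSpace (𝓡 2) p) (p : M) : ℤ :=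
  if h : ∃ n, IsLocIdx X p n then h.choose else 0

theorem isLocIdx_localIdx {X : ∀ p : M, TangentSpace (𝓡 2) p} {p : M}
    (h : ∃ n, IsLocIdx X p n) : IsLocIdx X p (localIdx X p) := by
  rw [localIdx, dif_pos h]
  exact h.choose_spec

theorem localIdx_congr {X Y : ∀ p : M, TangentSpace (𝓡 2) p} {p : M}
    (hXY : ∀ᶠ q in 𝓝 p, Y q = X q) : localIdx Y p = localIdx X p := by
  by_cases h : ∃ n, IsLocIdx X p n
  · obtain ⟨n, hn⟩ := h
    exact (isLocIdx_localIdx ⟨n, hn.congr hXY⟩).unique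
      ((isLocIdx_localIdx ⟨n, hn⟩).congr hXY)
  · rw [localIdx, localIdx, dif_neg h, dif_neg]
    rintro ⟨n, hn⟩
    exact h ⟨n, hn.congr (hXY.mono fun q hq => hq.symm)⟩

/-- The sum of the indices of the zeroes of `X` in `U`. -/
def idxSum (X : ∀ p : M, TangentSpace (𝓡 2) p) (U : Set M) : ℤ :=
  ∑ᶠ p ∈ zeros X ∩ U, localIdx X p

theorem exists_isLocIdx_of_finite [T1Space M] (X : VField M 0) {U : Set M} (hU : IsOpen U)
    (hf : (zeros X ∩ U).Finite) {p : M} (hp : p ∈ U) : ∃ n, IsLocIdx X p n := by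
  refine exists_isLocIdx X ?_
  have h1 : ((zeros X ∩ U) \ {p})ᶜ ∈ 𝓝 p :=
    (hf.subset sdiff_subset).isClosed.isOpen_compl.mem_nhds fun h => h.2 rfl
  filter_upwards [mem_nhdsWithin_of_mem_nhds h1, self_mem_nhdsWithin,
    mem_nhdsWithin_of_mem_nhds (hU.mem_nhds hp)] with q h2 h3 h4 h5
  exact h2 ⟨⟨h5, h4⟩, h3⟩

theorem hasIndexSum_idxSum [T1Space M] (X : VField M 0) {U : Set M} (hU : IsOpen U)
    (hf : (zeros X ∩ U).Finite) : HasIndexSum X U (idxSum X U) :=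
  ⟨hf, localIdx X, fun _ hp => (isLocIdx_localIdx
    (exists_isLocIdx_of_finite X hU hf hp.2)).hasLocalIndex, rfl⟩

theorem idxSum_congr {X Y : ∀ p : M, TangentSpace (𝓡 2) p} {U : Set M} (hU : IsOpen U)
    (h : ∀ p ∈ U, Y p = X p) : idxSum Y U = idxSum X U := by
  have h1 : zeros Y ∩ U = zeros X ∩ U := by
    ext p
    simp only [zeros, mem_inter_iff, mem_ofPred_eq]
    constructor
    · rintro ⟨h2, h3⟩; exact ⟨(h p h3).symm.trans h2, h3⟩
    · rintro ⟨h2, h3⟩; exact ⟨(h p h3).trans h2, h3⟩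
  unfold idxSum
  rw [h1]
  refine finsum_mem_congr rfl fun p hp => localIdx_congr ?_
  filter_upwards [hU.mem_nhds hp.2] with q hq using h q hq

end Index

/-! ### The index sum only depends on the boundary behaviour -/

section Degree

variable {M : Type*} [TopologicalSpace M] [T2Space M] [ChartedSpace Plane M]
  [IsManifold (𝓡 2) ω M] {e : OpenPartialHomeomorph M Plane}

/-- The part of the source of `e` that is mapped into the ball of radius `R` about `z₀`. -/
def disc (e : OpenPartialHomeomorph M Plane) (z₀ : ℂ) (R : ℝ) : Set M :=
  {p | p ∈ e.source ∧ toC (e p) ∈ Metric.ball z₀ R}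

theorem isOpen_disc (e : OpenPartialHomeomorph M Plane) (z₀ : ℂ) (R : ℝ) :
    IsOpen (disc e z₀ R) :=
  e.isOpen_inter_preimage (Metric.isOpen_ball.preimage toC.continuous)

theorem symm_mem_disc {z₀ w : ℂ} {R : ℝ} (hw : toC.symm w ∈ e.target)
    (hb : w ∈ Metric.ball z₀ R) : e.symm (toC.symm w) ∈ disc e z₀ R := by
  refine ⟨e.map_target hw, ?_⟩
  rwa [e.right_inv hw, toC.apply_symm_apply]

/-- The argument principle read in the chart; the chart is injective on the disc, so sums over
zeroes on M and in ℂ agree. -/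
theorem finsum_localIdx_disc (he : e ∈ IsManifold.maximalAtlas (𝓡 2) 1 M) {z₀ : ℂ} {R : ℝ}
    (hR : 0 < R) (ht : ∀ w ∈ Metric.closedBall z₀ R, toC.symm w ∈ e.target) (X : VField M 0)
    (hfin : (zeros X ∩ disc e z₀ R).Finite)
    (h0 : ∀ w, dist w z₀ = R → X (e.symm (toC.symm w)) ≠ 0) :
    Wind (fun s => cRep e X (circ z₀ R s)) (∑ᶠ p ∈ zeros X ∩ disc e z₀ R, localIdx X p) := by
  classical
  set φ : M → ℂ := fun p => toC (e p) with hφ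
  have hinj : InjOn φ (zeros X ∩ disc e z₀ R) := fun p hp q hq h =>
    e.injOn hp.2.1 hq.2.1 (toC.injective h)
  have hz : ∀ w ∈ Metric.closedBall z₀ R, cRep e X w = 0 ↔
      w ∈ (hfin.image φ).toFinset := by
    intro w hw
    rw [cRep_eq_zero he X (ht w hw), Set.Finite.mem_toFinset]
    constructor
    · intro h
      have hb : w ∈ Metric.ball z₀ R := by
        rcases eq_or_lt_of_le (Metric.mem_closedBall.1 hw) with h1 | h1
        · exact absurd h (h0 w h1)
        · exact h1
      refine ⟨_, ⟨h, symm_mem_disc (ht w hw) hb⟩, ?_⟩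
      rw [hφ]
      dsimp only
      rw [e.right_inv (ht w hw), toC.apply_symm_apply]
    · rintro ⟨p, ⟨hp, hpd⟩, rfl⟩
      rw [hφ]
      dsimp only
      rw [toC.symm_apply_apply, e.left_inv hpd.1]
      exact hp
  have key := argument_principle hR (hfin.image φ).toFinset (cRep e X)
    (fun w => localIdx X (e.symm (toC.symm w)))
    ((continuousOn_cRep X he).mono fun w hw => ht w hw) hz ?_ ?_
  · convert key using 1
    rw [← finsum_mem_coe_finset, Set.Finite.coe_toFinset, finsum_mem_image hinj]
    refine finsum_mem_congr rfl fun p hp => ?_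
    rw [hφ]
    dsimp only
    rw [toC.symm_apply_apply, e.left_inv hp.2.1]
  · intro w hw
    obtain ⟨p, hp, rfl⟩ := (Set.Finite.mem_toFinset _).1 hw
    exact hp.2.2
  · intro w hw
    obtain ⟨p, hp, rfl⟩ := (Set.Finite.mem_toFinset _).1 hw
    rw [hφ]
    dsimp only
    rw [toC.symm_apply_apply, e.left_inv hp.2.1]
    exact (isLocIdx_iff he hp.2.1).1
      (isLocIdx_localIdx (exists_isLocIdx_of_finite X (isOpen_disc e z₀ R) hfin hp.2))

/-- Only finitely many radii are occupied by zeroes, so some circle encloses C and misses all of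
them. Both fields agree on it and have the same winding there, hence equal sums inside by the
argument principle. Outside C they coincide. -/
theorem idxSum_eq_of_disc (he : e ∈ IsManifold.maximalAtlas (𝓡 2) 1 M) {z₀ : ℂ} {R : ℝ}
    {U C : Set M}
    (ht : ∀ w ∈ Metric.closedBall z₀ R, toC.symm w ∈ e.target ∧ e.symm (toC.symm w) ∈ U)
    (hU : IsOpen U) (hC : IsCompact C) (hCD : C ⊆ disc e z₀ R) (X X' : VField M 0)
    (hX : (zeros X ∩ U).Finite) (hX' : (zeros X' ∩ U).Finite)
    (h : ∀ p ∈ U, p ∉ C → X' p = X p) : idxSum X' U = idxSum X U := by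
  rcases C.eq_empty_or_nonempty with rfl | hne
  · exact idxSum_congr hU fun p hp => h p hp (notMem_empty _)
  -- choose a radius
  have hCc : IsCompact ((fun p => dist (toC (e p)) z₀) '' C) :=
    hC.image_of_continuousOn ((continuous_id.dist continuous_const).comp_continuousOn
      (toC.continuous.comp_continuousOn (e.continuousOn.mono fun p hp => (hCD hp).1)))
  obtain ⟨ρ, ⟨p₀, hp₀, hρ⟩, hmax⟩ := hCc.exists_isGreatest (hne.image _)
  have hρR : ρ < R := by rw [← hρ]; exact (hCD hp₀).2
  have hρ0 : 0 ≤ ρ := by rw [← hρ]; exact dist_nonneg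
  obtain ⟨r, ⟨hr1, hr2⟩, hrn⟩ := ((Ioo_infinite hρR).sdiff
    (((hX.union hX').image fun p => dist (toC (e p)) z₀))).nonempty
  have hr0 : 0 < r := hρ0.trans_lt hr1
  have hsub : Metric.closedBall z₀ r ⊆ Metric.closedBall z₀ R :=
    Metric.closedBall_subset_closedBall hr2.le
  have hCr : C ⊆ disc e z₀ r := fun p hp =>
    ⟨(hCD hp).1, lt_of_le_of_lt (hmax (mem_image_of_mem _ hp)) hr1⟩
  have hrU : disc e z₀ r ⊆ U := fun p hp => by
    have := (ht _ (hsub (Metric.ball_subset_closedBall hp.2))).2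
    rwa [toC.symm_apply_apply, e.left_inv hp.1] at this
  have hbd : ∀ w, dist w z₀ = r → e.symm (toC.symm w) ∈ U ∧
      X (e.symm (toC.symm w)) ≠ 0 ∧ X' (e.symm (toC.symm w)) ≠ 0 ∧ e.symm (toC.symm w) ∉ C := by
    intro w hw
    have hw' : w ∈ Metric.closedBall z₀ R := hsub hw.le
    have h1 : dist (toC (e (e.symm (toC.symm w)))) z₀ = r := by
      rw [e.right_inv (ht w hw').1, toC.apply_symm_apply, hw]
    refine ⟨(ht w hw').2, fun h0 => hrn ⟨_, Or.inl ⟨h0, (ht w hw').2⟩, h1⟩,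
      fun h0 => hrn ⟨_, Or.inr ⟨h0, (ht w hw').2⟩, h1⟩, fun hc => ?_⟩
    have := hmax (mem_image_of_mem _ hc)
    have h2 : dist (toC (e (e.symm (toC.symm w)))) z₀ ≤ ρ := this
    linarith
  have e1 := finsum_localIdx_disc he hr0 (fun w hw => (ht w (hsub hw)).1) X
    (hX.subset (inter_subset_inter_right _ hrU)) fun w hw => (hbd w hw).2.1
  have e2 := finsum_localIdx_disc he hr0 (fun w hw => (ht w (hsub hw)).1) X'
    (hX'.subset (inter_subset_inter_right _ hrU)) fun w hw => (hbd w hw).2.2.1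
  have e3 := e1.unique (e2.congr fun s => by
    have h1 := hbd (circ z₀ r s) (dist_circ z₀ hr0.le s)
    unfold cRep chartRep
    rw [h _ h1.1 h1.2.2.2])
  have hsplit : ∀ Z : VField M 0, (zeros Z ∩ U).Finite → idxSum Z U =
      ∑ᶠ p ∈ zeros Z ∩ disc e z₀ r, localIdx Z p +
      ∑ᶠ p ∈ (zeros Z ∩ U) \ disc e z₀ r, localIdx Z p := by
    intro Z hZ
    unfold idxSum
    rw [← finsum_mem_inter_add_sdiff (disc e z₀ r) hZ, inter_assoc, inter_eq_self_of_subset_right hrU]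
  rw [hsplit X hX, hsplit X' hX', e3]
  congr 1
  have hz : (zeros X' ∩ U) \ disc e z₀ r = (zeros X ∩ U) \ disc e z₀ r := by
    ext p
    simp only [zeros, Set.mem_sdiff, mem_inter_iff, mem_ofPred_eq]
    constructor
    · rintro ⟨⟨h1, h2⟩, h3⟩
      exact ⟨⟨(h p h2 fun hc => h3 (hCr hc)).symm.trans h1, h2⟩, h3⟩
    · rintro ⟨⟨h1, h2⟩, h3⟩
      exact ⟨⟨(h p h2 fun hc => h3 (hCr hc)).trans h1, h2⟩, h3⟩
  rw [hz]
  refine finsum_mem_congr rfl fun p hp => localIdx_congr ?_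
  filter_upwards [hU.mem_nhds hp.1.2, hC.isClosed.isOpen_compl.mem_nhds fun hc => hp.2 (hCr hc)]
    with q hq hq' using h q hq hq'

/-- `D` is a coordinate disc whose closure lies in `U`. -/
def IsDiscIn (U D : Set M) : Prop :=
  ∃ (x : M) (z₀ : ℂ) (R : ℝ), D = disc (chartAt Plane x) z₀ R ∧
    ∀ w ∈ Metric.closedBall z₀ R, toC.symm w ∈ (chartAt Plane x).target ∧
      (chartAt Plane x).symm (toC.symm w) ∈ U

theorem exists_isDiscIn {U : Set M} (hU : IsOpen U) {p : M} (hp : p ∈ U) :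
    ∃ D, IsDiscIn U D ∧ p ∈ D := by
  set e := chartAt Plane p with he
  have h1 : e.target ∩ e.symm ⁻¹' U ∈ 𝓝 (e p) :=
    inter_mem (e.open_target.mem_nhds (mem_chart_target Plane p))
      ((e.continuousAt_symm (mem_chart_target Plane p)).preimage_mem_nhds
        (hU.mem_nhds (by rwa [e.left_inv (mem_chart_source Plane p)])))
  obtain ⟨r, hr, hrs⟩ := Metric.nhds_basis_closedBall.mem_iff.1 h1
  refine ⟨_, ⟨p, toC (e p), r, rfl, fun w hw => hrs ?_⟩, mem_chart_source Plane p, ?_⟩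
  · exact toC_mem_closedBall.1 (by simpa using hw)
  · change toC (e p) ∈ Metric.ball (toC (e p)) r
    exact Metric.mem_ball_self hr

/-- Two continuous fields with finitely many zeroes in `U` that agree off a compact subset of `U`
have the same index sum. -/
theorem idxSum_eq [LocallyCompactSpace M] {U : Set M} (hU : IsOpen U) {C : Set M}
    (hC : IsCompact C) (hCU : C ⊆ U)
    (X X' : VField M 0) (hX : (zeros X ∩ U).Finite) (hX' : (zeros X' ∩ U).Finite)
    (h : ∀ p ∈ U, p ∉ C → X' p = X p) : idxSum X' U = idxSum X U := by
  have main : ∀ n : ℕ, ∀ D : ℕ → Set M, (∀ i, IsDiscIn U (D i)) → ∀ C : Set M, IsCompact C →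
      C ⊆ (⋃ i ∈ Finset.range n, D i) → C ⊆ U → ∀ X X' : VField M 0, (zeros X ∩ U).Finite →
      (zeros X' ∩ U).Finite → (∀ p ∈ U, p ∉ C → X' p = X p) → idxSum X' U = idxSum X U := by
    intro n D hD
    have hDo : ∀ i, IsOpen (D i) := fun i => by
      obtain ⟨x, z₀, R, hDi, -⟩ := hD i
      rw [hDi]; exact isOpen_disc _ _ _
    induction n with
    | zero =>
      intro C _ hCD _ X X' _ _ h
      refine idxSum_congr hU fun p hp => h p hp fun hpC => ?_
      simpa using hCD hpC
    | succ n ih =>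
      intro C hC hCD hCU X X' hX hX' h
      set E := ⋃ i ∈ Finset.range n, D i with hE
      have hEo : IsOpen E := isOpen_biUnion fun i _ => hDo i
      have hcov : C ⊆ D n ∪ E := by
        rw [Finset.range_add_one, Finset.set_biUnion_insert] at hCD
        exact hCD
      obtain ⟨C₁, C₂, hC₁, hC₂, hC₁D, hC₂E, hC12⟩ :=
        hC.binary_compact_cover (hDo n) hEo hcov
      obtain ⟨x, z₀, R, hDn, hball⟩ := hD n
      set e := chartAt Plane x with he
      have hemax : ∀ m, e ∈ IsManifold.maximalAtlas (𝓡 2) m M := fun m =>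
        chartAt_mem_maximalAtlas m x
      have hDe : D n ⊆ e.source := by rw [hDn]; exact fun p hp => hp.1
      have hDU : D n ⊆ U := by
        rw [hDn]
        intro p hp
        have := (hball _ (Metric.ball_subset_closedBall hp.2)).2
        rwa [toC.symm_apply_apply, e.left_inv hp.1] at this
      obtain ⟨χ, V, hχ, hV, hC₁V, -, -, hχ1, hχc, hχs, -⟩ := exists_cutoff hC₁ (hDo n) hC₁D
      -- the glued field
      have hcd : ContMDiff (𝓡 2) 𝓘(ℝ, ℝ) ((0 : ℕ) : ℕ∞ω) χ := by
        rw [Nat.cast_zero]; exact contMDiff_zero_iff.2 hχ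
      -- Inside U, Z₀ agrees with X' off a compact part of the disc D n, and with X off a compact
      -- part of the other discs E. Passing between X' and Z₀ is thus a change in one disc, and
      -- passing between X and Z₀ is covered by induction.
      set Z₀ : VField M 0 := X' + (X - X').mulFun hcd with hZ₀
      have hZ₀v : ∀ p, Z₀ p = X' p + χ p • (X p - X' p) := fun p => rfl
      have hZX' : ∀ p ∈ U, p ∉ C ∩ tsupport χ → Z₀ p = X' p := by
        intro p hp hpC
        rw [hZ₀v]
        by_cases hc : p ∈ C
        · have : χ p = 0 := image_eq_zero_of_notMem_tsupport fun ht => hpC ⟨hc, ht⟩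
          rw [this, zero_smul, add_zero]
        · rw [h p hp hc, sub_self, smul_zero, add_zero]
      have hZX : ∀ p ∈ U, p ∉ C \ V → Z₀ p = X p := by
        intro p hp hpC
        rw [hZ₀v]
        by_cases hc : p ∈ C
        · have : χ p = 1 := hχ1 p (subset_closure (by
            by_contra hv
            exact hpC ⟨hc, hv⟩))
          rw [this, one_smul, add_sub_cancel]
        · rw [h p hp hc, sub_self, smul_zero, add_zero]
      have hP₁ : IsCompact (C ∩ tsupport χ) := hC.inter_right (isClosed_tsupport χ)
      have hP₂ : IsCompact (C \ V) := hC.diff hV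
      have hP₁D : C ∩ tsupport χ ⊆ D n := inter_subset_right.trans hχs
      have hP₂E : C \ V ⊆ E := fun p hp => hC₂E (by
        rw [hC12] at hp
        exact hp.1.resolve_left fun h1 => hp.2 (hC₁V h1))
      -- perturb in the chart
      set O : Set Plane := e.target ∩ e.symm ⁻¹' (D n ∩ E) with hO
      have hOo : IsOpen O := e.isOpen_inter_preimage_symm ((hDo n).inter hEo)
      set P : Set Plane := e '' (C ∩ tsupport χ ∩ (C \ V)) with hP
      have hPs : C ∩ tsupport χ ∩ (C \ V) ⊆ e.source := fun p hp => hDe (hP₁D hp.1)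
      have hPc : IsCompact P :=
        (hP₁.inter hP₂).image_of_continuousOn (e.continuousOn.mono hPs)
      have hPO : P ⊆ O := by
        rintro _ ⟨p, hp, rfl⟩
        refine ⟨e.map_source (hPs hp), ?_⟩
        rw [mem_preimage, e.left_inv (hPs hp)]
        exact ⟨hP₁D hp.1, hP₂E hp.2⟩
      -- Off the overlap of the two parts Z₀ coincides with X or X'. Infinitely many zeroes can come
      -- only from the overlap, so perturbing near it is enough, and both comparisons survive.
      have hzer : ∀ p ∈ U, p ∉ C ∩ tsupport χ ∩ (C \ V) → Z₀ p = 0 →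
          p ∈ (zeros X ∩ U) ∪ (zeros X' ∩ U) := by
        intro p hp hpP h0
        by_cases h1 : p ∈ C ∩ tsupport χ
        · have h2 : p ∉ C \ V := fun h2 => hpP ⟨h1, h2⟩
          exact Or.inl ⟨(hZX p hp h2).symm.trans h0, hp⟩
        · exact Or.inr ⟨(hZX' p hp h1).symm.trans h0, hp⟩
      obtain ⟨g, hg, hgc, hgs, hgfin⟩ := exists_perturbation hOo hPc hPO
        (f := chartRep e Z₀) ((continuousOn_chartRep Z₀ (hemax 1)).mono inter_subset_left) (by
          refine ((hX.union hX').image e).subset ?_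
          rintro z ⟨⟨hzO, hzP⟩, h0⟩
          rw [chartRep_eq_zero (hemax 1) _ hzO.1] at h0
          refine ⟨e.symm z, hzer _ (hDU hzO.2.1) (fun hp => hzP ⟨_, hp, e.right_inv hzO.1⟩) h0,
            e.right_inv hzO.1⟩)
      have hgt : tsupport g ⊆ e.target := hgs.trans inter_subset_left
      set Y : VField M 0 := ofChart (k := 0) (hemax _) (by
        rw [Nat.cast_zero]; exact contDiff_zero.2 hg) hgc hgt with hY
      have hYv : ∀ p, Y p = pushField e g p := fun p => rfl
      set S : Set M := e.symm '' tsupport g with hS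
      have hSc : IsCompact S := hgc.isCompact.image_of_continuousOn (e.continuousOn_symm.mono hgt)
      have hSD : S ⊆ D n ∩ E := by
        rintro _ ⟨z, hz, rfl⟩
        exact (hgs hz).2
      have hY0 : ∀ p ∉ S, Y p = 0 := fun p hp => pushField_of_eq_zero fun hps =>
        image_eq_zero_of_notMem_tsupport fun ht => hp ⟨e p, ht, e.left_inv hps⟩
      set Z : VField M 0 := Z₀ + Y with hZ
      have hZv : ∀ p, Z p = Z₀ p + Y p := fun p => rfl
      have hZfin : (zeros Z ∩ U).Finite := by
        refine ((hgfin.image e.symm).union (hX.union hX')).subset ?_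
        rintro p ⟨h0, hp⟩
        have h0' : Z p = 0 := h0
        by_cases hpO : p ∈ D n ∩ E
        · left
          have hps := hDe hpO.1
          refine ⟨e p, ⟨⟨e.map_source hps, by rwa [mem_preimage, e.left_inv hps]⟩, ?_⟩,
            e.left_inv hps⟩
          rw [← chartRep_apply_eq_zero (hemax 1) Z hps] at h0'
          have h1 := chartRep_add (e := e) Z₀ Y (e p)
          have h2 := chartRep_pushField_apply (hemax 1) g hps
          rw [← h2, ← h0']
          exact h1.symm
        · right
          rw [hZv, hY0 p fun hs => hpO (hSD hs), add_zero] at h0'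
          exact hzer p hp (fun hpP => hpO ⟨hP₁D hpP.1, hP₂E hpP.2⟩) h0'
      have e1 : idxSum Z U = idxSum X U := by
        refine ih (C \ V ∪ S) (hP₂.union hSc) (union_subset hP₂E fun p hp => (hSD hp).2)
          (union_subset (fun p hp => hCU hp.1) fun p hp => hDU (hSD hp).1) X Z hX hZfin
          fun p hp hpn => ?_
        rw [hZv, hY0 p fun hs => hpn (Or.inr hs), add_zero]
        exact hZX p hp fun hc => hpn (Or.inl hc)
      have e2 : idxSum Z U = idxSum X' U := by
        refine idxSum_eq_of_disc (hemax 1) hball hU (hP₁.union hSc) ?_ X' Z hX' hZfin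
          fun p hp hpn => ?_
        · rw [← hDn]
          exact union_subset hP₁D fun p hp => (hSD hp).1
        · rw [hZv, hY0 p fun hs => hpn (Or.inr hs), add_zero]
          exact hZX' p hp fun hc => hpn (Or.inl hc)
      rw [← e2, e1]
  -- cover by finitely many discs
  rcases C.eq_empty_or_nonempty with rfl | ⟨c, hc⟩
  · exact idxSum_congr hU fun p hp => h p hp (notMem_empty _)
  choose! F hF hpF using fun p (hp : p ∈ U) => exists_isDiscIn hU hp
  obtain ⟨t, ht⟩ := hC.elim_finite_subcover (fun p : C => F p) (fun p => by
    obtain ⟨x, z₀, R, hD, -⟩ := hF p (hCU p.2)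
    rw [hD]; exact isOpen_disc _ _ _) fun p hp => mem_iUnion.2 ⟨⟨p, hp⟩, hpF p (hCU hp)⟩
  set l := t.toList with hl
  refine main l.length (fun i => F (l.getD i ⟨c, hc⟩)) (fun i => hF _ (hCU (l.getD i ⟨c, hc⟩).2)) C hC
    (ht.trans fun q hq => ?_) hCU X X' hX hX' h
  simp only [mem_iUnion] at hq ⊢
  obtain ⟨p, hp, hq⟩ := hq
  obtain ⟨i, hi, hip⟩ := List.getElem_of_mem (Finset.mem_toList.2 hp)
  refine ⟨i, Finset.mem_range.2 hi, ?_⟩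
  rw [List.getD_eq_getElem _ _ hi, hip]
  exact hq

end Degree

/-! ### The flow of a bounded Lipschitz field on a Banach space -/

section Flow

open scoped NNReal

variable {E : Type*} [NormedAddCommGroup E] [NormedSpace ℝ E]

/-- `α` is the flow of the field `G`, which is Lipschitz with constant `L` and bounded by `N`. -/
structure IsFlow (G : E → E) (α : E → ℝ → E) (L N : ℝ≥0) : Prop where
  lip : LipschitzWith L G
  bdd : ∀ z, ‖G z‖ ≤ N
  zero : ∀ z, α z 0 = z
  deriv : ∀ z t, HasDerivAt (α z) (G (α z t)) t

/-- With speed at most N a solution cannot leave the ball of radius N(n + 1) within time n + 1, so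
Picard–Lindelöf applies on every such interval; uniqueness glues the solutions. -/
theorem exists_isFlow [CompleteSpace E] {G : E → E} {L N : ℝ≥0} (hL : LipschitzWith L G)
    (hN : ∀ z, ‖G z‖ ≤ N) : ∃ α, IsFlow G α L N := by
  have h1 : ∀ (z : E) (n : ℕ), ∃ β : ℝ → E, β 0 = z ∧
      ∀ t ∈ Ioo (-(n + 1) : ℝ) (n + 1), HasDerivAt β (G (β t)) t := by
    intro z n
    have hpl : IsPicardLindelof (fun _ => G) (tmin := -(n + 1)) (tmax := n + 1)
        ⟨0, by constructor <;> linarith [n.cast_nonneg (α := ℝ)]⟩ z (N * (n + 1)) 0 N L := by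
      refine IsPicardLindelof.of_time_independent (fun x _ => hN x) hL.lipschitzOnWith ?_
      simp
    obtain ⟨β, hβ, hd⟩ := hpl.exists_eq_forall_mem_Icc_hasDerivWithinAt₀
    exact ⟨β, hβ, fun t ht => (hd t (Ioo_subset_Icc_self ht)).hasDerivAt (Icc_mem_nhds ht.1 ht.2)⟩
  choose β hβ0 hβ using h1
  have hagree : ∀ z (m n : ℕ) (t : ℝ), |t| < m + 1 → |t| < n + 1 → β z m t = β z n t := by
    intro z m n
    wlog hmn : m ≤ n generalizing m n
    · intro t h1 h2
      exact (this n m (le_of_not_ge hmn) t h2 h1).symm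
    intro t h1 h2
    have hmn' : (m : ℝ) ≤ n := by exact_mod_cast hmn
    have hm0 : (0 : ℝ) ≤ m := m.cast_nonneg
    exact ODE_solution_unique_of_mem_Ioo (v := fun _ => G) (s := fun _ => univ) (K := L)
      (a := -(m + 1)) (b := m + 1) (t₀ := 0) (fun _ _ => hL.lipschitzOnWith)
      ⟨by linarith, by linarith⟩ (fun t ht => ⟨hβ z m t ht, mem_univ _⟩)
      (fun t ht => ⟨hβ z n t ⟨by linarith [ht.1], by linarith [ht.2]⟩, mem_univ _⟩)
      ((hβ0 z m).trans (hβ0 z n).symm) (abs_lt.1 h1)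
  refine ⟨fun z t => β z ⌈|t|⌉₊ t, hL, hN, fun z => hβ0 z _, fun z t => ?_⟩
  set n := ⌈|t|⌉₊ with hn
  have ht : |t| < n + 1 := by linarith [Nat.le_ceil |t|]
  refine (hβ z n t (abs_lt.1 ht)).congr_of_eventuallyEq ?_
  filter_upwards [(isOpen_lt continuous_abs continuous_const).mem_nhds ht] with s hs
  exact hagree z _ _ s (by linarith [Nat.le_ceil |s|]) hs

namespace IsFlow

variable {G : E → E} {α : E → ℝ → E} {L N : ℝ≥0}

theorem continuous (h : IsFlow G α L N) (z : E) : Continuous (α z) :=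
  continuous_iff_continuousAt.2 fun t => (h.deriv z t).continuousAt

theorem add (h : IsFlow G α L N) (z : E) (s t : ℝ) : α (α z s) t = α z (s + t) := by
  have h1 : (fun t => α z (s + t)) = α (α z s) :=
    ODE_solution_unique_univ (v := fun _ => G) (s := fun _ => univ) (K := L) (t₀ := 0)
      (fun _ => h.lip.lipschitzOnWith)
      (fun t => ⟨by simpa using (h.deriv z (s + t)).comp_const_add s t, mem_univ _⟩)
      (fun t => ⟨h.deriv _ t, mem_univ _⟩) (by simp [h.zero])
  exact (congrFun h1 t).symm

theorem neg (h : IsFlow G α L N) : IsFlow (fun z => -G z) (fun z t => α z (-t)) L N where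
  lip := h.lip.neg
  bdd z := by rw [norm_neg]; exact h.bdd z
  zero z := by simp [h.zero]
  deriv z t := by
    exact ((h.deriv z (-t)).scomp t (hasDerivAt_neg t)).congr_deriv (by simp)

theorem add_neg (h : IsFlow G α L N) (z : E) (t : ℝ) : α (α z t) (-t) = z := by
  rw [h.add, add_neg_cancel, h.zero]

theorem neg_add (h : IsFlow G α L N) (z : E) (t : ℝ) : α (α z (-t)) t = z := by
  rw [h.add, neg_add_cancel, h.zero]

theorem norm_sub_le_of_nonneg (h : IsFlow G α L N) (z w : E) {t : ℝ} (ht : 0 ≤ t) :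
    ‖α z t - α w t‖ ≤ Real.exp (L * t) * ‖z - w‖ := by
  have := dist_le_of_trajectories_ODE (v := fun _ => G) (K := L) (f := α z) (g := α w)
    (a := 0) (b := t) (δ := dist z w) (fun _ => h.lip) (h.continuous z).continuousOn
    (fun s _ => (h.deriv z s).hasDerivWithinAt) (h.continuous w).continuousOn
    (fun s _ => (h.deriv w s).hasDerivWithinAt) (by rw [h.zero, h.zero]) t ⟨ht, le_rfl⟩
  rw [dist_eq_norm, dist_eq_norm, sub_zero] at this
  linarith [mul_comm ‖z - w‖ (Real.exp (L * t))]

theorem norm_sub_le (h : IsFlow G α L N) (z w : E) (t : ℝ) :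
    ‖α z t - α w t‖ ≤ Real.exp (L * |t|) * ‖z - w‖ := by
  rcases le_total 0 t with ht | ht
  · rw [abs_of_nonneg ht]; exact h.norm_sub_le_of_nonneg z w ht
  · have := h.neg.norm_sub_le_of_nonneg z w (neg_nonneg.2 ht)
    rw [abs_of_nonpos ht]
    simpa using this

/-- The Lipschitz bound for the backward flow: the time t map is bi-Lipschitz, so chords are not
collapsed. -/
theorem le_norm_sub (h : IsFlow G α L N) (z w : E) (t : ℝ) :
    ‖z - w‖ ≤ Real.exp (L * |t|) * ‖α z t - α w t‖ := by
  have := h.norm_sub_le (α z t) (α w t) (-t)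
  rwa [h.add_neg, h.add_neg, abs_neg] at this

theorem continuous_left (h : IsFlow G α L N) (t : ℝ) : Continuous fun z => α z t := by
  refine (LipschitzWith.of_dist_le_mul (K := ⟨Real.exp (L * |t|), (Real.exp_pos _).le⟩)
    fun z w => ?_).continuous
  rw [dist_eq_norm, dist_eq_norm]
  exact h.norm_sub_le z w t

/-- The mean value inequality, on either side of `0`. -/
theorem norm_sub_le_of_deriv {f f' : ℝ → E} {C t : ℝ} (hf : ∀ s, HasDerivAt f (f' s) s)
    (hC : ∀ s, |s| ≤ |t| → ‖f' s‖ ≤ C) : ‖f t - f 0‖ ≤ C * |t| := by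
  have := (convex_Icc (-|t|) |t|).norm_image_sub_le_of_norm_hasDerivWithin_le (f := f) (f' := f')
    (C := C) (fun s _ => (hf s).hasDerivWithinAt) (fun s hs => hC s (abs_le.2 hs))
    (x := 0) (y := t) ⟨by simp, by simp⟩ ⟨neg_abs_le t, le_abs_self t⟩
  simpa using this

theorem norm_sub_self_le (h : IsFlow G α L N) (z : E) (t : ℝ) : ‖α z t - z‖ ≤ N * |t| := by
  have := norm_sub_le_of_deriv (h.deriv z) (t := t) (fun s _ => h.bdd _)
  rwa [h.zero] at this

/-- Relative to its length, a chord changes by O(t) under the time t map. This is what limits the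
turning of directions, and it needs only the Lipschitz constant of the field. -/
theorem norm_sub_sub_le (h : IsFlow G α L N) (z w : E) (t : ℝ) :
    ‖(α z t - α w t) - (z - w)‖ ≤ L * Real.exp (L * |t|) * |t| * ‖z - w‖ := by
  have := norm_sub_le_of_deriv (f := fun t => α z t - α w t) (t := t)
    (C := L * (Real.exp (L * |t|) * ‖z - w‖)) (fun s => (h.deriv z s).sub (h.deriv w s))
    (fun s hs => ?_)
  · rw [h.zero, h.zero] at this
    refine this.trans (le_of_eq ?_)
    ring
  · refine (h.lip.norm_sub_le _ _).trans ?_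
    gcongr
    refine (h.norm_sub_le z w s).trans ?_
    gcongr

theorem norm_sub_smul_le (h : IsFlow G α L N) (z : E) (t : ℝ) :
    ‖α z t - z - t • G z‖ ≤ L * N * t ^ 2 := by
  have := norm_sub_le_of_deriv (f := fun t => α z t - t • G z) (t := t)
    (C := L * (N * |t|)) (f' := fun s => G (α z s) - G z) (fun s => ?_) (fun s hs => ?_)
  · rw [h.zero, zero_smul, sub_zero, sub_right_comm] at this
    refine this.trans (le_of_eq ?_)
    rw [← sq_abs]
    ring
  · exact ((h.deriv z s).sub ((hasDerivAt_id s).smul_const (G z))).congr_deriv (by simp)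
  · refine (h.lip.norm_sub_le _ _).trans ?_
    gcongr
    refine (h.norm_sub_self_le z s).trans ?_
    gcongr

end IsFlow

/-- A `C¹` field near a point has a bounded Lipschitz modification with the same germ. -/
theorem exists_germ_isFlow [FiniteDimensional ℝ E] {G : E → E} {O : Set E} (hO : IsOpen O) {z₀ : E}
    (hz : z₀ ∈ O) (hG : ContDiffOn ℝ 1 G O) : ∃ (G₁ : E → E) (α : E → ℝ → E) (L N : ℝ≥0),
      IsFlow G₁ α L N ∧ ∃ ρ > 0, Metric.closedBall z₀ ρ ⊆ O ∧ EqOn G₁ G (Metric.closedBall z₀ ρ) := by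
  obtain ⟨r, hr, hrO⟩ := Metric.nhds_basis_closedBall.mem_iff.1 (hO.mem_nhds hz)
  let χ : ContDiffBump z₀ := ⟨r / 2, r, by positivity, by linarith⟩
  have hsub : tsupport χ ⊆ O := by rw [χ.tsupport_eq]; exact hrO
  have hcs : HasCompactSupport fun z => χ z • G z := χ.hasCompactSupport.smul_right
  have hsm : ContDiff ℝ 1 fun z => χ z • G z := by
    rw [← contDiffOn_univ]
    have h1 : ContDiffOn ℝ 1 (fun z => χ z • G z) O := χ.contDiff.contDiffOn.smul hG
    have h2 : ContDiffOn ℝ 1 (fun z => χ z • G z) (tsupport χ)ᶜ := by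
      refine (contDiffOn_const (c := (0 : E))).congr fun z hz => ?_
      rw [image_eq_zero_of_notMem_tsupport hz, zero_smul]
    have h3 : (univ : Set E) = O ∪ (tsupport χ)ᶜ := by
      symm
      rw [eq_univ_iff_forall]
      intro z
      by_cases hz : z ∈ tsupport χ
      · exact Or.inl (hsub hz)
      · exact Or.inr hz
    rw [h3]
    exact h1.union_of_isOpen h2 hO (isClosed_tsupport _).isOpen_compl
  obtain ⟨L, hL⟩ := ContDiff.lipschitzWith_of_hasCompactSupport hcs hsm (by simp)
  obtain ⟨N, hN⟩ := hcs.exists_bound_of_continuous hsm.continuous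
  have : CompleteSpace E := FiniteDimensional.complete ℝ E
  obtain ⟨α, hα⟩ := exists_isFlow hL (N := N.toNNReal) fun z =>
    (hN z).trans (Real.le_coe_toNNReal N)
  refine ⟨_, α, L, _, hα, r / 2, by positivity,
    (Metric.closedBall_subset_closedBall (by linarith)).trans hrO, fun z hz => ?_⟩
  dsimp only
  rw [χ.one_of_mem_closedBall hz, one_smul]

end Flow

/-! ### Integral curves in charts -/

section Curves

variable {M : Type*} [TopologicalSpace M] [ChartedSpace Plane M] [IsManifold (𝓡 2) ω M]
  {e : OpenPartialHomeomorph M Plane}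

theorem hasDerivAt_chart (he : e ∈ IsManifold.maximalAtlas (𝓡 2) 1 M)
    {Y : ∀ p : M, TangentSpace (𝓡 2) p} {γ : ℝ → M} {s : Set ℝ} (hs : IsOpen s)
    (hγ : IsMIntegralCurveOn γ Y s) {t : ℝ} (ht : t ∈ s) (hte : γ t ∈ e.source) :
    HasDerivAt (fun t => e (γ t)) (chartRep e Y (e (γ t))) t := by
  have h1 := (hγ t ht).hasMFDerivAt (hs.mem_nhds ht)
  have h2 := ((mdifferentiable_of_mem he).mdifferentiableAt hte).hasMFDerivAt
  let A : ℝ →L[ℝ] Plane := (mfderiv (𝓡 2) 𝓘(ℝ, Plane) e (γ t)).comp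
    ((1 : ℝ →L[ℝ] ℝ).smulRight (Y (γ t)))
  have h3 : HasFDerivAt (fun t => e (γ t)) A t := (h2.comp t h1).hasFDerivAt
  refine h3.hasDerivAt.congr_deriv ?_
  rw [chartRep_apply Y hte]
  exact congrArg (mfderiv (𝓡 2) 𝓘(ℝ, Plane) e (γ t)) (one_smul ℝ (Y (γ t)))

theorem isMIntegralCurveOn_symm (he : e ∈ IsManifold.maximalAtlas (𝓡 2) 1 M)
    {Y : ∀ p : M, TangentSpace (𝓡 2) p} {β : ℝ → Plane} {s : Set ℝ}
    (hβ : ∀ t ∈ s, HasDerivAt β (chartRep e Y (β t)) t) (hβs : ∀ t ∈ s, β t ∈ e.target) :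
    IsMIntegralCurveOn (fun t => e.symm (β t)) Y s := by
  intro t ht
  have h1 := (hβ t ht).hasFDerivAt.hasMFDerivAt
  have h2 := ((mdifferentiable_of_mem he).mdifferentiableAt_symm (hβs t ht)).hasMFDerivAt
  have h3 := (h2.comp t h1).hasMFDerivWithinAt (s := s)
  have h4 := DFunLike.congr_fun ((mdifferentiable_of_mem he).symm_comp_deriv
    (e.map_target (hβs t ht))) (Y (e.symm (β t)))
  rw [e.right_inv (hβs t ht)] at h4
  have h5 : (mfderiv 𝓘(ℝ, Plane) (𝓡 2) e.symm (β t)).comp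
      (ContinuousLinearMap.toSpanSingleton ℝ (chartRep e Y (β t))) =
      (1 : ℝ →L[ℝ] ℝ).smulRight (Y (e.symm (β t))) := by
    refine ContinuousLinearMap.ext_ring ?_
    exact (congrArg (mfderiv 𝓘(ℝ, Plane) (𝓡 2) e.symm (β t))
      (one_smul ℝ (chartRep e Y (β t)))).trans (h4.trans (one_smul ℝ (Y (e.symm (β t)))).symm)
  rw [← h5]
  exact h3

end Curves

/-! ### The determinant of two plane vectors -/

/-- The determinant of two plane vectors. -/
def det2 (v w : Plane) : ℝ := v 0 * w 1 - v 1 * w 0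

theorem det2_self (v : Plane) : det2 v v = 0 := by unfold det2; ring

theorem det2_swap (v w : Plane) : det2 w v = -det2 v w := by unfold det2; ring

theorem det2_add_right (v w w' : Plane) : det2 v (w + w') = det2 v w + det2 v w' := by
  simp only [det2, PiLp.add_apply]; ring

theorem det2_sub_left (v v' w : Plane) : det2 (v - v') w = det2 v w - det2 v' w := by
  simp only [det2, PiLp.sub_apply]; ring

theorem det2_sub_right (v w w' : Plane) : det2 v (w - w') = det2 v w - det2 v w' := by
  simp only [det2, PiLp.sub_apply]; ring

theorem det2_smul_left (c : ℝ) (v w : Plane) : det2 (c • v) w = c * det2 v w := by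
  simp only [det2, PiLp.smul_apply, smul_eq_mul]; ring

theorem det2_smul_right (c : ℝ) (v w : Plane) : det2 v (c • w) = c * det2 v w := by
  simp only [det2, PiLp.smul_apply, smul_eq_mul]; ring

@[fun_prop]
theorem Continuous.det2 {A : Type*} [TopologicalSpace A] {f g : A → Plane} (hf : Continuous f)
    (hg : Continuous g) : Continuous fun a => det2 (f a) (g a) := by
  unfold SurfaceFields.det2; fun_prop

theorem Tendsto.det2 {A : Type*} {l : Filter A} {f g : A → Plane} {v w : Plane}
    (hf : Tendsto f l (𝓝 v)) (hg : Tendsto g l (𝓝 w)) :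
    Tendsto (fun a => det2 (f a) (g a)) l (𝓝 (det2 v w)) := by
  have h : Continuous fun p : Plane × Plane => SurfaceFields.det2 p.1 p.2 := by fun_prop
  exact (h.tendsto (v, w)).comp (hf.prodMk_nhds hg)

theorem sq_norm_plane (v : Plane) : ‖v‖ ^ 2 = v 0 ^ 2 + v 1 ^ 2 := by
  rw [EuclideanSpace.norm_sq_eq]; simp

theorem abs_det2_le (v w : Plane) : |det2 v w| ≤ ‖v‖ * ‖w‖ := by
  refine abs_le_of_sq_le_sq ?_ (by positivity)
  rw [mul_pow, sq_norm_plane, sq_norm_plane]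
  unfold det2
  nlinarith [sq_nonneg (v 0 * w 0 + v 1 * w 1)]

theorem eq_smul_of_det2_eq_zero {v w : Plane} (hw : w ≠ 0) (h : det2 v w = 0) :
    ∃ c : ℝ, v = c • w := by
  have hn : w 0 ^ 2 + w 1 ^ 2 ≠ 0 := by
    rw [← sq_norm_plane]; exact pow_ne_zero 2 (norm_ne_zero_iff.2 hw)
  refine ⟨(v 0 * w 0 + v 1 * w 1) / (w 0 ^ 2 + w 1 ^ 2), ?_⟩
  unfold det2 at h
  ext i
  fin_cases i
  · simp only [PiLp.smul_apply, smul_eq_mul, Fin.zero_eta, Fin.isValue]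
    field_simp
    linear_combination w 1 * h
  · simp only [PiLp.smul_apply, smul_eq_mul, Fin.mk_one, Fin.isValue]
    field_simp
    linear_combination -w 0 * h

/-! ### Flow relations and orbits -/

section Orbits

variable {M : Type*} [TopologicalSpace M] [T2Space M] [ChartedSpace Plane M]
  [IsManifold (𝓡 2) ω M] {e : OpenPartialHomeomorph M Plane}

instance : IsManifold (𝓡 2) 1 M := IsManifold.of_le (n := ω) le_top

theorem VField.contMDiff_one {k : ℕ} (hk : 1 ≤ k) (X : VField M k) :
    ContMDiff (𝓡 2) (𝓡 2).tangent 1 (fun p => (⟨p, X p⟩ : TangentBundle (𝓡 2) M)) :=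
  X.contMDiff.of_le (by exact_mod_cast hk)

theorem eq_of_isMIntegralCurveOn {k : ℕ} (hk : 1 ≤ k) (X : VField M k) {γ γ' : ℝ → M}
    {a b a' b' t : ℝ} (hγ : IsMIntegralCurveOn γ X (Ioo a b))
    (hγ' : IsMIntegralCurveOn γ' X (Ioo a' b')) (h0 : (0 : ℝ) ∈ Ioo a b)
    (h0' : (0 : ℝ) ∈ Ioo a' b') (h : γ 0 = γ' 0) (ht : t ∈ Ioo a b) (ht' : t ∈ Ioo a' b') :
    γ t = γ' t := by
  refine isMIntegralCurveOn_Ioo_eqOn_of_contMDiff_boundaryless (I := 𝓡 2) (v := X)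
    (a := max a a') (b := min b b') (t₀ := 0)
    ⟨max_lt h0.1 h0'.1, lt_min h0.2 h0'.2⟩ (X.contMDiff_one hk)
    (hγ.mono (Ioo_subset_Ioo (le_max_left _ _) (min_le_left _ _)))
    (hγ'.mono (Ioo_subset_Ioo (le_max_right _ _) (min_le_right _ _))) h
    ⟨max_lt ht.1 ht'.1, lt_min ht.2 ht'.2⟩

theorem FlowRel.unique {k : ℕ} (hk : 1 ≤ k) {Y : VField M k} {t : ℝ} {p q q' : M}
    (h : FlowRel Y t p q) (h' : FlowRel Y t p q') : q = q' := by
  obtain ⟨γ, a, b, h0, ht, hγ, rfl, rfl⟩ := h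
  obtain ⟨γ', a', b', h0', ht', hγ', h1, rfl⟩ := h'
  exact eq_of_isMIntegralCurveOn hk Y hγ hγ' h0 h0' h1.symm ht ht'

/-- Together with `exists_ne_mem_orbitIn` this recognizes zeroes by the size of their orbits, the
only information that a map of orbits transmits. -/
theorem orbitIn_of_eq_zero {k : ℕ} (hk : 1 ≤ k) (X : VField M k) {D : Set M} {p : M} (hp : p ∈ D)
    (h : X p = 0) : orbitIn X D p = {p} := by
  have hc := (isMIntegralCurve_const (I := 𝓡 2) (v := X) h).isMIntegralCurveOn (Ioo (-1 : ℝ) 1)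
  refine Subset.antisymm ?_ (singleton_subset_iff.2 ⟨fun _ => p, -1, 1, 0, by norm_num,
    by norm_num, hc, fun _ _ => hp, rfl, rfl⟩)
  rintro q ⟨γ, a, b, s, h0, hs, hγ, -, h1, rfl⟩
  have hc' := (isMIntegralCurve_const (I := 𝓡 2) (v := X) h).isMIntegralCurveOn (Ioo a b)
  exact eq_of_isMIntegralCurveOn hk X hγ hc' h0 h0 h1 hs hs

theorem self_mem_orbitIn {k : ℕ} (hk : 1 ≤ k) (X : VField M k) {D : Set M} {p : M} (hp : D ∈ 𝓝 p) :
    ∃ (γ : ℝ → M) (ε : ℝ), 0 < ε ∧ IsMIntegralCurveOn γ X (Ioo (-ε) ε) ∧ γ 0 = p ∧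
      ∀ u ∈ Ioo (-ε) ε, γ u ∈ D ∧ γ u ∈ orbitIn X D p := by
  obtain ⟨γ, h0, hγ⟩ := exists_isMIntegralCurveAt_of_contMDiffAt_boundaryless (I := 𝓡 2) 0
    (X.contMDiff_one hk p)
  rw [isMIntegralCurveAt_iff'] at hγ
  obtain ⟨ε, hε, hγ⟩ := hγ
  rw [Real.ball_eq_Ioo, zero_sub, zero_add] at hγ
  have hc : ContinuousAt γ 0 := (hγ.continuousOn).continuousAt (Ioo_mem_nhds (by linarith) hε)
  have hD : ∀ᶠ u in 𝓝 (0 : ℝ), γ u ∈ D := hc (by rwa [h0])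
  obtain ⟨δ, hδ, hδD⟩ := Metric.eventually_nhds_iff.1 hD
  have hsub : Ioo (-min δ ε) (min δ ε) ⊆ Ioo (-ε) ε :=
    Ioo_subset_Ioo (neg_le_neg (min_le_right _ _)) (min_le_right _ _)
  have hDu : ∀ u ∈ Ioo (-min δ ε) (min δ ε), γ u ∈ D := fun u hu => hδD (by
    rw [Real.dist_0_eq_abs]
    exact (abs_lt.2 hu).trans_le (min_le_left _ _))
  have hm := lt_min hδ hε
  exact ⟨γ, min δ ε, hm, hγ.mono hsub, h0, fun u hu => ⟨hDu u hu, γ, _, _, u,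
    ⟨by linarith, hm⟩, hu, hγ.mono hsub, hDu, h0, rfl⟩⟩

theorem exists_ne_mem_orbitIn {k : ℕ} (hk : 1 ≤ k) (X : VField M k) {D : Set M} {p : M}
    (hp : D ∈ 𝓝 p) (h : X p ≠ 0) : ∃ q ∈ orbitIn X D p, q ≠ p := by
  obtain ⟨γ, ε, hε, hγ, h0, hD⟩ := self_mem_orbitIn hk X hp
  by_contra! hall
  have hcon : ∀ u ∈ Ioo (-ε) ε, γ u = p := fun u hu => hall _ (hD u hu).2
  have he := chartAt_mem_maximalAtlas (M := M) 1 p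
  have hd := hasDerivAt_chart he isOpen_Ioo hγ (t := 0) ⟨by linarith, hε⟩
    (by rw [h0]; exact mem_chart_source Plane p)
  have hd' : HasDerivAt (fun t => chartAt Plane p (γ t)) 0 0 := by
    refine (hasDerivAt_const (0 : ℝ) (chartAt Plane p p)).congr_of_eventuallyEq ?_
    filter_upwards [Ioo_mem_nhds (by linarith : -ε < 0) hε] with u hu
    rw [hcon u hu]
  have := hd.unique hd'
  rw [h0, chartRep_apply_eq_zero he X (mem_chart_source Plane p)] at this
  exact h this

/-- The flow of `Y` near a point, in a chart. -/
structure IsChartFlow (e : OpenPartialHomeomorph M Plane) (Y : ∀ p : M, TangentSpace (𝓡 2) p)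
    (z₀ : Plane) (ρ : ℝ) (G : Plane → Plane) (α : Plane → ℝ → Plane) (L N : NNReal) : Prop where
  mem : e ∈ IsManifold.maximalAtlas (𝓡 2) 1 M
  flow : IsFlow G α L N
  subset : Metric.closedBall z₀ ρ ⊆ e.target
  eq : EqOn G (chartRep e Y) (Metric.closedBall z₀ ρ)

theorem exists_isChartFlow {k : ℕ} (hk : 1 ≤ k) (Y : VField M k)
    (he : e ∈ IsManifold.maximalAtlas (𝓡 2) ((k : ℕ∞ω) + 1) M) {z₀ : Plane} (hz : z₀ ∈ e.target) :
    ∃ ρ > 0, ∃ G α L N, IsChartFlow e Y z₀ ρ G α L N := by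
  obtain ⟨G, α, L, N, hf, ρ, hρ, hs, heq⟩ := exists_germ_isFlow e.open_target hz
    ((contDiffOn_chartRep Y he).of_le (by exact_mod_cast hk))
  exact ⟨ρ, hρ, G, α, L, N, mem_maximalAtlas_one he, hf, hs, heq⟩

namespace IsChartFlow

variable {Y : ∀ p : M, TangentSpace (𝓡 2) p} {z₀ : Plane} {ρ : ℝ} {G : Plane → Plane}
  {α : Plane → ℝ → Plane} {L N : NNReal}

/-- The field G represents Y only on the ball of radius ρ. Since the speed is at most N, the
condition N|t| + ‖z - z₀‖ < ρ keeps the trajectory inside up to time t; it recurs in all local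
statements below. -/
theorem mem_ball (h : IsChartFlow e Y z₀ ρ G α L N) {z : Plane} {t : ℝ}
    (ht : N * |t| + ‖z - z₀‖ < ρ) : α z t ∈ Metric.ball z₀ ρ := by
  rw [mem_ball_iff_norm]
  have h1 := h.flow.norm_sub_self_le z t
  have h2 := norm_add_le (α z t - z) (z - z₀)
  rw [sub_add_sub_cancel] at h2
  linarith

theorem mem_target (h : IsChartFlow e Y z₀ ρ G α L N) {z : Plane} {t : ℝ}
    (ht : N * |t| + ‖z - z₀‖ < ρ) : α z t ∈ e.target :=
  h.subset (Metric.ball_subset_closedBall (h.mem_ball ht))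

theorem isMIntegralCurveOn (h : IsChartFlow e Y z₀ ρ G α L N) {z : Plane} {T : ℝ}
    (hT : N * T + ‖z - z₀‖ < ρ) :
    IsMIntegralCurveOn (fun t => e.symm (α z t)) Y (Ioo (-T) T) := by
  have hsm : ∀ t ∈ Ioo (-T) T, N * |t| + ‖z - z₀‖ < ρ := fun t ht => by
    have : |t| < T := abs_lt.2 ht
    nlinarith [N.coe_nonneg]
  refine isMIntegralCurveOn_symm h.mem (fun t ht => ?_) fun t ht => h.mem_target (hsm t ht)
  rw [← h.eq (Metric.ball_subset_closedBall (h.mem_ball (hsm t ht)))]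
  exact h.flow.deriv z t

theorem exists_time {z : Plane} {t : ℝ}
    (ht : N * |t| + ‖z - z₀‖ < ρ) : ∃ T, |t| < T ∧ N * T + ‖z - z₀‖ < ρ := by
  have hN := N.coe_nonneg
  set δ := ρ - (N * |t| + ‖z - z₀‖) with hδ
  have hδ0 : 0 < δ := sub_pos.2 ht
  refine ⟨|t| + δ / (N + 1), lt_add_of_pos_right _ (by positivity), ?_⟩
  have : N * (δ / (N + 1)) < δ := by
    rw [mul_div_assoc', div_lt_iff₀ (by positivity)]
    nlinarith
  nlinarith

theorem flowRel (h : IsChartFlow e Y z₀ ρ G α L N) {z : Plane} {t : ℝ}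
    (ht : N * |t| + ‖z - z₀‖ < ρ) : FlowRel Y t (e.symm z) (e.symm (α z t)) := by
  obtain ⟨T, htT, hT⟩ := exists_time ht
  have hT0 : 0 < T := (abs_nonneg t).trans_lt htT
  exact ⟨fun t => e.symm (α z t), -T, T, ⟨by linarith, hT0⟩, abs_lt.1 htT,
    h.isMIntegralCurveOn hT, congrArg e.symm (h.flow.zero z), rfl⟩

theorem eventually_small {z : Plane} {t : ℝ} (ht : N * |t| + ‖z - z₀‖ < ρ) :
    ∀ᶠ y in 𝓝 z, N * |t| + ‖y - z₀‖ < ρ :=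
  (by fun_prop : Continuous fun y : Plane => N * |t| + ‖y - z₀‖).continuousAt.eventually_lt
    continuousAt_const ht

theorem mem_target_self (h : IsChartFlow e Y z₀ ρ G α L N) {z : Plane} {t : ℝ}
    (ht : N * |t| + ‖z - z₀‖ < ρ) : z ∈ e.target := by
  refine h.subset (mem_closedBall_iff_norm.2 ?_)
  have := mul_nonneg N.coe_nonneg (abs_nonneg t)
  linarith

theorem flowDomain_mem_nhds (h : IsChartFlow e Y z₀ ρ G α L N) {z : Plane} {t : ℝ}
    (ht : N * |t| + ‖z - z₀‖ < ρ) : flowDomain Y t ∈ 𝓝 (e.symm z) := by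
  have hz := h.mem_target_self ht
  have h1 : ∀ᶠ q in 𝓝 (e.symm z), N * |t| + ‖e q - z₀‖ < ρ := by
    have := e.continuousAt (e.map_target hz)
    rw [ContinuousAt, e.right_inv hz] at this
    exact this.eventually (eventually_small ht)
  filter_upwards [h1, e.open_source.mem_nhds (e.map_target hz)] with q hq hqs
  exact ⟨_, by simpa [e.left_inv hqs] using h.flowRel hq⟩

theorem flowRange_mem_nhds (h : IsChartFlow e Y z₀ ρ G α L N) {z : Plane} {t : ℝ}
    (ht : N * |t| + ‖z - z₀‖ < ρ) : flowRange Y t ∈ 𝓝 (e.symm (α z t)) := by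
  have hz := h.mem_target ht
  have h1 : ∀ᶠ q in 𝓝 (e.symm (α z t)), N * |t| + ‖α (e q) (-t) - z₀‖ < ρ := by
    have h2 := e.continuousAt (e.map_target hz)
    rw [ContinuousAt, e.right_inv hz] at h2
    have h3 : Tendsto (fun y => α y (-t)) (𝓝 (α z t)) (𝓝 z) := by
      have := (h.flow.continuous_left (-t)).tendsto (α z t)
      rwa [h.flow.add_neg] at this
    exact (h3.comp h2).eventually (eventually_small ht)
  filter_upwards [h1, e.open_source.mem_nhds (e.map_target hz)] with q hq hqs
  refine ⟨e.symm (α (e q) (-t)), ?_⟩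
  have := h.flowRel hq
  rwa [h.flow.neg_add, e.left_inv hqs] at this

end IsChartFlow

/-! ### The action of a tracking flow on the zeroes and directions of X. -/

variable {z₀ : Plane} {ρ : ℝ} {G : Plane → Plane} {α : Plane → ℝ → Plane} {L N : NNReal} {k : ℕ}

/-- A one-point orbit is mapped to a one-point set, which by tracking is an orbit. A point with X ≠
0 has further points on its orbit inside the range of the time t map, as this range is a
neighbourhood of it. -/
theorem Tracks.eq_zero_of_eq_zero (hk : 1 ≤ k) {X Y : VField M k} (hT : Tracks Y X)
    (h : IsChartFlow e Y z₀ ρ G α L N) {z : Plane} {t : ℝ} (ht : N * |t| + ‖z - z₀‖ < ρ)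
    (h0 : X (e.symm z) = 0) : X (e.symm (α z t)) = 0 := by
  have hD : e.symm z ∈ flowDomain Y t := ⟨_, h.flowRel ht⟩
  obtain ⟨p', hp', hO⟩ := hT t _ ⟨_, hD, rfl⟩
  have him : flowImage Y t (orbitIn X (flowDomain Y t) (e.symm z)) = {e.symm (α z t)} := by
    rw [orbitIn_of_eq_zero hk X hD h0]
    refine Subset.antisymm ?_ (singleton_subset_iff.2 ⟨_, rfl, h.flowRel ht⟩)
    rintro q ⟨p, rfl, hq⟩
    exact hq.unique hk (h.flowRel ht)
  rw [him] at hO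
  by_contra hne
  -- An orbit contains its base point, and this one is a singleton.
  have hself : p' = e.symm (α z t) := by
    by_cases hp0 : X p' = 0
    · rw [orbitIn_of_eq_zero hk X hp' hp0] at hO
      exact (singleton_eq_singleton_iff.1 hO).symm
    · have : e.symm (α z t) ∈ orbitIn X (flowRange Y t) p' := by rw [← hO]; rfl
      obtain ⟨γ, a, b, s, hab, hs, hγ, hD, h1, h2⟩ := this
      have : γ 0 ∈ orbitIn X (flowRange Y t) p' := ⟨γ, a, b, 0, hab, hab, hγ, hD, h1, rfl⟩
      rw [← hO, h1] at this
      exact this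
  obtain ⟨q, hq, hqne⟩ := exists_ne_mem_orbitIn hk X (h.flowRange_mem_nhds ht) hne
  rw [hself] at hO
  rw [← hO] at hq
  exact hqne hq

/-- The factor 2 leaves room for flowing during time t and then back. -/
theorem IsChartFlow.small_neg (h : IsChartFlow e Y z₀ ρ G α L N) {z : Plane} {t : ℝ}
    (ht : 2 * N * |t| + ‖z - z₀‖ < ρ) : N * |-t| + ‖α z t - z₀‖ < ρ := by
  have h1 := h.flow.norm_sub_self_le z t
  have h2 := norm_add_le (α z t - z) (z - z₀)
  rw [sub_add_sub_cancel] at h2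
  rw [abs_neg]
  linarith

theorem small_of_small {N : NNReal} {z z₀ : Plane} {t ρ : ℝ}
    (ht : 2 * N * |t| + ‖z - z₀‖ < ρ) : N * |t| + ‖z - z₀‖ < ρ := by
  have := mul_nonneg N.coe_nonneg (abs_nonneg t)
  linarith

theorem Tracks.eq_zero_iff (hk : 1 ≤ k) {X Y : VField M k} (hT : Tracks Y X)
    (h : IsChartFlow e Y z₀ ρ G α L N) {z : Plane} {t : ℝ} (ht : 2 * N * |t| + ‖z - z₀‖ < ρ) :
    X (e.symm (α z t)) = 0 ↔ X (e.symm z) = 0 := by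
  refine ⟨fun h0 => ?_, hT.eq_zero_of_eq_zero hk h (small_of_small ht)⟩
  have := hT.eq_zero_of_eq_zero hk h (h.small_neg ht) h0
  rwa [h.flow.add_neg] at this

/-- The points of an orbit that lie on a given family of points form countably many closed sets. -/
theorem exists_closed_cover (hk : 1 ≤ k) (X : VField M k) (D : Set M) (p : M) :
    ∃ (Γ : ℚ × ℚ → ℝ → M) (C : ℚ × ℚ → Set M),
      (∀ i, IsCompact (C i)) ∧ orbitIn X D p ⊆ ⋃ i, C i ∧
      ∀ i, C i = ∅ ∨ C i = Γ i '' Icc i.1 i.2 ∧ ∃ a b : ℝ, a < i.1 ∧ (i.2 : ℝ) < b ∧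
        IsMIntegralCurveOn (Γ i) X (Ioo a b) := by
  classical
  -- Rational end points on both sides of 0 make the family countable; requiring them strictly
  -- inside the interval of definition makes each arc compact. By uniqueness it does not matter
  -- which curve is chosen.
  let P : ℚ × ℚ → (ℝ → M) → Prop := fun i γ => ∃ a b : ℝ, a < i.1 ∧ (i.1 : ℝ) < 0 ∧ 0 < (i.2 : ℝ) ∧
    (i.2 : ℝ) < b ∧ IsMIntegralCurveOn γ X (Ioo a b) ∧ γ 0 = p
  let Γ : ℚ × ℚ → ℝ → M := fun i => if h : ∃ γ, P i γ then h.choose else fun _ => p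
  have hΓ : ∀ i, (∃ γ, P i γ) → P i (Γ i) := fun i h => by
    change P i (if h : ∃ γ, P i γ then h.choose else fun _ => p)
    rw [dif_pos h]
    exact h.choose_spec
  refine ⟨Γ, fun i => if ∃ γ, P i γ then Γ i '' Icc i.1 i.2 else ∅, fun i => ?_, ?_, fun i => ?_⟩
  · by_cases h : ∃ γ, P i γ
    · simp only [if_pos h]
      obtain ⟨a, b, ha, -, -, hb, hγ, -⟩ := hΓ i h
      exact isCompact_Icc.image_of_continuousOn (hγ.continuousOn.mono fun s hs =>
        ⟨ha.trans_le hs.1, hs.2.trans_lt hb⟩)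
    · simp only [if_neg h]; exact isCompact_empty
  · rintro q ⟨γ, a, b, s, h0, hs, hγ, -, h1, rfl⟩
    obtain ⟨a', ha', ha's⟩ := exists_rat_btwn (lt_min h0.1 hs.1)
    obtain ⟨b', hb's, hb'⟩ := exists_rat_btwn (max_lt h0.2 hs.2)
    have hP : ∃ γ, P (a', b') γ := ⟨γ, a, b, ha', ha's.trans_le (min_le_left _ _),
      (le_max_left _ _).trans_lt hb's, hb', hγ, h1⟩
    refine mem_iUnion.2 ⟨(a', b'), ?_⟩
    rw [if_pos hP]
    have hs' : s ∈ Icc (a' : ℝ) b' := ⟨(ha's.trans_le (min_le_right _ _)).le,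
      ((le_max_right _ _).trans_lt hb's).le⟩
    refine ⟨s, hs', ?_⟩
    obtain ⟨a₁, b₁, ha₁, h0', h0'', hb₁, hγ₁, h1'⟩ := hΓ _ hP
    exact eq_of_isMIntegralCurveOn hk X hγ₁ hγ ⟨ha₁.trans h0', h0''.trans hb₁⟩ h0
      (h1'.trans h1.symm) ⟨ha₁.trans_le hs'.1, hs'.2.trans_lt hb₁⟩ hs
  · by_cases h : ∃ γ, P i γ
    · obtain ⟨a, b, ha, -, -, hb, hγ, -⟩ := hΓ i h
      exact Or.inr ⟨if_pos h, a, b, ha, hb, hγ⟩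
    · exact Or.inl (if_neg h)

/-- Tracking gives only that the time t image of an X-arc lies in an orbit as a set. That orbit is a
countable union of compact arcs, so by Baire a whole subinterval of times is sent into one arc.
There, difference quotients of the original curve approach X near z, and those of the image points,
taken along the arc that contains them, approach X near the image of z. -/
theorem exists_chord (hk : 1 ≤ k) {X Y : VField M k} (hT : Tracks Y X)
    (he : e ∈ IsManifold.maximalAtlas (𝓡 2) ((k : ℕ∞ω) + 1) M)
    (h : IsChartFlow e Y z₀ ρ G α L N) {z : Plane} {t : ℝ} (ht : N * |t| + ‖z - z₀‖ < ρ)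
    (hz : chartRep e X z ≠ 0) {η : ℝ} (hη : 0 < η) :
    ∃ (z₂ z₃ v w : Plane) (a b : ℝ), z₂ ≠ z₃ ∧ ‖z₂ - z‖ ≤ η ∧ ‖z₃ - z‖ ≤ η ∧
      ‖v - chartRep e X z‖ ≤ η ∧ ‖w - chartRep e X (α z t)‖ ≤ η ∧ z₃ - z₂ = a • v ∧
      α z₃ t - α z₂ t = b • w := by
  set F := chartRep e X with hF
  have hFc : ContinuousOn F e.target := continuousOn_chartRep X h.mem
  have hzt : z ∈ e.target := h.mem_target_self ht
  -- the integral curve of `X` through `z`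
  obtain ⟨F₁, β, L', N', hβ, r, hr, hrt, hF₁⟩ := exists_germ_isFlow e.open_target hzt
    ((contDiffOn_chartRep X he).of_le (by exact_mod_cast hk))
  set σ := β z with hσ
  have hσc : Continuous σ := hβ.continuous z
  have hσ0 : σ 0 = z := hβ.zero z
  have hαc := h.flow.continuous_left t
  have hαzt : α z t ∈ e.target := h.mem_target ht
  have hFz : ContinuousAt F z := hFc.continuousAt (e.open_target.mem_nhds hzt)
  have hFαz : ContinuousAt (fun y => F (α y t)) z :=
    ContinuousAt.comp (g := F) (hFc.continuousAt (e.open_target.mem_nhds hαzt)) hαc.continuousAt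
  have hev : ∀ᶠ y in 𝓝 z, y ∈ Metric.closedBall z r ∧ N * |t| + ‖y - z₀‖ < ρ ∧ F y ≠ 0 ∧
      ‖y - z‖ < η ∧ ‖F y - F z‖ < η / 2 ∧ ‖F (α y t) - F (α z t)‖ < η / 2 := by
    have hb : ∀ᶠ y in 𝓝 z, y ∈ Metric.closedBall z r := Metric.closedBall_mem_nhds z hr
    refine hb.and ((IsChartFlow.eventually_small ht).and ((hFz.eventually_ne hz).and ?_))
    simp only [← dist_eq_norm]
    exact inter_mem (Metric.ball_mem_nhds z hη) (inter_mem (hFz (Metric.ball_mem_nhds _ (half_pos hη)))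
      (hFαz (Metric.ball_mem_nhds _ (half_pos hη))))
  have hD : ∀ᶠ y in 𝓝 z, e.symm y ∈ flowDomain Y t :=
    (e.continuousAt_symm hzt) (h.flowDomain_mem_nhds ht)
  have hσt : Tendsto σ (𝓝 0) (𝓝 z) := by have := hσc.tendsto 0; rwa [hσ0] at this
  obtain ⟨s₁, hs₁, hσs⟩ := Metric.nhds_basis_closedBall.mem_iff.1 (hσt (hev.and hD))
  rw [Real.closedBall_eq_Icc, zero_sub, zero_add] at hσs
  have hσm : ∀ s ∈ Icc (-s₁) s₁, _ := fun s hs => hσs hs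
  -- its image lies on a single orbit
  obtain ⟨p', hp', hO⟩ := hT t _ ⟨e.symm z, ⟨_, h.flowRel ht⟩, rfl⟩
  have hγX : IsMIntegralCurveOn (fun s => e.symm (σ s)) X (Ioo (-s₁) s₁) := by
    refine isMIntegralCurveOn_symm h.mem (fun s hs => ?_) fun s hs =>
      hrt (hσm s (Ioo_subset_Icc_self hs)).1.1
    rw [← hF₁ (hσm s (Ioo_subset_Icc_self hs)).1.1]
    exact hβ.deriv z s
  have hq : ∀ s ∈ Ioo (-s₁) s₁, e.symm (α (σ s) t) ∈ orbitIn X (flowRange Y t) p' := by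
    intro s hs
    rw [← hO]
    refine ⟨e.symm (σ s), ⟨fun s => e.symm (σ s), -s₁, s₁, s, ⟨by linarith, hs₁⟩, hs, hγX,
      fun u hu => (hσm u (Ioo_subset_Icc_self hu)).2, congrArg e.symm hσ0, rfl⟩, ?_⟩
    exact h.flowRel (hσm s (Ioo_subset_Icc_self hs)).1.2.1
  obtain ⟨Γ, C, hC, hcov, hCΓ⟩ := exists_closed_cover hk X (flowRange Y t) p'
  -- Baire
  have hqc : ContinuousOn (fun s => e.symm (α (σ s) t)) (Icc (-s₁) s₁) :=
    e.continuousOn_symm.comp (hαc.comp hσc).continuousOn fun s hs => h.mem_target (hσm s hs).1.2.1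
  have hdense := dense_iUnion_interior_of_closed
    -- The index `none` carries the complement of the interval, so that the closed sets cover all of
    -- ℝ.
    (f := fun i : Option (ℚ × ℚ) => i.elim (Ioo (-s₁) s₁)ᶜ
      fun i => Icc (-s₁) s₁ ∩ (fun s => e.symm (α (σ s) t)) ⁻¹' C i) (fun i => by
        cases i with
        | none => exact isOpen_Ioo.isClosed_compl
        | some i => exact hqc.preimage_isClosed_of_isClosed isClosed_Icc (hC i).isClosed) (by
        rw [eq_univ_iff_forall]
        intro s
        by_cases hs : s ∈ Ioo (-s₁) s₁
        · obtain ⟨i, hi⟩ := mem_iUnion.1 (hcov (hq s hs))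
          exact mem_iUnion.2 ⟨some i, Ioo_subset_Icc_self hs, hi⟩
        · exact mem_iUnion.2 ⟨none, hs⟩)
  obtain ⟨s', hs', hs'i⟩ := hdense.inter_open_nonempty _ isOpen_Ioo
    (nonempty_Ioo.2 (by linarith : -s₁ < s₁))
  obtain ⟨i, hi⟩ := mem_iUnion.1 hs'i
  cases i with
  | none => exact absurd hs' (interior_subset hi)
  | some i =>
  have hi' : ∀ᶠ s in 𝓝 s', s ∈ Icc (-s₁) s₁ ∧ e.symm (α (σ s) t) ∈ C i :=
    mem_interior_iff_mem_nhds.1 hi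
  obtain hempty | ⟨hCi, a, b, ha, hb, hΓi⟩ := hCΓ i
  · have := hi'.self_of_nhds.2
    rw [hempty] at this
    exact this.elim
  -- a sequence converging to `s'`
  have hslope : Tendsto (slope σ s') (𝓝[≠] s') (𝓝 (F (σ s'))) := by
    have := hasDerivAt_iff_tendsto_slope.1 (hβ.deriv z s')
    rwa [hF₁ (hσm s' (Ioo_subset_Icc_self hs')).1.1] at this
  have hm' := (hσm s' (Ioo_subset_Icc_self hs')).1
  have hv : ∀ᶠ s in 𝓝[≠] s', ‖slope σ s' s - F (σ s')‖ < η / 2 ∧ slope σ s' s ≠ 0 := by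
    refine Filter.Eventually.and ?_ (hslope.eventually_ne hm'.2.2.1)
    simp only [← dist_eq_norm]
    exact hslope (Metric.ball_mem_nhds _ (half_pos hη))
  obtain ⟨x, hx⟩ := exists_seq_tendsto (𝓝[≠] s')
  have hx' : Tendsto x atTop (𝓝 s') := tendsto_nhds_of_tendsto_nhdsWithin hx
  have hxev : ∀ᶠ n in atTop, (‖slope σ s' (x n) - F (σ s')‖ < η / 2 ∧ slope σ s' (x n) ≠ 0) ∧
      x n ≠ s' ∧ x n ∈ Icc (-s₁) s₁ ∧ ∃ u ∈ Icc (i.1 : ℝ) i.2, Γ i u = e.symm (α (σ (x n)) t) := by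
    filter_upwards [hx.eventually hv, hx.eventually self_mem_nhdsWithin, hx'.eventually hi']
      with n h1 h2 h3
    refine ⟨h1, h2, h3.1, ?_⟩
    have := h3.2
    rw [hCi] at this
    exact this
  obtain ⟨n₀, hn₀⟩ := eventually_atTop.1 hxev
  choose! u hu hΓu using fun n (hn : n₀ ≤ n) => (hn₀ n hn).2.2.2
  -- The parameters of the image points on the arc need not depend continuously on time. Compactness
  -- supplies a limit parameter u'; it represents the image of σ s', and the difference quotients of
  -- the arc at u' tend to X there.
  obtain ⟨u', hu', φ, hφ, hφu⟩ := isCompact_Icc.tendsto_subseq (x := fun n => u (n + n₀))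
    (fun n => hu _ (Nat.le_add_left _ _))
  have hsub : Tendsto (fun n => φ n + n₀) atTop atTop :=
    tendsto_atTop_mono (fun n => Nat.le_add_right _ _) hφ.tendsto_atTop
  have hu'ab : u' ∈ Ioo a b := ⟨ha.trans_le hu'.1, hu'.2.trans_lt hb⟩
  have hαs' : α (σ s') t ∈ e.target := h.mem_target hm'.2.1
  have hΓu' : Γ i u' = e.symm (α (σ s') t) := by
    have h1 : Tendsto (fun n => Γ i (u (φ n + n₀))) atTop (𝓝 (Γ i u')) :=
      ((hΓi.continuousOn).continuousAt (Ioo_mem_nhds hu'ab.1 hu'ab.2)).tendsto.comp hφu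
    have h2 : Tendsto (fun n => e.symm (α (σ (x (φ n + n₀))) t)) atTop
        (𝓝 (e.symm (α (σ s') t))) :=
      (hqc.continuousAt (Icc_mem_nhds hs'.1 hs'.2)).tendsto.comp (hx'.comp hsub)
    refine tendsto_nhds_unique h1 (h2.congr fun n => ?_)
    exact (hΓu _ (Nat.le_add_left _ _)).symm
  have hne : ∀ n, n₀ ≤ n → σ (x n) ≠ σ s' := by
    intro n hn heq
    refine (hn₀ n hn).1.2 ?_
    rw [slope_def_module, heq, sub_self, smul_zero]
  have hune : ∀ n, n₀ ≤ n → u n ≠ u' := by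
    intro n hn heq
    have h1 := hΓu n hn
    rw [heq, hΓu'] at h1
    have h2 := e.symm.injOn hαs' (h.mem_target (hσm _ (hn₀ n hn).2.2.1).1.2.1) h1
    have h3 := congrArg (fun y => α y (-t)) h2
    simp only [h.flow.add_neg] at h3
    exact hne n hn h3.symm
  have hdΓ : HasDerivAt (fun s => e (Γ i s)) (F (α (σ s') t)) u' := by
    have := hasDerivAt_chart h.mem isOpen_Ioo hΓi hu'ab (by rw [hΓu']; exact e.map_target hαs')
    rwa [hΓu', e.right_inv hαs'] at this
  have hw : ∀ᶠ n in atTop, ‖slope (fun s => e (Γ i s)) u' (u (φ n + n₀)) - F (α (σ s') t)‖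
      < η / 2 := by
    have h1 : Tendsto (fun n => u (φ n + n₀)) atTop (𝓝[≠] u') :=
      tendsto_nhdsWithin_iff.2 ⟨hφu, Eventually.of_forall fun n =>
        hune _ (Nat.le_add_left _ _)⟩
    have h2 := (hasDerivAt_iff_tendsto_slope.1 hdΓ).comp h1
    simp only [← dist_eq_norm]
    exact h2 (Metric.ball_mem_nhds _ (half_pos hη))
  obtain ⟨n, hn⟩ := hw.exists
  set m := φ n + n₀ with hm
  have hmn : n₀ ≤ m := Nat.le_add_left _ _
  have hmm := (hσm _ (hn₀ m hmn).2.2.1).1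
  refine ⟨σ s', σ (x m), slope σ s' (x m), slope (fun s => e (Γ i s)) u' (u m), x m - s',
    u m - u', (hne m hmn).symm, hm'.2.2.2.1.le, hmm.2.2.2.1.le, ?_, ?_,
    (sub_smul_slope σ s' (x m)).symm, ?_⟩
  · have := norm_add_le (slope σ s' (x m) - F (σ s')) (F (σ s') - F z)
    rw [sub_add_sub_cancel] at this
    linarith [(hn₀ m hmn).1.1, hm'.2.2.2.2.1]
  · have := norm_add_le (slope (fun s => e (Γ i s)) u' (u m) - F (α (σ s') t))
      (F (α (σ s') t) - F (α z t))
    rw [sub_add_sub_cancel] at this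
    linarith [hm'.2.2.2.2.2]
  · rw [sub_smul_slope, vsub_eq_sub, hΓu m hmn, hΓu', e.right_inv hαs',
      e.right_inv (h.mem_target hmm.2.1)]

/-- There are short chords near `z`, almost parallel to `X`, that the time `t` map sends to chords
almost parallel to `X`. -/
theorem exists_chord_seq (hk : 1 ≤ k) {X Y : VField M k} (hT : Tracks Y X)
    (he : e ∈ IsManifold.maximalAtlas (𝓡 2) ((k : ℕ∞ω) + 1) M)
    (h : IsChartFlow e Y z₀ ρ G α L N) {z : Plane} {t : ℝ} (ht : N * |t| + ‖z - z₀‖ < ρ)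
    (hz : chartRep e X z ≠ 0) :
    ∃ (z₂ z₃ v w : ℕ → Plane) (a b : ℕ → ℝ), Tendsto z₂ atTop (𝓝 z) ∧ Tendsto z₃ atTop (𝓝 z) ∧
      Tendsto v atTop (𝓝 (chartRep e X z)) ∧ Tendsto w atTop (𝓝 (chartRep e X (α z t))) ∧
      (∀ n, z₂ n ≠ z₃ n) ∧ (∀ n, z₃ n - z₂ n = a n • v n) ∧
      (∀ n, α (z₃ n) t - α (z₂ n) t = b n • w n) := by
  have h1 : ∀ n : ℕ, (0 : ℝ) < 1 / (n + 1) := fun n => by positivity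
  choose z₂ z₃ v w a b hne h2 h3 hv hw ha hb using
    fun n : ℕ => exists_chord hk hT he h ht hz (h1 n)
  have hlim : ∀ (f : ℕ → Plane) (y : Plane), (∀ n : ℕ, ‖f n - y‖ ≤ 1 / (n + 1)) →
      Tendsto f atTop (𝓝 y) := fun f y hf =>
    tendsto_iff_norm_sub_tendsto_zero.2 (squeeze_zero (fun n => norm_nonneg _) hf
      tendsto_one_div_add_atTop_nhds_zero_nat)
  exact ⟨z₂, z₃, v, w, a, b, hlim _ _ h2, hlim _ _ h3, hlim _ _ hv, hlim _ _ hw, hne, ha, hb⟩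

/-- Take a short chord a v parallel to X up to a small error, and its image b w. Then b det(v, w) =
det(v, bw - av), and the difference of the chords is O(t) times their length. Dividing by |b| and
passing to the limit bounds the sine of the angle. -/
theorem abs_det2_flow_le (hk : 1 ≤ k) {X Y : VField M k} (hT : Tracks Y X)
    (he : e ∈ IsManifold.maximalAtlas (𝓡 2) ((k : ℕ∞ω) + 1) M)
    (h : IsChartFlow e Y z₀ ρ G α L N) {z : Plane} {t : ℝ} (ht : N * |t| + ‖z - z₀‖ < ρ) :
    |det2 (chartRep e X z) (chartRep e X (α z t))| ≤
      L * Real.exp (L * |t|) ^ 2 * |t| * (‖chartRep e X z‖ * ‖chartRep e X (α z t)‖) := by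
  by_cases hz : chartRep e X z = 0
  · rw [hz]
    simp [det2]
  obtain ⟨z₂, z₃, v, w, a, b, -, -, hv, hw, hne, ha, hb⟩ := exists_chord_seq hk hT he h ht hz
  refine le_of_tendsto_of_tendsto' (Tendsto.det2 hv hw).abs
    ((hv.norm.mul hw.norm).const_mul (L * Real.exp (L * |t|) ^ 2 * |t|)) fun n => ?_
  have h1 : ‖a n • v n‖ ≤ Real.exp (L * |t|) * ‖b n • w n‖ := by
    rw [← ha, ← hb]; exact h.flow.le_norm_sub _ _ _
  have h2 : ‖b n • w n - a n • v n‖ ≤ L * Real.exp (L * |t|) * |t| * ‖a n • v n‖ := by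
    rw [← ha, ← hb]; exact h.flow.norm_sub_sub_le _ _ _
  have hb0 : 0 < |b n| := by
    rw [abs_pos]
    intro hb0
    rw [hb0, zero_smul, norm_zero, mul_zero, ← ha] at h1
    exact hne n (sub_eq_zero.1 (norm_le_zero_iff.1 h1)).symm
  have h3 : b n * det2 (v n) (w n) = det2 (v n) (b n • w n - a n • v n) := by
    rw [det2_sub_right, det2_smul_right, det2_smul_right, det2_self, mul_zero, sub_zero]
  have h4 : |b n| * |det2 (v n) (w n)| ≤
      |b n| * (L * Real.exp (L * |t|) ^ 2 * |t| * (‖v n‖ * ‖w n‖)) := by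
    rw [← abs_mul, h3]
    calc _ ≤ ‖v n‖ * ‖b n • w n - a n • v n‖ := abs_det2_le _ _
      _ ≤ ‖v n‖ * (L * Real.exp (L * |t|) * |t| * (Real.exp (L * |t|) * ‖b n • w n‖)) := by
          gcongr
          exact h2.trans (by gcongr)
      _ = _ := by rw [norm_smul, Real.norm_eq_abs]; ring
  exact le_of_mul_le_mul_left h4 hb0

/-- If X = cY at z, a short chord along X agrees to first order with a step of length ac along the
trajectory of Y. The flow of Y commutes with itself, so the image chord agrees to first order with
such a step at the image point, and X is parallel to Y there too. -/
theorem det2_flow_eq_zero (hk : 1 ≤ k) {X Y : VField M k} (hT : Tracks Y X)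
    (he : e ∈ IsManifold.maximalAtlas (𝓡 2) ((k : ℕ∞ω) + 1) M)
    (h : IsChartFlow e Y z₀ ρ G α L N) {z : Plane} {t : ℝ} (ht : N * |t| + ‖z - z₀‖ < ρ)
    (hGz : G z ≠ 0) (hd : det2 (chartRep e X z) (G z) = 0) :
    det2 (chartRep e X (α z t)) (G (α z t)) = 0 := by
  by_cases hz : chartRep e X z = 0
  · have := hT.eq_zero_of_eq_zero hk h ht ((chartRep_eq_zero h.mem X (h.mem_target_self ht)).1 hz)
    rw [← chartRep_eq_zero h.mem X (h.mem_target ht)] at this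
    rw [this]; simp [det2]
  obtain ⟨c, hc⟩ := eq_smul_of_det2_eq_zero hGz hd
  obtain ⟨z₂, z₃, v, w, a, b, hz₂, hz₃, hv, hw, hne, ha, hb⟩ := exists_chord_seq hk hT he h ht hz
  have hGc := h.flow.lip.continuous
  have hvn : Tendsto (fun n => ‖v n‖⁻¹) atTop (𝓝 ‖chartRep e X z‖⁻¹) :=
    hv.norm.inv₀ (norm_ne_zero_iff.2 hz)
  have hav : Tendsto (fun n => |a n| * ‖v n‖) atTop (𝓝 0) := by
    have := (hz₃.sub hz₂).norm
    rw [sub_self, norm_zero] at this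
    refine this.congr fun n => ?_
    rw [ha, norm_smul, Real.norm_eq_abs]
  have hv0 : ∀ᶠ n in atTop, v n ≠ 0 := hv.eventually_ne hz
  have ha0 : Tendsto (fun n => |a n|) atTop (𝓝 0) := by
    have := hav.mul hvn
    rw [zero_mul] at this
    refine this.congr' ?_
    filter_upwards [hv0] with n hn
    rw [mul_assoc, mul_inv_cancel₀ (norm_ne_zero_iff.2 hn), mul_one]
  -- the error terms
  let E := Real.exp (L * |t|)
  let κ : ℕ → ℝ := fun n => E * (‖v n - chartRep e X z‖ + |c| * ‖G z - G (z₂ n)‖ +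
      L * N * c ^ 2 * |a n|) + (L * N * c ^ 2 * |a n| + |c| * ‖G (α (z₂ n) t) - G (α z t)‖)
  have hκ : Tendsto κ atTop (𝓝 0) := by
    have h1 : Tendsto (fun n => ‖v n - chartRep e X z‖) atTop (𝓝 0) :=
      tendsto_iff_norm_sub_tendsto_zero.1 hv
    have h2 : Tendsto (fun n => ‖G z - G (z₂ n)‖) atTop (𝓝 0) := by
      have := ((tendsto_const_nhds (x := G z)).sub ((hGc.tendsto z).comp hz₂)).norm
      simpa using this
    have h3 : Tendsto (fun n => ‖G (α (z₂ n) t) - G (α z t)‖) atTop (𝓝 0) :=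
      tendsto_iff_norm_sub_tendsto_zero.1
        (((hGc.comp (h.flow.continuous_left t)).tendsto z).comp hz₂)
    have h4 := (((h1.add (h2.const_mul |c|)).add (ha0.const_mul (L * N * c ^ 2))).const_mul E).add
      ((ha0.const_mul (L * N * c ^ 2)).add (h3.const_mul |c|))
    simpa using h4
  have hbd : ∀ᶠ n in atTop, |det2 (w n) (G (α z t))| ≤
      κ n * ‖G (α z t)‖ * E * ‖w n‖ * ‖v n‖⁻¹ := by
    filter_upwards [hv0] with n hn
    have h1 : |a n| * ‖v n‖ ≤ E * (|b n| * ‖w n‖) := by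
      rw [← Real.norm_eq_abs, ← norm_smul, ← Real.norm_eq_abs (b n), ← norm_smul, ← ha, ← hb]
      exact h.flow.le_norm_sub _ _ _
    have hb0 : 0 < |b n| := by
      rw [abs_pos]
      intro hb0
      rw [hb0, abs_zero, zero_mul, mul_zero, ← Real.norm_eq_abs, ← norm_smul, ← ha] at h1
      exact hne n (sub_eq_zero.1 (norm_le_zero_iff.1 h1)).symm
    -- The point reached from z₂ along Y that matches z₃ up to o(a); its image under the time t map
    -- is the point reached from the image of z₂ in the same additional time.
    set y := α (z₂ n) (a n * c) with hy
    have h2 : ‖z₃ n - y‖ ≤ |a n| * (‖v n - chartRep e X z‖ + |c| * ‖G z - G (z₂ n)‖ +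
        L * N * c ^ 2 * |a n|) := by
      have e1 : z₃ n - y = a n • (v n - chartRep e X z) + (a n * c) • (G z - G (z₂ n)) -
          (y - z₂ n - (a n * c) • G (z₂ n)) := by
        have : z₃ n = z₂ n + a n • v n := by rw [← ha]; abel
        rw [this, hc, smul_sub, smul_sub, smul_smul]
        abel
      rw [e1]
      refine (norm_sub_le _ _).trans ((add_le_add (norm_add_le _ _)
        (h.flow.norm_sub_smul_le _ _)).trans (le_of_eq ?_))
      rw [norm_smul, norm_smul, Real.norm_eq_abs, Real.norm_eq_abs, abs_mul, mul_pow, ← sq_abs (a n)]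
      ring
    have h3 : α y t = α (α (z₂ n) t) (a n * c) := by
      rw [hy, h.flow.add, h.flow.add, add_comm]
    set r := b n • w n - (a n * c) • G (α z t) with hr
    have h4 : ‖r‖ ≤ |a n| * κ n := by
      have e1 : r = (α (z₃ n) t - α y t) +
          (α (α (z₂ n) t) (a n * c) - α (z₂ n) t - (a n * c) • G (α (z₂ n) t)) +
          (a n * c) • (G (α (z₂ n) t) - G (α z t)) := by
        rw [hr, ← hb, h3, smul_sub]
        abel
      rw [e1]
      refine (norm_add_le _ _).trans ((add_le_add ((norm_add_le _ _).trans (add_le_add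
        ((h.flow.norm_sub_le _ _ _).trans (mul_le_mul_of_nonneg_left h2 (Real.exp_pos _).le))
        (h.flow.norm_sub_smul_le _ _))) le_rfl).trans (le_of_eq ?_))
      rw [norm_smul, Real.norm_eq_abs, abs_mul, mul_pow, ← sq_abs (a n)]
      simp only [κ, E]
      ring
    have h5 : b n * det2 (w n) (G (α z t)) = det2 r (G (α z t)) := by
      rw [hr, det2_sub_left, det2_smul_left, det2_smul_left, det2_self, mul_zero, sub_zero]
    have hκ0 : 0 ≤ κ n := by
      simp only [κ, E]
      positivity
    have hvp : 0 < ‖v n‖ := norm_pos_iff.2 hn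
    refine le_of_mul_le_mul_left ?_ hb0
    rw [← abs_mul, h5]
    calc |det2 r (G (α z t))| ≤ ‖r‖ * ‖G (α z t)‖ := abs_det2_le _ _
      _ ≤ (|a n| * κ n) * ‖G (α z t)‖ := by gcongr
      _ = (|a n| * ‖v n‖) * (κ n * ‖G (α z t)‖ * ‖v n‖⁻¹) := by
          field_simp
      _ ≤ (E * (|b n| * ‖w n‖)) * (κ n * ‖G (α z t)‖ * ‖v n‖⁻¹) := by gcongr
      _ = _ := by ring
  have hlim : Tendsto (fun n => κ n * ‖G (α z t)‖ * E * ‖w n‖ * ‖v n‖⁻¹) atTop (𝓝 0) := by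
    have := ((((hκ.mul_const ‖G (α z t)‖).mul_const E).mul hw.norm).mul hvn)
    simpa using this
  have h6 := le_of_tendsto_of_tendsto (Tendsto.det2 hw tendsto_const_nhds).abs hlim hbd
  exact abs_eq_zero.1 (le_antisymm h6 (abs_nonneg _))

end Orbits

/-! ### Symmetry of iterated derivatives and Taylor expansion along a line -/

section Taylor

universe u

variable {E : Type u} [NormedAddCommGroup E] [NormedSpace ℝ E]

/-- Induction on the order. Swaps fixing the first slot are handled by differentiating the symmetric
derivative of lower order; swaps fixing the last slot, by applying the induction hypothesis to
`fderiv`. The swap of the two extreme slots is a conjugate of such swaps as soon as there are three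
slots; with two slots it is the symmetry of the second derivative. -/
theorem iteratedFDeriv_comp_perm (n : ℕ) : ∀ {F : Type u} [NormedAddCommGroup F] [NormedSpace ℝ F]
    {f : E → F} (_ : ContDiff ℝ n f) (x : E) (σ : Equiv.Perm (Fin n)) (v : Fin n → E),
    iteratedFDeriv ℝ n f x (v ∘ σ) = iteratedFDeriv ℝ n f x v := by
  induction n with
  | zero =>
    intro F _ _ f hf x σ v
    rw [Subsingleton.elim (v ∘ σ) v]
  | succ n ih =>
    intro F _ _ f hf x σ v
    have hdiff : Differentiable ℝ (iteratedFDeriv ℝ n f) :=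
      hf.differentiable_iteratedFDeriv (by exact_mod_cast n.lt_succ_self)
    have h0 : ∀ (a b : Fin n) (v : Fin (n + 1) → E),
        iteratedFDeriv ℝ (n + 1) f x (v ∘ Equiv.swap a.succ b.succ) =
          iteratedFDeriv ℝ (n + 1) f x v := by
      intro a b v
      rw [(hdiff x).iteratedFDeriv_succ_apply_left', (hdiff x).iteratedFDeriv_succ_apply_left']
      have h1 : Fin.tail (v ∘ Equiv.swap a.succ b.succ) = Fin.tail v ∘ Equiv.swap a b := by
        ext i
        simp only [Fin.tail, Function.comp_apply]
        rw [(Fin.succ_injective n).swap_apply]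
      have h2 : (v ∘ Equiv.swap a.succ b.succ) 0 = v 0 := by
        simp only [Function.comp_apply]
        rw [Equiv.swap_apply_of_ne_of_ne (Fin.succ_ne_zero a).symm (Fin.succ_ne_zero b).symm]
      rw [h1, h2]
      congr 2
      ext y
      exact ih (hf.of_le (by exact_mod_cast n.le_succ)) y _ _
    have hl : ∀ (a b : Fin n) (v : Fin (n + 1) → E),
        iteratedFDeriv ℝ (n + 1) f x (v ∘ Equiv.swap a.castSucc b.castSucc) =
          iteratedFDeriv ℝ (n + 1) f x v := by
      intro a b v
      rw [iteratedFDeriv_succ_apply_right, iteratedFDeriv_succ_apply_right]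
      have h1 : Fin.init (v ∘ Equiv.swap a.castSucc b.castSucc) =
          Fin.init v ∘ Equiv.swap a b := by
        ext i
        simp only [Fin.init, Function.comp_apply]
        rw [(Fin.castSucc_injective n).swap_apply]
      have h2 : (v ∘ Equiv.swap a.castSucc b.castSucc) (Fin.last n) = v (Fin.last n) := by
        simp only [Function.comp_apply]
        rw [Equiv.swap_apply_of_ne_of_ne (Fin.castSucc_lt_last a).ne'
          (Fin.castSucc_lt_last b).ne']
      rw [h1, h2, ih (hf.fderiv_right (m := n) (by norm_cast))]
    have hswap : ∀ (a b : Fin (n + 1)) (v : Fin (n + 1) → E),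
        iteratedFDeriv ℝ (n + 1) f x (v ∘ Equiv.swap a b) = iteratedFDeriv ℝ (n + 1) f x v := by
      have h0l : ∀ v : Fin (n + 1) → E,
          iteratedFDeriv ℝ (n + 1) f x (v ∘ Equiv.swap 0 (Fin.last n)) =
            iteratedFDeriv ℝ (n + 1) f x v := by
        intro v
        match n, hf, h0, hl with
        | 0, _, _, _ => simp
        | 1, hf, _, _ =>
          have := (hf.contDiffAt (x := x)).isSymmSndFDerivAt (by simp) (v 1) (v 0)
          rw [iteratedFDeriv_two_apply, iteratedFDeriv_two_apply]
          simpa using this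
        | n + 2, hf, h0, hl =>
          have e1 : Equiv.swap (0 : Fin (n + 3)) (Fin.last (n + 2)) =
              Equiv.swap (Fin.castSucc 0) (Fin.castSucc 1) *
                Equiv.swap (Fin.succ 0) (Fin.succ (Fin.last (n + 1))) *
                Equiv.swap (Fin.castSucc 0) (Fin.castSucc 1) := by
            have h := Equiv.swap_mul_swap_mul_swap (x := Fin.last (n + 2)) (y := 1)
              (z := (0 : Fin (n + 3))) (by simp [Fin.ext_iff]) (by simp [Fin.ext_iff])
            simp only [Fin.castSucc_zero, Fin.castSucc_one, Fin.succ_zero_eq_one, Fin.succ_last]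
            rw [Equiv.swap_comm 0 1, Equiv.swap_comm 1 (Fin.last (n + 2))]
            exact h.symm
          rw [e1, Equiv.Perm.coe_mul, Equiv.Perm.coe_mul, ← Function.comp_assoc,
            ← Function.comp_assoc, hl, h0, hl]
      intro a b v
      induction a using Fin.cases with
      | zero =>
        induction b using Fin.lastCases with
        | last => exact h0l v
        | cast b =>
          cases n with
          | zero => exact b.elim0
          | succ n => exact hl 0 b v
      | succ a =>
        induction b using Fin.cases with
        | zero =>
          rw [Equiv.swap_comm]
          cases n with
          | zero => exact a.elim0
          | succ n =>
            induction a using Fin.lastCases with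
            | last => exact h0l v
            | cast a => exact hl 0 a.succ v
        | succ b => exact h0 a b v
    induction σ using Equiv.Perm.swap_induction_on generalizing v with
    | one => rfl
    | swap_mul σ a b _ ih' =>
      rw [Equiv.Perm.coe_mul, ← Function.comp_assoc, ih', hswap]

/-- Polarization: the n-th derivative of the diagonal restriction is the sum of the form over all
permutations of its arguments, which by symmetry is n! times the form. -/
theorem exists_diagonal_ne_zero {n : ℕ} {F : Type u} [NormedAddCommGroup F] [NormedSpace ℝ F]
    {f : E → F} (hf : ContDiff ℝ n f) {x : E} (h : iteratedFDeriv ℝ n f x ≠ 0) :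
    ∃ w, iteratedFDeriv ℝ n f x (fun _ => w) ≠ 0 := by
  by_contra! hall
  refine h (ContinuousMultilinearMap.ext fun v => ?_)
  have h1 := (iteratedFDeriv ℝ n f x).iteratedFDeriv_comp_diagonal 0 v
  have h2 : (fun y => (iteratedFDeriv ℝ n f x) fun _ => y) = fun _ => 0 := funext hall
  have h3 : ∀ σ : Equiv.Perm (Fin n), iteratedFDeriv ℝ n f x (fun i => v (σ i)) =
      iteratedFDeriv ℝ n f x v := fun σ => iteratedFDeriv_comp_perm n hf x σ v
  rw [h2, Finset.sum_congr rfl fun σ _ => h3 σ, Finset.sum_const] at h1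
  have h4 : iteratedFDeriv ℝ n (fun _ : E => (0 : F)) 0 v = 0 := by
    rw [iteratedFDeriv_fun_zero]; rfl
  rw [h4, Finset.card_univ, Fintype.card_perm] at h1
  rw [← Nat.cast_smul_eq_nsmul ℝ] at h1
  simpa using (smul_eq_zero.1 h1.symm).resolve_left (Nat.cast_ne_zero.2 (Nat.factorial_ne_zero _))

theorem tendsto_inv_pow_smul {n : ℕ} {F : Type u} [NormedAddCommGroup F] [NormedSpace ℝ F]
    {f : E → F} (hf : ContDiff ℝ n f) {x : E} (h0 : ∀ i < n, iteratedFDeriv ℝ i f x = 0) (w : E) :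
    Tendsto (fun s : ℝ => (s ^ n)⁻¹ • f (x + s • w)) (𝓝[≠] 0)
      (𝓝 ((n.factorial : ℝ)⁻¹ • iteratedFDeriv ℝ n f x (fun _ => w))) := by
  set g : ℝ → F := fun s => f (x + s • w) with hg
  have hg1 : g = (fun y => f (x + y)) ∘ (ContinuousLinearMap.toSpanSingleton ℝ w) := by
    ext s; simp [hg]
  have hf1 : ContDiff ℝ n fun y => f (x + y) := hf.comp (contDiff_const.add contDiff_id)
  have hgc : ContDiff ℝ n g := by
    rw [hg1]; exact hf1.comp (ContinuousLinearMap.contDiff _)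
  have hder : ∀ i ≤ n, iteratedDeriv i g 0 = iteratedFDeriv ℝ i f x (fun _ => w) := by
    intro i hi
    rw [iteratedDeriv_eq_iteratedFDeriv, hg1,
      ContinuousLinearMap.iteratedFDeriv_comp_right _ hf1 _ (by exact_mod_cast hi)]
    simp only [ContinuousMultilinearMap.compContinuousLinearMap_apply]
    rw [iteratedFDeriv_comp_add_left]
    simp
  have ht := taylor_isLittleO_univ (x₀ := 0) hgc
  have hT : ∀ s, taylorWithinEval g n univ 0 s =
      s ^ n • ((n.factorial : ℝ)⁻¹ • iteratedFDeriv ℝ n f x (fun _ => w)) := by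
    intro s
    rw [taylor_within_apply, Finset.sum_range_succ, Finset.sum_eq_zero, zero_add,
      iteratedDerivWithin_univ, hder n le_rfl, sub_zero, smul_smul, mul_comm]
    intro i hi
    have hi' := Finset.mem_range.1 hi
    rw [iteratedDerivWithin_univ, hder i hi'.le, h0 i hi']
    simp
  simp only [hT, sub_zero] at ht
  have h1 := (ht.mono nhdsWithin_le_nhds : _ =o[𝓝[≠] (0 : ℝ)] _).tendsto_inv_smul_nhds_zero
  rw [← tendsto_sub_nhds_zero_iff]
  refine h1.congr' ?_
  filter_upwards [self_mem_nhdsWithin] with s hs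
  have : s ^ n ≠ 0 := pow_ne_zero n hs
  rw [smul_sub, smul_smul, inv_mul_cancel₀ this, one_smul]

/-- A smooth map near a point has a globally smooth modification with the same germ. -/
theorem exists_contDiff_germ [FiniteDimensional ℝ E] {F : Type u} [NormedAddCommGroup F]
    [NormedSpace ℝ F] {n : ℕ∞} {f : E → F} {O : Set E} (hO : IsOpen O) {x : E} (hx : x ∈ O)
    (hf : ContDiffOn ℝ n f O) : ∃ g : E → F, ContDiff ℝ n g ∧ g =ᶠ[𝓝 x] f := by
  obtain ⟨r, hr, hrO⟩ := Metric.nhds_basis_closedBall.mem_iff.1 (hO.mem_nhds hx)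
  let χ : ContDiffBump x := ⟨r / 2, r, by positivity, by linarith⟩
  have hsub : tsupport χ ⊆ O := by rw [χ.tsupport_eq]; exact hrO
  refine ⟨fun z => χ z • f z, ?_, ?_⟩
  · rw [← contDiffOn_univ]
    have h1 : ContDiffOn ℝ n (fun z => χ z • f z) O := χ.contDiff.contDiffOn.smul hf
    have h2 : ContDiffOn ℝ n (fun z => χ z • f z) (tsupport χ)ᶜ := by
      refine (contDiffOn_const (c := (0 : F))).congr fun z hz => ?_
      rw [image_eq_zero_of_notMem_tsupport hz, zero_smul]
    have h3 : (univ : Set E) = O ∪ (tsupport χ)ᶜ := by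
      symm
      rw [eq_univ_iff_forall]
      intro z
      by_cases hz : z ∈ tsupport χ
      · exact Or.inl (hsub hz)
      · exact Or.inr hz
    rw [h3]
    exact h1.union_of_isOpen h2 hO (isClosed_tsupport _).isOpen_compl
  · filter_upwards [χ.eventuallyEq_one] with z hz
    simp only [Pi.one_apply] at hz
    rw [hz, one_smul]

end Taylor

/-! ### The structure of a non-flat field near a zero -/

section NonFlat

variable {M : Type*} [TopologicalSpace M] [T2Space M] [ChartedSpace Plane M]
  [IsManifold (𝓡 2) ω M] {e : OpenPartialHomeomorph M Plane}
  {z₀ : Plane} {ρ : ℝ} {G : Plane → Plane} {α : Plane → ℝ → Plane} {L N : NNReal} {k : ℕ}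

/-- The j-th derivative is nonzero on the diagonal at some w. This persists for small changes of w,
which suffice to make w transverse to v; Taylor's formula along that line gives the limit. -/
theorem exists_transversal_expansion {F : Plane → Plane} {O : Set Plane} (hO : IsOpen O)
    (hz : z₀ ∈ O) {j : ℕ} (hF : ContDiffOn ℝ j F O) (h0 : ∀ i < j, iteratedFDeriv ℝ i F z₀ = 0)
    (hj : iteratedFDeriv ℝ j F z₀ ≠ 0) {v : Plane} (hv : v ≠ 0) :
    ∃ n ℓ : Plane, det2 v n ≠ 0 ∧ ℓ ≠ 0 ∧
      Tendsto (fun s : ℝ => (s ^ j)⁻¹ • F (z₀ + s • n)) (𝓝[≠] 0) (𝓝 ℓ) := by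
  obtain ⟨f, hf, hfF⟩ := exists_contDiff_germ (n := (j : ℕ∞)) hO hz (by exact_mod_cast hF)
  have hf' : ContDiff ℝ j f := by exact_mod_cast hf
  have hder : ∀ i, iteratedFDeriv ℝ i f z₀ = iteratedFDeriv ℝ i F z₀ := fun i =>
    (hfF.iteratedFDeriv ℝ i).self_of_nhds
  obtain ⟨w, hw⟩ := exists_diagonal_ne_zero hf' (x := z₀) (by rwa [hder])
  -- make `w` transverse to `v`
  obtain ⟨m, hm⟩ : ∃ m : Plane, det2 v m ≠ 0 := by
    refine ⟨!₂[-v 1, v 0], ?_⟩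
    have : det2 v !₂[-v 1, v 0] = ‖v‖ ^ 2 := by
      rw [sq_norm_plane]; simp [det2]; ring
    rw [this]
    exact pow_ne_zero 2 (norm_ne_zero_iff.2 hv)
  have hcont : Continuous fun y : Plane => iteratedFDeriv ℝ j f z₀ (fun _ => y) :=
    (iteratedFDeriv ℝ j f z₀).cont.comp (continuous_pi fun _ => continuous_id)
  have hev : ∀ᶠ ε : ℝ in 𝓝 0, iteratedFDeriv ℝ j f z₀ (fun _ => w + ε • m) ≠ 0 := by
    have : Tendsto (fun ε : ℝ => iteratedFDeriv ℝ j f z₀ (fun _ => w + ε • m)) (𝓝 0)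
        (𝓝 (iteratedFDeriv ℝ j f z₀ (fun _ => w))) := by
      have h1 : Continuous fun ε : ℝ => iteratedFDeriv ℝ j f z₀ (fun _ => w + ε • m) :=
        hcont.comp (by fun_prop)
      simpa using h1.tendsto 0
    exact this.eventually_ne hw
  have hev2 : ∀ᶠ ε : ℝ in 𝓝[≠] 0, det2 v (w + ε • m) ≠ 0 := by
    by_cases h : det2 v w = 0
    · filter_upwards [self_mem_nhdsWithin] with ε hε
      rw [det2_add_right, det2_smul_right, h, zero_add]
      exact mul_ne_zero hε hm
    · have h1 : Tendsto (fun ε : ℝ => det2 v (w + ε • m)) (𝓝 0) (𝓝 (det2 v w)) := by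
        have : Continuous fun ε : ℝ => det2 v (w + ε • m) := by fun_prop
        simpa using this.tendsto 0
      exact (h1.eventually_ne h).filter_mono nhdsWithin_le_nhds
  obtain ⟨ε, hε1, hε2⟩ := ((hev.filter_mono nhdsWithin_le_nhds).and hev2).exists
  refine ⟨w + ε • m, (j.factorial : ℝ)⁻¹ • iteratedFDeriv ℝ j f z₀ (fun _ => w + ε • m), hε2,
    smul_ne_zero (inv_ne_zero (Nat.cast_ne_zero.2 (Nat.factorial_ne_zero j))) hε1, ?_⟩
  · refine (tendsto_inv_pow_smul hf' (x := z₀) (fun i hi => by rw [hder, h0 i hi])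
      (w + ε • m)).congr' ?_
    have h1 : Tendsto (fun s : ℝ => z₀ + s • (w + ε • m)) (𝓝[≠] 0) (𝓝 z₀) := by
      have : Continuous fun s : ℝ => z₀ + s • (w + ε • m) := by fun_prop
      have h2 := this.tendsto 0
      rw [zero_smul, add_zero] at h2
      exact h2.mono_left nhdsWithin_le_nhds
    filter_upwards [h1.eventually hfF] with s hs
    rw [hs]

/-- Points near `z₀` lie on trajectories through a given transversal of the flow. -/
theorem IsFlow.exists_hitting (h : IsFlow G α L N) {n : Plane} (hn : det2 (G z₀) n ≠ 0) {δ : ℝ}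
    (hδ : 0 < δ) : ∀ᶠ z in 𝓝 z₀, ∃ t s : ℝ, |t| < δ ∧ |s| < δ ∧ α (z₀ + s • n) t = z := by
  set D := det2 (G z₀) n with hD
  have hn0 : n ≠ 0 := by
    rintro rfl
    exact hn (by simp [hD, det2])
  have hnn : 0 < ‖n‖ := norm_pos_iff.2 hn0
  have hDp : 0 < |D| := abs_pos.2 hn
  -- choice of the time scale
  obtain ⟨τ, hτ, hτδ, hτ1, hτ2⟩ : ∃ τ > 0, τ < δ ∧ L * N * τ * ‖n‖ < |D| / 4 ∧
      N * τ < δ * ‖n‖ / 2 := by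
    have h1 : ∀ᶠ τ : ℝ in 𝓝 0, τ < δ ∧ L * N * τ * ‖n‖ < |D| / 4 ∧ N * τ < δ * ‖n‖ / 2 := by
      refine (gt_mem_nhds hδ).and (Filter.Eventually.and ?_ ?_)
      · have : Continuous fun τ : ℝ => L * N * τ * ‖n‖ := by fun_prop
        exact (this.tendsto 0).eventually (gt_mem_nhds (by simpa using hDp))
      · have : Continuous fun τ : ℝ => N * τ := by fun_prop
        exact (this.tendsto 0).eventually (gt_mem_nhds (by simp; positivity))
    obtain ⟨τ, h2, h3⟩ := ((h1.filter_mono nhdsWithin_le_nhds).and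
      (self_mem_nhdsWithin (s := Ioi (0 : ℝ)))).exists
    exact ⟨τ, h3, h2⟩
  have hGc := h.lip.continuous
  have e1 : ∀ᶠ z in 𝓝 z₀, |det2 (z - z₀) n| < τ * |D| / 4 := by
    have : Continuous fun z => |det2 (z - z₀) n| := by fun_prop
    refine (this.tendsto z₀).eventually (gt_mem_nhds ?_)
    simp [det2]
    positivity
  have e2 : ∀ᶠ z in 𝓝 z₀, |det2 (G z) n - D| < |D| / 4 := by
    have : Continuous fun z => |det2 (G z) n - D| := by fun_prop
    refine (this.tendsto z₀).eventually (gt_mem_nhds ?_)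
    rw [hD, sub_self, abs_zero]
    positivity
  have e3 : ∀ᶠ z in 𝓝 z₀, ‖z - z₀‖ < δ * ‖n‖ / 2 := by
    have : Continuous fun z => ‖z - z₀‖ := by fun_prop
    refine (this.tendsto z₀).eventually (gt_mem_nhds ?_)
    simp
    positivity
  filter_upwards [e1, e2, e3] with z h1 h2 h3
  -- Zeroes of ψ are the times at which the trajectory of z meets the transversal line. For z close
  -- to z₀, ψ(t) is close to t D at t = ±τ, so it changes sign between them.
  set ψ : ℝ → ℝ := fun t => det2 (α z t - z₀) n with hψ
  have hψc : Continuous ψ := by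
    have := h.continuous z
    fun_prop
  have hest : ∀ t, |t| = τ → |ψ t - t * D| < τ * |D| := by
    intro t ht
    have e4 : ψ t - t * D = det2 (α z t - z - t • G z) n + det2 (z - z₀) n +
        t * (det2 (G z) n - D) := by
      simp only [hψ, det2_sub_left, det2_smul_left]
      ring
    rw [e4]
    have e5 : |det2 (α z t - z - t • G z) n| ≤ τ * (L * N * τ * ‖n‖) := by
      refine (abs_det2_le _ _).trans ?_
      have := h.norm_sub_smul_le z t
      rw [← sq_abs, ht] at this
      calc _ ≤ (L * N * τ ^ 2) * ‖n‖ := by gcongr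
        _ = _ := by ring
    have e6 : |t * (det2 (G z) n - D)| ≤ τ * (|D| / 4) := by
      rw [abs_mul, ht]; gcongr
    have e7 : τ * (L * N * τ * ‖n‖) < τ * (|D| / 4) := by gcongr
    have e8 := abs_add_le (det2 (α z t - z - t • G z) n + det2 (z - z₀) n)
      (t * (det2 (G z) n - D))
    have e9 := abs_add_le (det2 (α z t - z - t • G z) n) (det2 (z - z₀) n)
    nlinarith
  have hp := abs_lt.1 (hest τ (abs_of_pos hτ))
  have hm := abs_lt.1 (hest (-τ) (by rw [abs_neg, abs_of_pos hτ]))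
  obtain ⟨t, ht, ht0⟩ : ∃ t ∈ Icc (-τ) τ, ψ t = 0 := by
    rcases lt_or_gt_of_ne hn with hneg | hpos
    · rw [abs_of_neg hneg] at hp hm
      exact intermediate_value_Icc' (by linarith) hψc.continuousOn
        ⟨by nlinarith, by nlinarith⟩
    · rw [abs_of_pos hpos] at hp hm
      exact intermediate_value_Icc (by linarith) hψc.continuousOn
        ⟨by nlinarith, by nlinarith⟩
  obtain ⟨s, hs⟩ := eq_smul_of_det2_eq_zero hn0 ht0
  have htτ : |t| ≤ τ := abs_le.2 ht
  refine ⟨-t, s, by rw [abs_neg]; linarith, ?_, ?_⟩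
  · have e4 : ‖α z t - z₀‖ < δ * ‖n‖ := by
      have e5 := norm_add_le (α z t - z) (z - z₀)
      rw [sub_add_sub_cancel] at e5
      have e6 := h.norm_sub_self_le z t
      have e7 : N * |t| ≤ N * τ := by gcongr
      linarith
    rw [hs, norm_smul, Real.norm_eq_abs] at e4
    exact lt_of_mul_lt_mul_right e4 hnn.le
  · rw [← hs, add_sub_cancel, h.add_neg]

/-- Near a non-flat zero `z₀` the other zeroes lie on the trajectory of `z₀`. -/
theorem eventually_zero_mem_trajectory (hk : 1 ≤ k) {X Y : VField M k} (hT : Tracks Y X)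
    (he : e ∈ IsManifold.maximalAtlas (𝓡 2) ((k : ℕ∞ω) + 1) M)
    (h : IsChartFlow e Y z₀ ρ G α L N) (hρ : 0 < ρ) (hG : G z₀ ≠ 0) {j : ℕ} (hjk : j ≤ k)
    (h0 : ∀ i < j, iteratedFDeriv ℝ i (chartRep e X) z₀ = 0)
    (hj : iteratedFDeriv ℝ j (chartRep e X) z₀ ≠ 0) {δ : ℝ} (hδ : 0 < δ) :
    ∀ᶠ z in 𝓝 z₀, chartRep e X z = 0 → ∃ t, |t| < δ ∧ α z₀ t = z := by
  have hz₀ : z₀ ∈ e.target := h.subset (Metric.mem_closedBall_self hρ.le)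
  obtain ⟨n, ℓ, hn, hℓ, hlim⟩ := exists_transversal_expansion e.open_target hz₀
    ((contDiffOn_chartRep X he).of_le (by exact_mod_cast hjk)) h0 hj hG
  obtain ⟨r, hr, hrF⟩ := Metric.eventually_nhds_iff.1
    (eventually_nhdsWithin_iff.1 (hlim.eventually_ne hℓ))
  obtain ⟨δ', hδ', hδδ, hδr, hδρ⟩ : ∃ δ' > 0, δ' ≤ δ ∧ δ' ≤ r ∧ 2 * N * δ' + δ' * ‖n‖ < ρ := by
    refine ⟨min (min δ r) (ρ / (2 * (2 * N + ‖n‖ + 1))), by positivity,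
      (min_le_left _ _).trans (min_le_left _ _), (min_le_left _ _).trans (min_le_right _ _), ?_⟩
    set m := min (min δ r) (ρ / (2 * (2 * N + ‖n‖ + 1)))
    have h1 : m ≤ ρ / (2 * (2 * N + ‖n‖ + 1)) := min_le_right _ _
    rw [le_div_iff₀ (by positivity)] at h1
    have h2 : 0 < m := by positivity
    nlinarith [N.coe_nonneg, norm_nonneg n]
  filter_upwards [h.flow.exists_hitting hn hδ', e.open_target.mem_nhds hz₀] with z hz hzt hz0
  obtain ⟨t, s, ht, hs, rfl⟩ := hz
  have hsmall : 2 * N * |t| + ‖z₀ + s • n - z₀‖ < ρ := by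
    rw [add_sub_cancel_left, norm_smul, Real.norm_eq_abs]
    have h1 : 2 * N * |t| ≤ 2 * N * δ' := by gcongr
    have h2 : |s| * ‖n‖ ≤ δ' * ‖n‖ := by gcongr
    linarith
  -- A zero at the end of the trajectory forces a zero at its starting point on the transversal,
  -- where the expansion excludes all parameters but s = 0.
  rw [chartRep_eq_zero h.mem X hzt, hT.eq_zero_iff hk h hsmall,
    ← chartRep_eq_zero h.mem X (h.mem_target_self (small_of_small hsmall))] at hz0
  have hs0 : s = 0 := by
    by_contra hs0
    refine hrF (y := s) (by rw [Real.dist_0_eq_abs]; linarith) hs0 ?_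
    rw [hz0, smul_zero]
  refine ⟨t, by linarith, ?_⟩
  rw [hs0, zero_smul, add_zero]

/-- Near a non-flat zero the field has a limiting direction. -/
theorem exists_limit_direction (hk : 1 ≤ k) {X Y : VField M k} (hT : Tracks Y X)
    (he : e ∈ IsManifold.maximalAtlas (𝓡 2) ((k : ℕ∞ω) + 1) M)
    (h : IsChartFlow e Y z₀ ρ G α L N) (hρ : 0 < ρ) (hG : G z₀ ≠ 0) {j : ℕ} (hjk : j ≤ k)
    (hj0 : 1 ≤ j) (h0 : ∀ i < j, iteratedFDeriv ℝ i (chartRep e X) z₀ = 0)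
    (hj : iteratedFDeriv ℝ j (chartRep e X) z₀ ≠ 0) :
    ∃ ℓ : Plane, ℓ ≠ 0 ∧ ∀ η > 0, ∀ᶠ z in 𝓝 z₀,
      |det2 (chartRep e X z) ℓ| ≤ η * ‖chartRep e X z‖ := by
  set F := chartRep e X with hF
  have hz₀ : z₀ ∈ e.target := h.subset (Metric.mem_closedBall_self hρ.le)
  have hF0 : F z₀ = 0 := by
    have := h0 0 (by omega)
    have h1 := DFunLike.congr_fun this (fun _ => 0)
    simpa using h1
  obtain ⟨n, ℓ, hn, hℓ, hlim⟩ := exists_transversal_expansion e.open_target hz₀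
    ((contDiffOn_chartRep X he).of_le (by exact_mod_cast hjk)) h0 hj hG
  -- A point near z₀ is reached in short time t from z₀ + s n. There s^(-j) X is close to ℓ, and the
  -- flow turns the direction by at most a constant times |t|. The bound 1 in η' only serves to keep
  -- the rescaled vector below ‖ℓ‖ + 1.
  refine ⟨ℓ, hℓ, fun η hη => ?_⟩
  set C := L * Real.exp (L * 1) ^ 2 with hC
  have hC0 : 0 ≤ C := by positivity
  set η' := min 1 (η / 2) with hη'
  have hη'0 : 0 < η' := by positivity
  obtain ⟨r, hr, hrF⟩ := Metric.eventually_nhds_iff.1 (eventually_nhdsWithin_iff.1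
    (hlim (Metric.ball_mem_nhds _ hη'0)))
  obtain ⟨δ', hδ', hδ1, hδr, hδρ, hδη⟩ : ∃ δ' > 0, δ' ≤ 1 ∧ δ' ≤ r ∧
      2 * N * δ' + δ' * ‖n‖ < ρ ∧ C * δ' * (‖ℓ‖ + 1) ≤ η / 2 := by
    have h1 : ∀ᶠ d : ℝ in 𝓝 0, d < 1 ∧ d < r ∧ 2 * N * d + d * ‖n‖ < ρ ∧
        C * d * (‖ℓ‖ + 1) < η / 2 := by
      refine (gt_mem_nhds one_pos).and ((gt_mem_nhds hr).and (Filter.Eventually.and ?_ ?_))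
      · have : Continuous fun d : ℝ => 2 * N * d + d * ‖n‖ := by fun_prop
        exact (this.tendsto 0).eventually (gt_mem_nhds (by simpa using hρ))
      · have : Continuous fun d : ℝ => C * d * (‖ℓ‖ + 1) := by fun_prop
        exact (this.tendsto 0).eventually (gt_mem_nhds (by simpa using hη))
    obtain ⟨d, h2, h3⟩ := ((h1.filter_mono nhdsWithin_le_nhds).and
      (self_mem_nhdsWithin (s := Ioi (0 : ℝ)))).exists
    exact ⟨d, h3, h2.1.le, h2.2.1.le, h2.2.2.1, h2.2.2.2.le⟩
  filter_upwards [h.flow.exists_hitting hn hδ', e.open_target.mem_nhds hz₀] with z hz hzt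
  obtain ⟨t, s, ht, hs, rfl⟩ := hz
  have hsmall : 2 * N * |t| + ‖z₀ + s • n - z₀‖ < ρ := by
    rw [add_sub_cancel_left, norm_smul, Real.norm_eq_abs]
    have h1 : 2 * N * |t| ≤ 2 * N * δ' := by gcongr
    have h2 : |s| * ‖n‖ ≤ δ' * ‖n‖ := by gcongr
    linarith
  by_cases hs0 : s = 0
  · have : F (α (z₀ + s • n) t) = 0 := by
      rw [hs0] at hsmall hzt ⊢
      rw [hF, chartRep_eq_zero h.mem X hzt, hT.eq_zero_iff hk h hsmall,
        ← chartRep_eq_zero h.mem X (h.mem_target_self (small_of_small hsmall)), zero_smul,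
        add_zero]
      exact hF0
    rw [this]; simp [det2]
  set x := z₀ + s • n with hx
  set v := (s ^ j)⁻¹ • F x with hv
  have hvℓ : ‖ℓ - v‖ < η' := by
    have := hrF (y := s) (by rw [Real.dist_0_eq_abs]; linarith) hs0
    rwa [mem_ball_iff_norm, norm_sub_rev] at this
  have hvn : ‖v‖ ≤ ‖ℓ‖ + 1 := by
    have := norm_sub_norm_le v ℓ
    rw [norm_sub_rev] at this
    linarith [min_le_left 1 (η / 2)]
  have hT2 := abs_det2_flow_le hk hT he h (small_of_small hsmall)
  have h1 : |det2 (F (α x t)) v| ≤ C * δ' * (‖ℓ‖ + 1) * ‖F (α x t)‖ := by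
    rw [hv, det2_smul_right, det2_swap, abs_mul, abs_neg]
    have hvn' := hvn
    rw [hv, norm_smul, Real.norm_eq_abs] at hvn'
    have hexp : Real.exp (L * |t|) ≤ Real.exp (L * 1) := by
      gcongr; linarith
    calc |(s ^ j)⁻¹| * |det2 (F x) (F (α x t))|
        ≤ |(s ^ j)⁻¹| * (L * Real.exp (L * |t|) ^ 2 * |t| * (‖F x‖ * ‖F (α x t)‖)) := by gcongr
      _ ≤ |(s ^ j)⁻¹| * (C * δ' * (‖F x‖ * ‖F (α x t)‖)) := by
          rw [hC]; gcongr
      _ = C * δ' * (|(s ^ j)⁻¹| * ‖F x‖) * ‖F (α x t)‖ := by ring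
      _ ≤ _ := by gcongr
  have h2 : |det2 (F (α x t)) (ℓ - v)| ≤ η / 2 * ‖F (α x t)‖ := by
    refine (abs_det2_le _ _).trans ?_
    rw [mul_comm]
    gcongr
    exact hvℓ.le.trans (min_le_right _ _)
  have h3 : det2 (F (α x t)) ℓ = det2 (F (α x t)) v + det2 (F (α x t)) (ℓ - v) := by
    rw [← det2_add_right, add_sub_cancel]
  rw [h3]
  have h4 : C * δ' * (‖ℓ‖ + 1) * ‖F (α x t)‖ ≤ η / 2 * ‖F (α x t)‖ := by gcongr
  have := abs_add_le (det2 (F (α x t)) v) (det2 (F (α x t)) (ℓ - v))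
  linarith

end NonFlat

/-! ### Smooth cutoff functions -/

section Cutoff

variable {M : Type*} [TopologicalSpace M] [T2Space M] [ChartedSpace Plane M]
  [IsManifold (𝓡 2) ω M]

instance : IsManifold (𝓡 2) ∞ M := IsManifold.of_le (n := ω) le_top

theorem exists_smooth_cutoff {P O : Set M} (hP : IsCompact P) (hO : IsOpen O) (hPO : P ⊆ O) :
    ∃ χ : M → ℝ, ContMDiff (𝓡 2) 𝓘(ℝ, ℝ) ∞ χ ∧ (∃ V, IsOpen V ∧ P ⊆ V ∧ ∀ x ∈ V, χ x = 1) ∧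
      HasCompactSupport χ ∧ tsupport χ ⊆ O ∧ ∀ x, χ x ∈ Icc (0 : ℝ) 1 := by
  have h1 : ∀ x : P, ∃ f : SmoothBumpFunction (𝓡 2) (x : M), tsupport f ⊆ O := fun x => by
    obtain ⟨f, -, hf⟩ := (SmoothBumpFunction.nhds_basis_tsupport (I := 𝓡 2) (x : M)).mem_iff.1
      (hO.mem_nhds (hPO x.2))
    exact ⟨f, hf⟩
  choose f hf using h1
  have h2 : ∀ x : P, {y | f x y = 1} ∈ 𝓝 (x : M) := fun x => (f x).eventuallyEq_one
  obtain ⟨t, ht⟩ := hP.elim_nhds_subcover' (fun x hx => interior {y | f ⟨x, hx⟩ y = 1})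
    fun x hx => interior_mem_nhds.2 (h2 ⟨x, hx⟩)
  let σ : M → ℝ := fun y => ∑ x ∈ t, f x y
  have hσ : ContMDiff (𝓡 2) 𝓘(ℝ, ℝ) ∞ σ := by
    refine contMDiff_finsetSum fun x _ => ?_
    exact (f x).contMDiff
  have hσ0 : ∀ y, 0 ≤ σ y := fun y => Finset.sum_nonneg fun x _ => (f x).nonneg
  have hsupp : Function.support (fun y => Real.smoothTransition (σ y)) ⊆ ⋃ x ∈ t, tsupport (f x) := by
    intro y hy
    by_contra hn
    simp only [mem_iUnion, not_exists] at hn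
    refine hy ?_
    have : σ y = 0 := Finset.sum_eq_zero fun x hx => image_eq_zero_of_notMem_tsupport (hn x hx)
    simp only [this, Real.smoothTransition.zero]
  have hcl : IsCompact (⋃ x ∈ t, tsupport (f x)) :=
    t.isCompact_biUnion fun x _ => (f x).hasCompactSupport
  have hts := closure_minimal hsupp hcl.isClosed
  refine ⟨fun y => Real.smoothTransition (σ y), ?_, ⟨⋃ x ∈ t, interior {y | f x y = 1}, ?_, ?_, ?_⟩,
    hcl.of_isClosed_subset (isClosed_tsupport _) hts, hts.trans (iUnion₂_subset fun x _ => hf x),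
    fun x => ⟨Real.smoothTransition.nonneg _, Real.smoothTransition.le_one _⟩⟩
  · exact (Real.smoothTransition.contDiff (n := ⊤)).contMDiff.comp hσ
  · exact isOpen_biUnion fun x _ => isOpen_interior
  · exact ht
  · intro y hy
    simp only [mem_iUnion] at hy
    obtain ⟨x, hx, hy⟩ := hy
    refine Real.smoothTransition.one_of_one_le ?_
    have h3 : f x y = 1 := interior_subset (s := {y | f x y = 1}) hy
    rw [← h3]
    exact Finset.single_le_sum (f := fun x => f x y) (fun x _ => (f x).nonneg) hx

end Cutoff

/-! ### Global integral curves in compact invariant sets -/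

section Curves

variable {M : Type*} [TopologicalSpace M] [T2Space M] [ChartedSpace Plane M]
  [IsManifold (𝓡 2) ω M] {k : ℕ}

theorem exists_uniform_time (hk : 1 ≤ k) (Y : VField M k) {C : Set M} (hC : IsCompact C) :
    ∃ ε > 0, ∀ x ∈ C, ∃ γ : ℝ → M, γ 0 = x ∧ IsMIntegralCurveOn γ Y (Ioo (-ε) ε) := by
  refine hC.induction_on (p := fun s => ∃ ε > 0, ∀ x ∈ s, ∃ γ : ℝ → M, γ 0 = x ∧
    IsMIntegralCurveOn γ Y (Ioo (-ε) ε)) ⟨1, one_pos, by simp⟩ ?_ ?_ ?_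
  · rintro s t hst ⟨ε, hε, h⟩
    exact ⟨ε, hε, fun x hx => h x (hst hx)⟩
  · rintro s t ⟨ε, hε, h⟩ ⟨ε', hε', h'⟩
    refine ⟨min ε ε', lt_min hε hε', fun x hx => ?_⟩
    rcases hx with hx | hx
    · obtain ⟨γ, h0, hγ⟩ := h x hx
      exact ⟨γ, h0, hγ.mono (Ioo_subset_Ioo (neg_le_neg (min_le_left _ _)) (min_le_left _ _))⟩
    · obtain ⟨γ, h0, hγ⟩ := h' x hx
      exact ⟨γ, h0, hγ.mono (Ioo_subset_Ioo (neg_le_neg (min_le_right _ _)) (min_le_right _ _))⟩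
  · intro p _
    have hps := mem_chart_source Plane p
    obtain ⟨ρ, hρ, G, α, L, N, h⟩ := exists_isChartFlow hk Y
      (chartAt_mem_maximalAtlas ((k : ℕ∞ω) + 1) p) (mem_chart_target Plane p)
    set e := chartAt Plane p
    have hN := N.coe_nonneg
    have hT : 0 < ρ / (2 * (N + 1)) := by positivity
    have hV : ∀ᶠ q in 𝓝 p, ‖e q - e p‖ < ρ / 2 := by
      have := (e.continuousAt hps).eventually (Metric.ball_mem_nhds (e p) (half_pos hρ))
      filter_upwards [this] with q hq
      rwa [← mem_ball_iff_norm]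
    refine ⟨_, mem_nhdsWithin_of_mem_nhds (inter_mem hV (e.open_source.mem_nhds hps)), _, hT, ?_⟩
    rintro x ⟨hx, hxs⟩
    refine ⟨fun t => e.symm (α (e x) t), by simp only [h.flow.zero, e.left_inv hxs],
      h.isMIntegralCurveOn ?_⟩
    have : (N : ℝ) * (ρ / (2 * (N + 1))) ≤ ρ / 2 := by
      rw [mul_div_assoc', div_le_div_iff₀ (by positivity) (by positivity)]
      nlinarith
    have hx' : ‖e x - e p‖ < ρ / 2 := hx
    linarith

theorem exists_isMIntegralCurve_of_compact_support (hk : 1 ≤ k) (Y : VField M k) {C : Set M}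
    (hC : IsCompact C) (h0 : ∀ x ∉ C, Y x = 0) (x : M) :
    ∃ γ : ℝ → M, γ 0 = x ∧ IsMIntegralCurve γ Y := by
  obtain ⟨ε, hε, h⟩ := exists_uniform_time hk Y hC
  refine exists_isMIntegralCurve_of_isMIntegralCurveOn (I := 𝓡 2) (Y.contMDiff_one hk) hε
    (fun x => ?_) x
  by_cases hx : x ∈ C
  · exact h x hx
  · exact ⟨fun _ => x, rfl, (isMIntegralCurve_const (I := 𝓡 2) (v := Y)
      (h0 x hx)).isMIntegralCurveOn _⟩

/-- Multiplied by a cutoff equal to 1 near K, the field becomes complete. The times at which its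
curve lies in K form a closed set, and an open one by local invariance; on K the two fields agree.
-/
theorem exists_isMIntegralCurve_mem (hk : 1 ≤ k) (Y : VField M k) {K : Set M} (hK : IsCompact K)
    (hloc : ∀ p ∈ K, ∃ T > 0, ∃ β : ℝ → M, β 0 = p ∧ IsMIntegralCurveOn β Y (Ioo (-T) T) ∧
      ∀ t ∈ Ioo (-T) T, β t ∈ K) {p : M} (hp : p ∈ K) :
    ∃ γ : ℝ → M, γ 0 = p ∧ IsMIntegralCurve γ Y ∧ ∀ t, γ t ∈ K := by
  obtain ⟨χ, hχ, ⟨V, -, hKV, hV⟩, hcs, -, -⟩ := exists_smooth_cutoff hK isOpen_univ (subset_univ K)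
  let Y' := Y.mulFun (hχ.of_le (by exact_mod_cast le_top) : ContMDiff (𝓡 2) 𝓘(ℝ, ℝ) k χ)
  have hYY : ∀ q ∈ K, Y' q = Y q := fun q hq => by
    rw [VField.mulFun_apply, hV q (hKV hq), one_smul]
  obtain ⟨γ, hγ0, hγ⟩ := exists_isMIntegralCurve_of_compact_support hk Y' hcs (fun x hx => by
    rw [VField.mulFun_apply, image_eq_zero_of_notMem_tsupport hx, zero_smul]) p
  have hcont : Continuous γ := hγ.continuous
  have hall : ∀ t, γ t ∈ K := by
    have hclosed : IsClosed (γ ⁻¹' K) := hK.isClosed.preimage hcont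
    have hopen : IsOpen (γ ⁻¹' K) := by
      rw [isOpen_iff_mem_nhds]
      intro t ht
      obtain ⟨T, hT, β, hβ0, hβ, hβK⟩ := hloc (γ t) ht
      have hβ' : IsMIntegralCurveOn β Y' (Ioo (-T) T) := fun s hs => by
        have := hβ s hs
        rwa [← hYY _ (hβK s hs)] at this
      have h1 : ∀ s ∈ Ioo (-T) T, γ (s + t) = β s := fun s hs =>
        eq_of_isMIntegralCurveOn hk Y' ((hγ.comp_add t).isMIntegralCurveOn (Ioo (-T) T)) hβ'
          ⟨by linarith, hT⟩ ⟨by linarith, hT⟩ (by simp [hβ0]) hs hs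
      filter_upwards [Ioo_mem_nhds (show t - T < t by linarith) (show t < t + T by linarith)]
        with u hu
      have h2 := h1 (u - t) ⟨by linarith [hu.1], by linarith [hu.2]⟩
      rw [sub_add_cancel] at h2
      rw [mem_preimage, h2]
      exact hβK _ ⟨by linarith [hu.1], by linarith [hu.2]⟩
    have := IsClopen.eq_univ ⟨hclosed, hopen⟩ ⟨0, by rwa [mem_preimage, hγ0]⟩
    exact fun t => (this ▸ mem_univ t : t ∈ γ ⁻¹' K)
  refine ⟨γ, hγ0, fun t => ?_, hall⟩
  have := hγ t
  rwa [hYY _ (hall t)] at this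

theorem IsMIntegralCurve.eq_comp_add (hk : 1 ≤ k) (Y : VField M k) {γ γ' : ℝ → M}
    (hγ : IsMIntegralCurve γ Y) (hγ' : IsMIntegralCurve γ' Y) {s t : ℝ} (h : γ s = γ' t) (u : ℝ) :
    γ u = γ' (u + (t - s)) := by
  have h1 := isMIntegralCurve_Ioo_eq_of_contMDiff_boundaryless (I := 𝓡 2) (v := Y) (t₀ := s)
    (Y.contMDiff_one hk) hγ (hγ'.comp_add (t - s)) (by simp [h])
  exact congrFun h1 u

theorem IsMIntegralCurve.flowRel_iff (hk : 1 ≤ k) (Y : VField M k) {γ : ℝ → M}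
    (hγ : IsMIntegralCurve γ Y) {s t : ℝ} {q : M} : FlowRel Y t (γ s) q ↔ γ (s + t) = q := by
  have h1 : FlowRel Y t (γ s) (γ (s + t)) := by
    refine ⟨fun u => γ (u + s), -(|t| + 1), |t| + 1, ⟨?_, ?_⟩, ⟨?_, ?_⟩,
      (hγ.comp_add s).isMIntegralCurveOn _, by simp, by simp [add_comm]⟩ <;>
    linarith [abs_nonneg t, neg_abs_le t, le_abs_self t]
  exact ⟨fun h => h1.unique hk h, fun h => h ▸ h1⟩

end Curves

/-! ### Tracked blocks -/

section Tracked

variable {M : Type*} [TopologicalSpace M] [T2Space M] [ChartedSpace Plane M]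
  [IsManifold (𝓡 2) ω M] {k : ℕ}

theorem exists_order_chart (hk : 1 ≤ k) (X Y : VField M k) {p : M} (hf : ¬ IsFlat k X p)
    (hY : Y p ≠ 0) : ∃ e ∈ IsManifold.maximalAtlas (𝓡 2) ((k : ℕ∞ω) + 1) M, p ∈ e.source ∧
      ∃ (j : ℕ) (ρ : ℝ) (G : Plane → Plane) (α : Plane → ℝ → Plane) (L N : NNReal),
        IsChartFlow e Y (e p) ρ G α L N ∧ 0 < ρ ∧ G (e p) ≠ 0 ∧ 1 ≤ j ∧ j ≤ k ∧
        (∀ i < j, iteratedFDeriv ℝ i (chartRep e X) (e p) = 0) ∧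
        iteratedFDeriv ℝ j (chartRep e X) (e p) ≠ 0 := by
  obtain ⟨j, hj1, hjk, e, he, hp, h0, hj⟩ := not_not.1 hf
  obtain ⟨ρ, hρ, G, α, L, N, h⟩ := exists_isChartFlow hk Y he (e.map_source hp)
  refine ⟨e, he, hp, j, ρ, G, α, L, N, h, hρ, ?_, hj1, hjk, h0, hj⟩
  rw [h.eq (Metric.mem_closedBall_self hρ.le)]
  exact fun h0 => hY ((chartRep_apply_eq_zero h.mem Y hp).1 h0)

theorem Tracks.eventually_flowRel (hk : 1 ≤ k) {X Y : VField M k} (hT : Tracks Y X) {p : M}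
    (hf : ¬ IsFlat k X p) (hY : Y p ≠ 0) {δ : ℝ} (hδ : 0 < δ) :
    ∀ᶠ q in 𝓝 p, X q = 0 → ∃ t, |t| < δ ∧ FlowRel Y t p q := by
  obtain ⟨e, he, hp, j, ρ, G, α, L, N, h, hρ, hG, -, hjk, h0, hj⟩ := exists_order_chart hk X Y hf hY
  have hN := N.coe_nonneg
  have hδ' : 0 < min δ (ρ / (N + 1)) := lt_min hδ (by positivity)
  have h1 := eventually_zero_mem_trajectory hk hT he h hρ hG hjk h0 hj hδ'
  filter_upwards [(e.continuousAt hp).eventually h1, e.open_source.mem_nhds hp] with q hq hqs hXq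
  obtain ⟨t, ht, hαt⟩ := hq ((chartRep_apply_eq_zero h.mem X hqs).2 hXq)
  refine ⟨t, ht.trans_le (min_le_left _ _), ?_⟩
  have h2 : N * |t| + ‖e p - e p‖ < ρ := by
    have h3 := ht.trans_le (min_le_right _ _)
    rw [lt_div_iff₀ (by positivity)] at h3
    simp only [sub_self, norm_zero, add_zero]
    nlinarith [abs_nonneg t]
  have := h.flowRel h2
  rwa [hαt, e.left_inv hp, e.left_inv hqs] at this

theorem Tracks.exists_curve_zero (hk : 1 ≤ k) {X Y : VField M k} (hT : Tracks Y X) {p : M}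
    (h0 : X p = 0) : ∃ T > 0, ∃ β : ℝ → M, β 0 = p ∧ IsMIntegralCurveOn β Y (Ioo (-T) T) ∧
      ∀ t ∈ Ioo (-T) T, X (β t) = 0 := by
  have hps := mem_chart_source Plane p
  obtain ⟨ρ, hρ, G, α, L, N, h⟩ := exists_isChartFlow hk Y
    (chartAt_mem_maximalAtlas ((k : ℕ∞ω) + 1) p) (mem_chart_target Plane p)
  set e := chartAt Plane p
  have hN := N.coe_nonneg
  have hT0 : 0 < ρ / (2 * (N + 1)) := by positivity
  have hTρ : N * (ρ / (2 * (N + 1))) + ‖e p - e p‖ < ρ := by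
    have : (N : ℝ) * (ρ / (2 * (N + 1))) ≤ ρ / 2 := by
      rw [mul_div_assoc', div_le_div_iff₀ (by positivity) (by positivity)]
      nlinarith
    simp only [sub_self, norm_zero, add_zero]
    linarith
  refine ⟨_, hT0, fun t => e.symm (α (e p) t), by simp only [h.flow.zero, e.left_inv hps],
    h.isMIntegralCurveOn hTρ, fun t ht => hT.eq_zero_of_eq_zero hk h (lt_of_le_of_lt ?_ hTρ)
      (by rw [e.left_inv hps]; exact h0)⟩
  gcongr
  exact (abs_lt.2 ht).le

/-- The hypotheses on a block `K` of zeroes of `X` and an isolating neighbourhood `U`. -/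
structure IsTracked (X Y : VField M k) (K U : Set M) : Prop where
  one_le : 1 ≤ k
  not_flat : ∀ p ∈ K, ¬ IsFlat k X p
  tracks : Tracks Y X
  ne_zero : ∀ p ∈ K, Y p ≠ 0
  isCompact : IsCompact K
  isolating : IsIsolating X K U

/-- The part of a preconnected subset of `K` in a relatively clopen subset of `K`. -/
theorem subset_of_relatively_clopen {A : Type*} [TopologicalSpace A] {C K S : Set A}
    (hC : IsPreconnected C) (hCK : C ⊆ K) (h1 : ∀ q ∈ S, ∀ᶠ q' in 𝓝 q, q' ∈ K → q' ∈ S)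
    (h2 : ∀ q ∈ K, q ∉ S → ∀ᶠ q' in 𝓝 q, q' ∈ K → q' ∉ S) {p : A} (hpC : p ∈ C) (hpS : p ∈ S) :
    C ⊆ S := by
  have hu : ∀ T : Set A, IsOpen {q | ∀ᶠ q' in 𝓝 q, q' ∈ K → q' ∈ T} := fun T =>
    isOpen_iff_mem_nhds.2 fun q hq => eventually_eventually_nhds.2 hq
  have hmem : ∀ (T : Set A) {q}, q ∈ C → (∀ᶠ q' in 𝓝 q, q' ∈ K → q' ∈ T) → q ∈ T :=
    fun T q hq h => h.self_of_nhds (hCK hq)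
  have h3 : C ⊆ {q | ∀ᶠ q' in 𝓝 q, q' ∈ K → q' ∈ S} ∪ {q | ∀ᶠ q' in 𝓝 q, q' ∈ K → q' ∈ Sᶜ} := by
    intro q hq
    by_cases hqS : q ∈ S
    · exact Or.inl (h1 q hqS)
    · exact Or.inr (h2 q (hCK hq) hqS)
  rcases isPreconnected_iff_subset_of_disjoint.1 hC _ _ (hu S) (hu Sᶜ) h3 (by
    ext q
    simp only [mem_inter_iff, mem_empty_iff_false, iff_false, not_and]
    exact fun hq h3 h4 => hmem Sᶜ hq h4 (hmem S hq h3)) with h | h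
  · exact fun q hq => hmem S hq (h hq)
  · exact absurd hpS (hmem Sᶜ hpC (h hpC))

/-! ### The components of a tracked block are periodic orbits. -/

namespace IsTracked

variable {X Y : VField M k} {K U : Set M}

theorem subset (h : IsTracked X Y K U) : K ⊆ U := h.isolating.2.2.1

theorem mem_iff (h : IsTracked X Y K U) {p : M} (hp : p ∈ U) : p ∈ K ↔ X p = 0 := by
  rw [← h.isolating.2.2.2]
  exact ⟨fun h => h.1, fun h => ⟨h, subset_closure hp⟩⟩

theorem eq_zero (h : IsTracked X Y K U) {p : M} (hp : p ∈ K) : X p = 0 :=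
  (h.mem_iff (h.subset hp)).1 hp

theorem mem_nhds (h : IsTracked X Y K U) {p : M} (hp : p ∈ K) : U ∈ 𝓝 p :=
  h.isolating.1.mem_nhds (h.subset hp)

/-- Starting in K, the trajectory consists of zeroes of X and remains in U for a short time, so it
remains in K; compactness then gives all times. -/
theorem exists_curve (h : IsTracked X Y K U) {p : M} (hp : p ∈ K) :
    ∃ γ : ℝ → M, γ 0 = p ∧ IsMIntegralCurve γ Y ∧ ∀ t, γ t ∈ K := by
  refine exists_isMIntegralCurve_mem h.one_le Y h.isCompact (fun p hp => ?_) hp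
  obtain ⟨T, hT, β, h0, hβ, hβ0⟩ := h.tracks.exists_curve_zero h.one_le (h.eq_zero hp)
  have hc : ContinuousAt β 0 := (hβ.continuousOn).continuousAt
    (Ioo_mem_nhds (by linarith) hT)
  obtain ⟨T', hT', hs⟩ := Metric.mem_nhds_iff.1 (hc (h0 ▸ h.mem_nhds hp))
  refine ⟨min T T', lt_min hT hT', β, h0, hβ.mono (Ioo_subset_Ioo (neg_le_neg (min_le_left _ _))
    (min_le_left _ _)), fun t ht => ?_⟩
  have ht' := abs_lt.2 ht
  have htT := abs_lt.1 (ht'.trans_le (min_le_left _ _))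
  refine (h.mem_iff (hs ?_)).2 (hβ0 t htT)
  rw [mem_ball_zero_iff, Real.norm_eq_abs]
  exact ht'.trans_le (min_le_right _ _)

theorem eventually_mem_curve (h : IsTracked X Y K U) {γ : ℝ → M} (hγ : IsMIntegralCurve γ Y)
    (hγK : ∀ t, γ t ∈ K) (t₀ : ℝ) {δ : ℝ} (hδ : 0 < δ) :
    ∀ᶠ q in 𝓝 (γ t₀), q ∈ K → ∃ t, |t - t₀| < δ ∧ γ t = q := by
  filter_upwards [h.tracks.eventually_flowRel h.one_le (h.not_flat _ (hγK t₀))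
    (h.ne_zero _ (hγK t₀)) hδ] with q hq hqK
  obtain ⟨t, ht, hf⟩ := hq (h.eq_zero hqK)
  exact ⟨t₀ + t, by simpa using ht, (IsMIntegralCurve.flowRel_iff h.one_le Y hγ).1 hf⟩

/-- A trajectory is relatively open in K, since zeroes near one of its points lie on it. Distinct
trajectories are disjoint, so it is also relatively closed, and it is connected. -/
theorem connectedComponentIn_eq (h : IsTracked X Y K U) {γ : ℝ → M} (hγ : IsMIntegralCurve γ Y)
    (hγK : ∀ t, γ t ∈ K) {p : M} (hp : p ∈ range γ) : connectedComponentIn K p = range γ := by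
  have hpK : p ∈ K := by obtain ⟨t, rfl⟩ := hp; exact hγK t
  refine Subset.antisymm ?_ ((isPreconnected_range hγ.continuous).subset_connectedComponentIn hp
    (range_subset_iff.2 hγK))
  refine subset_of_relatively_clopen isPreconnected_connectedComponentIn
    (connectedComponentIn_subset K p) ?_ ?_ (mem_connectedComponentIn hpK) hp
  · rintro _ ⟨t, rfl⟩
    filter_upwards [h.eventually_mem_curve hγ hγK t one_pos] with q hq hqK
    obtain ⟨s, -, hs⟩ := hq hqK
    exact ⟨s, hs⟩
  · intro q hqK hq
    obtain ⟨β, rfl, hβ, hβK⟩ := h.exists_curve hqK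
    filter_upwards [h.eventually_mem_curve hβ hβK 0 one_pos] with q hq' hqK
    obtain ⟨s, -, rfl⟩ := hq' hqK
    rintro ⟨t, ht⟩
    exact hq ⟨_, (IsMIntegralCurve.eq_comp_add h.one_le Y hβ hγ ht.symm 0).symm⟩

theorem eventually_mem_connectedComponentIn (h : IsTracked X Y K U) {p : M} (hp : p ∈ K) :
    ∀ᶠ q in 𝓝 p, q ∈ K → q ∈ connectedComponentIn K p := by
  obtain ⟨γ, rfl, hγ, hγK⟩ := h.exists_curve hp
  rw [h.connectedComponentIn_eq hγ hγK ⟨0, rfl⟩]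
  filter_upwards [h.eventually_mem_curve hγ hγK 0 one_pos] with q hq hqK
  obtain ⟨s, -, hs⟩ := hq hqK
  exact ⟨s, hs⟩

theorem isCompact_connectedComponentIn (h : IsTracked X Y K U) (p : M) :
    IsCompact (connectedComponentIn K p) := by
  refine h.isCompact.of_isClosed_subset ?_ (connectedComponentIn_subset K p)
  rw [← isOpen_compl_iff, isOpen_iff_mem_nhds]
  intro q hq
  by_cases hqK : q ∈ K
  · filter_upwards [h.eventually_mem_connectedComponentIn hqK] with q' hq' hmem
    have h1 := _root_.connectedComponentIn_eq (hq' (connectedComponentIn_subset K p hmem))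
    have h2 := _root_.connectedComponentIn_eq hmem
    exact hq (h2 ▸ h1 ▸ mem_connectedComponentIn hqK)
  · filter_upwards [h.isCompact.isClosed.isOpen_compl.mem_nhds hqK] with q' hq' hmem
    exact hq' (connectedComponentIn_subset K p hmem)

theorem finite_components (h : IsTracked X Y K U) :
    {L : Set M | ∃ p ∈ K, L = connectedComponentIn K p}.Finite := by
  obtain ⟨t, htK, ht⟩ := h.isCompact.elim_nhds_subcover
    (fun p => {q | q ∈ K → q ∈ connectedComponentIn K p})
    (fun p hp => h.eventually_mem_connectedComponentIn hp)
  refine (t.finite_toSet.image (connectedComponentIn K)).subset ?_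
  rintro _ ⟨p, hp, rfl⟩
  obtain ⟨q, hq, hpq⟩ := mem_iUnion₂.1 (ht hp)
  exact ⟨q, hq, (_root_.connectedComponentIn_eq (hpq hp))⟩

/-- A nonconstant integral curve is locally injective. -/
theorem eventually_ne_curve (h : IsTracked X Y K U) {γ : ℝ → M} (hγ : IsMIntegralCurve γ Y)
    (hγK : ∀ t, γ t ∈ K) (t₀ : ℝ) : ∀ᶠ t in 𝓝[≠] t₀, γ t ≠ γ t₀ := by
  have hs := mem_chart_source Plane (γ t₀)
  have he := chartAt_mem_maximalAtlas (M := M) 1 (γ t₀)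
  have h1 := hasDerivAt_chart he isOpen_univ (hγ.isMIntegralCurveOn univ) (mem_univ t₀) hs
  have h2 := h1.eventually_ne (c := chartAt Plane (γ t₀) (γ t₀)) fun h0 =>
    h.ne_zero _ (hγK t₀) ((chartRep_apply_eq_zero he Y hs).1 h0)
  filter_upwards [h2] with t ht heq
  exact ht (by rw [heq])

/-- Finitely many neighbourhoods cover the compact trajectory, and each meets K only in points
visited near one fixed time. So the point visited at a time beyond all of these was already visited
earlier, which gives a period. Local injectivity bounds the periods below. -/
theorem exists_min_period (h : IsTracked X Y K U) {γ : ℝ → M} (hγ : IsMIntegralCurve γ Y)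
    (hγK : ∀ t, γ t ∈ K) :
    ∃ T, 0 < T ∧ Function.Periodic γ T ∧ InjOn γ (Ico 0 T) := by
  have hper : ∀ s t, γ s = γ t → Function.Periodic γ (s - t) := fun s t hst =>
    IsMIntegralCurve.periodic_of_eq hγ (Y.contMDiff_one h.one_le) hst
  have hcl : IsCompact (range γ) := by
    rw [← h.connectedComponentIn_eq hγ hγK ⟨0, rfl⟩]
    exact h.isCompact_connectedComponentIn (γ 0)
  have hex : ∃ T, 0 < T ∧ γ T = γ 0 := by
    obtain ⟨t, ht⟩ := hcl.elim_nhds_subcover' (fun q hq => {q' | q' ∈ K → ∃ t,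
      |t - (mem_range.1 hq).choose| < 1 ∧ γ t = q'}) (fun q hq => by
        have := h.eventually_mem_curve hγ hγK (mem_range.1 hq).choose one_pos
        rwa [(mem_range.1 hq).choose_spec] at this)
    obtain ⟨B, hB⟩ := (t.finite_toSet.image fun q => (mem_range.1 q.2).choose).bddAbove
    obtain ⟨q, hq, h3⟩ := mem_iUnion₂.1 (ht ⟨B + 1, rfl⟩)
    obtain ⟨s, hs, hsB⟩ := h3 (hγK _)
    have h4 : (mem_range.1 q.2).choose ≤ B := hB ⟨q, hq, rfl⟩
    have h5 : s < B + 1 := by linarith [(abs_lt.1 hs).2]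
    refine ⟨B + 1 - s, by linarith, ?_⟩
    have := hper _ _ hsB.symm 0
    simpa using this
  obtain ⟨δ, hδ, hδne⟩ : ∃ δ > 0, ∀ t, 0 < t → t < δ → γ t ≠ γ 0 := by
    have := h.eventually_ne_curve hγ hγK 0
    rw [eventually_nhdsWithin_iff, Metric.eventually_nhds_iff] at this
    obtain ⟨δ, hδ, h1⟩ := this
    refine ⟨δ, hδ, fun t ht htδ => h1 ?_ ht.ne'⟩
    rwa [Real.dist_0_eq_abs, abs_of_pos ht]
  -- There are no returns in (0, δ), so starting at δ loses nothing, and it makes the set closed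
  -- with a positive infimum.
  let S : Set ℝ := {t | δ ≤ t ∧ γ t = γ 0}
  have hSc : IsClosed S := (isClosed_Ici.inter (isClosed_eq hγ.continuous continuous_const))
  have hSn : S.Nonempty := by
    obtain ⟨T, hT, hT0⟩ := hex
    exact ⟨T, not_lt.1 fun hlt => hδne T hT hlt hT0, hT0⟩
  have hSb : BddBelow S := ⟨δ, fun t ht => ht.1⟩
  obtain ⟨hT1, hT2⟩ := hSc.csInf_mem hSn hSb
  refine ⟨sInf S, hδ.trans_le hT1, by simpa using hper _ _ hT2, ?_⟩
  have hmin : ∀ s t, s ∈ Ico 0 (sInf S) → t ∈ Ico 0 (sInf S) → s < t → γ s ≠ γ t := by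
    intro s t hs ht hst heq
    have h0 : γ (t - s) = γ 0 := by simpa using hper _ _ heq.symm 0
    have h1 : δ ≤ t - s := not_lt.1 fun hlt => hδne _ (sub_pos.2 hst) hlt h0
    have := csInf_le hSb (show t - s ∈ S from ⟨h1, h0⟩)
    linarith [hs.1, ht.2]
  intro s hs t ht heq
  rcases lt_trichotomy s t with hlt | rfl | hlt
  · exact absurd heq (hmin s t hs ht hlt)
  · rfl
  · exact absurd heq.symm (hmin t s ht hs hlt)

theorem isPeriodicOrbit (h : IsTracked X Y K U) {p : M} (hp : p ∈ K) :
    IsPeriodicOrbit Y (connectedComponentIn K p) := by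
  obtain ⟨γ, rfl, hγ, hγK⟩ := h.exists_curve hp
  obtain ⟨T, hT, hper, hinj⟩ := h.exists_min_period hγ hγK
  exact ⟨γ, T, hT, hγ, hper, hinj, (h.connectedComponentIn_eq hγ hγK ⟨0, rfl⟩).symm⟩

end IsTracked

end Tracked

/-! ### Charts adapted to a trajectory -/

section Adapted

variable {M : Type*} [TopologicalSpace M] [T2Space M] [ChartedSpace Plane M]
  [IsManifold (𝓡 2) ω M] {k : ℕ}

/-- Restriction of a chart to the preimage of a small ball. -/
theorem exists_restr_ball {n : ℕ∞ω} {e : OpenPartialHomeomorph M Plane}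
    (he : e ∈ IsManifold.maximalAtlas (𝓡 2) n M) {z₀ : Plane} {P : Plane → Prop}
    (hz : z₀ ∈ e.target) (hP : ∀ᶠ z in 𝓝 z₀, P z) :
    ∃ e' ∈ IsManifold.maximalAtlas (𝓡 2) n M, ∃ r > 0, e'.target = Metric.ball z₀ r ∧
      (∀ z, e'.symm z = e.symm z) ∧ (∀ z ∈ Metric.ball z₀ r, z ∈ e.target ∧ P z) := by
  obtain ⟨r, hr, hrs⟩ := Metric.mem_nhds_iff.1
    (inter_mem (e.open_target.mem_nhds hz) hP)
  have hs : IsOpen (e.source ∩ e ⁻¹' Metric.ball z₀ r) := e.isOpen_inter_preimage Metric.isOpen_ball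
  refine ⟨e.restr (e.source ∩ e ⁻¹' Metric.ball z₀ r), ?_, r, hr, ?_, fun z => rfl,
    fun z hz => hrs hz⟩
  · exact restr_mem_maximalAtlas (contDiffGroupoid n (𝓡 2)) he hs
  · ext z
    rw [OpenPartialHomeomorph.restr_toPartialEquiv' _ _ hs]
    simp only [PartialEquiv.restr_target, mem_inter_iff, mem_preimage]
    constructor
    · rintro ⟨h1, h2, h3⟩
      have := e.right_inv h1
      simp_all
    · intro hz
      have h1 := (hrs hz).1
      exact ⟨h1, e.map_target h1, by
        have := e.right_inv h1
        simp_all⟩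

/-- A local `C^n` parametrization of a chart domain defines a chart. -/
theorem exists_chart_of_contDiffAt {n : ℕ} (hn : n ≠ 0) {e : OpenPartialHomeomorph M Plane}
    (he : e ∈ IsManifold.maximalAtlas (𝓡 2) n M) {S : Plane → Plane} {A : Plane ≃L[ℝ] Plane}
    {z₀ : Plane} (hS : ContDiffAt ℝ n S z₀) (hA : HasFDerivAt S (A : Plane →L[ℝ] Plane) z₀)
    (hz : S z₀ ∈ e.target) : ∃ e' ∈ IsManifold.maximalAtlas (𝓡 2) n M, z₀ ∈ e'.target ∧
      (∀ z, e'.symm z = e.symm (S z)) ∧ ∀ z ∈ e'.target, S z ∈ e.target := by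
  have hn0 : (n : ℕ∞ω) ≠ 0 := by exact_mod_cast hn
  set Φ := hS.toOpenPartialHomeomorph S hA hn0 with hΦ
  have hΦS : ∀ z, Φ z = S z := fun z => rfl
  have hz₀ : z₀ ∈ Φ.source := hS.mem_toOpenPartialHomeomorph_source hA hn0
  have h1 : ∀ᶠ z in 𝓝 z₀, ContDiffAt ℝ n S z := hS.eventually (by simp)
  have h2 : ContDiffAt ℝ n Φ.symm (S z₀) := hS.to_localInverse hA hn0
  have h3 : ∀ᶠ w in 𝓝 (S z₀), ContDiffAt ℝ n Φ.symm w := h2.eventually (by simp)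
  obtain ⟨V, hV, hVo, hzV⟩ := eventually_nhds_iff.1
    (h1.and ((hS.continuousAt.eventually h3).and (Φ.open_source.mem_nhds hz₀)))
  have hV1 : ∀ z ∈ V, ContDiffAt ℝ n S z := fun z h => (hV z h).1
  have hV2 : ∀ z ∈ V, ContDiffAt ℝ n Φ.symm (S z) := fun z h => (hV z h).2.1
  set Ψ := Φ.restrOpen V hVo with hΨ
  have hsrc : Ψ.source = Φ.source ∩ V := rfl
  refine ⟨e.trans Ψ.symm, ?_, ?_, fun z => rfl, ?_⟩
  · refine OpenPartialHomeomorph.mem_maximalAtlas_of_contMDiffOn _ ?_ ?_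
    · intro p hp
      simp only [OpenPartialHomeomorph.trans_source, mem_inter_iff, mem_preimage] at hp
      have h4 : Ψ.symm (e p) ∈ Ψ.source := Ψ.symm.map_source hp.2
      have h5 : S (Ψ.symm (e p)) = e p := Ψ.right_inv hp.2
      have h6 := hV2 _ h4.2
      rw [h5] at h6
      exact (h6.contMDiffAt.comp p ((contMDiffOn_of_mem_maximalAtlas he).contMDiffAt
        (e.open_source.mem_nhds hp.1))).contMDiffWithinAt
    · intro z hz
      have hz0 : z ∈ Ψ.source ∧ Ψ z ∈ e.target := by
        simpa [OpenPartialHomeomorph.trans_target] using hz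
      have hz' : z ∈ Ψ.source ∧ S z ∈ e.target := hz0
      have h4 : ContMDiffAt (𝓡 2) (𝓡 2) n e.symm (S z) :=
        (contMDiffOn_symm_of_mem_maximalAtlas he).contMDiffAt (e.open_target.mem_nhds hz'.2)
      exact (h4.comp z (hV1 z hz'.1.2).contMDiffAt).contMDiffWithinAt
  · rw [OpenPartialHomeomorph.trans_target]
    exact ⟨⟨hz₀, hzV⟩, hz⟩
  · intro z hz
    rw [OpenPartialHomeomorph.trans_target] at hz
    exact hz.2

/-- The representation of an integral curve in a chart is one order smoother than the field. -/
theorem contDiffAt_chart_curve (Y : VField M k) {e : OpenPartialHomeomorph M Plane}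
    (he : e ∈ IsManifold.maximalAtlas (𝓡 2) ((k : ℕ∞ω) + 1) M) {γ : ℝ → M}
    (hγ : IsMIntegralCurve γ Y) {t₀ : ℝ} (ht : γ t₀ ∈ e.source) :
    ContDiffAt ℝ ((k : ℕ∞ω) + 1) (fun t => e (γ t)) t₀ := by
  have hO : γ ⁻¹' e.source ∈ 𝓝 t₀ := hγ.continuous.continuousAt (e.open_source.mem_nhds ht)
  obtain ⟨δ, hδ, hs⟩ := Metric.nhds_basis_closedBall.mem_iff.1 hO
  rw [Real.closedBall_eq_Icc] at hs
  have hd : ∀ t ∈ Icc (t₀ - δ) (t₀ + δ),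
      HasDerivAt (fun t => e (γ t)) (chartRep e Y (e (γ t))) t := fun t ht =>
    hasDerivAt_chart (mem_maximalAtlas_one he) isOpen_univ (hγ.isMIntegralCurveOn univ)
      (mem_univ t) (hs ht)
  have hmap : MapsTo (fun t => e (γ t)) (Icc (t₀ - δ) (t₀ + δ)) e.target :=
    fun t ht => e.map_source (hs ht)
  have hF : ContDiffOn ℝ (k : ℕ∞) (chartRep e Y) e.target := by
    exact_mod_cast contDiffOn_chartRep Y he
  have h1 : ContDiffOn ℝ (k : ℕ∞) (fun t => e (γ t)) (Icc (t₀ - δ) (t₀ + δ)) :=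
    ODE.contDiffOn_enat_Icc_of_hasDerivWithinAt (f := fun _ z => chartRep e Y z) (u := e.target)
      (hF.comp contDiff_snd.contDiffOn fun z hz => hz.2)
      (fun t ht => (hd t ht).hasDerivWithinAt) hmap
  have h2 : ContDiffOn ℝ ((k : ℕ∞ω) + 1) (fun t => e (γ t)) (Ioo (t₀ - δ) (t₀ + δ)) := by
    rw [contDiffOn_succ_iff_deriv_of_isOpen isOpen_Ioo]
    refine ⟨fun t ht => (hd t (Ioo_subset_Icc_self ht)).differentiableAt.differentiableWithinAt,
      by simp, ?_⟩
    refine ((hF.comp h1 hmap).mono Ioo_subset_Icc_self).congr fun t ht => ?_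
    exact (hd t (Ioo_subset_Icc_self ht)).deriv
  exact h2.contDiffAt (Ioo_mem_nhds (by linarith) (by linarith))

/-- A chart in which `K` is a segment of the first axis, along which `Y` is the unit field. -/
structure IsAdapted (Y : VField M k) (K : Set M) (e : OpenPartialHomeomorph M Plane) (r : ℝ) :
    Prop where
  mem : e ∈ IsManifold.maximalAtlas (𝓡 2) ((k : ℕ∞ω) + 1) M
  pos : 0 < r
  target : e.target = Metric.ball 0 r
  mem_iff : ∀ z ∈ Metric.ball (0 : Plane) r, e.symm z ∈ K ↔ z 1 = 0
  field : ∀ z ∈ Metric.ball (0 : Plane) r, z 1 = 0 → chartRep e Y z = !₂[1, 0]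

theorem norm_axis (t : ℝ) : ‖(!₂[t, 0] : Plane)‖ = |t| := by
  rw [← sq_eq_sq₀ (norm_nonneg _) (abs_nonneg _), sq_norm_plane]
  simp

theorem eq_axis {z : Plane} (h : z 1 = 0) : z = !₂[z 0, 0] := by
  ext i; fin_cases i <;> simp [h]

/-- The linear map with the columns `v` and its quarter turn. -/
theorem exists_frame {v : Plane} (hv : v ≠ 0) : ∃ (n : Plane) (A : Plane ≃L[ℝ] Plane),
    ∀ z, A z = z 0 • v + z 1 • n := by
  let n : Plane := !₂[-v 1, v 0]
  let B : Plane →ₗ[ℝ] Plane :=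
    ((EuclideanSpace.proj 0 : Plane →L[ℝ] ℝ).smulRight v +
      (EuclideanSpace.proj 1 : Plane →L[ℝ] ℝ).smulRight n : Plane →L[ℝ] Plane)
  have hB : ∀ z, B z = z 0 • v + z 1 • n := fun z => rfl
  have hpos : v 0 ^ 2 + v 1 ^ 2 ≠ 0 := by
    rw [← sq_norm_plane]; exact pow_ne_zero 2 (norm_ne_zero_iff.2 hv)
  have hinj : Function.Injective B := by
    rw [injective_iff_map_eq_zero]
    intro z hz
    rw [hB] at hz
    have h0 : z 0 * v 0 - z 1 * v 1 = 0 := by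
      have := congrArg (fun w : Plane => w 0) hz
      simp [n] at this; linarith
    have h1 : z 0 * v 1 + z 1 * v 0 = 0 := by
      have := congrArg (fun w : Plane => w 1) hz
      simp [n] at this; linarith
    have h2 : z 0 = 0 := by
      have : z 0 * (v 0 ^ 2 + v 1 ^ 2) = 0 := by linear_combination v 0 * h0 + v 1 * h1
      simpa [hpos] using this
    have h3 : z 1 = 0 := by
      have : z 1 * (v 0 ^ 2 + v 1 ^ 2) = 0 := by linear_combination v 0 * h1 - v 1 * h0
      simpa [hpos] using this
    ext i; fin_cases i <;> simp [h2, h3]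
  exact ⟨n, (LinearEquiv.ofInjectiveEndo B hinj).toContinuousLinearEquiv, fun z => hB z⟩

/-- The inverse chart is (x, y) ↦ γ(x) + y n, read in a given chart, with n a quarter turn of the
velocity. It is C^{k+1} because trajectories of a C^k field are. The ball is shrunk until K meets it
only along the axis. -/
theorem IsTracked.exists_isAdapted {X Y : VField M k} {K U : Set M} (h : IsTracked X Y K U)
    {γ : ℝ → M} (hγ : IsMIntegralCurve γ Y) (hγK : ∀ t, γ t ∈ K) {O : Set M} (hO : O ∈ 𝓝 (γ 0)) :
    ∃ e r, IsAdapted Y K e r ∧ e.source ⊆ O ∧ ∀ t, |t| < r → e.symm !₂[t, 0] = γ t := by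
  set e₀ := chartAt Plane (γ 0) with he₀_def
  have hs₀ : γ 0 ∈ e₀.source := mem_chart_source Plane (γ 0)
  have he₀ : e₀ ∈ IsManifold.maximalAtlas (𝓡 2) ((k : ℕ∞ω) + 1) M := chartAt_mem_maximalAtlas _ _
  have he₀1 := mem_maximalAtlas_one he₀
  set v := chartRep e₀ Y (e₀ (γ 0)) with hv_def
  have hv : v ≠ 0 := fun h0 => h.ne_zero _ (hγK 0) ((chartRep_apply_eq_zero he₀1 Y hs₀).1 h0)
  obtain ⟨n, A, hA⟩ := exists_frame hv
  set S : Plane → Plane := fun z => e₀ (γ (z 0)) + z 1 • n with hS_def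
  have hS0 : S 0 = e₀ (γ 0) := by simp [S]
  have hc0 := contDiffAt_chart_curve Y he₀ hγ hs₀
  have hproj : ∀ i : Fin 2, ContDiff ℝ ((k : ℕ∞ω) + 1) fun z : Plane => z i := fun i =>
    (EuclideanSpace.proj i : Plane →L[ℝ] ℝ).contDiff
  have hSc : ContDiffAt ℝ ((k + 1 : ℕ) : ℕ∞ω) S 0 := by
    push_cast
    refine ContDiffAt.add ?_ ((hproj 1).smul contDiff_const).contDiffAt
    exact ContDiffAt.comp (0 : Plane) (f := fun z : Plane => z 0) (g := fun t => e₀ (γ t))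
      (by simpa using hc0) (hproj 0).contDiffAt
  have hSd : HasFDerivAt S (A : Plane →L[ℝ] Plane) 0 := by
    have h1 : HasDerivAt (fun t => e₀ (γ t)) v ((0 : Plane) 0) :=
      hasDerivAt_chart he₀1 isOpen_univ (hγ.isMIntegralCurveOn univ) (mem_univ 0) hs₀
    have h2 := h1.hasFDerivAt.comp (0 : Plane) (EuclideanSpace.proj 0 : Plane →L[ℝ] ℝ).hasFDerivAt
    have h3 := ((EuclideanSpace.proj 1 : Plane →L[ℝ] ℝ).smulRight n).hasFDerivAt (x := (0 : Plane))
    refine (h2.add h3).congr_fderiv ?_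
    ext1 z
    rw [ContinuousLinearEquiv.coe_coe, hA]
    simp
  obtain ⟨e₁, he₁, h0e₁, hsymm, -⟩ := exists_chart_of_contDiffAt (Nat.succ_ne_zero k)
    (by exact_mod_cast he₀) hSc hSd (hS0 ▸ e₀.map_source hs₀)
  have he₁' : e₁ ∈ IsManifold.maximalAtlas (𝓡 2) ((k : ℕ∞ω) + 1) M := by exact_mod_cast he₁
  -- the axis is the trajectory
  have haxis : ∀ᶠ t in 𝓝 (0 : ℝ), e₁.symm !₂[t, 0] = γ t ∧ (!₂[t, 0] : Plane) ∈ e₁.target := by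
    have hcont : Continuous fun t : ℝ => (!₂[t, 0] : Plane) := by
      refine (PiLp.continuous_toLp 2 _).comp (continuous_pi fun i => ?_)
      fin_cases i <;> simp <;> fun_prop
    have h1 : ∀ᶠ t in 𝓝 (0 : ℝ), (!₂[t, 0] : Plane) ∈ e₁.target :=
      hcont.continuousAt.eventually (e₁.open_target.mem_nhds (by
        convert h0e₁; ext i; fin_cases i <;> simp))
    filter_upwards [h1, hγ.continuous.continuousAt (e₀.open_source.mem_nhds hs₀)] with t ht hts
    refine ⟨?_, ht⟩
    rw [hsymm]
    have : S !₂[t, 0] = e₀ (γ t) := by simp [S]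
    rw [this, e₀.left_inv hts]
  obtain ⟨δ, hδ, hδa⟩ := Metric.eventually_nhds_iff.1 haxis
  have hδ' : ∀ t, |t| < δ → e₁.symm !₂[t, 0] = γ t ∧ (!₂[t, 0] : Plane) ∈ e₁.target :=
    fun t ht => hδa (by rwa [Real.dist_0_eq_abs])
  have hsymm0 : e₁.symm 0 = γ 0 := by rw [hsymm, hS0, e₀.left_inv hs₀]
  have hc1 : ContinuousAt e₁.symm 0 := e₁.continuousAt_symm h0e₁
  -- This excludes that K, or γ itself at a later time, returns to the chart off the axis: nearby
  -- points of K are visited at times below δ.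
  have hP1 : ∀ᶠ z in 𝓝 (0 : Plane), e₁.symm z ∈ K → ∃ t, |t - 0| < δ ∧ γ t = e₁.symm z := by
    have := h.eventually_mem_curve hγ hγK 0 hδ
    rw [← hsymm0] at this
    exact hc1.eventually this
  have hP2 : ∀ᶠ z in 𝓝 (0 : Plane), e₁.symm z ∈ O := by
    rw [← hsymm0] at hO
    exact hc1.eventually hO
  have hP3 : ∀ᶠ z in 𝓝 (0 : Plane), ‖z‖ < δ := by
    filter_upwards [Metric.ball_mem_nhds (0 : Plane) hδ] with z hz
    rwa [mem_ball_zero_iff] at hz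
  obtain ⟨e, he, r, hr, htar, hes, hall⟩ := exists_restr_ball he₁' h0e₁ (hP1.and (hP2.and hP3))
  have hax : ∀ t, |t| < r → (!₂[t, 0] : Plane) ∈ Metric.ball (0 : Plane) r := fun t ht => by
    rwa [mem_ball_zero_iff, norm_axis]
  have haxγ : ∀ t, |t| < r → e.symm !₂[t, 0] = γ t := fun t ht => by
    have h1 := (hall _ (hax t ht)).2.2.2
    rw [norm_axis] at h1
    rw [hes]
    exact (hδ' t h1).1
  have hz0 : ∀ z ∈ Metric.ball (0 : Plane) r, z 1 = 0 → |z 0| < r ∧ e.symm z = γ (z 0) := by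
    intro z hz hz1
    have h1 : |z 0| < r := by
      rw [eq_axis hz1, mem_ball_zero_iff, norm_axis] at hz
      exact hz
    refine ⟨h1, ?_⟩
    conv_lhs => rw [eq_axis hz1]
    exact haxγ _ h1
  refine ⟨e, r, ⟨he, hr, htar, ?_, ?_⟩, ?_, haxγ⟩
  · intro z hz
    obtain ⟨hzt, hzK, -, -⟩ := hall z hz
    constructor
    · intro hK
      rw [hes] at hK
      obtain ⟨t, ht, hγt⟩ := hzK hK
      rw [sub_zero] at ht
      obtain ⟨h1, h2⟩ := hδ' t ht
      have := e₁.symm.injOn h2 hzt (h1.trans hγt)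
      rw [← this]; simp
    · intro hz1
      rw [(hz0 z hz hz1).2]
      exact hγK _
  · intro z hz hz1
    obtain ⟨h1, h2⟩ := hz0 z hz hz1
    have hsrc : γ (z 0) ∈ e.source := by rw [← h2]; exact e.map_target (htar ▸ hz)
    have h3 := hasDerivAt_chart (mem_maximalAtlas_one he) isOpen_univ
      (hγ.isMIntegralCurveOn univ) (mem_univ (z 0)) hsrc
    have h4 : (fun t => e (γ t)) =ᶠ[𝓝 (z 0)] fun t => t • (!₂[1, 0] : Plane) := by
      have : ∀ᶠ t in 𝓝 (z 0), |t| < r := continuous_abs.continuousAt.eventually_lt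
        continuousAt_const h1
      filter_upwards [this] with t ht
      rw [← haxγ t ht, e.right_inv (htar ▸ hax t ht)]
      ext i; fin_cases i <;> simp
    have h5 : HasDerivAt (fun t : ℝ => t • (!₂[1, 0] : Plane)) (!₂[1, 0] : Plane) (z 0) :=
      ((hasDerivAt_id (z 0)).smul_const (!₂[1, 0] : Plane)).congr_deriv (by simp)
    have h6 := h3.unique (h5.congr_of_eventuallyEq h4)
    rwa [← h2, e.right_inv (htar ▸ hz)] at h6
  · intro p hp
    have h1 := (hall (e p) (htar ▸ e.map_source hp)).2.2.1
    rwa [← hes, e.left_inv hp] at h1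

end Adapted

/-! ### Angle charts of the circle -/

/-- The chart of the circle whose inverse is `u ↦ exp (θ + u)`. -/
def angleChart (θ : ℝ) : OpenPartialHomeomorph Circle (EuclideanSpace ℝ (Fin 1)) where
  toFun z := !₂[Complex.arg ((z / Circle.exp θ : Circle) : ℂ)]
  invFun u := Circle.exp (θ + u 0)
  source := {z | ((z / Circle.exp θ : Circle) : ℂ) ∈ Complex.slitPlane}
  target := {u | u 0 ∈ Ioo (-Real.pi) Real.pi}
  map_source' z hz := by
    refine ⟨Complex.neg_pi_lt_arg _, (Complex.arg_le_pi _).lt_of_ne ?_⟩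
    exact Complex.slitPlane_arg_ne_pi hz
  map_target' u hu := by
    have h1 : Circle.exp (θ + u 0) / Circle.exp θ = Circle.exp (u 0) := by
      rw [Circle.exp_add, mul_div_cancel_left]
    simp only [Set.mem_ofPred_eq, h1]
    rw [Complex.mem_slitPlane_iff_arg, Circle.arg_exp hu.1 hu.2.le]
    exact ⟨hu.2.ne, by simp⟩
  left_inv' z hz := by
    have h1 : Circle.exp (Complex.arg ((z / Circle.exp θ : Circle) : ℂ)) = z / Circle.exp θ :=
      Circle.exp_arg _
    have h2 : Circle.exp (θ + Complex.arg ((z / Circle.exp θ : Circle) : ℂ)) = z := by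
      rw [Circle.exp_add, h1, mul_div_cancel]
    exact h2
  right_inv' u hu := by
    have h1 : Circle.exp (θ + u 0) / Circle.exp θ = Circle.exp (u 0) := by
      rw [Circle.exp_add, mul_div_cancel_left]
    ext i
    fin_cases i
    simp only [h1]
    simpa using Circle.arg_exp hu.1 hu.2.le
  open_source := Complex.isOpen_slitPlane.preimage (by fun_prop)
  open_target := isOpen_Ioo.preimage (by fun_prop)
  continuousOn_toFun := by
    refine (PiLp.continuous_toLp 2 _).comp_continuousOn (continuousOn_pi.2 fun i => ?_)
    fin_cases i
    intro z hz
    refine (Complex.continuousAt_arg hz).comp_continuousWithinAt (f := fun z : Circle =>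
      ((z / Circle.exp θ : Circle) : ℂ)) ?_
    exact Continuous.continuousWithinAt (by fun_prop)
  continuousOn_invFun := Continuous.continuousOn (by fun_prop)

theorem contMDiff_coe_circle (n : ℕ∞ω) : ContMDiff (𝓡 1) 𝓘(ℝ, ℂ) n fun z : Circle => (z : ℂ) :=
  haveI : Fact (Module.finrank ℝ ℂ = 1 + 1) := ⟨Complex.finrank_real_complex⟩
  contMDiff_coe_sphere

theorem angleChart_mem_maximalAtlas (θ : ℝ) (n : ℕ∞ω) :
    angleChart θ ∈ IsManifold.maximalAtlas (𝓡 1) n Circle := by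
  refine OpenPartialHomeomorph.mem_maximalAtlas_of_contMDiffOn _ ?_ ?_
  · intro z hz
    have h1 : ContMDiff (𝓡 1) (𝓡 1) n fun z : Circle => z / Circle.exp θ := by
      simp only [div_eq_mul_inv]
      exact contMDiff_id.mul contMDiff_const
    have h2 : ContMDiff (𝓡 1) 𝓘(ℝ, ℂ) n fun z : Circle => ((z / Circle.exp θ : Circle) : ℂ) :=
      (contMDiff_coe_circle n).comp h1
    have h3 : ContDiffAt ℝ n (fun w : ℂ => (!₂[Complex.arg w] : EuclideanSpace ℝ (Fin 1)))
        ((z / Circle.exp θ : Circle) : ℂ) := by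
      rw [contDiffAt_piLp]
      intro i
      fin_cases i
      have h4 : ContDiffAt ℝ n (Complex.imCLM ∘ Complex.log) ((z / Circle.exp θ : Circle) : ℂ) :=
        Complex.imCLM.contDiff.contDiffAt.comp _ ((Complex.contDiffAt_log hz).restrict_scalars ℝ)
      exact h4.congr_of_eventuallyEq (Eventually.of_forall fun w => (Complex.log_im w).symm)
    exact (h3.contMDiffAt.comp z h2.contMDiffAt).contMDiffWithinAt
  · have h1 : ContMDiff (𝓡 1) 𝓘(ℝ, ℝ) n fun u : EuclideanSpace ℝ (Fin 1) => θ + u 0 :=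
      ContDiff.contMDiff (contDiff_const.add (EuclideanSpace.proj 0 : EuclideanSpace ℝ (Fin 1) →L[ℝ] ℝ).contDiff)
    exact (contMDiff_circleExp.comp h1).contMDiffOn

/-! ### Embedded circles -/

section EmbeddedCircle

variable {M : Type*} [TopologicalSpace M] [T2Space M] [ChartedSpace Plane M]
  [IsManifold (𝓡 2) ω M] {k : ℕ}

/-- The linear isomorphism `(u, y) ↦ (c u, y)`. -/
def axisEquiv {c : ℝ} (hc : c ≠ 0) : (EuclideanSpace ℝ (Fin 1) × ℝ) ≃L[ℝ] Plane :=
  LinearEquiv.toContinuousLinearEquiv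
    { toFun := fun x => !₂[c * x.1 0, x.2]
      invFun := fun z => (!₂[c⁻¹ * z 0], z 1)
      map_add' := fun x y => by ext i; fin_cases i <;> simp [mul_add]
      map_smul' := fun a x => by ext i; fin_cases i <;> simp; ring
      left_inv := fun x => by
        refine Prod.ext ?_ (by simp)
        ext i; fin_cases i; simp [hc]
      right_inv := fun z => by ext i; fin_cases i <;> simp [hc] }

theorem axisEquiv_apply {c : ℝ} (hc : c ≠ 0) (x : EuclideanSpace ℝ (Fin 1) × ℝ) :
    axisEquiv hc x = !₂[c * x.1 0, x.2] := rfl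

/-- The embedding is exp(iθ) ↦ γ(Tθ/2π), injective because T is the minimal period. In an angle
chart and an adapted chart it reads u ↦ (cu, 0), which is the immersion normal form. -/
theorem IsTracked.isEmbeddedCircle {X Y : VField M k} {K U : Set M} (h : IsTracked X Y K U)
    {p : M} (hp : p ∈ K) : IsEmbeddedCircle k (connectedComponentIn K p) := by
  obtain ⟨γ, rfl, hγ, hγK⟩ := h.exists_curve hp
  rw [h.connectedComponentIn_eq hγ hγK ⟨0, rfl⟩]
  obtain ⟨T, hT, hper, hinj⟩ := h.exists_min_period hγ hγK
  have hπ := Real.pi_pos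
  set c := T / (2 * Real.pi) with hc_def
  have hc : 0 < c := by positivity
  have hcT : c * (2 * Real.pi) = T := by rw [hc_def]; field_simp
  -- The jump of `arg` is absorbed by the period of γ; continuity is therefore checked after
  -- composing with the local homeomorphism `Circle.exp`.
  set f : Circle → M := fun z => γ (c * Complex.arg z) with hf_def
  have hfexp : ∀ θ, f (Circle.exp θ) = γ (c * θ) := fun θ => by
    obtain ⟨m, hm⟩ := Circle.exp_eq_exp.1 (Circle.exp_arg (Circle.exp θ))
    have h1 : c * Complex.arg (Circle.exp θ) = c * θ + m * T := by rw [hm, ← hcT]; ring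
    simp only [hf_def, h1]
    exact hper.int_mul m _
  have hfc : Continuous f := by
    rw [continuous_iff_continuousAt]
    intro z
    obtain ⟨θ, rfl⟩ := Circle.exp_surjective z
    rw [ContinuousAt, ← isLocalHomeomorph_circleExp.map_nhds_eq θ, tendsto_map'_iff, hfexp]
    have h1 : f ∘ Circle.exp = fun θ => γ (c * θ) := funext hfexp
    rw [h1]
    exact (hγ.continuous.comp (by fun_prop : Continuous fun θ => c * θ)).continuousAt
  have hle : ∀ a b, a ≤ b → b - a < T → γ a = γ b → a = b := by
    intro a b hab hlt heq
    have h1 := IsMIntegralCurve.eq_comp_add h.one_le Y hγ hγ heq 0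
    rw [zero_add] at h1
    have h2 := hinj (show (0 : ℝ) ∈ Ico 0 T from ⟨le_rfl, hT⟩)
      (show b - a ∈ Ico 0 T from ⟨sub_nonneg.2 hab, hlt⟩) h1
    linarith
  have hfi : Function.Injective f := by
    intro z w hzw
    have hb : ∀ x : Circle, c * -Real.pi < c * Complex.arg x ∧ c * Complex.arg x ≤ c * Real.pi :=
      fun x => ⟨by gcongr; exact Complex.neg_pi_lt_arg _, by gcongr; exact Complex.arg_le_pi _⟩
    have hz := hb z
    have hw := hb w
    have h1 : c * Complex.arg z = c * Complex.arg w := by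
      rcases le_total (c * Complex.arg z) (c * Complex.arg w) with hle' | hle'
      · exact hle _ _ hle' (by linarith) hzw
      · exact (hle _ _ hle' (by linarith) hzw.symm).symm
    exact Circle.arg_eq_arg.1 (mul_left_cancel₀ hc.ne' h1)
  refine ⟨f, ⟨?_, (hfc.isClosedEmbedding hfi).isEmbedding⟩, ?_⟩
  · suffices hF : IsImmersionOfComplement ℝ (𝓡 1) (𝓡 2) (k : ℕ∞ω) f from hF.isImmersion
    intro z
    obtain ⟨θ, rfl⟩ := Circle.exp_surjective z
    obtain ⟨e, r, he, -, hax⟩ := h.exists_isAdapted (hγ.comp_add (c * θ)) (fun t => hγK _) univ_mem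
    have hsrc : ∀ t, |t| < r → γ (t + c * θ) ∈ e.source ∧ e (γ (t + c * θ)) = !₂[t, 0] := by
      intro t ht
      have hm : (!₂[t, 0] : Plane) ∈ e.target := by
        rw [he.target, mem_ball_zero_iff, norm_axis]; exact ht
      have h1 : e.symm !₂[t, 0] = γ (t + c * θ) := hax t ht
      rw [← h1]
      exact ⟨e.map_target hm, e.right_inv hm⟩
    have hkatlas : e ∈ IsManifold.maximalAtlas (𝓡 2) (k : ℕ∞ω) M :=
      IsManifold.maximalAtlas_subset_of_le le_self_add he.mem
    let s : Set Circle := (angleChart θ).source ∩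
      angleChart θ ⁻¹' {u | |c * u 0| < r}
    have hs : IsOpen s := (angleChart θ).isOpen_inter_preimage
      (isOpen_lt (by fun_prop) continuous_const)
    have h1src : Circle.exp θ ∈ (angleChart θ).source := by
      have h0 : (0 : EuclideanSpace ℝ (Fin 1)) ∈ (angleChart θ).target := by
        show (0 : EuclideanSpace ℝ (Fin 1)) 0 ∈ Ioo (-Real.pi) Real.pi
        simp [hπ]
      have := (angleChart θ).map_target h0
      have h3 : (angleChart θ).symm 0 = Circle.exp θ := by
        show Circle.exp (θ + (0 : EuclideanSpace ℝ (Fin 1)) 0) = _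
        simp
      rwa [h3] at this
    refine IsImmersionAtOfComplement.mk_of_continuousAt hfc.continuousAt (axisEquiv hc.ne')
      ((angleChart θ).restr s) e ?_ ?_
      (restr_mem_maximalAtlas (contDiffGroupoid _ (𝓡 1)) (angleChart_mem_maximalAtlas θ _) hs)
      hkatlas ?_
    · rw [OpenPartialHomeomorph.restr_source' _ _ hs]
      refine ⟨h1src, h1src, ?_⟩
      show |c * (!₂[Complex.arg ((Circle.exp θ / Circle.exp θ : Circle) : ℂ)] :
        EuclideanSpace ℝ (Fin 1)) 0| < r
      simp [he.pos]
    · rw [hfexp]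
      simpa using (hsrc 0 (by simpa using he.pos)).1
    · intro u hu
      have hu' : u ∈ (angleChart θ).target ∧ |c * u 0| < r := by
        simp only [OpenPartialHomeomorph.extend_target, OpenPartialHomeomorph.restr_toPartialEquiv' _ _ hs] at hu
        have h4 : u ∈ (angleChart θ).target ∧ (angleChart θ).symm u ∈ s := by simpa using hu
        have h5 := h4.2.2
        rw [mem_preimage, (angleChart θ).right_inv h4.1] at h5
        exact ⟨h4.1, h5⟩
      show e (f (Circle.exp (θ + u 0))) = axisEquiv hc.ne' (u, 0)
      rw [hfexp, axisEquiv_apply, mul_add, add_comm]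
      exact (hsrc _ hu'.2).2
  · refine Subset.antisymm (range_subset_iff.2 fun z => ⟨_, rfl⟩) ?_
    rintro _ ⟨t, rfl⟩
    exact ⟨Circle.exp (t / c), by rw [hfexp, mul_div_cancel₀ _ hc.ne']⟩

end EmbeddedCircle

/-! ### Directions in the plane -/

/-- The scalar product of two plane vectors. -/
def dot2 (v w : Plane) : ℝ := v 0 * w 0 + v 1 * w 1

theorem abs_dot2_le (v w : Plane) : |dot2 v w| ≤ ‖v‖ * ‖w‖ := by
  refine abs_le_of_sq_le_sq ?_ (by positivity)
  rw [mul_pow, sq_norm_plane, sq_norm_plane]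
  unfold dot2
  nlinarith [sq_nonneg (v 0 * w 1 - v 1 * w 0)]

theorem sq_det2_add_sq_dot2 (v w : Plane) : det2 v w ^ 2 + dot2 v w ^ 2 = (‖v‖ * ‖w‖) ^ 2 := by
  rw [mul_pow, sq_norm_plane, sq_norm_plane]
  unfold dot2 det2; ring

theorem dot2_smul_left (c : ℝ) (v w : Plane) : dot2 (c • v) w = c * dot2 v w := by
  simp only [dot2, PiLp.smul_apply, smul_eq_mul]; ring

theorem dot2_sub_left (v v' w : Plane) : dot2 (v - v') w = dot2 v w - dot2 v' w := by
  simp only [dot2, PiLp.sub_apply]; ring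

/-- Divided by the three norms, this is the triangle inequality for the sines of the angles between
lines. -/
theorem norm_mul_abs_det2_le (a b c : Plane) :
    ‖c‖ * |det2 a b| ≤ |det2 c a| * ‖b‖ + |det2 c b| * ‖a‖ := by
  rcases eq_or_ne c 0 with rfl | hc
  · simp only [norm_zero, zero_mul]; positivity
  have hc' : 0 < ‖c‖ := norm_pos_iff.2 hc
  have h1 : ‖c‖ ^ 2 * det2 a b = dot2 c a * det2 c b - det2 c a * dot2 c b := by
    rw [sq_norm_plane]; unfold dot2 det2; ring
  have h2 : ‖c‖ ^ 2 * |det2 a b| ≤ ‖c‖ * (|det2 c a| * ‖b‖ + |det2 c b| * ‖a‖) := by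
    calc ‖c‖ ^ 2 * |det2 a b| = |dot2 c a * det2 c b - det2 c a * dot2 c b| := by
          rw [← h1, abs_mul, abs_of_pos (by positivity : 0 < ‖c‖ ^ 2)]
      _ ≤ |dot2 c a| * |det2 c b| + |det2 c a| * |dot2 c b| := by
          rw [← abs_mul, ← abs_mul]; exact abs_sub _ _
      _ ≤ (‖c‖ * ‖a‖) * |det2 c b| + |det2 c a| * (‖c‖ * ‖b‖) := by
          gcongr <;> exact abs_dot2_le _ _
      _ = _ := by ring
  rw [sq, mul_assoc] at h2
  exact le_of_mul_le_mul_left h2 hc'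

theorem exists_det2_map (A : Plane →L[ℝ] Plane) : ∃ κ : ℝ, ∀ a b, det2 (A a) (A b) = κ * det2 a b := by
  refine ⟨det2 (A !₂[1, 0]) (A !₂[0, 1]), fun a b => ?_⟩
  have h : ∀ v : Plane, A v = v 0 • A !₂[1, 0] + v 1 • A !₂[0, 1] := fun v => by
    rw [← map_smul, ← map_smul, ← map_add]
    congr 1
    ext i; fin_cases i <;> simp
  rw [h a, h b]
  simp only [det2, PiLp.add_apply, PiLp.smul_apply, smul_eq_mul]
  ring

section Direction

variable {A : Type*} [TopologicalSpace A] {F ℓ : A → Plane} {S : Set A}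

/-- Limit directions depend continuously on the point. -/
theorem eventually_abs_det2_le (hS : IsOpen S)
    (hF : ∀ p ∈ S, ∀ η > 0, ∀ᶠ q in 𝓝 p, |det2 (F q) (ℓ p)| ≤ η * ‖F q‖)
    (hd : ∀ p ∈ S, ∃ᶠ q in 𝓝 p, F q ≠ 0) {p : A} (hp : p ∈ S) {η : ℝ} (hη : 0 < η) :
    ∀ᶠ q in 𝓝 p, |det2 (ℓ q) (ℓ p)| ≤ η * ‖ℓ q‖ := by
  filter_upwards [eventually_eventually_nhds.2 (hF p hp η hη), hS.mem_nhds hp] with q hq hqS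
  refine le_of_forall_pos_le_add fun ε hε => ?_
  have hε' : 0 < ε / (‖ℓ p‖ + 1) := by positivity
  -- A point x near q with F x ≠ 0 at which F is almost parallel both to ℓ p and to ℓ q; the angle
  -- between these is compared through F x.
  obtain ⟨x, hx0, hx1, hx2⟩ := ((hd q hqS).and_eventually (hq.and (hF q hqS _ hε'))).exists
  have hx : 0 < ‖F x‖ := norm_pos_iff.2 hx0
  have h1 := norm_mul_abs_det2_le (ℓ q) (ℓ p) (F x)
  have h2 : ‖F x‖ * |det2 (ℓ q) (ℓ p)| ≤ ‖F x‖ * (η * ‖ℓ q‖ + ε / (‖ℓ p‖ + 1) * ‖ℓ p‖) := by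
    calc _ ≤ _ := h1
      _ ≤ (ε / (‖ℓ p‖ + 1) * ‖F x‖) * ‖ℓ p‖ + (η * ‖F x‖) * ‖ℓ q‖ := by gcongr
      _ = _ := by ring
  refine (le_of_mul_le_mul_left h2 hx).trans (add_le_add le_rfl ?_)
  rw [div_mul_eq_mul_div, div_le_iff₀ (by positivity)]
  nlinarith [norm_nonneg (ℓ p)]

theorem eventually_dot2_ne_zero {p : A} (hp : ℓ p ≠ 0) (h0 : ∀ᶠ q in 𝓝 p, ℓ q ≠ 0)
    (h : ∀ η > 0, ∀ᶠ q in 𝓝 p, |det2 (ℓ q) (ℓ p)| ≤ η * ‖ℓ q‖) :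
    ∀ᶠ q in 𝓝 p, dot2 (ℓ q) (ℓ p) ≠ 0 := by
  have hp' : 0 < ‖ℓ p‖ := norm_pos_iff.2 hp
  filter_upwards [h0, h (‖ℓ p‖ / 2) (by positivity)] with q hq0 hq hd
  have hq' : 0 < ‖ℓ q‖ := norm_pos_iff.2 hq0
  have h1 := sq_det2_add_sq_dot2 (ℓ q) (ℓ p)
  rw [hd] at h1
  have h2 : |det2 (ℓ q) (ℓ p)| ^ 2 ≤ (‖ℓ p‖ / 2 * ‖ℓ q‖) ^ 2 := by gcongr
  rw [sq_abs] at h2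
  have h3 : 0 < ‖ℓ q‖ * ‖ℓ p‖ := by positivity
  nlinarith

/-- The spanning vectors normalized by a linear form vary continuously. -/
theorem continuousOn_normalized {w : Plane} {W : Set A}
    (hW : ∀ p ∈ W, dot2 (ℓ p) w ≠ 0)
    (h : ∀ p ∈ W, ∀ η > 0, ∀ᶠ q in 𝓝 p, |det2 (ℓ q) (ℓ p)| ≤ η * ‖ℓ q‖) :
    ContinuousOn (fun q => (dot2 (ℓ q) w)⁻¹ • ℓ q) W := by
  intro p hp
  set v := fun q => (dot2 (ℓ q) w)⁻¹ • ℓ q with hv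
  have hv1 : ∀ q ∈ W, dot2 (v q) w = 1 := fun q hq => by
    simp only [hv, dot2_smul_left]; exact inv_mul_cancel₀ (hW q hq)
  have hvd : ∀ η > 0, ∀ᶠ q in 𝓝 p, |det2 (v q) (v p)| ≤ η * ‖v q‖ := by
    intro η hη
    have hc : 0 < |(dot2 (ℓ p) w)⁻¹| := abs_pos.2 (inv_ne_zero (hW p hp))
    filter_upwards [h p hp (η / |(dot2 (ℓ p) w)⁻¹|) (by positivity)] with q hq
    simp only [hv, det2_smul_left, det2_smul_right, norm_smul, abs_mul, Real.norm_eq_abs]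
    rw [div_mul_eq_mul_div, le_div_iff₀ hc] at hq
    calc _ = |(dot2 (ℓ q) w)⁻¹| * (|det2 (ℓ q) (ℓ p)| * |(dot2 (ℓ p) w)⁻¹|) := by ring
      _ ≤ |(dot2 (ℓ q) w)⁻¹| * (η * ‖ℓ q‖) := by gcongr
      _ = _ := by ring
  rw [ContinuousWithinAt, Metric.tendsto_nhds]
  intro ε hε
  set η := (2 * (‖w‖ + 1))⁻¹ * min 1 (ε / (‖v p‖ + 1)) with hη_def
  have hη : 0 < η := by positivity
  have hη1 : ‖w‖ * η ≤ 1 / 2 * min 1 (ε / (‖v p‖ + 1)) := by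
    rw [hη_def, ← mul_assoc]
    gcongr
    rw [← div_eq_mul_inv, div_le_div_iff₀ (by positivity) (by positivity)]
    linarith
  filter_upwards [mem_nhdsWithin_of_mem_nhds (hvd η hη), self_mem_nhdsWithin] with q hq hqW
  rw [dist_eq_norm]
  -- Both vectors have scalar product 1 with w, so δ is orthogonal to w and its length is ‖w‖ times
  -- |det(δ, v p)|, which is small by the angle estimate.
  set δ := v q - v p with hδ
  have hδw : dot2 δ w = 0 := by rw [hδ, dot2_sub_left, hv1 q hqW, hv1 p hp, sub_self]
  have h1 : ‖w‖ ^ 2 * det2 δ (v p) = det2 δ w := by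
    have : ‖w‖ ^ 2 * det2 δ (v p) = det2 δ w * dot2 (v p) w + dot2 δ w * det2 w (v p) := by
      rw [sq_norm_plane]; unfold dot2 det2; ring
    rw [this, hδw, hv1 p hp]; ring
  have hw : w ≠ 0 := by
    rintro rfl
    exact hW p hp (by simp [dot2])
  have hw' : 0 < ‖w‖ := norm_pos_iff.2 hw
  have h2 : |det2 δ w| = ‖δ‖ * ‖w‖ := by
    rw [← sq_eq_sq₀ (abs_nonneg _) (by positivity), sq_abs, ← sq_det2_add_sq_dot2, hδw]; ring
  have h3 : ‖δ‖ = ‖w‖ * |det2 δ (v p)| := by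
    have : ‖δ‖ * ‖w‖ = ‖w‖ * |det2 δ (v p)| * ‖w‖ := by
      rw [← h2, ← h1, abs_mul, abs_of_pos (by positivity : 0 < ‖w‖ ^ 2)]; ring
    exact mul_right_cancel₀ hw'.ne' this
  have h4 : det2 δ (v p) = det2 (v q) (v p) := by rw [hδ, det2_sub_left, det2_self, sub_zero]
  rw [h4] at h3
  have h5 : ‖v q‖ ≤ ‖v p‖ + ‖δ‖ := by
    have := norm_add_le (v p) δ
    rwa [hδ, add_sub_cancel] at this
  set m := min 1 (ε / (‖v p‖ + 1)) with hm
  have hm0 : 0 < m := lt_min one_pos (by positivity)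
  have hm1 : m ≤ 1 := min_le_left _ _
  have hm2 : m * (‖v p‖ + 1) ≤ ε := by
    rw [← le_div_iff₀ (by positivity)]; exact min_le_right _ _
  have h6 : ‖δ‖ ≤ (1 / 2 * m) * (‖v p‖ + ‖δ‖) := by
    calc ‖δ‖ = ‖w‖ * |det2 (v q) (v p)| := h3
      _ ≤ ‖w‖ * (η * (‖v p‖ + ‖δ‖)) := by gcongr; exact hq.trans (by gcongr)
      _ = (‖w‖ * η) * (‖v p‖ + ‖δ‖) := by ring
      _ ≤ _ := by gcongr
  nlinarith [norm_nonneg δ, norm_nonneg (v p)]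

end Direction

/-! ### Limit directions of a field -/

section LimitDirection

variable {M : Type*} [TopologicalSpace M] [T2Space M] [ChartedSpace Plane M]
  [IsManifold (𝓡 2) ω M] {k : ℕ} {e e' : OpenPartialHomeomorph M Plane}

/-- Near `p`, the directions of `X` are close to that of `w p`, as seen in the chart `e`. -/
def IsLimitDirection (X w : ∀ p : M, TangentSpace (𝓡 2) p) (e : OpenPartialHomeomorph M Plane)
    (p : M) : Prop :=
  ∀ η > 0, ∀ᶠ q in 𝓝 p,
    |det2 (chartRep e X (e q)) (chartRep e w (e p))| ≤ η * ‖chartRep e X (e q)‖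

/-- The derivative of the transition is close to its value B at the point, and B multiplies
determinants by a constant; B being invertible, the norms are comparable. -/
theorem IsLimitDirection.change {X w : ∀ p : M, TangentSpace (𝓡 2) p} {p : M}
    (he : e ∈ IsManifold.maximalAtlas (𝓡 2) 1 M) (he' : e' ∈ IsManifold.maximalAtlas (𝓡 2) 1 M)
    (hp : p ∈ e.source) (hp' : p ∈ e'.source) (h : IsLimitDirection X w e p) :
    IsLimitDirection X w e' p := by
  intro η hη
  obtain ⟨B, hB, -⟩ := exists_equiv_transition he he' (e.map_source hp)
    (by rwa [e.left_inv hp])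
  obtain ⟨κ, hκ⟩ := exists_det2_map (B : Plane →L[ℝ] Plane)
  have hchange : ∀ (V : ∀ p : M, TangentSpace (𝓡 2) p), ∀ q ∈ e.source ∩ e'.source,
      chartRep e' V (e' q) = fderiv ℝ (e' ∘ e.symm) (e q) (chartRep e V (e q)) := fun V q hq => by
    have := chartRep_change he he' V (e.map_source hq.1) (by rw [e.left_inv hq.1]; exact hq.2)
    rwa [e.left_inv hq.1] at this
  set ℓ := chartRep e w (e p) with hℓ
  have hw : chartRep e' w (e' p) = B ℓ := by
    rw [hchange w p ⟨hp, hp'⟩, hB.fderiv]; rfl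
  set b := ‖(B.symm : Plane →L[ℝ] Plane)‖ with hb
  have hb0 : 0 ≤ b := norm_nonneg _
  set σ := min (1 / (2 * (b + 1))) (η / (4 * (b + 1) * (‖B ℓ‖ + 1))) with hσ
  have hσ0 : 0 < σ := by positivity
  have hσ1 : σ * b ≤ 1 / 2 := by
    have h1 : σ ≤ 1 / (2 * (b + 1)) := min_le_left _ _
    rw [le_div_iff₀ (by positivity)] at h1
    nlinarith
  have hσ2 : σ * (4 * (b + 1) * (‖B ℓ‖ + 1)) ≤ η := by
    rw [← le_div_iff₀ (by positivity)]; exact min_le_right _ _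
  have hcd : ContinuousAt (fderiv ℝ (e' ∘ e.symm)) (e p) :=
    ((contDiffAt_transition he he' (e.map_source hp) (by rwa [e.left_inv hp])).fderiv_right
      (m := 0) (by simp)).continuousAt
  have hcd' : ∀ᶠ q in 𝓝 p, ‖fderiv ℝ (e' ∘ e.symm) (e q) - B‖ < σ := by
    have h1 := (hcd.tendsto.comp (e.continuousAt hp)).eventually (Metric.ball_mem_nhds _ hσ0)
    filter_upwards [h1] with q hq
    have hq' : dist (fderiv ℝ (e' ∘ e.symm) (e q)) (fderiv ℝ (e' ∘ e.symm) (e p)) < σ := hq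
    rw [dist_eq_norm, hB.fderiv] at hq'
    exact hq'
  set τ := η / (4 * (b + 1) * (|κ| + 1)) with hτ
  have hτ0 : 0 < τ := by positivity
  have hτ2 : τ * (4 * (b + 1) * (|κ| + 1)) = η := by rw [hτ]; field_simp
  filter_upwards [hcd', h τ hτ0, e.open_source.mem_nhds hp, e'.open_source.mem_nhds hp']
    with q hq1 hq2 hqs hqs'
  rw [hchange X q ⟨hqs, hqs'⟩, hw]
  set D := fderiv ℝ (e' ∘ e.symm) (e q) with hD
  set F := chartRep e X (e q) with hF
  have hDB : ‖D F - B F‖ ≤ σ * ‖F‖ := by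
    have h1 := (D - (B : Plane →L[ℝ] Plane)).le_opNorm F
    have h2 : (D - (B : Plane →L[ℝ] Plane)) F = D F - B F := rfl
    rw [h2] at h1
    exact h1.trans (by gcongr)
  have hFD : ‖F‖ ≤ 2 * (b + 1) * ‖D F‖ := by
    have h1 : ‖F‖ ≤ b * ‖B F‖ := by
      have := (B.symm : Plane →L[ℝ] Plane).le_opNorm (B F)
      simpa using this
    have h2 : ‖B F‖ ≤ ‖D F‖ + ‖D F - B F‖ := by
      have := norm_sub_le (D F) (D F - B F)
      simpa using this
    have h3 : b * ‖B F‖ ≤ b * (‖D F‖ + σ * ‖F‖) := by gcongr; linarith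
    nlinarith [norm_nonneg F, norm_nonneg (D F)]
  have hdet : det2 (D F) (B ℓ) = det2 (D F - B F) (B ℓ) + κ * det2 F ℓ := by
    rw [det2_sub_left]
    have := hκ F ℓ
    simp only [ContinuousLinearEquiv.coe_coe] at this
    rw [this]; ring
  calc |det2 (D F) (B ℓ)| ≤ ‖D F - B F‖ * ‖B ℓ‖ + |κ| * |det2 F ℓ| := by
        rw [hdet, ← abs_mul]
        exact (abs_add_le _ _).trans (add_le_add (abs_det2_le _ _) le_rfl)
    _ ≤ (σ * ‖F‖) * ‖B ℓ‖ + |κ| * (τ * ‖F‖) := by gcongr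
    _ = (σ * ‖B ℓ‖ + |κ| * τ) * ‖F‖ := by ring
    _ ≤ (σ * ‖B ℓ‖ + |κ| * τ) * (2 * (b + 1) * ‖D F‖) := by gcongr
    _ = (σ * (4 * (b + 1) * ‖B ℓ‖) / 2 + τ * (4 * (b + 1) * |κ|) / 2) * ‖D F‖ := by ring
    _ ≤ η * ‖D F‖ := by
        gcongr
        have h1 : σ * (4 * (b + 1) * ‖B ℓ‖) ≤ σ * (4 * (b + 1) * (‖B ℓ‖ + 1)) := by
          gcongr; linarith
        have h2 : τ * (4 * (b + 1) * |κ|) ≤ τ * (4 * (b + 1) * (|κ| + 1)) := by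
          gcongr; linarith
        linarith

theorem isLimitDirection_self {X : ∀ p : M, TangentSpace (𝓡 2) p} {p : M}
    (hX : ContinuousAt (chartRep e X) (e p)) (hp : p ∈ e.source)
    (h0 : chartRep e X (e p) ≠ 0) : IsLimitDirection X X e p := by
  intro η hη
  have hc : ContinuousAt (fun q => chartRep e X (e q)) p :=
    ContinuousAt.comp (f := e) hX (e.continuousAt hp)
  have h1 : Tendsto (fun q => |det2 (chartRep e X (e q)) (chartRep e X (e p))|) (𝓝 p) (𝓝 0) := by
    have := (Tendsto.det2 hc (tendsto_const_nhds (x := chartRep e X (e p)))).abs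
    rwa [det2_self, abs_zero] at this
  have h2 : Tendsto (fun q => η * ‖chartRep e X (e q)‖) (𝓝 p) (𝓝 (η * ‖chartRep e X (e p)‖)) :=
    (hc.norm).const_mul η
  have h3 : 0 < η * ‖chartRep e X (e p)‖ := mul_pos hη (norm_pos_iff.2 h0)
  filter_upwards [h1.eventually_lt h2 h3] with q hq using hq.le

/-- In an adapted chart the zeroes are a segment of the axis, which has empty interior. Limit
directions are determined by X only because of this. -/
theorem IsTracked.frequently_ne_zero {X Y : VField M k} {K U : Set M} (h : IsTracked X Y K U)
    {p : M} (hp : p ∈ U) : ∃ᶠ q in 𝓝 p, X q ≠ 0 := by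
  by_cases hpK : p ∈ K
  · obtain ⟨γ, rfl, hγ, hγK⟩ := h.exists_curve hpK
    obtain ⟨e, r, he, -, hax⟩ := h.exists_isAdapted hγ hγK (h.mem_nhds hpK)
    have h0 : (0 : Plane) ∈ e.target := by rw [he.target]; exact Metric.mem_ball_self he.pos
    have hs : e.symm 0 = γ 0 := by
      rw [← hax 0 (by simpa using he.pos)]
      congr 1; ext i; fin_cases i <;> simp
    intro hev
    simp only [not_not] at hev
    have h1 : ∀ᶠ z in 𝓝 (0 : Plane), z 1 = 0 := by
      have h2 := (hev.and (h.mem_nhds hpK))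
      rw [← hs] at h2
      filter_upwards [(e.continuousAt_symm h0).eventually h2, e.open_target.mem_nhds h0]
        with z hz hzt
      exact (he.mem_iff z (he.target ▸ hzt)).1 ((h.mem_iff hz.2).2 hz.1)
    have h3 : Tendsto (fun s : ℝ => s • (!₂[0, 1] : Plane)) (𝓝 0) (𝓝 0) := by
      have : Continuous fun s : ℝ => s • (!₂[0, 1] : Plane) := by fun_prop
      simpa using this.tendsto 0
    have h4 : ∀ᶠ s : ℝ in 𝓝[≠] 0, s = 0 := by
      filter_upwards [mem_nhdsWithin_of_mem_nhds (h3.eventually h1)] with s hs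
      simpa using hs
    obtain ⟨s, hs0, hs1⟩ := (h4.and self_mem_nhdsWithin).exists
    exact hs1 hs0
  · have h0 : X p ≠ 0 := fun h0 => hpK ((h.mem_iff hp).2 h0)
    exact fun hev => hev.self_of_nhds h0

theorem IsTracked.exists_limitDirection_at {X Y : VField M k} {K U : Set M}
    (h : IsTracked X Y K U) {p : M} (hp : p ∈ U) : ∃ w : ∀ p : M, TangentSpace (𝓡 2) p, w p ≠ 0 ∧
      ∀ e ∈ IsManifold.maximalAtlas (𝓡 2) 1 M, p ∈ e.source → IsLimitDirection X w e p := by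
  by_cases hpK : p ∈ K
  · obtain ⟨e, he, hps, j, ρ, G, α, L, N, hc, hρ, hG, hj1, hjk, h0, hj⟩ :=
      exists_order_chart h.one_le X Y (h.not_flat p hpK) (h.ne_zero p hpK)
    obtain ⟨ℓ, hℓ, hlim⟩ := exists_limit_direction h.one_le h.tracks he hc hρ hG hjk hj1 h0 hj
    have hw : chartRep e (pushField e fun _ => ℓ) (e p) = ℓ :=
      chartRep_pushField_apply hc.mem _ hps
    refine ⟨pushField e fun _ => ℓ, fun hw0 => hℓ ?_, fun e' he' hps' => ?_⟩
    · rw [← hw]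
      exact (chartRep_apply_eq_zero hc.mem _ hps).2 hw0
    · refine IsLimitDirection.change hc.mem he' hps hps' fun η hη => ?_
      rw [hw]
      exact (e.continuousAt hps).eventually (hlim η hη)
  · have h0 : X p ≠ 0 := fun h0 => hpK ((h.mem_iff hp).2 h0)
    refine ⟨X, h0, fun e he hps => isLimitDirection_self ?_ hps fun h1 =>
      h0 ((chartRep_apply_eq_zero he X hps).1 h1)⟩
    exact (continuousOn_chartRep X he).continuousAt (e.open_target.mem_nhds (e.map_source hps))

theorem IsTracked.exists_limitDirection {X Y : VField M k} {K U : Set M}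
    (h : IsTracked X Y K U) : ∃ w : ∀ p : M, TangentSpace (𝓡 2) p, ∀ p ∈ U, w p ≠ 0 ∧
      ∀ e ∈ IsManifold.maximalAtlas (𝓡 2) 1 M, p ∈ e.source → IsLimitDirection X w e p := by
  classical
  choose w hw hlim using fun (p : M) (hp : p ∈ U) => h.exists_limitDirection_at hp
  let W : ∀ p : M, TangentSpace (𝓡 2) p := fun p => if hp : p ∈ U then w p hp p else 0
  refine ⟨W, fun p hp => ?_⟩
  have hwp : W p = w p hp p := dif_pos hp
  refine ⟨by rw [hwp]; exact hw p hp, fun e he hps η hη => ?_⟩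
  have h1 := hlim p hp e he hps η hη
  rw [chartRep_apply _ hps] at h1 ⊢
  rwa [hwp]

/-! ### The controlling line field -/

theorem mk_smul_eq {V : Type*} [AddCommGroup V] [Module ℝ V] {v w : V} (hv : v ≠ 0) (hw : w ≠ 0)
    {c : ℝ} (h : v = c • w) : Projectivization.mk ℝ v hv = Projectivization.mk ℝ w hw :=
  (Projectivization.mk_eq_mk_iff' ℝ v w hv hw).2 ⟨c, h.symm⟩

theorem eq_smul_of_chartRep (he : e ∈ IsManifold.maximalAtlas (𝓡 2) 1 M) {p : M}
    (hp : p ∈ e.source) {V W : ∀ p : M, TangentSpace (𝓡 2) p} {c : ℝ}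
    (h : chartRep e V (e p) = c • chartRep e W (e p)) : V p = c • W p :=
  eq_of_chartRep_eq (Y := fun q => c • W q) he hp
    (h.trans (chartRep_smul (fun _ => c) W (e p)).symm)

/-- The field of limit directions is continuous. -/
theorem IsTracked.exists_continuous_span {X Y : VField M k} {K U : Set M} (h : IsTracked X Y K U)
    {w : ∀ p : M, TangentSpace (𝓡 2) p} (hw : ∀ p ∈ U, w p ≠ 0 ∧
      ∀ e ∈ IsManifold.maximalAtlas (𝓡 2) 1 M, p ∈ e.source → IsLimitDirection X w e p)
    {p : M} (hp : p ∈ U) : ∃ W : Set M, IsOpen W ∧ p ∈ W ∧ ∃ v : ∀ q : M, TangentSpace (𝓡 2) q,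
      ContinuousOn (fun q : M => (⟨q, v q⟩ : TangentBundle (𝓡 2) M)) W ∧
      ∀ q ∈ W, ∃ c : ℝ, c ≠ 0 ∧ v q = c • w q := by
  set e := chartAt Plane p with he_def
  have hps : p ∈ e.source := mem_chart_source Plane p
  have he : e ∈ IsManifold.maximalAtlas (𝓡 2) (((0 : ℕ) : ℕ∞ω) + 1) M :=
    chartAt_mem_maximalAtlas _ p
  have he1 := mem_maximalAtlas_one he
  set S := U ∩ e.source with hS_def
  have hS : IsOpen S := h.isolating.1.inter e.open_source
  set ℓ : M → Plane := fun q => chartRep e w (e q) with hℓ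
  have hF : ∀ q ∈ S, ∀ η > 0, ∀ᶠ x in 𝓝 q,
      |det2 (chartRep e X (e x)) (ℓ q)| ≤ η * ‖chartRep e X (e x)‖ :=
    fun q hq => (hw q hq.1).2 e he1 hq.2
  have hd : ∀ q ∈ S, ∃ᶠ x in 𝓝 q, chartRep e X (e x) ≠ 0 := fun q hq =>
    ((h.frequently_ne_zero hq.1).and_eventually (e.open_source.mem_nhds hq.2)).mono
      fun x hx h0 => hx.1 ((chartRep_apply_eq_zero he1 X hx.2).1 h0)
  have hdir : ∀ q ∈ S, ∀ η > 0, ∀ᶠ x in 𝓝 q, |det2 (ℓ x) (ℓ q)| ≤ η * ‖ℓ x‖ :=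
    fun q hq η hη => eventually_abs_det2_le hS hF hd hq hη
  have hℓ0 : ∀ q ∈ S, ℓ q ≠ 0 := fun q hq h0 =>
    (hw q hq.1).1 ((chartRep_apply_eq_zero he1 w hq.2).1 h0)
  have hpS : p ∈ S := ⟨hp, hps⟩
  have hdot := eventually_dot2_ne_zero (hℓ0 p hpS)
    (by filter_upwards [hS.mem_nhds hpS] with q hq using hℓ0 q hq) (hdir p hpS)
  obtain ⟨W, hWs, hWo, hpW⟩ := mem_nhds_iff.1 (inter_mem hdot (hS.mem_nhds hpS))
  have hW1 : ∀ q ∈ W, dot2 (ℓ q) (ℓ p) ≠ 0 := fun q hq => (hWs hq).1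
  have hW2 : ∀ q ∈ W, q ∈ S := fun q hq => (hWs hq).2
  have hcont := continuousOn_normalized hW1 fun q hq => hdir q (hW2 q hq)
  -- The vectors ℓ q are chosen pointwise, with arbitrary length and sign; prescribing the scalar
  -- product with ℓ p selects a continuous section.
  set g : Plane → Plane := fun z => (dot2 (chartRep e w z) (ℓ p))⁻¹ • chartRep e w z with hg
  have hgs : ContDiffOn ℝ ((0 : ℕ) : ℕ∞ω) g (e.target ∩ e.symm ⁻¹' W) := by
    refine contDiffOn_zero.2 ?_
    refine (hcont.comp (e.continuousOn_symm.mono inter_subset_left) fun z hz => hz.2).congr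
      fun z hz => ?_
    simp only [hg, hℓ, Function.comp_apply, e.right_inv hz.1]
  refine ⟨W, hWo, hpW, pushField e g, ?_, fun q hq => ?_⟩
  · refine (contMDiffOn_pushField he hgs).continuousOn.mono fun q hq => ?_
    have hqs := (hW2 q hq).2
    refine ⟨hqs, e.map_source hqs, ?_⟩
    rwa [mem_preimage, e.left_inv hqs]
  · exact ⟨_, inv_ne_zero (hW1 q hq), eq_smul_of_chartRep he1 (hW2 q hq).2
      (chartRep_pushField_apply he1 g (hW2 q hq).2)⟩

/-- A line field that controls `X` consists of the limit directions of `X`. -/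
theorem IsTracked.line_eq {X Y : VField M k} {K U : Set M} (h : IsTracked X Y K U)
    {w : ∀ p : M, TangentSpace (𝓡 2) p} {Λ : LineField U} (hΛ : Λ.Controls X) (p : U)
    (hw0 : w p ≠ 0) (hw : ∀ e ∈ IsManifold.maximalAtlas (𝓡 2) 1 M, (p : M) ∈ e.source →
      IsLimitDirection X w e p) : Λ.line p = Projectivization.mk ℝ (w p) hw0 := by
  obtain ⟨W, hWo, hpW, v, hv, hline⟩ := Λ.continuous_line p
  set e := chartAt Plane (p : M) with he_def
  have hps : (p : M) ∈ e.source := mem_chart_source Plane (p : M)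
  have he : e ∈ IsManifold.maximalAtlas (𝓡 2) (((0 : ℕ) : ℕ∞ω) + 1) M :=
    chartAt_mem_maximalAtlas _ _
  have he1 := mem_maximalAtlas_one he
  set g : U → Plane := fun q => mfderiv (𝓡 2) 𝓘(ℝ, Plane) e (q : M) (v q) with hg
  have hgc : ContinuousAt g p := by
    have h1 : ContinuousOn (tangentMapWithin (𝓡 2) (𝓡 2) e e.source) _ :=
      ((contMDiffOn_of_mem_maximalAtlas he).contMDiffOn_tangentMapWithin (m := 0) (by simp)
        e.open_source.uniqueMDiffOn).continuousOn
    have hs : IsOpen (W ∩ Subtype.val ⁻¹' e.source) :=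
      hWo.inter (e.open_source.preimage continuous_subtype_val)
    have h2 := h1.comp (hv.mono (inter_subset_left (t := Subtype.val ⁻¹' e.source)))
      (fun q hq => hq.2)
    have h3 := (contMDiff_snd_tangentBundle_modelSpace Plane (𝓡 2)
      (n := 0)).continuous.comp_continuousOn h2
    refine (h3.congr fun q hq => ?_).continuousAt (hs.mem_nhds ⟨hpW, hps⟩)
    exact (DFunLike.congr_fun (mfderivWithin_of_isOpen (I := 𝓡 2) (I' := 𝓡 2) (f := e)
      e.open_source hq.2) (v q)).symm
  set ℓ := chartRep e w (e p) with hℓ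
  obtain ⟨hvp, hlp⟩ := hline p hpW
  have hdet : det2 (g p) ℓ = 0 := by
    by_contra hne
    have hpos : 0 < |det2 (g p) ℓ| := abs_pos.2 hne
    set η := |det2 (g p) ℓ| / (2 * (‖g p‖ + 1)) with hη
    have hη0 : 0 < η := by positivity
    have h1 : η * ‖g p‖ < |det2 (g p) ℓ| := by
      rw [hη, div_mul_eq_mul_div, div_lt_iff₀ (by positivity)]
      nlinarith [norm_nonneg (g p)]
    have h2 : ∀ᶠ q in 𝓝 p, η * ‖g q‖ < |det2 (g q) ℓ| :=
      Tendsto.eventually_lt ((hgc.norm).const_mul η)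
        ((Tendsto.det2 hgc tendsto_const_nhds).abs) h1
    have hmap := h.isolating.1.isOpenEmbedding_subtypeVal.map_nhds_eq p
    have h3 : ∃ᶠ q : U in 𝓝 p, X (q : M) ≠ 0 := by
      have := h.frequently_ne_zero p.2
      rwa [← hmap, frequently_map] at this
    have h4 : ∀ᶠ q : U in 𝓝 p, |det2 (chartRep e X (e q)) ℓ| ≤ η * ‖chartRep e X (e q)‖ := by
      have := hw e he1 hps η hη0
      rwa [← hmap, eventually_map] at this
    have h5 : ∀ᶠ q : U in 𝓝 p, (q : M) ∈ e.source :=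
      continuous_subtype_val.continuousAt.eventually (e.open_source.mem_nhds hps)
    -- At a point q near p with X ≠ 0 the line of Λ is spanned by X, whose direction is close to ℓ,
    -- while the direction of g stays away from ℓ.
    obtain ⟨q, hq0, hq2, hq4, hq5, hqW⟩ :=
      (h3.and_eventually (h2.and (h4.and (h5.and (hWo.mem_nhds hpW))))).exists
    obtain ⟨hvq, hlq⟩ := hline q hqW
    have hmem := hΛ q
    rw [hlq, Projectivization.submodule_mk, Submodule.mem_span_singleton] at hmem
    obtain ⟨a, ha⟩ := hmem
    have hFa : chartRep e X (e q) = a • g q := by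
      rw [chartRep_apply X hq5]
      exact (congrArg (mfderiv (𝓡 2) 𝓘(ℝ, Plane) e (q : M)) ha.symm).trans (map_smul _ a (v q))
    have ha0 : 0 < |a| := by
      refine abs_pos.2 fun ha0 => hq0 ?_
      rw [← ha, ha0, zero_smul]
    rw [hFa, det2_smul_left, abs_mul, norm_smul, Real.norm_eq_abs] at hq4
    have : |a| * |det2 (g q) ℓ| ≤ |a| * (η * ‖g q‖) := by linarith
    exact absurd (le_of_mul_le_mul_left this ha0) (not_le.2 hq2)
  have hℓ0 : ℓ ≠ 0 := fun h0 => hw0 ((chartRep_apply_eq_zero he1 w hps).1 h0)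
  obtain ⟨c, hc⟩ := eq_smul_of_det2_eq_zero hℓ0 hdet
  rw [hlp]
  refine mk_smul_eq hvp hw0 (c := c) ((mdifferentiable_of_mem he1).mfderiv_injective hps ?_)
  have h6 : ℓ = mfderiv (𝓡 2) 𝓘(ℝ, Plane) e (p : M) (w p) := chartRep_apply w hps
  have h7 : g p = c • mfderiv (𝓡 2) 𝓘(ℝ, Plane) e (p : M) (w p) := by rw [hc, h6]; rfl
  exact h7.trans (map_smul _ c (w p)).symm

theorem IsTracked.existsUnique_lineField {X Y : VField M k} {K U : Set M}
    (h : IsTracked X Y K U) : ∃! Λ : LineField U, Λ.Controls X := by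
  obtain ⟨w, hw⟩ := h.exists_limitDirection
  let Λ : LineField U :=
    { line := fun p => Projectivization.mk ℝ (w p) (hw p p.2).1
      continuous_line := fun p => by
        obtain ⟨W, hWo, hpW, v, hv, hvw⟩ := h.exists_continuous_span hw p.2
        refine ⟨Subtype.val ⁻¹' W, hWo.preimage continuous_subtype_val, hpW, fun q => v q,
          hv.comp continuous_subtype_val.continuousOn fun q hq => hq, fun q hq => ?_⟩
        obtain ⟨c, hc, hvc⟩ := hvw q hq
        have h0 : v q ≠ 0 := by rw [hvc]; exact smul_ne_zero hc (hw q q.2).1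
        exact ⟨h0, (mk_smul_eq h0 (hw q q.2).1 hvc).symm⟩ }
  refine ⟨Λ, fun p => ?_, fun Λ' hΛ' => ?_⟩
  · show X p ∈ (Projectivization.mk ℝ (w p) (hw p p.2).1).submodule
    rw [Projectivization.submodule_mk, Submodule.mem_span_singleton]
    have he1 := chartAt_mem_maximalAtlas (M := M) 1 (p : M)
    set e := chartAt Plane (p : M)
    have hps : (p : M) ∈ e.source := mem_chart_source Plane (p : M)
    have hdet : det2 (chartRep e X (e p)) (chartRep e w (e p)) = 0 := by
      rw [← abs_eq_zero]
      refine le_antisymm (le_of_forall_pos_le_add fun ε hε => ?_) (abs_nonneg _)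
      have h1 := ((hw p p.2).2 e he1 hps (ε / (‖chartRep e X (e p)‖ + 1))
        (by positivity)).self_of_nhds
      refine h1.trans ?_
      rw [div_mul_eq_mul_div, div_le_iff₀ (by positivity)]
      nlinarith [norm_nonneg (chartRep e X (e p))]
    obtain ⟨c, hc⟩ := eq_smul_of_det2_eq_zero
      (fun h0 => (hw p p.2).1 ((chartRep_apply_eq_zero he1 w hps).1 h0)) hdet
    exact ⟨c, (eq_smul_of_chartRep he1 hps hc).symm⟩
  · have hl : Λ'.line = Λ.line := funext fun p => h.line_eq hΛ' p (hw p p.2).1 (hw p p.2).2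
    cases Λ'
    simp only at hl
    subst hl
    rfl

end LimitDirection

/-! ### Fields that push the zeroes away -/

section Push

variable {M : Type*} [TopologicalSpace M] [T2Space M] [ChartedSpace Plane M]
  [IsManifold (𝓡 2) ω M] {k : ℕ} {e e' : OpenPartialHomeomorph M Plane}

/-- Near `p`, the positive multiples of `V` added to `X` have no zeroes. -/
def Pushes (X V : ∀ p : M, TangentSpace (𝓡 2) p) (p : M) : Prop :=
  ∀ᶠ q in 𝓝 p, ∀ ε : ℝ, 0 < ε → X q + ε • V q ≠ 0

theorem isOpen_pushes (X V : ∀ p : M, TangentSpace (𝓡 2) p) : IsOpen {p | Pushes X V p} :=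
  isOpen_iff_mem_nhds.2 fun _ hp => eventually_eventually_nhds.2 hp

theorem Pushes.congr {X V V' : ∀ p : M, TangentSpace (𝓡 2) p} {p : M} (h : Pushes X V p)
    (hV : ∀ᶠ q in 𝓝 p, V' q = V q) : Pushes X V' p := by
  filter_upwards [h, hV] with q hq hqV
  rwa [hqV]

/-- Pushing allows every ε > 0, so V may be multiplied by a cutoff χ: where χ > 0 the factor εχ
still pushes, and where χ = 0 the point is off K and X itself is nonzero. -/
theorem IsTracked.exists_perturbation_of_pushes {X Y : VField M k} {K U : Set M}
    (h : IsTracked X Y K U) {V : VField M k} (hV : ∀ p ∈ K, Pushes X V p) :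
    ∃ W : VField M k, (∃ C, IsCompact C ∧ C ⊆ U ∧ ∀ p ∉ C, W p = 0) ∧
      ∀ ε : ℝ, 0 < ε → ∀ p ∈ U, X p + ε • W p ≠ 0 := by
  obtain ⟨χ, hχ, ⟨N, -, hKN, hN⟩, hcs, hts, hI⟩ := exists_smooth_cutoff h.isCompact
    (h.isolating.1.inter (isOpen_pushes X V)) fun p hp => ⟨h.subset hp, hV p hp⟩
  refine ⟨V.mulFun (hχ.of_le (by exact_mod_cast le_top) : ContMDiff (𝓡 2) 𝓘(ℝ, ℝ) k χ),
    ⟨_, hcs, fun p hp => (hts hp).1, fun p hp => ?_⟩, fun ε hε p hp => ?_⟩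
  · rw [VField.mulFun_apply, image_eq_zero_of_notMem_tsupport hp, zero_smul]
  · rw [VField.mulFun_apply, smul_smul]
    rcases (hI p).1.eq_or_lt with h0 | h0
    · rw [← h0, mul_zero, zero_smul, add_zero]
      intro hX
      have := hN p (hKN ((h.mem_iff hp).2 hX))
      rw [← h0] at this
      exact zero_ne_one this
    · exact (hts (subset_tsupport _ (Function.mem_support.2 h0.ne'))).2.self_of_nhds _
        (mul_pos hε h0)

theorem exists_pushes_union {X V₁ V₂ : VField M k} {K₁ K₂ : Set M} (hK₁ : IsCompact K₁)
    (hK₂ : IsClosed K₂) (hd : Disjoint K₁ K₂) (h₁ : ∀ p ∈ K₁, Pushes X V₁ p)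
    (h₂ : ∀ p ∈ K₂, Pushes X V₂ p) : ∃ V : VField M k, ∀ p ∈ K₁ ∪ K₂, Pushes X V p := by
  obtain ⟨χ, hχ, ⟨N, hNo, hKN, hN⟩, -, hts, -⟩ := exists_smooth_cutoff hK₁ hK₂.isOpen_compl
    (subset_compl_iff_disjoint_right.2 hd)
  refine ⟨V₂ + (V₁ - V₂).mulFun (hχ.of_le (by exact_mod_cast le_top) :
    ContMDiff (𝓡 2) 𝓘(ℝ, ℝ) k χ), ?_⟩
  rintro p (hp | hp)
  · refine (h₁ p hp).congr ?_
    filter_upwards [hNo.mem_nhds (hKN hp)] with q hq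
    show V₂ q + χ q • (V₁ q - V₂ q) = V₁ q
    rw [hN q hq, one_smul, add_sub_cancel]
  · refine (h₂ p hp).congr ?_
    have : (tsupport χ)ᶜ ∈ 𝓝 p := (isClosed_tsupport χ).isOpen_compl.mem_nhds fun h => hts h hp
    filter_upwards [this] with q hq
    show V₂ q + χ q • (V₁ q - V₂ q) = V₂ q
    rw [image_eq_zero_of_notMem_tsupport hq, zero_smul, add_zero]

theorem chartRep_add_smul (X V : ∀ p : M, TangentSpace (𝓡 2) p) (ε : ℝ) {q : M}
    (hq : q ∈ e.source) (h : X q + ε • V q = 0) :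
    chartRep e X (e q) + ε • chartRep e V (e q) = 0 := by
  rw [chartRep_apply X hq, chartRep_apply V hq]
  have h1 := map_add (mfderiv (𝓡 2) 𝓘(ℝ, Plane) e q) (X q) (ε • V q)
  have h2 := map_smul (mfderiv (𝓡 2) 𝓘(ℝ, Plane) e q) ε (V q)
  have h3 := (congrArg (mfderiv (𝓡 2) 𝓘(ℝ, Plane) e q) h).trans
    (map_zero (mfderiv (𝓡 2) 𝓘(ℝ, Plane) e q))
  exact ((congrArg (mfderiv (𝓡 2) 𝓘(ℝ, Plane) e q (X q) + ·) h2).symm.trans h1.symm).trans h3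

/-- A zero of X + εV would make V parallel to X, hence nearly parallel to the limit direction,
whereas V stays transverse to it. -/
theorem pushes_of_isLimitDirection {X w V : ∀ p : M, TangentSpace (𝓡 2) p} {p : M}
    (hp : p ∈ e.source) (hw : IsLimitDirection X w e p)
    (hV : ContinuousAt (chartRep e V) (e p))
    (hd : det2 (chartRep e V (e p)) (chartRep e w (e p)) ≠ 0) : Pushes X V p := by
  set ℓ := chartRep e w (e p) with hℓ
  have hc : ContinuousAt (fun q => chartRep e V (e q)) p :=
    ContinuousAt.comp (f := e) hV (e.continuousAt hp)
  set v := chartRep e V (e p) with hv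
  have hpos : 0 < |det2 v ℓ| := abs_pos.2 hd
  set η := |det2 v ℓ| / (2 * (‖v‖ + 1)) with hη
  have hη0 : 0 < η := by positivity
  have h1 : η * ‖v‖ < |det2 v ℓ| := by
    rw [hη, div_mul_eq_mul_div, div_lt_iff₀ (by positivity)]
    nlinarith [norm_nonneg v]
  have h2 : ∀ᶠ q in 𝓝 p, η * ‖chartRep e V (e q)‖ < |det2 (chartRep e V (e q)) ℓ| :=
    Tendsto.eventually_lt ((hc.norm).const_mul η) ((Tendsto.det2 hc tendsto_const_nhds).abs) h1
  filter_upwards [h2, hw η hη0, e.open_source.mem_nhds hp] with q hq1 hq2 hqs ε hε h0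
  have h3 := eq_neg_of_add_eq_zero_left (chartRep_add_smul X V ε hqs h0)
  rw [h3, ← neg_smul, det2_smul_left, abs_mul, norm_smul, Real.norm_eq_abs, abs_neg,
    abs_of_pos hε] at hq2
  have : ε * |det2 (chartRep e V (e q)) ℓ| ≤ ε * (η * ‖chartRep e V (e q)‖) := by linarith
  exact absurd (le_of_mul_le_mul_left this hε) (not_le.2 hq1)

theorem IsLimitDirection.of_smul {X w w' : ∀ p : M, TangentSpace (𝓡 2) p} {p : M} {c : ℝ}
    (h : IsLimitDirection X w e p) (hc : chartRep e w' (e p) = c • chartRep e w (e p)) :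
    IsLimitDirection X w' e p := by
  intro η hη
  filter_upwards [h (η / (|c| + 1)) (by positivity)] with q hq
  rw [hc, det2_smul_right, abs_mul]
  calc |c| * |det2 (chartRep e X (e q)) (chartRep e w (e p))|
      ≤ (|c| + 1) * (η / (|c| + 1) * ‖chartRep e X (e q)‖) := by gcongr; linarith
    _ = η * ‖chartRep e X (e q)‖ := by field_simp

/-- Were the limit direction transverse to Y, the field σY would push. -/
theorem IsTracked.isLimitDirection_of_not_pushes {X Y : VField M k} {K U : Set M}
    (h : IsTracked X Y K U) {p : M} (hp : p ∈ K) {σ : ℝ} (hσ : σ ≠ 0)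
    (hn : ¬ Pushes X (fun q => σ • Y q) p) (he : e ∈ IsManifold.maximalAtlas (𝓡 2) 1 M)
    (hps : p ∈ e.source) : IsLimitDirection X Y e p := by
  obtain ⟨w, hw0, hw⟩ := h.exists_limitDirection_at (h.subset hp)
  have hrep : ∀ z, chartRep e (fun q => σ • Y q) z = σ • chartRep e Y z :=
    fun z => chartRep_smul (fun _ => σ) Y z
  have hc : ContinuousAt (chartRep e Y) (e p) :=
    (continuousOn_chartRep Y he).continuousAt (e.open_target.mem_nhds (e.map_source hps))
  have hdet : det2 (chartRep e Y (e p)) (chartRep e w (e p)) = 0 := by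
    by_contra hne
    refine hn (pushes_of_isLimitDirection hps (hw e he hps) ?_ ?_)
    · exact (hc.const_smul σ).congr (Eventually.of_forall fun z => (hrep z).symm)
    · rw [hrep, det2_smul_left]
      exact mul_ne_zero hσ hne
  obtain ⟨c, hc⟩ := eq_smul_of_det2_eq_zero
    (fun h0 => hw0 ((chartRep_apply_eq_zero he w hps).1 h0)) hdet
  exact (hw e he hps).of_smul hc

theorem IsChartFlow.mono {Y : ∀ p : M, TangentSpace (𝓡 2) p} {z₀ : Plane} {ρ ρ' : ℝ}
    {G : Plane → Plane} {α : Plane → ℝ → Plane} {L N : NNReal}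
    (h : IsChartFlow e Y z₀ ρ G α L N) (hρ : ρ' ≤ ρ) : IsChartFlow e Y z₀ ρ' G α L N where
  mem := h.mem
  flow := h.flow
  subset := (Metric.closedBall_subset_closedBall hρ).trans h.subset
  eq := h.eq.mono (Metric.closedBall_subset_closedBall hρ)

/-- A point where `X` is antiparallel to `σ Y` stays so along the flow of `Y`. -/
theorem antiparallel_flow (hk : 1 ≤ k) {X Y : VField M k} (hT : Tracks Y X) {z₀ : Plane} {ρ : ℝ}
    {G : Plane → Plane} {α : Plane → ℝ → Plane} {L N : NNReal}
    (he : e ∈ IsManifold.maximalAtlas (𝓡 2) ((k : ℕ∞ω) + 1) M)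
    (h : IsChartFlow e Y z₀ ρ G α L N) (hG : ∀ z ∈ Metric.closedBall z₀ ρ, G z ≠ 0)
    {σ ε t : ℝ} (hε : 0 < ε) (hσ : σ ≠ 0) {z : Plane} (ht : 2 * N * |t| + ‖z - z₀‖ < ρ)
    (hz : chartRep e X z + (ε * σ) • G z = 0) :
    ∃ ε' > 0, chartRep e X (α z t) + (ε' * σ) • G (α z t) = 0 := by
  set F := chartRep e X with hF
  have hs : ∀ s ∈ uIcc 0 t, 2 * N * |s| + ‖z - z₀‖ < ρ := fun s hs => by
    have h1 : |s| ≤ |t| := by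
      have := abs_sub_left_of_mem_uIcc hs
      simpa using this
    have : 2 * (N : ℝ) * |s| ≤ 2 * N * |t| := by gcongr
    linarith
  have hmem : ∀ s ∈ uIcc 0 t, α z s ∈ Metric.closedBall z₀ ρ := fun s hs' =>
    Metric.ball_subset_closedBall (h.mem_ball (small_of_small (hs s hs')))
  have hz0 : z ∈ Metric.closedBall z₀ ρ := by
    have := hmem 0 left_mem_uIcc
    rwa [h.flow.zero] at this
  have hFz : F z = (-(ε * σ)) • G z := by rw [neg_smul]; exact eq_neg_of_add_eq_zero_left hz
  have hFz0 : F z ≠ 0 := by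
    rw [hFz]
    exact smul_ne_zero (neg_ne_zero.2 (mul_ne_zero hε.ne' hσ)) (hG z hz0)
  have hpar : ∀ s ∈ uIcc 0 t, ∃ c : ℝ, F (α z s) = c • G (α z s) := fun s hs' =>
    eq_smul_of_det2_eq_zero (hG _ (hmem s hs')) (det2_flow_eq_zero hk hT he h
      (small_of_small (hs s hs')) (hG z hz0) (by
        show det2 (F z) (G z) = 0
        rw [hFz, det2_smul_left, det2_self, mul_zero]))
  have hne : ∀ s ∈ uIcc 0 t, F (α z s) ≠ 0 := fun s hs' h0 => by
    rw [hF, chartRep_eq_zero h.mem X (h.subset (hmem s hs')),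
      hT.eq_zero_iff hk h (hs s hs'), ← chartRep_eq_zero h.mem X (h.subset hz0)] at h0
    exact hFz0 h0
  -- The sign of d distinguishes parallel from antiparallel. Along the trajectory X stays a nonzero
  -- multiple of Y, so d does not vanish and keeps its negative sign.
  set d : ℝ → ℝ := fun s => σ * dot2 (F (α z s)) (G (α z s)) with hd
  have hdot : ∀ s ∈ uIcc 0 t, ∀ c : ℝ, F (α z s) = c • G (α z s) →
      d s = (σ * c) * ‖G (α z s)‖ ^ 2 := fun s _ c hc => by
    simp only [hd, hc, sq_norm_plane, dot2, PiLp.smul_apply, smul_eq_mul]; ring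
  have hdc : ContinuousOn d (uIcc 0 t) := by
    have hFc : ContinuousOn (fun s => F (α z s)) (uIcc 0 t) :=
      (continuousOn_chartRep X h.mem).comp (h.flow.continuous z).continuousOn
        fun s hs' => h.subset (hmem s hs')
    have hGc : Continuous fun s => G (α z s) := h.flow.lip.continuous.comp (h.flow.continuous z)
    have h0 : ∀ i : Fin 2, ContinuousOn (fun s => F (α z s) i) (uIcc 0 t) := fun i =>
      (EuclideanSpace.proj i : Plane →L[ℝ] ℝ).continuous.comp_continuousOn hFc
    have h1 : ∀ i : Fin 2, ContinuousOn (fun s => G (α z s) i) (uIcc 0 t) := fun i =>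
      ((EuclideanSpace.proj i : Plane →L[ℝ] ℝ).continuous.comp hGc).continuousOn
    exact continuousOn_const.mul (((h0 0).mul (h1 0)).add ((h0 1).mul (h1 1)))
  have hd0 : d 0 < 0 := by
    rw [hdot 0 left_mem_uIcc (-(ε * σ)) (by rw [h.flow.zero]; exact hFz), h.flow.zero]
    have := norm_pos_iff.2 (hG z hz0)
    have h2 : 0 < ε * σ ^ 2 := by positivity
    have h3 : 0 < (ε * σ ^ 2) * ‖G z‖ ^ 2 := by positivity
    linarith
  have hdt : d t < 0 := by
    by_contra hge
    obtain ⟨s, hs', hs0⟩ := intermediate_value_uIcc hdc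
      (show (0 : ℝ) ∈ uIcc (d 0) (d t) from mem_uIcc_of_le hd0.le (not_lt.1 hge))
    obtain ⟨c, hc⟩ := hpar s hs'
    have h1 := norm_pos_iff.2 (hG _ (hmem s hs'))
    rw [hdot s hs' c hc] at hs0
    have hc0 : c = 0 := by
      rcases mul_eq_zero.1 hs0 with h2 | h2
      · exact (mul_eq_zero.1 h2).resolve_left hσ
      · exact absurd h2 (by positivity)
    exact hne s hs' (by rw [hc, hc0, zero_smul])
  obtain ⟨c, hc⟩ := hpar t right_mem_uIcc
  rw [hdot t right_mem_uIcc c hc] at hdt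
  have hσc : σ * c < 0 := by
    by_contra hge
    have := mul_nonneg (not_lt.1 hge) (sq_nonneg ‖G (α z t)‖)
    linarith
  refine ⟨-(σ * c) / σ ^ 2, by have := neg_pos.2 hσc; positivity, ?_⟩
  have : -(σ * c) / σ ^ 2 * σ = -c := by field_simp
  rw [this, hc, neg_smul, add_neg_cancel]

/-- A point of K near p is Φ_t(p) for a short time t. A zero of X + εσY near p is carried by Φ_t to
a zero of X + ε'σY, with ε' > 0, near that point. So if σY pushed there, it would push at p. -/
theorem IsTracked.eventually_not_pushes {X Y : VField M k} {K U : Set M}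
    (h : IsTracked X Y K U) {p : M} (hp : p ∈ K) {σ : ℝ} (hσ : σ ≠ 0)
    (hn : ¬ Pushes X (fun q => σ • Y q) p) :
    ∀ᶠ q in 𝓝 p, q ∈ K → ¬ Pushes X (fun q => σ • Y q) q := by
  have hps := mem_chart_source Plane p
  have he : chartAt Plane p ∈ IsManifold.maximalAtlas (𝓡 2) ((k : ℕ∞ω) + 1) M :=
    chartAt_mem_maximalAtlas _ p
  obtain ⟨ρ₀, hρ₀, G, α, L, N, hc₀⟩ := exists_isChartFlow h.one_le Y he (mem_chart_target Plane p)
  set e := chartAt Plane p with he_def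
  have hG0 : G (e p) ≠ 0 := by
    rw [hc₀.eq (Metric.mem_closedBall_self hρ₀.le)]
    exact fun h0 => h.ne_zero p hp ((chartRep_apply_eq_zero hc₀.mem Y hps).1 h0)
  obtain ⟨ρ₁, hρ₁, hGρ⟩ := Metric.nhds_basis_closedBall.mem_iff.1
    (hc₀.flow.lip.continuous.continuousAt.eventually_ne hG0)
  set ρ := min ρ₀ ρ₁ with hρ_def
  have hρ : 0 < ρ := lt_min hρ₀ hρ₁
  have hc := hc₀.mono (min_le_left ρ₀ ρ₁)
  have hG : ∀ z ∈ Metric.closedBall (e p) ρ, G z ≠ 0 := fun z hz =>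
    hGρ (Metric.closedBall_subset_closedBall (min_le_right _ _) hz)
  have hN := N.coe_nonneg
  have hδ : 0 < ρ / (4 * (N + 1)) := by positivity
  filter_upwards [h.tracks.eventually_flowRel h.one_le (h.not_flat p hp) (h.ne_zero p hp) hδ]
    with q hq hqK hpush
  obtain ⟨t, ht, hflow⟩ := hq (h.eq_zero hqK)
  have ht' : 2 * N * |t| < ρ / 2 := by
    rw [lt_div_iff₀ (by positivity)] at ht
    nlinarith [abs_nonneg t]
  have hsm : 2 * N * |t| + ‖e p - e p‖ < ρ := by
    rw [sub_self, norm_zero]; linarith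
  have hqα : e.symm (α (e p) t) = q := by
    have := hc.flowRel (small_of_small hsm)
    rw [e.left_inv hps] at this
    exact this.unique h.one_le hflow
  have htend : Tendsto (fun x => e.symm (α (e x) t)) (𝓝 p) (𝓝 q) := by
    rw [← hqα]
    exact (e.continuousAt_symm (hc.mem_target (small_of_small hsm))).tendsto.comp
      (((hc.flow.continuous_left t).tendsto (e p)).comp (e.continuousAt hps))
  have hnear : ∀ᶠ x in 𝓝 p, 2 * N * |t| + ‖e x - e p‖ < ρ := by
    have := (e.continuousAt hps).eventually (Metric.ball_mem_nhds (e p) (half_pos hρ))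
    filter_upwards [this] with x hx
    rw [dist_eq_norm] at hx
    linarith
  refine hn ?_
  filter_upwards [htend.eventually hpush, hnear, e.open_source.mem_nhds hps]
    with x hx1 hx2 hxs ε hε h0
  have hxρ : e x ∈ Metric.closedBall (e p) ρ := by
    rw [mem_closedBall_iff_norm]
    have := mul_nonneg hN (abs_nonneg t)
    linarith
  have h1 := chartRep_add_smul X (fun q => σ • Y q) ε hxs h0
  have h2 : chartRep e (fun q => σ • Y q) (e x) = σ • chartRep e Y (e x) :=
    chartRep_smul (fun _ => σ) Y _
  rw [h2, smul_smul, ← hc.eq hxρ] at h1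
  obtain ⟨ε', hε', h3⟩ := antiparallel_flow h.one_le h.tracks he hc hG hε hσ hx2 h1
  have hmb := Metric.ball_subset_closedBall (hc.mem_ball (small_of_small hx2))
  rw [hc.eq hmb] at h3
  set y := e.symm (α (e x) t) with hy
  have hys : y ∈ e.source := e.map_target (hc.subset hmb)
  have hey : e y = α (e x) t := e.right_inv (hc.subset hmb)
  refine hx1 ε' hε' ?_
  rw [← hey] at h3
  have h4 : chartRep e (fun q => X q + ε' • σ • Y q) (e y) = 0 := by
    have h5 : chartRep e (fun q => X q + (ε' * σ) • Y q) (e y) =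
        chartRep e X (e y) + (ε' * σ) • chartRep e Y (e y) :=
      (chartRep_add X (fun q => (ε' * σ) • Y q) (e y)).trans
        (congrArg (chartRep e X (e y) + ·) (chartRep_smul (fun _ => ε' * σ) Y (e y)))
    simp only [smul_smul]
    exact h5.trans h3
  exact (chartRep_apply_eq_zero hc.mem _ hys).1 h4

end Push

/-! ### The case of opposite directions on the two sides -/

section Sides

variable {M : Type*} [TopologicalSpace M] [T2Space M] [ChartedSpace Plane M]
  [IsManifold (𝓡 2) ω M] {k : ℕ} {e e' : OpenPartialHomeomorph M Plane}

theorem exists_constant_sign {A : Type*} [TopologicalSpace A] {S : Set A} (hS : IsPreconnected S)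
    {f : A → ℝ} (hf : ContinuousOn f S) (h0 : ∀ x ∈ S, f x ≠ 0) :
    ∃ σ : ℝ, (σ = 1 ∨ σ = -1) ∧ ∀ x ∈ S, 0 < σ * f x := by
  by_cases h : ∀ x ∈ S, 0 < f x
  · exact ⟨1, Or.inl rfl, fun x hx => by rw [one_mul]; exact h x hx⟩
  · push Not at h
    obtain ⟨a, ha, hfa⟩ := h
    refine ⟨-1, Or.inr rfl, fun x hx => ?_⟩
    by_contra hx0
    have h1 : 0 ≤ f x := by linarith
    obtain ⟨y, hy, hy0⟩ := hS.intermediate_value ha hx hf ⟨hfa, h1⟩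
    exact h0 y hy hy0

/-- On the side `0 < σ y` of the first axis in the chart `e`, the field `X` has a positive first
component, and on the other side a negative one. -/
def SideSign (X : ∀ p : M, TangentSpace (𝓡 2) p) (e : OpenPartialHomeomorph M Plane) (σ : ℝ)
    (q : M) : Prop :=
  q ∈ e.source ∧ (e q 1 ≠ 0 → 0 < σ * e q 1 * chartRep e X (e q) 0)

theorem convex_half_ball (δ τ : ℝ) : Convex ℝ {z : Plane | z ∈ Metric.ball (0 : Plane) δ ∧ 0 < τ * z 1} :=
  (convex_ball 0 δ).inter (convex_halfSpace_gt (f := fun z : Plane => τ * z 1)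
    ⟨fun x y => by simp [mul_add], fun c x => by simp; ring⟩ 0)

/-- As neither Y nor -Y pushes, the limit direction is that of Y, the first axis. So off K the first
component of X is nonzero and has a constant sign on each half ball; the two signs must differ. -/
theorem IsTracked.exists_sideSign {X Y : VField M k} {K U : Set M} (h : IsTracked X Y K U)
    {p : M} (hp : p ∈ K) (h1 : ¬ Pushes X (fun q => (1 : ℝ) • Y q) p)
    (h2 : ¬ Pushes X (fun q => (-1 : ℝ) • Y q) p) :
    ∃ e r σ, IsAdapted Y K e r ∧ p ∈ e.source ∧ σ ≠ 0 ∧ ∀ᶠ q in 𝓝 p, SideSign X e σ q := by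
  obtain ⟨γ, rfl, hγ, hγK⟩ := h.exists_curve hp
  obtain ⟨e, r, he, heU, hax⟩ := h.exists_isAdapted hγ hγK (h.mem_nhds hp)
  have he1 := mem_maximalAtlas_one he.mem
  have h0t : (0 : Plane) ∈ e.target := by rw [he.target]; exact Metric.mem_ball_self he.pos
  have hs0 : e.symm 0 = γ 0 := by
    rw [← hax 0 (by simpa using he.pos)]
    congr 1; ext i; fin_cases i <;> simp
  have hps : γ 0 ∈ e.source := by rw [← hs0]; exact e.map_target h0t
  have hp0 : e (γ 0) = 0 := by rw [← hs0, e.right_inv h0t]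
  have hlim := h.isLimitDirection_of_not_pushes hp one_ne_zero h1 he1 hps
  set F := chartRep e X with hF
  have hY0 : chartRep e Y (e (γ 0)) = !₂[1, 0] := by
    rw [hp0]; exact he.field 0 (Metric.mem_ball_self he.pos) rfl
  have hdetax : ∀ v : Plane, det2 v !₂[1, 0] = -v 1 := fun v => by simp [det2]
  have hev : ∀ᶠ z in 𝓝 (0 : Plane), |F z 1| ≤ 1 / 2 * ‖F z‖ ∧ 0 < chartRep e Y z 0 := by
    have h3 := hlim (1 / 2) (by norm_num)
    rw [hY0] at h3
    simp only [hdetax, abs_neg] at h3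
    rw [← hs0] at h3
    have h4 := (e.continuousAt_symm h0t).eventually h3
    have h5 : ContinuousAt (fun z => chartRep e Y z 0) 0 :=
      (EuclideanSpace.proj 0 : Plane →L[ℝ] ℝ).continuous.continuousAt.comp
        ((continuousOn_chartRep Y he1).continuousAt (e.open_target.mem_nhds h0t))
    have h6 : (0 : ℝ) < chartRep e Y 0 0 := by rw [← hp0, hY0]; simp
    filter_upwards [h4, e.open_target.mem_nhds h0t, h5.eventually (lt_mem_nhds h6)] with z hz hzt hz2
    rw [e.right_inv hzt] at hz
    exact ⟨hz, hz2⟩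
  obtain ⟨δ₀, hδ₀, hδ⟩ := Metric.nhds_basis_ball.mem_iff.1 hev
  set δ := min δ₀ r with hδ_def
  have hδ0 : 0 < δ := lt_min hδ₀ he.pos
  have hball : ∀ z ∈ Metric.ball (0 : Plane) δ, z ∈ Metric.ball (0 : Plane) r ∧ z ∈ e.target ∧
      |F z 1| ≤ 1 / 2 * ‖F z‖ ∧ 0 < chartRep e Y z 0 := fun z hz => by
    have hzr := Metric.ball_subset_ball (min_le_right δ₀ r) hz
    exact ⟨hzr, he.target ▸ hzr, hδ (Metric.ball_subset_ball (min_le_left δ₀ r) hz)⟩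
  have hzero : ∀ z ∈ Metric.ball (0 : Plane) δ, F z = 0 ↔ z 1 = 0 := fun z hz => by
    obtain ⟨hzr, hzt, -⟩ := hball z hz
    rw [hF, chartRep_eq_zero he1 X hzt, ← h.mem_iff (heU (e.map_target hzt)), he.mem_iff z hzr]
  have hF0 : ∀ z ∈ Metric.ball (0 : Plane) δ, z 1 ≠ 0 → F z 0 ≠ 0 := fun z hz hz1 h0 => by
    have h3 := (hball z hz).2.2.1
    have h4 : ‖F z‖ ^ 2 = F z 1 ^ 2 := by rw [sq_norm_plane, h0]; ring
    have h5 : 0 < ‖F z‖ := norm_pos_iff.2 fun h5 => hz1 ((hzero z hz).1 h5)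
    have h6 : |F z 1| = ‖F z‖ := by
      rw [← sq_eq_sq₀ (abs_nonneg _) (norm_nonneg _), sq_abs, h4]
    linarith
  have hside : ∀ τ : ℝ, τ ≠ 0 → ∃ σ : ℝ, (σ = 1 ∨ σ = -1) ∧
      ∀ z ∈ Metric.ball (0 : Plane) δ, 0 < τ * z 1 → 0 < σ * F z 0 := fun τ hτ => by
    obtain ⟨σ, hσ, h3⟩ := exists_constant_sign (convex_half_ball δ τ).isPreconnected
      (f := fun z => F z 0) ((EuclideanSpace.proj 0 : Plane →L[ℝ] ℝ).continuous.comp_continuousOn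
        ((continuousOn_chartRep X he1).mono fun z hz => (hball z hz.1).2.1))
      (fun z hz => hF0 z hz.1 fun h0 => by
        have := hz.2
        rw [h0, mul_zero] at this
        exact lt_irrefl _ this)
    exact ⟨σ, hσ, fun z hz hz1 => h3 z ⟨hz, hz1⟩⟩
  obtain ⟨σ, hσ, hup⟩ := hside 1 one_ne_zero
  obtain ⟨σ', hσ', hdown⟩ := hside (-1) (by norm_num)
  have hnear : ∀ᶠ q in 𝓝 (γ 0), q ∈ e.source ∧ e q ∈ Metric.ball (0 : Plane) δ := by
    have := e.continuousAt hps
    rw [ContinuousAt, hp0] at this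
    filter_upwards [e.open_source.mem_nhds hps, this (Metric.ball_mem_nhds 0 hδ0)] with q h3 h4
    exact ⟨h3, h4⟩
  -- With the same sign σ on both sides, the first components of X and of σY could not cancel, and
  -- σY would push.
  have hne : σ ≠ σ' := by
    rintro rfl
    have hpush : Pushes X (fun q => σ • Y q) (γ 0) := by
      filter_upwards [hnear] with q hq ε hε h0
      have h3 := chartRep_add_smul X (fun q => σ • Y q) ε hq.1 h0
      have h4 : chartRep e (fun q => σ • Y q) (e q) = σ • chartRep e Y (e q) :=
        chartRep_smul (fun _ => σ) Y _
      rw [h4] at h3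
      have h5 : F (e q) 0 + ε * (σ * chartRep e Y (e q) 0) = 0 := by
        have := congrArg (fun w : Plane => w 0) h3
        simpa using this
      have h6 : 0 ≤ σ * F (e q) 0 := by
        rcases lt_trichotomy (e q 1) 0 with h7 | h7 | h7
        · exact (hdown _ hq.2 (by linarith)).le
        · rw [(hzero _ hq.2).2 h7]; simp
        · exact (hup _ hq.2 (by linarith)).le
      have h7 := (hball _ hq.2).2.2.2
      have h8 : σ * σ = 1 := by rcases hσ with rfl | rfl <;> norm_num
      have h9 : 0 < ε * chartRep e Y (e q) 0 := mul_pos hε h7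
      have h10 : σ * F (e q) 0 + (σ * σ) * (ε * chartRep e Y (e q) 0) = 0 := by
        linear_combination σ * h5
      rw [h8] at h10
      linarith
    rcases hσ with rfl | rfl
    · exact h1 hpush
    · exact h2 hpush
  have hσσ : σ' = -σ := by
    rcases hσ with rfl | rfl <;> rcases hσ' with rfl | rfl <;> simp_all
  refine ⟨e, r, σ, he, hps, by rcases hσ with rfl | rfl <;> norm_num, ?_⟩
  filter_upwards [hnear] with q hq
  refine ⟨hq.1, fun hq1 => ?_⟩
  rcases lt_or_gt_of_ne hq1 with h7 | h7
  · have := hdown _ hq.2 (by linarith)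
    rw [hσσ] at this
    show 0 < σ * e q 1 * F (e q) 0
    have h8 : σ * e q 1 * F (e q) 0 = (-σ * F (e q) 0) * (-(e q 1)) := by ring
    rw [h8]
    exact mul_pos this (by linarith)
  · have := hup _ hq.2 (by linarith)
    show 0 < σ * e q 1 * F (e q) 0
    have h8 : σ * e q 1 * F (e q) 0 = (σ * F (e q) 0) * e q 1 := by ring
    rw [h8]
    exact mul_pos this h7

/-- The transversal fields of two charts with side signs point to the same side. -/
theorem SideSign.transversal {X Y : VField M k} {K : Set M} {p : M} {r r' σ σ' : ℝ}
    (he : IsAdapted Y K e r) (he' : IsAdapted Y K e' r') (hp : p ∈ K) (hps : p ∈ e.source)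
    (hps' : p ∈ e'.source) (hlim : IsLimitDirection X Y e' p) (hσ : σ ≠ 0) (hσ' : σ' ≠ 0)
    (hs : ∀ᶠ q in 𝓝 p, SideSign X e σ q) (hs' : ∀ᶠ q in 𝓝 p, SideSign X e' σ' q) :
    0 < σ * (chartRep e (pushField e' fun _ => !₂[0, σ']) (e p)) 1 := by
  have he1 := mem_maximalAtlas_one he.mem
  have he1' := mem_maximalAtlas_one he'.mem
  have hKiff : ∀ q ∈ e.source, q ∈ K ↔ e q 1 = 0 := fun q hq => by
    rw [← he.mem_iff (e q) (he.target ▸ e.map_source hq), e.left_inv hq]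
  have hKiff' : ∀ q ∈ e'.source, q ∈ K ↔ e' q 1 = 0 := fun q hq => by
    rw [← he'.mem_iff (e' q) (he'.target ▸ e'.map_source hq), e'.left_inv hq]
  have hYp : chartRep e Y (e p) = !₂[1, 0] :=
    he.field _ (he.target ▸ e.map_source hps) ((hKiff p hps).1 hp)
  have hYp' : chartRep e' Y (e' p) = !₂[1, 0] :=
    he'.field _ (he'.target ▸ e'.map_source hps') ((hKiff' p hps').1 hp)
  obtain ⟨B, hB, -⟩ := exists_equiv_transition he1' he1 (e'.map_source hps')
    (by rwa [e'.left_inv hps'])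
  have hchange : ∀ (V : ∀ p : M, TangentSpace (𝓡 2) p), ∀ q ∈ e'.source ∩ e.source,
      chartRep e V (e q) = fderiv ℝ (e ∘ e'.symm) (e' q) (chartRep e' V (e' q)) := fun V q hq => by
    have := chartRep_change he1' he1 V (e'.map_source hq.1)
      (by rw [e'.left_inv hq.1]; exact hq.2)
    rwa [e'.left_inv hq.1] at this
  -- Both charts normalize Y to the first basis vector along K, so the derivative of the transition
  -- fixes it.
  have hB1 : B !₂[1, 0] = !₂[1, 0] := by
    have := hchange Y p ⟨hps', hps⟩
    rw [hYp, hYp', hB.fderiv] at this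
    exact this.symm
  set n : Plane := !₂[0, σ'] with hn
  have hN : chartRep e (pushField e' fun _ => n) (e p) = B n := by
    rw [hchange _ p ⟨hps', hps⟩, hB.fderiv, chartRep_pushField_apply he1' _ hps']; rfl
  rw [hN]
  have hne : σ * B n 1 ≠ 0 := by
    refine mul_ne_zero hσ fun h0 => hσ' ?_
    have h1 : B n = B (B n 0 • !₂[1, 0]) := by
      rw [map_smul, hB1]
      ext i; fin_cases i <;> simp [h0]
    have h2 := congrArg (fun w : Plane => w 1) (B.injective h1)
    simpa [hn] using h2
  refine lt_of_le_of_ne ?_ hne.symm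
  -- the path leaving `K` in the direction `n`
  set x : ℝ → M := fun s => e'.symm (e' p + s • n) with hx
  have hpath : Continuous fun s : ℝ => e' p + s • n := by fun_prop
  have hpath0 : Tendsto (fun s : ℝ => e' p + s • n) (𝓝 0) (𝓝 (e' p)) := by
    simpa using hpath.tendsto 0
  have hx0 : Tendsto x (𝓝 0) (𝓝 p) := by
    have := (e'.continuousAt_symm (e'.map_source hps')).tendsto.comp hpath0
    rwa [e'.left_inv hps'] at this
  set D : M → Plane →L[ℝ] Plane := fun q => fderiv ℝ (e ∘ e'.symm) (e' q) with hD
  have hDc : ContinuousAt D p := by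
    have hcd : ContinuousAt (fderiv ℝ (e ∘ e'.symm)) (e' p) :=
      ((contDiffAt_transition he1' he1 (e'.map_source hps')
        (by rwa [e'.left_inv hps'])).fderiv_right (m := 0) (by simp)).continuousAt
    exact ContinuousAt.comp (f := e') hcd (e'.continuousAt hps')
  have hDp : D p = (B : Plane →L[ℝ] Plane) := hB.fderiv
  have hcomp : ∀ v : Plane, ContinuousAt (fun q => (D q v) 0) p := fun v =>
    (EuclideanSpace.proj 0 : Plane →L[ℝ] ℝ).continuous.continuousAt.comp
      (hDc.clm_apply continuousAt_const)
  set β := |(B !₂[0, 1]) 0| with hβ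
  have hβ0 : 0 ≤ β := abs_nonneg _
  have hd1 : ∀ᶠ q in 𝓝 p, 1 / 2 < (D q !₂[1, 0]) 0 := by
    refine (hcomp _).eventually (lt_mem_nhds ?_)
    show 1 / 2 < (D p !₂[1, 0]) 0
    rw [hDp, ContinuousLinearEquiv.coe_coe, hB1]
    norm_num
  have hd2 : ∀ᶠ q in 𝓝 p, |(D q !₂[0, 1]) 0| < β + 1 := by
    refine (hcomp _).abs.eventually (gt_mem_nhds ?_)
    show |(D p !₂[0, 1]) 0| < β + 1
    rw [hDp, ContinuousLinearEquiv.coe_coe]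
    linarith
  set η := 1 / (8 * (β + 1)) with hη
  have hη0 : 0 < η := by positivity
  -- With this η the second component of X contributes at most 1/4 of the first one to the first
  -- component in e, while the first itself contributes more than 1/2.
  have hη1 : η * (β + 1) = 1 / 8 := by rw [hη]; field_simp
  have hη2 : η ≤ 1 / 8 := by nlinarith
  have hl := hlim η hη0
  rw [hYp'] at hl
  -- Just off K in the direction n, the first component of X in e' is positive. X being almost
  -- parallel to Y, the first component in e is positive as well, so the path lies on the side
  -- selected by σ.
  have hev : ∀ᶠ s in 𝓝[>] (0 : ℝ), 0 < σ * (e (x s)) 1 := by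
    have hto : Tendsto x (𝓝[>] 0) (𝓝 p) := hx0.mono_left nhdsWithin_le_nhds
    have htar : ∀ᶠ s in 𝓝[>] (0 : ℝ), e' p + s • n ∈ e'.target :=
      (hpath0.mono_left nhdsWithin_le_nhds).eventually
        (e'.open_target.mem_nhds (e'.map_source hps'))
    filter_upwards [hto.eventually hs, hto.eventually hs', hto.eventually hl, hto.eventually hd1,
      hto.eventually hd2, htar, self_mem_nhdsWithin] with s h1 h2 h3 h4 h5 h6 hs0
    have hs0' : 0 < s := hs0
    have hex : e' (x s) = e' p + s • n := e'.right_inv h6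
    have hex1 : e' (x s) 1 = s * σ' := by
      rw [hex]
      have := (hKiff' p hps').1 hp
      simp [this, hn]
    have h7 := h2.2 (by rw [hex1]; exact mul_ne_zero hs0'.ne' hσ')
    set f := chartRep e' X (e' (x s)) with hf
    have hf0 : 0 < f 0 := by
      rw [hex1] at h7
      have h8 : 0 < σ' * (s * σ') := by
        have : 0 < σ' ^ 2 := by positivity
        nlinarith
      exact (pos_iff_pos_of_mul_pos h7).1 h8
    have hdet : det2 f !₂[1, 0] = -f 1 := by simp [det2]
    rw [hdet, abs_neg] at h3
    have hfn : ‖f‖ ≤ f 0 + |f 1| := by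
      refine le_of_sq_le_sq ?_ (by positivity)
      rw [sq_norm_plane, ← sq_abs (f 1)]
      nlinarith [abs_nonneg (f 1)]
    have hf1 : |f 1| ≤ 2 * η * f 0 := by
      have : |f 1| ≤ η * (f 0 + |f 1|) := h3.trans (by gcongr)
      nlinarith [abs_nonneg (f 1)]
    have hDf : chartRep e X (e (x s)) = D (x s) f := hchange X _ ⟨h2.1, h1.1⟩
    have hsplit : (D (x s) f) 0 = f 0 * (D (x s) !₂[1, 0]) 0 + f 1 * (D (x s) !₂[0, 1]) 0 := by
      have : f = f 0 • (!₂[1, 0] : Plane) + f 1 • (!₂[0, 1] : Plane) := by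
        ext i; fin_cases i <;> simp
      conv_lhs => rw [this, map_add, map_smul, map_smul]
      simp
    have hpos : 0 < chartRep e X (e (x s)) 0 := by
      rw [hDf, hsplit]
      have h8 : |f 1 * (D (x s) !₂[0, 1]) 0| ≤ 2 * η * f 0 * (β + 1) := by
        rw [abs_mul]; gcongr
      have h9 : 2 * η * f 0 * (β + 1) = f 0 / 4 := by linear_combination 2 * f 0 * hη1
      have h10 := neg_abs_le (f 1 * (D (x s) !₂[0, 1]) 0)
      nlinarith
    have hnK : x s ∉ K := fun hK => by
      have := (hKiff' _ h2.1).1 hK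
      rw [hex1] at this
      exact mul_ne_zero hs0'.ne' hσ' this
    exact (pos_iff_pos_of_mul_pos (h1.2 fun h0 => hnK ((hKiff _ h1.1).2 h0))).2 hpos
  have hderiv : HasDerivAt (fun s : ℝ => (e (x s)) 1) (B n 1) 0 := by
    have h1 : HasDerivAt (fun s : ℝ => e' p + s • n) n 0 :=
      (((hasDerivAt_id (0 : ℝ)).smul_const n).const_add (e' p)).congr_deriv (by simp)
    have hB' : HasFDerivAt (e ∘ e'.symm) (B : Plane →L[ℝ] Plane) (e' p + (0 : ℝ) • n) := by
      rwa [zero_smul, add_zero]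
    have h2 := hB'.comp_hasDerivAt (0 : ℝ) h1
    exact (EuclideanSpace.proj 1 : Plane →L[ℝ] ℝ).hasFDerivAt.comp_hasDerivAt (0 : ℝ) h2
  have hslope := (hasDerivAt_iff_tendsto_slope.1 hderiv).mono_left
    (nhdsWithin_mono (0 : ℝ) (s := Ioi 0) fun s (hs : 0 < s) => hs.ne')
  refine ge_of_tendsto (hslope.const_mul σ) ?_
  filter_upwards [hev, self_mem_nhdsWithin] with s hs1 hs0
  have hs0' : 0 < s := hs0
  have hx00 : (e (x 0)) 1 = 0 := by
    have : x 0 = p := by simp only [hx, zero_smul, add_zero, e'.left_inv hps']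
    rw [this]
    exact (hKiff p hps).1 hp
  simp only [slope_def_field, hx00, sub_zero]
  rw [mul_div_assoc']
  exact (div_pos hs1 hs0').le

/-- A bump times the constant field `c` of a chart. -/
theorem exists_bump_field (he : e ∈ IsManifold.maximalAtlas (𝓡 2) ((k : ℕ∞ω) + 1) M) {p : M}
    (hp : p ∈ e.source) {O : Set M} (hO : IsOpen O) (hpO : p ∈ O) (c : Plane) :
    ∃ (V : VField M k) (b : M → ℝ), (∀ q, 0 ≤ b q) ∧ (∀ᶠ q in 𝓝 p, 0 < b q) ∧
      (∀ q, b q ≠ 0 → q ∈ O ∧ q ∈ e.source) ∧ (∀ q, b q = 0 → V q = 0) ∧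
      ∀ e' ∈ IsManifold.maximalAtlas (𝓡 2) 1 M, ∀ q ∈ e'.source, q ∈ e.source →
        chartRep e' V (e' q) = b q • chartRep e' (pushField e fun _ => c) (e' q) := by
  have hopen : IsOpen (e.target ∩ e.symm ⁻¹' O) := e.symm.isOpen_inter_preimage hO
  obtain ⟨r, hr, hrs⟩ := Metric.nhds_basis_closedBall.mem_iff.1 (hopen.mem_nhds
    (show e p ∈ e.target ∩ e.symm ⁻¹' O from ⟨e.map_source hp, by rwa [mem_preimage, e.left_inv hp]⟩))
  let f : ContDiffBump (e p) := ⟨r / 2, r, by positivity, by linarith⟩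
  have hfs : tsupport f = Metric.closedBall (e p) r := f.tsupport_eq
  let g : Plane → Plane := fun z => f z • c
  have hgs : tsupport g ⊆ tsupport f := tsupport_smul_subset_left f fun _ => c
  have hg : ContDiff ℝ k g := f.contDiff.smul contDiff_const
  let V : VField M k := ofChart he hg (f.hasCompactSupport.smul_right)
    (hgs.trans (hfs ▸ fun z hz => (hrs hz).1))
  have he1 := mem_maximalAtlas_one he
  have hind : ∀ q, e.source.indicator (fun q => f (e q)) q ≠ 0 → q ∈ e.source ∧ f (e q) ≠ 0 := by
    intro q hq
    have hqs := Set.mem_of_indicator_ne_zero hq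
    rw [Set.indicator_of_mem hqs] at hq
    exact ⟨hqs, hq⟩
  refine ⟨V, e.source.indicator fun q => f (e q), fun q => Set.indicator_nonneg
    (fun q _ => f.nonneg) q, ?_, fun q hq => ?_, fun q hq => ?_, fun e' he' q hq' hq => ?_⟩
  · filter_upwards [e.open_source.mem_nhds hp, (e.continuousAt hp).eventually f.eventuallyEq_one]
      with q hqs hq
    have hq1 : f (e q) = 1 := hq
    rw [Set.indicator_of_mem hqs, hq1]
    exact one_pos
  · obtain ⟨hqs, hf⟩ := hind q hq
    have h1 := (hrs (hfs ▸ subset_tsupport f (Function.mem_support.2 hf))).2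
    rw [mem_preimage, e.left_inv hqs] at h1
    exact ⟨h1, hqs⟩
  · refine pushField_of_eq_zero fun hqs => ?_
    rw [Set.indicator_of_mem hqs] at hq
    simp only [g, hq, zero_smul]
  · rw [Set.indicator_of_mem hq]
    have h1 : V q = f (e q) • pushField e (fun _ => c) q := by
      refine eq_smul_of_chartRep he1 hq ?_
      rw [chartRep_pushField_apply he1 _ hq]
      exact chartRep_pushField_apply he1 g hq
    rw [chartRep_apply _ hq', chartRep_apply _ hq', h1]
    exact map_smul (mfderiv (𝓡 2) 𝓘(ℝ, Plane) e' q) _ _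

theorem exists_sum_field {ι : Type*} (t : Finset ι) (V : ι → VField M k) : ∃ S : VField M k,
    ∀ e : OpenPartialHomeomorph M Plane, ∀ z, chartRep e S z = ∑ i ∈ t, chartRep e (V i) z := by
  classical
  induction t using Finset.induction_on with
  | empty =>
    exact ⟨0, fun e z => by
      rw [Finset.sum_empty]
      exact map_zero (mfderiv (𝓡 2) 𝓘(ℝ, Plane) e (e.symm z))⟩
  | insert i t hi ih =>
    obtain ⟨S, hS⟩ := ih
    refine ⟨V i + S, fun e z => ?_⟩
    rw [Finset.sum_insert hi, ← hS]
    exact chartRep_add (V i) S z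

/-- The side on which X runs along Y does not depend on the chart, so the local transversal fields
all point to it. Nonnegative combinations that are positive somewhere cannot cancel, and their sum
is transverse to the limit direction Y. -/
theorem IsTracked.exists_pushes_transversal {X Y : VField M k} {K U : Set M}
    (h : IsTracked X Y K U) {K' : Set M} (hK' : IsCompact K') (hKK : K' ⊆ K)
    (h1 : ∀ p ∈ K', ¬ Pushes X (fun q => (1 : ℝ) • Y q) p)
    (h2 : ∀ p ∈ K', ¬ Pushes X (fun q => (-1 : ℝ) • Y q) p) :
    ∃ V : VField M k, ∀ p ∈ K', Pushes X V p := by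
  rcases K'.eq_empty_or_nonempty with rfl | ⟨p₀, -⟩
  · exact ⟨0, fun p hp => hp.elim⟩
  have : Nonempty (OpenPartialHomeomorph M Plane) := ⟨chartAt Plane p₀⟩
  have : Nonempty (VField M k) := ⟨0⟩
  choose! e r σ he hps hσ hside using fun p (hp : p ∈ K') =>
    h.exists_sideSign (hKK hp) (h1 p hp) (h2 p hp)
  let O : M → Set M := fun p => interior {q | SideSign X (e p) (σ p) q}
  have hpO : ∀ p ∈ K', p ∈ O p := fun p hp => mem_interior_iff_mem_nhds.2 (hside p hp)
  choose! V b hb0 hbp hbO hbV hbrep using fun p (hp : p ∈ K') =>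
    exists_bump_field (he p hp).mem (hps p hp) isOpen_interior (hpO p hp) !₂[0, σ p]
  obtain ⟨t, htK, ht⟩ := hK'.elim_nhds_subcover (fun p => {q | 0 < b p q}) hbp
  obtain ⟨S, hS⟩ := exists_sum_field t V
  refine ⟨S, fun p hp => ?_⟩
  have he1 := mem_maximalAtlas_one (he p hp).mem
  have hsrc := hps p hp
  have hYp : chartRep (e p) Y (e p p) = !₂[1, 0] := by
    have hpt := (he p hp).target ▸ (e p).map_source hsrc
    refine (he p hp).field _ hpt (((he p hp).mem_iff _ hpt).1 ?_)
    rw [(e p).left_inv hsrc]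
    exact hKK hp
  have hterm : ∀ i ∈ t, 0 ≤ σ p * (chartRep (e p) (V i) (e p p)) 1 ∧
      (0 < b i p → 0 < σ p * (chartRep (e p) (V i) (e p p)) 1) := by
    intro i hi
    have hiK := htK i hi
    by_cases hbi : b i p = 0
    · have h0 : chartRep (e p) (V i) (e p p) = 0 :=
        (chartRep_apply_eq_zero he1 (V i) hsrc).2 (hbV i hiK p hbi)
      rw [h0]
      simp [hbi]
    · obtain ⟨hpOi, hpi⟩ := hbO i hiK p hbi
      have hbpos : 0 < b i p := (hb0 i hiK p).lt_of_ne' hbi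
      have h3 := SideSign.transversal (he p hp) (he i hiK) (hKK hp) hsrc hpi
        (h.isLimitDirection_of_not_pushes (hKK hp) one_ne_zero (h1 p hp)
          (mem_maximalAtlas_one (he i hiK).mem) hpi) (hσ p hp) (hσ i hiK) (hside p hp)
        (mem_interior_iff_mem_nhds.1 hpOi)
      have h4 : 0 < σ p * (chartRep (e p) (V i) (e p p)) 1 := by
        rw [hbrep i hiK (e p) he1 p hsrc hpi, PiLp.smul_apply, smul_eq_mul, mul_left_comm]
        exact mul_pos hbpos h3
      exact ⟨h4.le, fun _ => h4⟩
  refine pushes_of_isLimitDirection hsrc (h.isLimitDirection_of_not_pushes (hKK hp) one_ne_zero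
    (h1 p hp) he1 hsrc) ((continuousOn_chartRep S he1).continuousAt
      ((e p).open_target.mem_nhds ((e p).map_source hsrc))) ?_
  rw [hYp]
  have hdet : det2 (chartRep (e p) S (e p p)) !₂[1, 0] = -(chartRep (e p) S (e p p)) 1 := by
    simp [det2]
  rw [hdet, neg_ne_zero]
  intro h0
  have hsum : σ p * (chartRep (e p) S (e p p)) 1 =
      ∑ i ∈ t, σ p * (chartRep (e p) (V i) (e p p)) 1 := by
    rw [hS, ← Finset.mul_sum]
    congr 1
    exact map_sum (EuclideanSpace.proj 1 : Plane →L[ℝ] ℝ) _ _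
  obtain ⟨i, hi, hip⟩ := mem_iUnion₂.1 (ht hp)
  have hpos : 0 < ∑ i ∈ t, σ p * (chartRep (e p) (V i) (e p p)) 1 :=
    Finset.sum_pos' (fun i hi => (hterm i hi).1) ⟨i, hi, (hterm i hi).2 hip⟩
  rw [← hsum, h0, mul_zero] at hpos
  exact lt_irrefl _ hpos

/-- A tracked block can be removed by an arbitrarily small perturbation. -/
theorem IsTracked.exists_perturbation {X Y : VField M k} {K U : Set M} (h : IsTracked X Y K U) :
    ∃ W : VField M k, (∃ C, IsCompact C ∧ C ⊆ U ∧ ∀ p ∉ C, W p = 0) ∧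
      ∀ ε : ℝ, 0 < ε → ∀ p ∈ U, X p + ε • W p ≠ 0 := by
  -- Not pushing is an open condition relative to K by `eventually_not_pushes`, so the part where σY
  -- pushes is compact as well as relatively open.
  have hclosed : ∀ σ : ℝ, σ ≠ 0 → ∀ K₁ ⊆ K, IsCompact K₁ →
      IsCompact (K₁ ∩ {p | Pushes X (fun q => σ • Y q) p}) := fun σ hσ K₁ hK hK₁ => by
    refine hK₁.of_isClosed_subset ?_ inter_subset_left
    rw [← isOpen_compl_iff, isOpen_iff_mem_nhds]
    intro q hq
    by_cases hq1 : q ∈ K₁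
    · filter_upwards [h.eventually_not_pushes (hK hq1) hσ fun hp => hq ⟨hq1, hp⟩] with x hx hmem
      exact hx (hK hmem.1) hmem.2
    · filter_upwards [hK₁.isClosed.isOpen_compl.mem_nhds hq1] with x hx hmem
      exact hx hmem.1
  have hopen : ∀ σ : ℝ, IsOpen {p | Pushes X (fun q => σ • Y q) p} := fun σ => isOpen_pushes X _
  -- A partition of K into disjoint compact parts, treated with Y, with -Y and with a transversal
  -- field; disjointness allows gluing by cutoffs.
  set Ka := K ∩ {p | Pushes X (fun q => (1 : ℝ) • Y q) p} with hKa
  set K' := K \ {p | Pushes X (fun q => (1 : ℝ) • Y q) p} with hK'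
  set Kb := K' ∩ {p | Pushes X (fun q => (-1 : ℝ) • Y q) p} with hKb
  set Kc := K' \ {p | Pushes X (fun q => (-1 : ℝ) • Y q) p} with hKc
  have hK'c : IsCompact K' := h.isCompact.diff (hopen 1)
  have hKac : IsCompact Ka := hclosed 1 one_ne_zero K subset_rfl h.isCompact
  have hKbc : IsCompact Kb := hclosed (-1) (by norm_num) K' sdiff_subset hK'c
  have hKcc : IsCompact Kc := hK'c.diff (hopen (-1))
  obtain ⟨Vc, hVc⟩ := h.exists_pushes_transversal hKcc (fun p hp => hp.1.1) (fun p hp => hp.1.2)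
    (fun p hp => hp.2)
  obtain ⟨Vb, hVb⟩ := exists_pushes_union (X := X) (V₁ := (-1 : ℝ) • Y) hKbc hKcc.isClosed
    (disjoint_sdiff_right.mono_left inter_subset_right) (fun p hp => hp.2) hVc
  have hKbK : Kb ∪ Kc = K' := inter_union_sdiff _ _
  rw [hKbK] at hVb
  obtain ⟨V, hV⟩ := exists_pushes_union (X := X) (V₁ := (1 : ℝ) • Y) hKac hK'c.isClosed
    (disjoint_sdiff_right.mono_left inter_subset_right) (fun p hp => hp.2) hVb
  have hKaK : Ka ∪ K' = K := inter_union_sdiff _ _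
  rw [hKaK] at hV
  exact h.exists_perturbation_of_pushes hV

end Sides

/-! ### Approximation in the `C^k` topology -/

section Approximation

variable {M : Type*} [TopologicalSpace M] [ChartedSpace Plane M]
  [IsManifold (𝓡 2) ω M] {k : ℕ}

theorem tendsto_nhds_iff {ι : Type*} {l : Filter ι} {F : ι → VField M k} {X : VField M k} :
    Tendsto F l (𝓝 X) ↔ ∀ e ∈ IsManifold.maximalAtlas (𝓡 2) ((k : ℕ∞ω) + 1) M, ∀ i ≤ k,
      ∀ L, IsCompact L → L ⊆ e.target → TendstoUniformlyOn
        (fun a => iteratedFDeriv ℝ i (chartRep e (F a))) (iteratedFDeriv ℝ i (chartRep e X)) l L := by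
  simp only [nhds_iInf, tendsto_iInf, nhds_induced, tendsto_comap_iff,
    UniformOnFun.tendsto_iff_tendstoUniformlyOn]
  exact ⟨fun h e he i hi L hL hLt => h e he i hi L ⟨hL, hLt⟩,
    fun h e he i hi L hL => h e he i hi L hL.1 hL.2⟩

theorem tendsto_add_smul (X W : VField M k) :
    Tendsto (fun ε : ℝ => X + ε • W) (𝓝 0) (𝓝 X) := by
  refine tendsto_nhds_iff.2 fun e he i hi L hL hLt => ?_
  have hi' : (i : ℕ∞ω) ≤ k := by exact_mod_cast hi
  have hat : ∀ (V : VField M k), ∀ z ∈ L, ContDiffAt ℝ i (chartRep e V) z := fun V z hz =>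
    ((contDiffOn_chartRep V he).contDiffAt (e.open_target.mem_nhds (hLt hz))).of_le hi'
  have hcont : ContinuousOn (iteratedFDeriv ℝ i (chartRep e W)) L := fun z hz =>
    ((hat W z hz).continuousAt_iteratedFDeriv le_rfl).continuousWithinAt
  obtain ⟨B, hB⟩ := hL.exists_bound_of_continuousOn hcont
  have heq : ∀ ε : ℝ, ∀ z ∈ L, iteratedFDeriv ℝ i (chartRep e (X + ε • W : VField M k)) z =
      iteratedFDeriv ℝ i (chartRep e X) z + ε • iteratedFDeriv ℝ i (chartRep e W) z := by
    intro ε z hz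
    have h1 : chartRep e (X + ε • W : VField M k) = chartRep e X + ε • chartRep e W := by
      funext w
      exact (chartRep_add X (ε • W : VField M k) w).trans
        (congrArg (chartRep e X w + ·) (chartRep_smul (fun _ => ε) W w))
    have h2 : ContDiffAt ℝ i (ε • chartRep e W) z := (hat W z hz).const_smul ε
    rw [h1, iteratedFDeriv_add_apply (hat X z hz) h2,
      iteratedFDeriv_const_smul_apply (hat W z hz)]
  rw [Metric.tendstoUniformlyOn_iff]
  intro δ hδ
  have hlim : Tendsto (fun ε : ℝ => |ε| * (|B| + 1)) (𝓝 0) (𝓝 0) := by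
    have : Continuous fun ε : ℝ => |ε| * (|B| + 1) := by fun_prop
    simpa using this.tendsto 0
  filter_upwards [hlim.eventually_lt_const hδ] with ε hε z hz
  rw [heq ε z hz, dist_self_add_right, norm_smul, Real.norm_eq_abs]
  refine lt_of_le_of_lt ?_ hε
  gcongr
  linarith [hB z hz, le_abs_self B]

theorem tendsto_toC0_add_smul (X W : VField M k) :
    Tendsto (fun ε : ℝ => (X + ε • W).toC0) (𝓝 0) (𝓝 X.toC0) :=
  tendsto_add_smul X.toC0 W.toC0

theorem tendstoUniformlyOn_chartRep (X : VField M 0) {e : OpenPartialHomeomorph M Plane}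
    (he : e ∈ IsManifold.maximalAtlas (𝓡 2) 1 M) {L : Set Plane} (hL : IsCompact L)
    (hLt : L ⊆ e.target) :
    TendstoUniformlyOn (fun X' : VField M 0 => chartRep e X') (chartRep e X) (𝓝 X) L := by
  have h := tendsto_nhds_iff.1 (tendsto_id (x := 𝓝 X)) e (by simpa using he) 0 le_rfl L hL hLt
  rw [Metric.tendstoUniformlyOn_iff] at h ⊢
  intro δ hδ
  filter_upwards [h δ hδ] with X' hX' z hz
  have h1 := hX' z hz
  simp only [iteratedFDeriv_zero_eq_comp, Function.comp_apply] at h1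
  rwa [LinearIsometryEquiv.dist_map] at h1

/-- Fields close to a field without zeroes in a compact set are joined to it by a segment of fields
without zeroes there. -/
theorem eventually_segment_ne_zero [T2Space M] (X : VField M 0) {P : Set M} (hP : IsCompact P)
    (hX : ∀ p ∈ P, X p ≠ 0) :
    ∀ᶠ X' : VField M 0 in 𝓝 X, ∀ p ∈ P, ∀ s ∈ Icc (0 : ℝ) 1, X p + s • (X' p - X p) ≠ 0 := by
  have : LocallyCompactSpace M := ChartedSpace.locallyCompactSpace Plane M
  refine hP.induction_on (p := fun S => ∀ᶠ X' : VField M 0 in 𝓝 X, ∀ p ∈ S,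
    ∀ s ∈ Icc (0 : ℝ) 1, X p + s • (X' p - X p) ≠ 0) (by simp)
    (fun S T hST hT => hT.mono fun X' h p hp => h p (hST hp)) (fun S T hS hT => ?_)
    fun x hx => ?_
  · filter_upwards [hS, hT] with X' h1 h2 p hp
    exact hp.elim (h1 p) (h2 p)
  · set e := chartAt Plane x
    have he : e ∈ IsManifold.maximalAtlas (𝓡 2) 1 M := chartAt_mem_maximalAtlas 1 x
    have hxs : x ∈ e.source := mem_chart_source Plane x
    have h0 : 0 < ‖chartRep e X (e x)‖ := norm_pos_iff.2 fun h =>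
      hX x hx ((chartRep_apply_eq_zero he X hxs).1 h)
    have hc : ContinuousAt (fun q => ‖chartRep e X (e q)‖) x :=
      (((continuousOn_chartRep X he).continuousAt
        (e.open_target.mem_nhds (e.map_source hxs))).comp (e.continuousAt hxs)).norm
    obtain ⟨N, hN, hNs, hNc⟩ := local_compact_nhds
      (inter_mem (e.open_source.mem_nhds hxs)
        (hc.eventually_const_lt (half_lt_self h0)))
    refine ⟨N, mem_nhdsWithin_of_mem_nhds hN, ?_⟩
    have hu := tendstoUniformlyOn_chartRep X he
      (hNc.image_of_continuousOn (e.continuousOn.mono fun q hq => (hNs hq).1))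
      (image_subset_iff.2 fun q hq => e.map_source (hNs hq).1)
    rw [Metric.tendstoUniformlyOn_iff] at hu
    filter_upwards [hu _ (half_pos h0)] with X' hX' p hp s hs h
    have h1 := hX' (e p) (mem_image_of_mem _ hp)
    have h2 : ‖chartRep e X (e x)‖ / 2 < ‖chartRep e X (e p)‖ := (hNs hp).2
    have h3 : chartRep e X (e p) + s • (chartRep e X' (e p) - chartRep e X (e p)) = 0 := by
      have h4 := chartRep_add_smul X (X' - X : VField M 0) s (hNs hp).1 h
      have h5 : chartRep e (X' - X : VField M 0) (e p) = chartRep e X' (e p) - chartRep e X (e p) :=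
        map_sub (mfderiv (𝓡 2) 𝓘(ℝ, Plane) e (e.symm (e p))) _ _
      rwa [h5] at h4
    have h6 : ‖chartRep e X (e p)‖ ≤ ‖chartRep e X' (e p) - chartRep e X (e p)‖ := by
      rw [eq_neg_of_add_eq_zero_left h3, norm_neg, norm_smul, Real.norm_of_nonneg hs.1]
      rw [← eq_neg_of_add_eq_zero_left h3]
      exact mul_le_of_le_one_left (norm_nonneg _) hs.2
    rw [dist_comm, dist_eq_norm] at h1
    linarith

end Approximation

/-! ### The index of a tracked block -/

section Block

variable {M : Type*} [TopologicalSpace M] [T2Space M] [ChartedSpace Plane M]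
  [IsManifold (𝓡 2) ω M] {k : ℕ} {X Y : VField M k} {K U : Set M}

/-- The interpolated field X₃ is X₁ near C and X₂ off a compact subset of U. The segment condition
forbids zeroes of X₁ and X₃ off the interior of C, so these two have the same zeroes and indices,
and X₃ is compared with X₂ by `idxSum_eq`. -/
theorem idxSum_eq_zero_of_segment {X₁ X₂ : VField M 0} {C : Set M} (hC : IsCompact C) (hU : IsOpen U)
    (hCU : C ⊆ U) (hfin : (zeros X₁ ∩ U).Finite) (h2 : ∀ p ∈ U, X₂ p ≠ 0)
    (h : ∀ p ∈ U, p ∉ interior C → ∀ s ∈ Icc (0 : ℝ) 1, X₂ p + s • (X₁ p - X₂ p) ≠ 0) :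
    idxSum X₁ U = 0 := by
  have : LocallyCompactSpace M := ChartedSpace.locallyCompactSpace Plane M
  obtain ⟨χ, hχ, ⟨V, hVo, hCV, hV⟩, hcs, hts, hI⟩ := exists_smooth_cutoff hC hU hCU
  let X₃ : VField M 0 := X₂ + (X₁ - X₂).mulFun (hχ.of_le (by simp))
  have h3 : ∀ p, X₃ p = X₂ p + χ p • (X₁ p - X₂ p) := fun p => rfl
  have h31 : ∀ p ∈ interior C, X₃ p = X₁ p := fun p hp => by
    rw [h3, hV p (hCV (interior_subset hp)), one_smul, add_sub_cancel]
  have hz1 : zeros X₁ ∩ U = zeros X₁ ∩ interior C := by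
    refine Subset.antisymm (fun p hp => ⟨hp.1, ?_⟩)
      (inter_subset_inter_right _ (interior_subset.trans hCU))
    by_contra hpC
    refine h p hp.2 hpC 1 ⟨zero_le_one, le_rfl⟩ ?_
    rw [one_smul, add_sub_cancel]
    exact hp.1
  have hz3 : zeros X₃ ∩ U = zeros X₃ ∩ interior C := by
    refine Subset.antisymm (fun p hp => ⟨hp.1, ?_⟩)
      (inter_subset_inter_right _ (interior_subset.trans hCU))
    by_contra hpC
    exact h p hp.2 hpC (χ p) (hI p) hp.1
  have hz13 : zeros X₃ ∩ interior C = zeros X₁ ∩ interior C := by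
    ext p
    exact and_congr_left fun hp => ⟨fun h => (h31 p hp).symm.trans h, fun h => (h31 p hp).trans h⟩
  have hz2 : zeros X₂ ∩ U = ∅ := eq_empty_of_forall_notMem fun p hp => h2 p hp.2 hp.1
  calc idxSum X₁ U = idxSum X₁ (interior C) := by rw [idxSum, hz1, ← idxSum]
    _ = idxSum X₃ (interior C) := (idxSum_congr isOpen_interior h31).symm
    _ = idxSum X₃ U := by rw [idxSum, ← hz3, ← idxSum]
    _ = idxSum X₂ U := idxSum_eq hU hcs hts X₂ X₃ (hz2 ▸ finite_empty)
      (by rw [hz3, hz13, ← hz1]; exact hfin) fun p _ hp => by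
        rw [h3, image_eq_zero_of_notMem_tsupport hp, zero_smul, add_zero]
    _ = 0 := by rw [idxSum, hz2, finsum_mem_empty]

namespace IsTracked

/-- The fields X + εW are approximations without zeroes. Any X' close to X is joined to X without
zeroes off a compact set that contains the support of W, where X is also X + W; so its index sum is
that of X + W. -/
theorem hasIndexOn (h : IsTracked X Y K U) : HasIndexOn X U 0 := by
  have : LocallyCompactSpace M := ChartedSpace.locallyCompactSpace Plane M
  obtain ⟨W, ⟨C, hC, hCU, hW⟩, hne⟩ := h.exists_perturbation
  obtain ⟨hUo, hUc, hKU, hz⟩ := h.isolating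
  constructor
  · have ht := (tendsto_toC0_add_smul X W).mono_left (nhdsWithin_le_nhds (s := Ioi 0))
    refine ht.frequently (Eventually.frequently ?_)
    filter_upwards [self_mem_nhdsWithin] with ε hε
    have : zeros (X + ε • W).toC0 ∩ U = ∅ :=
      eq_empty_of_forall_notMem fun p hp => hne ε hε p hp.2 hp.1
    rw [this]
    exact finite_empty
  · obtain ⟨C₁, hC₁, hCC₁, hC₁U⟩ := exists_compact_between (hC.union h.isCompact) hUo
      (union_subset hCU hKU)
    have hP : ∀ p ∈ closure U \ interior C₁, X.toC0 p ≠ 0 := fun p hp h0 =>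
      hp.2 (hCC₁ (Or.inr (hz ▸ ⟨h0, hp.1⟩)))
    filter_upwards [eventually_segment_ne_zero X.toC0 (hUc.diff isOpen_interior) hP] with X' hX' hfin
    have h0 : idxSum X' U = 0 := by
      -- The comparison field need not be close to X: the value ε = 1 is as good as any, since all
      -- that matters is that it has no zeroes in U.
      refine idxSum_eq_zero_of_segment (X₂ := (X + (1 : ℝ) • W).toC0) hC₁ hUo hC₁U hfin
        (hne 1 one_pos) fun p hp hpC => ?_
      have hWp : (X + (1 : ℝ) • W).toC0 p = X.toC0 p := by
        show X p + (1 : ℝ) • W p = X p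
        rw [hW p fun h => hpC (hCC₁ (Or.inl h)), smul_zero, add_zero]
      rw [hWp]
      exact hX' p ⟨subset_closure hp, hpC⟩
    exact h0 ▸ hasIndexSum_idxSum X' hUo hfin

theorem of_isIsolating (h : IsTracked X Y K U) {U' : Set M} (hU' : IsIsolating X K U') :
    IsTracked X Y K U' :=
  { h with isolating := hU' }

theorem hasIndexAt (h : IsTracked X Y K U) : HasIndexAt X K 0 :=
  ⟨⟨h.isCompact, fun _ hp => h.eq_zero hp, U, h.isolating⟩,
    fun _ hU' => (h.of_isIsolating hU').hasIndexOn⟩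

/-- A component is compact and relatively open in K, so a smaller neighbourhood isolates it; the
other hypotheses pass to subsets of K. -/
theorem exists_isTracked_component (h : IsTracked X Y K U) (p : M) :
    ∃ U', IsTracked X Y (connectedComponentIn K p) U' := by
  have : LocallyCompactSpace M := ChartedSpace.locallyCompactSpace Plane M
  set L := connectedComponentIn K p with hL
  have hLK : L ⊆ K := connectedComponentIn_subset K p
  have hLc : IsCompact L := h.isCompact_connectedComponentIn p
  set G := interior {q | q ∈ K → q ∈ L} with hG
  have hLG : L ⊆ G := fun q hq => mem_interior_iff_mem_nhds.2 <| by
    have := h.eventually_mem_connectedComponentIn (hLK hq)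
    rwa [← _root_.connectedComponentIn_eq hq] at this
  obtain ⟨C, hC, hLC, hCU⟩ := exists_compact_between hLc (h.isolating.1.inter isOpen_interior)
    (subset_inter (hLK.trans h.isolating.2.2.1) hLG)
  have hcl : closure (interior C) ⊆ C := closure_minimal interior_subset hC.isClosed
  refine ⟨interior C, h.one_le, fun q hq => h.not_flat q (hLK hq), h.tracks,
    fun q hq => h.ne_zero q (hLK hq), hLc, isOpen_interior,
    hC.of_isClosed_subset isClosed_closure hcl, hLC, Subset.antisymm (fun q hq => ?_)
    fun q hq => ⟨h.eq_zero (hLK hq), subset_closure (hLC hq)⟩⟩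
  have hq' := hCU (hcl hq.2)
  exact interior_subset hq'.2 ((h.mem_iff hq'.1).2 hq.1)

theorem mem_closure (h : IsTracked X Y K U) :
    X ∈ closure {X' : VField M k | (∀ p ∈ U, X' p ≠ 0) ∧ ∀ p ∉ U, X' p = X p} := by
  obtain ⟨W, ⟨C, -, hCU, hW⟩, hne⟩ := h.exists_perturbation
  refine mem_closure_of_tendsto ((tendsto_add_smul X W).mono_left
    (nhdsWithin_le_nhds (s := Ioi 0))) ?_
  filter_upwards [self_mem_nhdsWithin] with ε hε
  refine ⟨hne ε hε, fun p hp => ?_⟩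
  show X p + ε • W p = X p
  rw [hW p fun h => hp (hCU h), smul_zero, add_zero]

end IsTracked

end Block

end SurfaceFields

end

open SurfaceFields in
theorem theorem2 {M : Type*} [TopologicalSpace M] [TopologicalSpace.MetrizableSpace M]
    [ChartedSpace Plane M] [IsManifold (𝓡 2) ω M]
    (k : ℕ) (hk : 1 ≤ k) (X Y : VField M k) (K U : Set M)
    (hK : IsBlock X K)
    (hflat : ∀ p ∈ K, ¬ IsFlat k X p)
    (hY : Tracks Y X)
    (hYK : zeros Y ∩ K = ∅)
    (hU : IsIsolating X K U) :
    -- (i)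
    HasIndexAt X K 0 ∧
    -- (ii)
    ({L : Set M | ∃ p ∈ K, L = connectedComponentIn K p}.Finite ∧
      ∀ p ∈ K, IsEmbeddedCircle k (connectedComponentIn K p) ∧
        IsPeriodicOrbit Y (connectedComponentIn K p)) ∧
    -- (iii)
    (∃! Λ : LineField U, Λ.Controls X) ∧
    -- (iv)
    (∀ p ∈ K, HasIndexAt X (connectedComponentIn K p) 0) ∧
    -- (v)
    X ∈ closure {X' : VField M k | (∀ p ∈ U, X' p ≠ 0) ∧ ∀ p ∉ U, X' p = X p} := by
  have h : IsTracked X Y K U :=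
    ⟨hk, hflat, hY, fun p hp h0 => (hYK ▸ ⟨h0, hp⟩ : p ∈ (∅ : Set M)), hK.1, hU⟩
  refine ⟨h.hasIndexAt, ⟨h.finite_components, fun p hp =>
    ⟨h.isEmbeddedCircle hp, h.isPeriodicOrbit hp⟩⟩, h.existsUnique_lineField, fun p _ => ?_,
    h.mem_closure⟩
  obtain ⟨U', h'⟩ := h.exists_isTracked_component p
  exact h'.hasIndexAt
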